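/- **Theorem 4.3.** Let $\kappa>0$, $p\in\mathbb R$, let $\{\mu_k\}$ be an arbitrary family of real numbers, and let $\xi_n>0$ $(n\ge1)$ with $\sum_n n\,\xi_n<\infty$. *Fields.* For $|z|,|w|<1$ put $\delta(z,w)=\sum_{n\ge0}(z\bar w)^n+\sum_{n>0}(\bar z w)^n$, $\;N(z,w)=\sum_{n>0}\xi_n\big((z\bar w)^n+(\bar z w)^n\big)$, $\;D(z,w)=\sum_{n>0}\xi_n^{-1}\big((z\bar w)^n+(\bar z w)^n\big)$, $\;W(z,w)=\sum_{n>0}2\kappa n\,(z\bar w)^n$. In the unitary module $D^l_K$ (Gaussian field with covariance $N$ and zero mode on a circle, vacuum $v_0=1$) one has creation, annihilation and exponential operators $b(z),a(z),\alpha^\pm(z)$ with $[a(z),b(w)]=D(z,w)$, $[a(z),\alpha^\pm(w)]=[b(z),\alpha^\pm(w)]=\mp\delta(z,w)\alpha^\pm(w)$, $a v_0=0$, $\langle v_0,b\,\cdot\,\rangle=0$; the correlator $\langle\prod_a\alpha^{q_a}(z_a)\rangle$ ($q_a\in\mathbb Z$, $\alpha^{q}=(\alpha^+)^q$) is $\exp\!\big(-\tfrac12\sum_{a,b}q_aq_bN(z_a,z_b)\big)$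 if $\sum_aq_a=0$ and $0$ otherwise. In the Fock module $F_{\kappa,p}$ the field $\rho(u)=\sum_n\rho_ne^{inu}$, $[\rho_n,\rho_m]=2\kappa n\,\delta_{n,-m}$, $\rho_n vac_p=0$ $(n>0)$, $\rho_0vac_p=p\,vac_p$, has vacuum correlators given by Wick's rule with contraction $W$ and one-point value $p$. The currents on $D^l_K\otimes F_{\kappa,p}$ are, with $z=re^{iu}$, $$J^\pm=\tfrac i2(b\,\alpha^\pm+\alpha^\pm a)\pm\kappa\,\partial_u\alpha^\pm\pm\rho\,\alpha^\pm,\qquad J^3=i(a+b)-2\kappa\,\alpha^-\partial_u\alpha^+ .$$ *Graphs.* Normal ordering writes $\langle\phi_1(z_1)\cdots\phi_n(z_n)\rangle_p$, $\phi_i\in\{J^3,J^\pm\}$, as a sum over graphs on the vertices $1,\dots,n$ (of sign $0,\pm$ respectively). At each vertex one term of the current is chosen. A term containing $a$ (resp. $b$) at $z_i$ has one outgoing line: either a solid line to a vertex $j>i$ (resp. $j<i$), with factor $-q\,\delta(z_i,w)$ (resp. $+q\,\delta(z_i,w)$) for a factor $\alpha^{q}(w)$ at $j$, summed over the factors $\alpha^{\pm}$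 of the term chosen at $j$; or a dotted line, with factor $D(z_i,z_j)$, joining an $a$ at $i$ with a $b$ at $j>i$. Terms without $a,b$ are terminal; terms with $\rho$ are joined in pairs $i<j$ by wavy lines with factor $W(z_i,z_j)$, or give $p$. The value of the graph is the product of the coefficients, the line factors and the correlator of the factors $\alpha$; the derivatives $\partial_u$ in the terminal terms act on the factor $\alpha$ concerned, inside that correlator and inside the $\delta$'s of its incoming lines. *Renormalization.* In the renormalized correlator $\langle\phi_1(z_1)\cdots\phi_n(z_n)\rangle_p^{R,\{\mu\}}$: 1. in each loop of $k$ solid lines, $\delta(z_{i_1},z_{i_2})\cdots\delta(z_{i_{k-1}},z_{i_k})\,\delta(z_{i_k},z_{i_1})$, with $i_1$ its leftmost vertex, is replaced by $\mu_k\,\delta(z_{i_1},z_{i_2})\cdots\delta(z_{i_{k-1}},z_{i_k})$; 2. for each dotted line, a side is the set of vertices joined to one of its two ends by directed solid paths (the end included); a graph is discarded unless each of its dotted lines has a side with equal numbers of plus and minus vertices; 3. in the graphs that are kept, the factors $\alpha^\pm$ of every such balanced side, whose points are identified by the solid lines, cancel, i.e. are replaced by $1$ in the correlator of the factors $\alpha$;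 4. since the series $D$ need not converge, it is truncated to $n\le M$, and $M\to\infty$ is taken on the modes. Let $C_{M,r}\big((\phi_1,m_1),\dots,(\phi_n,m_n)\big)=\frac1{(2\pi)^n}\int_{[0,2\pi]^n}\langle\phi_1(z_1)\cdots\phi_n(z_n)\rangle_p^{R,\{\mu\}}\,e^{i\sum_k m_ku_k}\,du$, with $z_k=r_ke^{iu_k}$, $0<r_k<1$, be the correlator of the modes $\phi_{k,m_k}$, where $\phi(u)=\sum_m\phi_{-m}e^{imu}$. Then: * **(existence)** for all currents $\phi_1,\dots,\phi_n$ and integers $m_1,\dots,m_n$ the limit $C\big((\phi_1,m_1),\dots,(\phi_n,m_n)\big)$ of $C_{M,r}$ as $M\to\infty$ and $(r_1,\dots,r_n)\to(1,\dots,1)$, jointly, exists; that is, the boundary correlators exist as functionals on trigonometric polynomials; * **(relations)** at any place inside the boundary correlators, the modes satisfy the relations of $\widehat{sl(2,\mathbb R)}$ $$[J^+_m,J^-_n]=iJ^3_{m+n}+4\kappa m\,\delta_{m+n,0},\quad [J^3_m,J^3_n]=-8\kappa m\,\delta_{m+n,0},\quad [J^3_m,J^\pm_n]=\mp2iJ^\pm_{m+n},\quad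 [J^\pm_m,J^\pm_n]=0,$$ i.e. $[J^+(u),J^-(v)]=iJ^3(v)\delta(u-v)+4i\kappa\delta'(u-v)$, $[J^3(u),J^3(v)]=-8i\kappa\delta'(u-v)$, $[J^3(u),J^\pm(v)]=\mp2iJ^\pm(v)\delta(u-v)$, $[J^\pm(u),J^\pm(v)]=0$; * **(Hermiticity)** with $(J^\pm_m)^*=-J^\mp_{-m}$, $(J^3_m)^*=-J^3_{-m}$, the boundary correlator of $\phi_{n,m_n}^*\cdots\phi_{1,m_1}^*$ is the complex conjugate of that of $\phi_{1,m_1}\cdots\phi_{n,m_n}$; * **(module)** the boundary correlators define a module with a Hermitian form: there are a complex vector space $V$ with operators $J^3_m,J^\pm_m$ $(m\in\mathbb Z)$ satisfying these relations, a vector $v\in V$ from which they generate $V$, and a Hermitian sesquilinear form on $V$ for which the operators have the adjoints above, such that $\langle v,\phi_{1,m_1}\cdots\phi_{n,m_n}v\rangle=C\big((\phi_1,m_1),\dots,(\phi_n,m_n)\big)$ for all $n$, $\phi_i$, $m_i$. -/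

import Mathlib

open Filter Topology
open scoped ComplexConjugate

noncomputable section

namespace AffineSl2

/-- The three currents `J⁺`, `J⁻`, `J³`, as the regularized composite currents
  `J^±(z) = (i/2)(b(z) α^±(z) + α^±(z) a(z)) ± κ ∂ᵤ α^±(z) ± ρ(z) α^±(z)`,
  `J³(z)  = i (a(z) + b(z)) - 2κ α⁻(z) ∂ᵤ α⁺(z)`,   `z = r e^{iu}`,
acting on the tensor product of the unitary module (Gaussian space with covariance `N`, in which
`[a(z), b(w)] = D(z, w)`, `[a(z), α^±(w)] = [b(z), α^±(w)] = ∓ δ(z, w) α^±(w)`) and of the Fock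
module of the Heisenberg field `ρ`. -/
inductive Current
  | plus
  | minus
  | three

namespace Current

/-- The sign over a vertex: `+`, `-` or `0`; it is the exponent of `α` in the current. -/
def sgn : Current → ℤ
  | plus => 1
  | minus => -1
  | three => 0

/-- `φ(z)* = - φ^†(z)`, where `†` exchanges `J⁺` and `J⁻` and fixes `J³`. -/
def dag : Current → Current
  | plus => minus
  | minus => plus
  | three => three

end Current

open Current

/-! ### Kernels: the values of the lines and the covariance -/

/-- `δ(z,w) = ∑_{n ≥ 0} (z w̄)ⁿ + ∑_{n > 0} (z̄ w)ⁿ`; on the circle it is the delta function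
`δ(u - v)` of total mass one with respect to `du / 2π`. -/
def deltaKer (z w : ℂ) : ℂ :=
  (∑' n : ℕ, (z * conj w) ^ n) + ∑' n : ℕ, (conj z * w) ^ (n + 1)

/-- `N(z,w) = ∑_{n > 0} ξₙ ((z w̄)ⁿ + (z̄ w)ⁿ)`, the covariance of the Gaussian field `x(z)`. -/
def covN (ξ : ℕ → ℝ) (z w : ℂ) : ℂ :=
  ∑' n : ℕ, (ξ (n + 1) : ℂ) * ((z * conj w) ^ (n + 1) + (conj z * w) ^ (n + 1))

/-- `D(z,w) = ∑_{n > 0} ξₙ⁻¹ ((z w̄)ⁿ + (z̄ w)ⁿ) = [a(z), b(w)]`, truncated to the modes `n ≤ M`.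
(The full series need not converge anywhere; paired with a trigonometric polynomial only finitely
many of its terms contribute.) -/
def dotD (ξ : ℕ → ℝ) (M : ℕ) (z w : ℂ) : ℂ :=
  ∑ n ∈ Finset.Icc 1 M, ((ξ n)⁻¹ : ℂ) * ((z * conj w) ^ n + (conj z * w) ^ n)

/-- The connected two-point function `∑_{n > 0} 2κ n (z w̄)ⁿ` of the Heisenberg field
`ρ(u) = ∑ ρₙ e^{inu}`, `[ρₙ, ρₘ] = 2κ n δ_{n,-m}`, `ρₙ vac = 0` for `n > 0`. -/
def wavyW (κ : ℝ) (z w : ℂ) : ℂ :=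
  ∑' n : ℕ, (2 * κ * (n + 1) : ℂ) * (z * conj w) ^ (n + 1)

/-- The vacuum correlator of exponentials `⟨∏ₐ exp (i qₐ x^c(zₐ))⟩` in the Gaussian space with
compactified zero mode: it vanishes unless the total charge is zero, and otherwise equals
`exp (-½ ∑ qₐ q_b N(zₐ, z_b))`. -/
def expCorr {ι : Type} [Fintype ι] (ξ : ℕ → ℝ) (q : ι → ℤ) (z : ι → ℂ) : ℂ :=
  if ∑ a, q a = 0 then
    Complex.exp (-(1 / 2) * ∑ a, ∑ b, (q a : ℂ) * (q b : ℂ) * covN ξ (z a) (z b))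
  else 0

/-! ### Graphs -/

/-- What the term of the current chosen at a vertex does in the normally ordered expansion:
* `solid j`: its creation or annihilation operator leaves a commutator with the `α` of vertex `j`
  (outgoing solid line; `a` moves to the right, `b` to the left);
* `dotted j`: its annihilation (creation) operator leaves a commutator `D` with the creation
  (annihilation) operator of vertex `j`;
* `diff`: the terminal vertex `± κ ∂ᵤ α^±`, respectively `-2κ α⁻ ∂ᵤ α⁺`;
* `wavy j`: the term `± ρ α^±`, with `ρ` contracted with the `ρ` of vertex `j`;
* `zeroMode`: the term `± ρ α^±`, with `ρ` contributing its eigenvalue `p` on the vacuum. -/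
inductive Role (n : ℕ)
  | solid (j : Fin n)
  | dotted (j : Fin n)
  | diff
  | wavy (j : Fin n)
  | zeroMode
  deriving DecidableEq, Fintype

variable {n : ℕ}

/-- The graphs that occur for the currents `φ₀, …, φₙ₋₁` (from left to right): solid lines end at a
different vertex that contains an `α`, dotted and wavy lines join two different vertices of the
same kind, and `J³` contains no `ρ`. -/
def IsGraph (φ : Fin n → Current) (R : Fin n → Role n) : Prop :=
  (∀ i j, R i = .solid j → j ≠ i ∧ (φ j = three → R j = .diff)) ∧
  (∀ i j, R i = .dotted j → j ≠ i ∧ R j = .dotted i) ∧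
  (∀ i j, R i = .wavy j → j ≠ i ∧ R j = .wavy i ∧ φ i ≠ three) ∧
  (∀ i, R i = .zeroMode → φ i ≠ three)

/-- There is a solid line from `i` to `j`. -/
def Step (R : Fin n → Role n) (i j : Fin n) : Prop := R i = .solid j

open Classical in
/-- The vertices connected with `i` through a directed solid path ending at `i` (with `i` itself).
If `i` is an end of a dotted line, this is the side of `i` of that dotted line. -/
def side (R : Fin n → Role n) (i : Fin n) : Finset (Fin n) :=
  Finset.univ.filter fun k => Relation.ReflTransGen (Step R) k i

/-- Equal numbers of plus and minus vertices. -/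
def Neutral (φ : Fin n → Current) (s : Finset (Fin n)) : Prop := ∑ k ∈ s, (φ k).sgn = 0

/-- The graphs that are not eliminated: every dotted line has a side with equal numbers of plus
and minus vertices. -/
def Kept (φ : Fin n → Current) (R : Fin n → Role n) : Prop :=
  ∀ i j, R i = .dotted j → Neutral φ (side R i) ∨ Neutral φ (side R j)

/-- The vertex `k` belongs to a neutral side of a dotted line. The solid lines of that side identify
all its points, so that its factors `α⁺` and `α⁻` cancel by `α⁺(u) α⁻(u) = 1`. -/
def Cancelled (φ : Fin n → Current) (R : Fin n → Role n) (k : Fin n) : Prop :=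
  ∃ i j, R i = .dotted j ∧ k ∈ side R i ∧ Neutral φ (side R i)

open Classical in
/-- The vertices of the loop through `i` (empty if there is none). -/
def loopOf (R : Fin n → Role n) (i : Fin n) : Finset (Fin n) :=
  Finset.univ.filter fun k =>
    Relation.TransGen (Step R) i k ∧ Relation.TransGen (Step R) k i

/-- The solid line from `i` to `j` is the line of a loop that enters its leftmost vertex `j`. -/
def Closes (R : Fin n → Role n) (i j : Fin n) : Prop :=
  i ∈ loopOf R j ∧ ∀ k ∈ loopOf R j, j ≤ k

/-! ### Feynman rules

Every vertex `k` has the point `z k` and a second point `z' k`, equal to `z k` in the end, which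
carries the factor `α` that is differentiated. -/

/-- The exponent of `α (z k)` at the vertex `k`. -/
def baseCharge (φ : Fin n → Current) (R : Fin n → Role n) (k : Fin n) : ℤ :=
  match φ k, R k with
  | three, .diff => -1
  | _, .diff => 0
  | c, _ => c.sgn

/-- The exponent of `α (z' k)` at the vertex `k`. -/
def diffCharge (φ : Fin n → Current) (R : Fin n → Role n) (k : Fin n) : ℤ :=
  match φ k, R k with
  | three, .diff => 1
  | c, .diff => c.sgn
  | _, _ => 0

/-- The coefficient of the chosen term in the current. -/
def coef (κ p : ℝ) (c : Current) (ρ : Role n) : ℂ :=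
  match c, ρ with
  | three, .solid _ => Complex.I
  | three, .dotted _ => Complex.I
  | three, .diff => -2 * κ
  | three, _ => 0
  | _, .solid _ => Complex.I / 2
  | _, .dotted _ => Complex.I / 2
  | c, .diff => c.sgn * κ
  | c, .wavy _ => c.sgn
  | c, .zeroMode => c.sgn * p

open Classical in
/-- The factor of the line leaving `i`. A solid line from `i` to `j` stands for
`[a(zᵢ), α^q(w)] = -q δ(zᵢ,w) α^q(w)` if it goes to the right, and for
`[α^q(w), b(zᵢ)] = q δ(zᵢ,w) α^q(w)` if it goes to the left; both factors `α` of a vertex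
contribute. In a loop with `k` vertices the delta function of the closing line is replaced
by `μ k`. Dotted and wavy lines are counted at their left end. -/
def lineFactor (ξ : ℕ → ℝ) (κ : ℝ) (μ : ℕ → ℝ) (M : ℕ) (φ : Fin n → Current)
    (R : Fin n → Role n) (z z' : Fin n → ℂ) (i : Fin n) : ℂ :=
  match R i with
  | .solid j =>
      (if i < j then -1 else 1) *
        (if Closes R i j then (baseCharge φ R j : ℂ) * (μ (loopOf R j).card : ℂ)
         else (baseCharge φ R j : ℂ) * deltaKer (z i) (z j) +
              (diffCharge φ R j : ℂ) * deltaKer (z i) (z' j))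
  | .dotted j => if i < j then dotD ξ M (z i) (z j) else 1
  | .wavy j => if i < j then wavyW κ (z i) (z j) else 1
  | .diff => 1
  | .zeroMode => 1

open Classical in
/-- The value of a graph before the derivatives at the `diff` vertices are taken: coefficients,
lines, and the vacuum correlator of the factors `α` that do not cancel. -/
def undiffAmp (ξ : ℕ → ℝ) (κ p : ℝ) (μ : ℕ → ℝ) (M : ℕ) (φ : Fin n → Current)
    (R : Fin n → Role n) (z z' : Fin n → ℂ) : ℂ :=
  (∏ i, coef κ p (φ i) (R i)) * (∏ i, lineFactor ξ κ μ M φ R z z' i) *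
    expCorr ξ
      (Sum.elim (fun k => if Cancelled φ R k then 0 else baseCharge φ R k) (diffCharge φ R))
      (Sum.elim z z')

/-- The iterated partial derivative with respect to the coordinates in the list `s`. -/
def partials (s : List (Fin n)) (f : (Fin n → ℝ) → ℂ) : (Fin n → ℝ) → ℂ :=
  s.foldr (fun k g v => deriv (fun t : ℝ => g (Function.update v k t)) (v k)) f

/-- The points `zₖ = rₖ e^{i uₖ}`. -/
def pts (r u : Fin n → ℝ) (k : Fin n) : ℂ := r k * Complex.exp (Complex.I * u k)

/-- The renormalized contribution of a graph at the points `zₖ = rₖ e^{i uₖ}`: the derivative with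
respect to the angles of the points `z' k`, for all `diff` vertices `k`, taken at `z' = z`. -/
def amplitude (ξ : ℕ → ℝ) (κ p : ℝ) (μ : ℕ → ℝ) (M : ℕ) (φ : Fin n → Current)
    (R : Fin n → Role n) (r u : Fin n → ℝ) : ℂ :=
  partials ((List.finRange n).filter fun k => R k = .diff)
    (fun u' => undiffAmp ξ κ p μ M φ R (pts r u) (pts r u')) u

open Classical in
/-- The renormalized correlator `⟨φ₀(z₀) ⋯ φₙ₋₁(zₙ₋₁)⟩_p^{R,{μ}}` at `zₖ = rₖ e^{i uₖ}`, with the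
dotted lines truncated to the modes up to `M`. -/
def renCorr (ξ : ℕ → ℝ) (κ p : ℝ) (μ : ℕ → ℝ) (M : ℕ) (φ : Fin n → Current)
    (r u : Fin n → ℝ) : ℂ :=
  ∑ R ∈ Finset.univ.filter (fun R : Fin n → Role n => IsGraph φ R ∧ Kept φ R),
    amplitude ξ κ p μ M φ R r u

/-! ### Correlators of the modes -/

/-- A product of modes, from left to right; the mode `φₘ` of a current is
`(1/2π) ∫ φ(u) e^{imu} du`, so that `φ(u) = ∑ φ₋ₘ e^{imu}`. -/
abbrev Word := List (Current × ℤ)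

/-- The renormalized correlator of a product of modes at the radii `r`. -/
def renMode (ξ : ℕ → ℝ) (κ p : ℝ) (μ : ℕ → ℝ) (w : Word) (M : ℕ) (r : Fin w.length → ℝ) : ℂ :=
  ((2 * Real.pi : ℝ) : ℂ)⁻¹ ^ w.length *
    ∫ u in Set.Icc (0 : Fin w.length → ℝ) (fun _ => 2 * Real.pi),
      renCorr ξ κ p μ M (fun k => (w.get k).1) r u *
        Complex.exp (Complex.I * ∑ k, ((w.get k).2 : ℂ) * (u k : ℂ))

/-- `C` is the family of limits of the renormalized correlators of modes as all radii tend to `1`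
from inside (and the cutoff of the dotted lines is removed). -/
def IsBoundaryValue (ξ : ℕ → ℝ) (κ p : ℝ) (μ : ℕ → ℝ) (C : Word → ℂ) : Prop :=
  ∀ w : Word,
    Tendsto (fun x : ℕ × (Fin w.length → ℝ) => renMode ξ κ p μ w x.1 x.2)
      (atTop ×ˢ 𝓝[Set.univ.pi fun _ => Set.Ioo (0 : ℝ) 1] 1) (𝓝 (C w))

/-! ### The affine Lie algebra -/

/-- `δ_{m+n,0} · a · κ · m`, the central terms; the mode form of `i a κ δ'(u - v)`. -/
def central (a κ : ℝ) (m n : ℤ) : ℂ := if m + n = 0 then (a * κ * m : ℂ) else 0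

/-- The relations of affine `sl(2,ℝ)` with central charge `κ`, under the correlator: the modes of
  `[J⁺(u),J⁻(v)] = i J³(v) δ(u-v) + 4iκ δ'(u-v)`,  `[J³(u),J³(v)] = -8iκ δ'(u-v)`,
  `[J³(u),J^±(v)] = ∓ 2i J^±(v) δ(u-v)`,  `[J^±(u),J^±(v)] = 0`. -/
structure CorrelatorRelations (κ : ℝ) (C : Word → ℂ) : Prop where
  plus_minus : ∀ (w w' : Word) (m n : ℤ),
    C (w ++ [(plus, m), (minus, n)] ++ w') - C (w ++ [(minus, n), (plus, m)] ++ w') =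
      Complex.I * C (w ++ [(three, m + n)] ++ w') + central 4 κ m n * C (w ++ w')
  three_three : ∀ (w w' : Word) (m n : ℤ),
    C (w ++ [(three, m), (three, n)] ++ w') - C (w ++ [(three, n), (three, m)] ++ w') =
      central (-8) κ m n * C (w ++ w')
  three_plus : ∀ (w w' : Word) (m n : ℤ),
    C (w ++ [(three, m), (plus, n)] ++ w') - C (w ++ [(plus, n), (three, m)] ++ w') =
      -2 * Complex.I * C (w ++ [(plus, m + n)] ++ w')
  three_minus : ∀ (w w' : Word) (m n : ℤ),
    C (w ++ [(three, m), (minus, n)] ++ w') - C (w ++ [(minus, n), (three, m)] ++ w') =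
      2 * Complex.I * C (w ++ [(minus, m + n)] ++ w')
  plus_plus : ∀ (w w' : Word) (m n : ℤ),
    C (w ++ [(plus, m), (plus, n)] ++ w') = C (w ++ [(plus, n), (plus, m)] ++ w')
  minus_minus : ∀ (w w' : Word) (m n : ℤ),
    C (w ++ [(minus, m), (minus, n)] ++ w') = C (w ++ [(minus, n), (minus, m)] ++ w')

/-- The adjoint word, up to the sign `(-1)^length`: `(φₘ)* = - φ^†₋ₘ`. -/
def adjWord (w : Word) : Word := (w.map fun x => (x.1.dag, -x.2)).reverse

/-- Hermiticity of the correlators. -/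
def CorrelatorHermitian (C : Word → ℂ) : Prop :=
  ∀ w : Word, (-1) ^ w.length * C (adjWord w) = conj (C w)

/-- A module over affine `sl(2,ℝ)` with central charge `κ`: operators `T c m` for the modes of the
currents with the commutation relations of the algebra. -/
structure IsAffineModule {V : Type} [AddCommGroup V] [Module ℂ V] (κ : ℝ)
    (T : Current → ℤ → Module.End ℂ V) : Prop where
  plus_minus : ∀ m n : ℤ,
    T plus m * T minus n - T minus n * T plus m =
      Complex.I • T three (m + n) + central 4 κ m n • (1 : Module.End ℂ V)
  three_three : ∀ m n : ℤ,
    T three m * T three n - T three n * T three m = central (-8) κ m n • (1 : Module.End ℂ V)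
  three_plus : ∀ m n : ℤ,
    T three m * T plus n - T plus n * T three m = (-2 * Complex.I) • T plus (m + n)
  three_minus : ∀ m n : ℤ,
    T three m * T minus n - T minus n * T three m = (2 * Complex.I) • T minus (m + n)
  plus_plus : ∀ m n : ℤ, T plus m * T plus n = T plus n * T plus m
  minus_minus : ∀ m n : ℤ, T minus m * T minus n = T minus n * T minus m

/-- The sesquilinear form `B` (antilinear in the first argument) is Hermitian, and the operators
satisfy `(φₘ)* = - φ^†₋ₘ` for it, i.e. `J^±(u)* = -J^∓(u)`, `J³(u)* = -J³(u)`. -/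
structure IsInvariantHermitian {V : Type} [AddCommGroup V] [Module ℂ V]
    (T : Current → ℤ → Module.End ℂ V) (B : V →ₗ⋆[ℂ] V →ₗ[ℂ] ℂ) : Prop where
  hermitian : ∀ x y : V, B y x = conj (B x y)
  adjoint : ∀ (c : Current) (m : ℤ) (x y : V), B (T c m x) y = -B x (T c.dag (-m) y)

/-- The action of a product of modes on a vector. -/
def applyWord {V : Type} [AddCommGroup V] [Module ℂ V]
    (T : Current → ℤ → Module.End ℂ V) (w : Word) (v : V) : V :=
  w.foldr (fun x y => T x.1 x.2 y) v

/-- The correlators `C` define a module with a Hermitian form: there are a module over affine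
`sl(2,ℝ)` generated by one vector and an invariant Hermitian form on it such that `C` gives the
matrix elements at the generating vector. -/
def DefinesModule (κ : ℝ) (C : Word → ℂ) : Prop :=
  ∃ (V : Type) (_ : AddCommGroup V) (_ : Module ℂ V) (T : Current → ℤ → Module.End ℂ V)
    (v : V) (B : V →ₗ⋆[ℂ] V →ₗ[ℂ] ℂ),
    IsAffineModule κ T ∧ IsInvariantHermitian T B ∧
      Submodule.span ℂ (Set.range fun w : Word => applyWord T w v) = ⊤ ∧
      ∀ w : Word, B v (applyWord T w v) = C w

end AffineSl2

end

/-!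
# Renormalized correlators and the affine algebra `sl(2, ℝ)^`

On the boundary `δ` becomes a delta function, so the points of a solid component of a graph are
identified and its factors `α` act as one exponential of the total charge. The value of a graph is
then the functional `Lam` of the Fourier coefficients of the correlator of exponentials, applied to
the momenta of the dotted and wavy lines (`graphW`). It depends on the charges only through their
push-forward to the components.

*Existence* (`isBoundaryValue`). Inside the disc every mode of a graph is the same series with
damping factors in the radii and the cutoff `M`. With each loop cut, the lines form a forest, so
conservation of momentum determines their momenta. A dotted line joins a neutral side, which
decouples from the correlator; its momentum is therefore fixed by the modes and the divergence of
`D` is harmless. Wavy lines and derivatives grow linearly in the momenta, and this growth is summable since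
`∑ n ξₙ < ∞`. Dominated convergence gives the limit.

*Relations.* Exchanging two neighbouring operators affects only the lines between them
(`corr_sub_swap`): a solid line changes sign, a dotted line is symmetric, and a wavy line changes by
a multiple of its momentum. A solid line between neighbours is a delta function and can be
contracted (`graphW_leaf`), which turns two vertices into one. For commutators with `J³` this is the
whole effect of the solid lines (`corr_three_swap`). For two charged currents the contraction is not
a single graph of the fused operator, because the other lines may end at either vertex; those graphs
cancel in pairs under the involution `flip`, which moves the end of one line. Two equal currents then commute
(`corr_swap_same`), while for `J⁺`, `J⁻` what remains is `J³` and the central term, produced by the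
wavy lines and the derivatives `∂ᵤ α^±` (`corr_plus_minus`). If the two vertices lie on a common
loop, they can be exchanged without changing its length (`graphW_exchange_loop`), so such graphs
cancel whatever the factors `μ_k` are.

*Hermiticity* (`boundaryCorr_hermitian`). Without `J³`, reversing the order, the charges and the
modes conjugates the value of each graph; the modes of `J³` are commutators of those of `J⁺` and `J⁻`.

*Module* (`definesModule`). The words form a free module carrying the Hermitian form given by the
correlators. Its quotient by the kernel of the form is the module; the relations hold there since
they hold at any place inside the correlators.
-/

noncomputable section

namespace AffineSl2

open Current Finset Function Relation Complex

variable {n n' : ℕ}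

/-- The roles of all vertices. -/
abbrev Graph (n : ℕ) := Fin n → Role n

/-- The weights `ξₙ` are positive. -/
abbrev PosWeights (ξ : ℕ → ℝ) := ∀ n, 1 ≤ n → 0 < ξ n

/-- The weights `ξₙ` decay: `∑ n ξₙ < ∞`. -/
abbrev Decay (ξ : ℕ → ℝ) := Summable fun n : ℕ => (n : ℝ) * ξ n

/-! ### Absolutely convergent expansions -/

/-- A finite product of absolutely convergent series, expanded. -/
theorem summable_and_hasSum_pi {X : Type} : ∀ {n : ℕ} (g : Fin n → X → ℂ),
    (∀ i, Summable fun x => ‖g i x‖) → (Summable fun f : Fin n → X => ‖∏ i, g i (f i)‖) ∧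
      HasSum (fun f : Fin n → X => ∏ i, g i (f i)) (∏ i, ∑' x, g i x) := by
  intro n
  induction n with
  | zero =>
    intro g _
    refine ⟨(hasSum_fintype _).summable, ?_⟩
    simp
  | succ n ih =>
    intro g hg
    obtain ⟨h1, h2⟩ := ih (fun i => g i.succ) (fun i => hg i.succ)
    have key : ∀ y : X × (Fin n → X), ∏ i, g i ((Fin.consEquiv fun _ => X) y i) =
        g 0 y.1 * ∏ i : Fin n, g i.succ (y.2 i) := by
      intro y
      rw [Fin.prod_univ_succ]
      simp [Fin.consEquiv]
    have hs := Summable.mul_norm (hg 0) h1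
    constructor
    · rw [← (Fin.consEquiv fun _ => X).summable_iff]
      refine hs.congr fun y => ?_
      simp only [comp, key]
    · rw [← (Fin.consEquiv fun _ => X).hasSum_iff, Fin.prod_univ_succ, ← h2.tsum_eq,
        tsum_mul_tsum_of_summable_norm (hg 0) h1]
      refine (hs.of_norm.hasSum).congr_fun ?_
      intro y
      simp only [comp, key]

/-- Finite sequences of integers: the index set of the expansion of the exponential. -/
abbrev Seqs : Type := Σ N : ℕ, (Fin N → ℤ)

theorem summable_norm_exp_seqs (y : ℤ → ℂ) (hy : Summable fun j => ‖y j‖) :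
    Summable fun t : Seqs => ‖((t.1.factorial : ℂ))⁻¹ * ∏ i, y (t.2 i)‖ := by
  have h0 : Summable fun j => ‖((‖y j‖ : ℝ) : ℂ)‖ := by simpa using hy
  have hs : ∀ N : ℕ, HasSum (fun f : Fin N → ℤ => ‖((N.factorial : ℂ))⁻¹ * ∏ i, y (f i)‖)
      ((N.factorial : ℝ)⁻¹ * (∑' j, ‖y j‖) ^ N) := by
    intro N
    have h1 := (summable_and_hasSum_pi (fun _ : Fin N => fun j => ((‖y j‖ : ℝ) : ℂ))
      (fun _ => h0)).2
    have h2 : HasSum (fun f : Fin N → ℤ => ∏ i, ‖y (f i)‖) ((∑' j, ‖y j‖) ^ N) := by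
      rw [← hasSum_ofReal]
      convert h1 using 1
      · ext f; push_cast; rfl
      · simp [← ofReal_tsum]
    have h3 : (fun f : Fin N → ℤ => ‖((N.factorial : ℂ))⁻¹ * ∏ i, y (f i)‖) =
        fun f => (N.factorial : ℝ)⁻¹ * ∏ i, ‖y (f i)‖ := by
      funext f
      rw [norm_mul, norm_prod, norm_inv, norm_natCast]
    rw [h3]
    exact h2.mul_left ((N.factorial : ℝ)⁻¹)
  rw [summable_sigma_of_nonneg (fun _ => norm_nonneg _)]
  refine ⟨fun N => (hs N).summable, ?_⟩
  have := Real.summable_pow_div_factorial (∑' j, ‖y j‖)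
  refine this.congr fun N => ?_
  rw [(hs N).tsum_eq]
  field_simp

/-- The exponential of an absolutely convergent series, expanded. -/
theorem hasSum_exp_seqs (y : ℤ → ℂ) (hy : Summable fun j => ‖y j‖) :
    HasSum (fun t : Seqs => ((t.1.factorial : ℂ))⁻¹ * ∏ i, y (t.2 i))
      (exp (∑' j, y j)) := by
  have hS := (summable_norm_exp_seqs y hy).of_norm
  have h1 : ∀ N : ℕ, HasSum (fun f : Fin N → ℤ => ((N.factorial : ℂ))⁻¹ * ∏ i, y (f i))
      (((N.factorial : ℂ))⁻¹ * (∑' j, y j) ^ N) := by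
    intro N
    have := (summable_and_hasSum_pi (fun _ : Fin N => y) (fun _ => hy)).2
    simpa using this.mul_left ((N.factorial : ℂ)⁻¹)
  have h2 := hS.hasSum.sigma h1
  have h3 : HasSum (fun N : ℕ => ((N.factorial : ℂ))⁻¹ * (∑' j, y j) ^ N)
      (exp (∑' j, y j)) := by
    have := NormedSpace.expSeries_div_hasSum_exp (𝔸 := ℂ) (∑' j, y j)
    rw [← exp_eq_exp_ℂ] at this
    refine this.congr_fun ?_
    intro N
    simp [div_eq_inv_mul]
  rw [← h2.unique h3]
  exact hS.hasSum

/-- Termwise differentiation of a series of products of functions of one variable. -/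
theorem partials_tsum {n : ℕ} {ι : Type} (c : ι → ℂ) (G G' : ι → Fin n → ℝ → ℂ) (b : ι → Fin n → ℝ)
    (hd : ∀ l k x, HasDerivAt (G l k) (G' l k x) x)
    (hb : ∀ l k x, ‖G l k x‖ ≤ b l k) (hb' : ∀ l k x, ‖G' l k x‖ ≤ b l k)
    (hs : Summable fun l => ‖c l‖ * ∏ k, b l k) (s : List (Fin n)) (hnd : s.Nodup) :
    partials s (fun v => ∑' l, c l * ∏ k, G l k (v k)) =
      fun v => ∑' l, c l * ∏ k, if k ∈ s then G' l k (v k) else G l k (v k) := by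
  induction s with
  | nil => simp [partials]
  | cons a s ih =>
    have hnd' := List.nodup_cons.1 hnd
    have ih' := ih hnd'.2
    have hcons : partials (a :: s) (fun v => ∑' l, c l * ∏ k, G l k (v k)) =
        fun v => deriv (fun t : ℝ =>
          partials s (fun v => ∑' l, c l * ∏ k, G l k (v k)) (update v a t)) (v a) := rfl
    rw [hcons, ih']
    funext v
    set K : ι → Fin n → ℝ → ℂ := fun l k x => if k ∈ s then G' l k x else G l k x with hK
    have hKb : ∀ l k x, ‖K l k x‖ ≤ b l k := by
      intro l k x
      simp only [hK]; split_ifs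
      · exact hb' l k x
      · exact hb l k x
    have hsplit : ∀ l (t : ℝ), ∏ k, K l k (update v a t k) =
        G l a t * ∏ k ∈ univ.erase a, K l k (v k) := by
      intro l t
      rw [← mul_prod_erase _ _ (mem_univ a)]
      congr 1
      · simp [hK, hnd'.1]
      · refine prod_congr rfl fun k hk => ?_
        rw [update_of_ne (ne_of_mem_erase hk)]
    have hsplitb : ∀ l, ∏ k, b l k = b l a * ∏ k ∈ univ.erase a, b l k := fun l =>
      (mul_prod_erase _ _ (mem_univ a)).symm
    have hderiv : HasDerivAt (fun t : ℝ => ∑' l, c l * ∏ k, K l k (update v a t k))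
        (∑' l, c l * (G' l a (v a) * ∏ k ∈ univ.erase a, K l k (v k))) (v a) := by
      have hprodb : ∀ l, ‖∏ k ∈ univ.erase a, K l k (v k)‖ ≤
          ∏ k ∈ univ.erase a, b l k := by
        intro l
        rw [norm_prod]
        exact prod_le_prod (fun _ _ => norm_nonneg _) fun k _ => hKb l k _
      have hb0 : ∀ l k, 0 ≤ b l k := fun l k => (norm_nonneg _).trans (hb l k 0)
      refine hasDerivAt_tsum (u := fun l => ‖c l‖ * ∏ k, b l k) hs (y₀ := v a)
        (g' := fun l t => c l * (G' l a t * ∏ k ∈ univ.erase a, K l k (v k))) ?_ ?_ ?_ (v a)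
      · intro l t
        have : (fun t => c l * ∏ k, K l k (update v a t k)) =
            fun t => c l * (G l a t * ∏ k ∈ univ.erase a, K l k (v k)) := by
          funext t; rw [hsplit l t]
        rw [this]
        exact ((hd l a t).mul_const _).const_mul _
      · intro l t
        rw [norm_mul, norm_mul, hsplitb]
        refine mul_le_mul_of_nonneg_left ?_ (norm_nonneg _)
        exact mul_le_mul (hb' l a t) (hprodb l) (norm_nonneg _) (hb0 l a)
      · refine Summable.of_norm_bounded hs fun l => ?_
        rw [norm_mul, norm_prod]
        exact mul_le_mul_of_nonneg_left
          (prod_le_prod (fun _ _ => norm_nonneg _) fun k _ => hKb l k _) (norm_nonneg _)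
    rw [hderiv.deriv]
    refine tsum_congr fun l => congrArg _ ?_
    rw [← mul_prod_erase univ _ (mem_univ a)]
    congr 1
    · simp
    · refine prod_congr rfl fun k hk => ?_
      have : k ≠ a := ne_of_mem_erase hk
      simp [hK, this]

theorem integral_torus_character {n : ℕ} (K : Fin n → ℤ) : ((2 * Real.pi : ℝ) : ℂ)⁻¹ ^ n *
      ∫ u in Set.Icc (0 : Fin n → ℝ) (fun _ => 2 * Real.pi),
        exp (I * ∑ k, (K k : ℂ) * (u k : ℂ)) = if K = 0 then 1 else 0 := by
  have hIcc : Set.Icc (0 : Fin n → ℝ) (fun _ => 2 * Real.pi) =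
      Set.univ.pi fun _ => Set.Icc (0 : ℝ) (2 * Real.pi) := (Set.pi_univ_Icc _ _).symm
  have h1 : ∫ u in Set.Icc (0 : Fin n → ℝ) (fun _ => 2 * Real.pi),
        exp (I * ∑ k, (K k : ℂ) * (u k : ℂ)) =
      ∏ k, ∫ x in Set.Icc (0 : ℝ) (2 * Real.pi), exp (I * ((K k : ℂ) * (x : ℂ))) := by
    rw [hIcc, MeasureTheory.volume_pi, MeasureTheory.Measure.restrict_pi_pi,
      ← MeasureTheory.integral_fintype_prod_eq_prod
        (μ := fun _ : Fin n => MeasureTheory.volume.restrict (Set.Icc (0 : ℝ) (2 * Real.pi)))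
        (f := fun k (x : ℝ) => exp (I * ((K k : ℂ) * (x : ℂ))))]
    refine MeasureTheory.integral_congr_ae (Filter.Eventually.of_forall fun u => ?_)
    simp only [mul_sum, exp_sum]
  have h2 : ∀ j : ℤ, ∫ x in Set.Icc (0 : ℝ) (2 * Real.pi),
      exp (I * ((j : ℂ) * (x : ℂ))) = if j = 0 then ((2 * Real.pi : ℝ) : ℂ) else 0 := by
    intro j
    rw [MeasureTheory.integral_Icc_eq_integral_Ioc,
      ← intervalIntegral.integral_of_le Real.two_pi_pos.le]
    split_ifs with hj
    · simp [hj]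
    · have hc : I * (j : ℂ) ≠ 0 := by
        simp [I_ne_zero, hj]
      have : (fun x : ℝ => exp (I * ((j : ℂ) * (x : ℂ)))) =
          fun x : ℝ => exp ((I * (j : ℂ)) * x) := by
        funext x; ring_nf
      rw [this, integral_exp_mul_complex hc]
      have h3 : exp (I * (j : ℂ) * ((2 * Real.pi : ℝ) : ℂ)) = 1 := by
        rw [exp_eq_one_iff]
        exact ⟨j, by push_cast; ring⟩
      rw [h3]; simp
  rw [h1]
  simp only [h2]
  have hpi : ((2 * Real.pi : ℝ) : ℂ) ≠ 0 := by
    exact_mod_cast Real.two_pi_pos.ne'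
  split_ifs with hK
  · subst hK
    simp only [Pi.zero_apply, if_true, prod_const, card_univ, Fintype.card_fin]
    rw [← mul_pow, inv_mul_cancel₀ hpi, one_pow]
  · obtain ⟨k, hk⟩ : ∃ k, K k ≠ 0 := by
      by_contra h
      push Not at h
      exact hK (funext h)
    rw [prod_eq_zero (mem_univ k) (by simp [hk]), mul_zero]

/-! ### Fourier expansion of the correlator of exponentials -/

/-- The coefficients `ξ_{|j|}`, `j ≠ 0`, of the covariance. -/
def xiHat (ξ : ℕ → ℝ) (j : ℤ) : ℝ := if j = 0 then 0 else ξ j.natAbs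

/-- The weight `(1/N!) ∏ ξ_{|jᵢ|}` of a sequence of modes in the expansion of the exponential. -/
def seqW (ξ : ℕ → ℝ) (t : Seqs) : ℂ :=
  ((t.1.factorial : ℂ))⁻¹ * ∏ i, (xiHat ξ (t.2 i) : ℂ)

variable {ι κ' : Type} [Fintype ι] [Fintype κ']

open Classical in
/-- The Fourier mode `∑ jᵢ (e_{aᵢ} - e_{bᵢ})` to which the pairs `(aᵢ, bᵢ)` contribute. -/
def mom (t : Seqs) (p : Fin t.1 → ι × ι) : ι → ℤ := fun a =>
  ∑ i, t.2 i * ((if (p i).1 = a then 1 else 0) - (if (p i).2 = a then 1 else 0))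

/-- The coefficient with which a pair of points contributes at the radii `ρ`. -/
def pairW (ρ : ι → ℝ) (q : ι → ℤ) (j : ℤ) (x : ι × ι) : ℂ :=
  -(1 / 2) * (q x.1 : ℂ) * (q x.2 : ℂ) * ((ρ x.1 * ρ x.2 : ℝ) : ℂ) ^ j.natAbs

/-- The term of `Lam` that belongs to a sequence of modes. -/
def lamTerm (ξ : ℕ → ℝ) (ρ : ι → ℝ) (q : ι → ℤ) (F : (ι → ℤ) → ℂ) (t : Seqs) : ℂ :=
  seqW ξ t * ∑ p : Fin t.1 → ι × ι, (∏ i, pairW ρ q (t.2 i) (p i)) * F (mom t p)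

/-- `∑_L Ê(L) F(L)`, where `Ê` are the Fourier coefficients of the correlator of the exponentials
of charges `q` at the radii `ρ`; the series is written in the unreduced form given by the expansion
of the exponential. -/
def Lam (ξ : ℕ → ℝ) (ρ : ι → ℝ) (q : ι → ℤ) (F : (ι → ℤ) → ℂ) : ℂ :=
  if ∑ a, q a = 0 then ∑' t, lamTerm ξ ρ q F t else 0

open Classical in
/-- The push-forward of a function along a map of points. -/
def push {A : Type} [AddCommMonoid A] (c : ι → κ') (L : ι → A) : κ' → A := fun b =>
  ∑ a with c a = b, L a

theorem sum_push {A : Type} [AddCommMonoid A] (c : ι → κ') (L : ι → A) :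
    ∑ b, push c L b = ∑ a, L a := by
  classical
  simp only [push]
  exact sum_fiberwise _ _ _

/-- Reindexing of a sum over sequences of points along a map of points. -/
theorem sum_prod_comp {α β : Type} [Fintype α] [Fintype β] {N : ℕ} (c : α → β)
    (Q : Fin N → α → ℂ) (H : (Fin N → β) → ℂ) :
    ∑ f : Fin N → α, (∏ i, Q i (f i)) * H (fun i => c (f i)) =
      ∑ g : Fin N → β, (∏ i, push c (Q i) (g i)) * H g := by
  classical
  rw [← sum_fiberwise univ (fun f : Fin N → α => fun i => c (f i))]
  refine sum_congr rfl fun g _ => ?_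
  simp only [push]
  rw [prod_univ_sum, sum_mul]
  have : (univ.filter fun f : Fin N → α => (fun i => c (f i)) = g) =
      Fintype.piFinset fun i => univ.filter fun a => c a = g i := by
    ext f
    simp [Fintype.mem_piFinset, funext_iff]
  rw [this]
  refine sum_congr rfl fun f hf => ?_
  congr 2
  funext i
  simpa using (Fintype.mem_piFinset.1 hf) i

theorem push_mom (c : ι → κ') (t : Seqs) (p : Fin t.1 → ι × ι) :
    push c (mom t p) = mom t fun i => (c (p i).1, c (p i).2) := by
  classical
  funext b
  simp only [push, mom]
  rw [sum_comm]
  refine sum_congr rfl fun i _ => ?_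
  rw [← mul_sum, sum_sub_distrib]
  simp [sum_ite_eq, mem_filter]

theorem push_pairW (c : ι → κ') (ρ : κ' → ℝ) (q : ι → ℤ) (j : ℤ) :
    push (Prod.map c c) (pairW (ρ ∘ c) q j) = pairW ρ (push c q) j := by
  classical
  funext ⟨x, y⟩
  simp only [push, pairW]
  rw [sum_congr (s₂ := (univ.filter fun a => c a = x) ×ˢ
      (univ.filter fun a => c a = y)) (by ext ⟨a, b⟩; simp [Prod.ext_iff])
      (fun _ _ => rfl), sum_product]
  push_cast
  rw [mul_assoc (-(1 / 2) : ℂ), sum_mul_sum, mul_sum, sum_mul]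
  refine sum_congr rfl fun a ha => ?_
  rw [mul_sum, sum_mul]
  refine sum_congr rfl fun b hb => ?_
  simp only [mem_filter, mem_univ, true_and] at ha hb
  simp only [comp, ha, hb]
  ring

/-- Exponentials at coinciding points fuse: the functional of the pushed-forward charges. -/
theorem lamTerm_push (ξ : ℕ → ℝ) (c : ι → κ') (ρ : κ' → ℝ) (q : ι → ℤ) (F : (κ' → ℤ) → ℂ)
    (t : Seqs) : lamTerm ξ (ρ ∘ c) q (fun L => F (push c L)) t = lamTerm ξ ρ (push c q) F t := by
  classical
  simp only [lamTerm]
  congr 1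
  have := sum_prod_comp (Prod.map c c) (fun i => pairW (ρ ∘ c) q (t.2 i)) (fun p => F (mom t p))
  simp only [push_pairW] at this
  rw [← this]
  refine sum_congr rfl fun p _ => ?_
  rw [push_mom]
  rfl

theorem lamTerm_congr (ξ : ℕ → ℝ) (ρ : ι → ℝ) (q : ι → ℤ) {F F' : (ι → ℤ) → ℂ}
    (h : ∀ L, (∀ a, q a = 0 → L a = 0) → F L = F' L) (t : Seqs) :
    lamTerm ξ ρ q F t = lamTerm ξ ρ q F' t := by
  classical
  simp only [lamTerm]
  congr 1
  refine sum_congr rfl fun p _ => ?_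
  by_cases hp : ∃ i, q (p i).1 = 0 ∨ q (p i).2 = 0
  · obtain ⟨i, hi⟩ := hp
    rw [prod_eq_zero (mem_univ i), zero_mul, zero_mul]
    rcases hi with hi | hi <;> simp [pairW, hi]
  · push Not at hp
    rw [h]
    intro a ha
    simp only [mom]
    refine sum_eq_zero fun i _ => ?_
    have h1 : (p i).1 ≠ a := fun h => (hp i).1 (h ▸ ha)
    have h2 : (p i).2 ≠ a := fun h => (hp i).2 (h ▸ ha)
    simp [h1, h2]

theorem Lam_push (ξ : ℕ → ℝ) (c : ι → κ') (ρ : κ' → ℝ) (q : ι → ℤ) (F : (κ' → ℤ) → ℂ) :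
    Lam ξ (ρ ∘ c) q (fun L => F (push c L)) = Lam ξ ρ (push c q) F := by
  simp only [Lam, sum_push, lamTerm_push]

theorem Lam_congr (ξ : ℕ → ℝ) (ρ : ι → ℝ) (q : ι → ℤ) {F F' : (ι → ℤ) → ℂ}
    (h : ∀ L, (∀ a, q a = 0 → L a = 0) → F L = F' L) : Lam ξ ρ q F = Lam ξ ρ q F' := by
  simp only [Lam, lamTerm_congr ξ ρ q h]

theorem Lam_neg_charge (ξ : ℕ → ℝ) (ρ : ι → ℝ) (q : ι → ℤ) (F : (ι → ℤ) → ℂ) :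
    Lam ξ ρ (-q) F = Lam ξ ρ q F := by
  simp [Lam, lamTerm, pairW]

theorem Lam_neg_modes (ξ : ℕ → ℝ) (ρ : ι → ℝ) (q : ι → ℤ) (F : (ι → ℤ) → ℂ) :
    Lam ξ ρ q (fun L => F (-L)) = Lam ξ ρ q F := by
  have : ∀ t, lamTerm ξ ρ q (fun L => F (-L)) t = lamTerm ξ ρ q F t := by
    intro t
    simp only [lamTerm]
    congr 1
    refine Fintype.sum_equiv (⟨fun p i => (p i).swap, fun p i => (p i).swap, fun _ => rfl,
      fun _ => rfl⟩ : (Fin t.1 → ι × ι) ≃ (Fin t.1 → ι × ι)) _ _ fun p => ?_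
    congr 1
    · refine prod_congr rfl fun i _ => ?_
      simp only [pairW, Equiv.coe_fn_mk, Prod.fst_swap, Prod.snd_swap]
      rw [mul_comm (ρ _) (ρ _)]
      ring
    · congr 1
      funext a
      simp only [mom, Pi.neg_apply, Equiv.coe_fn_mk, Prod.fst_swap, Prod.snd_swap]
      rw [← sum_neg_distrib]
      refine sum_congr rfl fun i _ => ?_
      ring
  simp only [Lam, this]

theorem conj_Lam (ξ : ℕ → ℝ) (ρ : ι → ℝ) (q : ι → ℤ) (F : (ι → ℤ) → ℂ) :
    conj (Lam ξ ρ q F) = Lam ξ ρ q (fun L => conj (F L)) := by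
  simp only [Lam]
  split_ifs
  · rw [conj_tsum]
    refine tsum_congr fun t => ?_
    simp only [lamTerm, map_mul, map_sum, map_prod]
    congr 1
    · simp [seqW]
    · refine sum_congr rfl fun p _ => ?_
      congr 1
      refine prod_congr rfl fun i _ => ?_
      simp [pairW, map_ofNat]
  · simp

variable {ι κ' : Type} [Fintype ι] [Fintype κ']

/-! ### Summability -/

theorem xiHat_nonneg {ξ : ℕ → ℝ} (hξ : PosWeights ξ) (j : ℤ) : 0 ≤ xiHat ξ j := by
  unfold xiHat
  split_ifs with h
  · exact le_rfl
  · exact (hξ _ (Int.natAbs_pos.2 h)).le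

theorem summable_int_of_nat {f : ℤ → ℝ} (h1 : Summable fun n : ℕ => f n)
    (h2 : Summable fun n : ℕ => f (-(n : ℤ))) : Summable f :=
  Summable.of_nat_of_neg h1 h2

theorem summable_xiHat_weight {ξ : ℕ → ℝ} (hξ : PosWeights ξ) (hsum : Decay ξ) :
    Summable fun j : ℤ => xiHat ξ j * (1 + |(j : ℝ)|) := by
  have h : Summable fun n : ℕ => xiHat ξ n * (1 + (n : ℝ)) := by
    refine Summable.of_nonneg_of_le (fun n => mul_nonneg (xiHat_nonneg hξ _) (by positivity)) ?_
      (hsum.mul_left 2)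
    intro n
    rcases Nat.eq_zero_or_pos n with rfl | hn
    · simp [xiHat]
    · have h0 : (n : ℤ) ≠ 0 := by omega
      have h1 : (1 : ℝ) ≤ n := by exact_mod_cast hn
      have h2 := hξ n hn
      simp only [xiHat, h0, if_false, Int.natAbs_natCast]
      nlinarith
  refine summable_int_of_nat ?_ ?_
  · refine h.congr fun n => ?_
    simp
  · refine h.congr fun n => ?_
    simp [xiHat]

/-- The weight `∏ (1 + |Lₐ|)^{1/2}`: the Fourier coefficients of the correlator of exponentials are
summable with it precisely because `∑ n ξₙ` converges. -/
def wgt (L : ι → ℤ) : ℝ := ∏ a, √(1 + |(L a : ℝ)|)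

theorem one_le_sqrt_one_add_abs (x : ℝ) : 1 ≤ √(1 + |x|) := by
  rw [Real.one_le_sqrt]
  have := abs_nonneg x
  linarith

theorem one_le_wgt (L : ι → ℤ) : 1 ≤ wgt L := by
  unfold wgt
  calc (1 : ℝ) = ∏ _a : ι, (1 : ℝ) := by simp
    _ ≤ _ := prod_le_prod (fun _ _ => zero_le_one) fun a _ => one_le_sqrt_one_add_abs _

theorem sqrt_one_add_abs_add_le (x y : ℝ) : √(1 + |x + y|) ≤ √(1 + |x|) * √(1 + |y|) := by
  rw [← Real.sqrt_mul (by positivity)]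
  refine Real.sqrt_le_sqrt ?_
  have := abs_add_le x y
  nlinarith [mul_nonneg (abs_nonneg x) (abs_nonneg y)]

theorem wgt_add_le (L L' : ι → ℤ) : wgt (L + L') ≤ wgt L * wgt L' := by
  unfold wgt
  rw [← prod_mul_distrib]
  refine prod_le_prod (fun _ _ => Real.sqrt_nonneg _) fun a _ => ?_
  have := sqrt_one_add_abs_add_le (L a : ℝ) (L' a : ℝ)
  simpa using this

theorem wgt_zero : wgt (0 : ι → ℤ) = 1 := by simp [wgt]

open Classical in
theorem wgt_single (j : ℤ) (a : ι) :
    wgt (fun b => j * (if a = b then 1 else 0)) = √(1 + |(j : ℝ)|) := by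
  unfold wgt
  rw [prod_eq_single a]
  · simp
  · intro b _ hb
    simp [hb.symm]
  · simp

open Classical in
theorem wgt_pair_le (j : ℤ) (a b : ι) :
    wgt (fun c => j * ((if a = c then 1 else 0) - (if b = c then 1 else 0))) ≤ 1 + |(j : ℝ)| := by
  have h1 := wgt_add_le (fun c => j * (if a = c then 1 else 0))
    (fun c => (-j) * (if b = c then 1 else 0))
  rw [wgt_single, wgt_single] at h1
  push_cast at h1
  rw [abs_neg, Real.mul_self_sqrt (by positivity)] at h1
  refine le_trans (le_of_eq ?_) h1
  congr 1
  funext c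
  simp only [Pi.add_apply]
  ring

theorem wgt_sum_le {α : Type} (s : Finset α) (f : α → ι → ℤ) :
    wgt (∑ i ∈ s, f i) ≤ ∏ i ∈ s, wgt (f i) := by
  classical
  induction s using Finset.induction_on with
  | empty => simp [wgt_zero]
  | insert a s ha ih =>
    rw [sum_insert ha, prod_insert ha]
    exact (wgt_add_le _ _).trans (mul_le_mul_of_nonneg_left ih (zero_le_one.trans (one_le_wgt _)))

theorem wgt_mom_le (t : Seqs) (p : Fin t.1 → ι × ι) : wgt (mom t p) ≤ ∏ i, (1 + |(t.2 i : ℝ)|) := by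
  classical
  have h := wgt_sum_le univ (fun (i : Fin t.1) (c : ι) =>
    t.2 i * ((if (p i).1 = c then 1 else 0) - (if (p i).2 = c then 1 else 0)))
  have h2 : mom t p = ∑ i, fun c : ι =>
      t.2 i * ((if (p i).1 = c then 1 else 0) - (if (p i).2 = c then 1 else 0)) := by
    funext c
    simp only [mom, Finset.sum_apply]
  rw [h2]
  refine h.trans (prod_le_prod (fun _ _ => zero_le_one.trans (one_le_wgt _)) fun i _ => ?_)
  exact wgt_pair_le _ _ _

/-- The total absolute value of the coefficients of the pairs of points. -/
def pairBound (q : ι → ℤ) : ℝ := ∑ x : ι × ι, |(q x.1 : ℝ)| * |(q x.2 : ℝ)|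

/-- A summable majorant of the terms of `Lam`. -/
def lamMaj (ξ : ℕ → ℝ) (q : ι → ℤ) (t : Seqs) : ℝ :=
  ‖((t.1.factorial : ℂ))⁻¹ * ∏ i, ((xiHat ξ (t.2 i) * (1 + |(t.2 i : ℝ)|) * pairBound q : ℝ) : ℂ)‖

theorem summable_lamMaj {ξ : ℕ → ℝ} (hξ : PosWeights ξ)
    (hsum : Decay ξ) (q : ι → ℤ) : Summable (lamMaj ξ q) := by
  refine summable_norm_exp_seqs
    (fun j => ((xiHat ξ j * (1 + |(j : ℝ)|) * pairBound q : ℝ) : ℂ)) ?_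
  have := ((summable_xiHat_weight hξ hsum).mul_right (pairBound q)).norm
  refine this.congr fun j => ?_
  rw [norm_real]

theorem norm_pairW_le {ρ : ι → ℝ} (hρ : ∀ a, 0 ≤ ρ a ∧ ρ a ≤ 1) (q : ι → ℤ) (j : ℤ) (x : ι × ι) :
    ‖pairW ρ q j x‖ ≤ |(q x.1 : ℝ)| * |(q x.2 : ℝ)| := by
  have h1 : (ρ x.1 * ρ x.2) ^ j.natAbs ≤ 1 :=
    pow_le_one₀ (mul_nonneg (hρ _).1 (hρ _).1) (mul_le_one₀ (hρ _).2 (hρ _).1 (hρ _).2)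
  have h0 : 0 ≤ (ρ x.1 * ρ x.2) ^ j.natAbs := pow_nonneg (mul_nonneg (hρ _).1 (hρ _).1) _
  have e : ‖pairW ρ q j x‖ = (1 / 2) * (|(q x.1 : ℝ)| * |(q x.2 : ℝ)|) *
      (ρ x.1 * ρ x.2) ^ j.natAbs := by
    simp only [pairW, norm_mul, norm_neg, norm_pow, norm_real, norm_intCast,
      Real.norm_eq_abs, abs_of_nonneg (hρ x.1).1, abs_of_nonneg (hρ x.2).1]
    norm_num [mul_assoc]
  rw [e]
  have h2 : 0 ≤ |(q x.1 : ℝ)| * |(q x.2 : ℝ)| := by positivity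
  calc (1 / 2) * (|(q x.1 : ℝ)| * |(q x.2 : ℝ)|) * (ρ x.1 * ρ x.2) ^ j.natAbs
      ≤ 1 * (|(q x.1 : ℝ)| * |(q x.2 : ℝ)|) * 1 := by gcongr; norm_num
    _ = _ := by ring

theorem norm_lamTerm_le {ξ : ℕ → ℝ} (hξ : PosWeights ξ) {ρ : ι → ℝ}
    (hρ : ∀ a, 0 ≤ ρ a ∧ ρ a ≤ 1) {q : ι → ℤ} {F : (ι → ℤ) → ℂ} {C : ℝ}
    (hF : ∀ L, (∀ a, q a = 0 → L a = 0) → ‖F L‖ ≤ C * wgt L) (t : Seqs) :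
    ‖lamTerm ξ ρ q F t‖ ≤ C * lamMaj ξ q t := by
  classical
  have hC : 0 ≤ C := by
    have := (norm_nonneg _).trans (hF 0 (fun _ _ => rfl))
    rw [wgt_zero] at this
    linarith
  -- outside the support of the charges `F` may be replaced by zero
  set F' : (ι → ℤ) → ℂ := fun L => if ∀ a, q a = 0 → L a = 0 then F L else 0 with hF'
  have hFF : lamTerm ξ ρ q F t = lamTerm ξ ρ q F' t :=
    lamTerm_congr ξ ρ q (fun L hL => by simp only [hF', if_pos hL]) t
  have hb : ∀ L, ‖F' L‖ ≤ C * wgt L := by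
    intro L
    simp only [hF']
    split_ifs with h
    · exact hF L h
    · rw [norm_zero]
      exact mul_nonneg hC (zero_le_one.trans (one_le_wgt _))
  rw [hFF, lamTerm, norm_mul]
  have h1 : ‖∑ p : Fin t.1 → ι × ι, (∏ i, pairW ρ q (t.2 i) (p i)) * F' (mom t p)‖ ≤
      (∏ _i : Fin t.1, pairBound q) * (C * ∏ i, (1 + |(t.2 i : ℝ)|)) := by
    calc _ ≤ ∑ p : Fin t.1 → ι × ι, ‖(∏ i, pairW ρ q (t.2 i) (p i)) * F' (mom t p)‖ :=
          norm_sum_le _ _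
      _ ≤ ∑ p : Fin t.1 → ι × ι, (∏ i, (|(q (p i).1 : ℝ)| * |(q (p i).2 : ℝ)|)) *
            (C * ∏ i, (1 + |(t.2 i : ℝ)|)) := by
          refine sum_le_sum fun p _ => ?_
          rw [norm_mul, norm_prod]
          refine mul_le_mul ?_ ?_ (norm_nonneg _) ?_
          · exact prod_le_prod (fun _ _ => norm_nonneg _) fun i _ => norm_pairW_le hρ q _ _
          · exact (hb _).trans (mul_le_mul_of_nonneg_left (wgt_mom_le t p) hC)
          · exact prod_nonneg fun _ _ => by positivity
      _ = _ := by
          rw [← sum_mul]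
          congr 1
          have := (prod_univ_sum (fun _ : Fin t.1 => (univ : Finset (ι × ι)))
            (fun _ x => |(q x.1 : ℝ)| * |(q x.2 : ℝ)|)).symm
          simpa [pairBound] using this
  refine (mul_le_mul_of_nonneg_left h1 (norm_nonneg _)).trans (le_of_eq ?_)
  have hx : ∀ j, 0 ≤ xiHat ξ j := xiHat_nonneg hξ
  have hB : 0 ≤ pairBound q := sum_nonneg fun _ _ => by positivity
  have ha : ∀ x : ℝ, |(1 + |x| : ℝ)| = 1 + |x| := fun x => abs_of_nonneg (by positivity)
  simp only [seqW, lamMaj, norm_mul, norm_prod, norm_real, Real.norm_eq_abs, ha,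
    abs_of_nonneg (hx _), abs_of_nonneg hB]
  rw [prod_mul_distrib, prod_mul_distrib]
  ring

theorem summable_lamTerm {ξ : ℕ → ℝ} (hξ : PosWeights ξ) (hsum : Decay ξ) {ρ : ι → ℝ}
    (hρ : ∀ a, 0 ≤ ρ a ∧ ρ a ≤ 1) {q : ι → ℤ} {F : (ι → ℤ) → ℂ} {C : ℝ}
    (hF : ∀ L, (∀ a, q a = 0 → L a = 0) → ‖F L‖ ≤ C * wgt L) : Summable (lamTerm ξ ρ q F) :=
  Summable.of_norm_bounded ((summable_lamMaj hξ hsum q).mul_left C) (norm_lamTerm_le hξ hρ hF)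

theorem lamTerm_add (ξ : ℕ → ℝ) (ρ : ι → ℝ) (q : ι → ℤ) (F F' : (ι → ℤ) → ℂ) (t : Seqs) :
    lamTerm ξ ρ q (fun L => F L + F' L) t = lamTerm ξ ρ q F t + lamTerm ξ ρ q F' t := by
  simp only [lamTerm, mul_add, sum_add_distrib]

theorem lamTerm_smul (ξ : ℕ → ℝ) (ρ : ι → ℝ) (q : ι → ℤ) (z : ℂ) (F : (ι → ℤ) → ℂ) (t : Seqs) :
    lamTerm ξ ρ q (fun L => z * F L) t = z * lamTerm ξ ρ q F t := by
  simp only [lamTerm, mul_sum]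
  refine sum_congr rfl fun p _ => ?_
  ring

theorem Lam_smul (ξ : ℕ → ℝ) (ρ : ι → ℝ) (q : ι → ℤ) (z : ℂ) (F : (ι → ℤ) → ℂ) :
    Lam ξ ρ q (fun L => z * F L) = z * Lam ξ ρ q F := by
  simp only [Lam, lamTerm_smul, tsum_mul_left, mul_ite, mul_zero]

theorem Lam_add (ξ : ℕ → ℝ) (ρ : ι → ℝ) (q : ι → ℤ) (F F' : (ι → ℤ) → ℂ)
    (h : Summable (lamTerm ξ ρ q F)) (h' : Summable (lamTerm ξ ρ q F')) :
    Lam ξ ρ q (fun L => F L + F' L) = Lam ξ ρ q F + Lam ξ ρ q F' := by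
  simp only [Lam, lamTerm_add]
  split_ifs
  · exact h.tsum_add h'
  · simp

/-! ### Blocks of a graph and the functional they define -/

/-- Two vertices are linked by a line of any kind. -/
def Link (R : Graph n) (i j : Fin n) : Prop :=
  R i = .solid j ∨ R i = .dotted j ∨ R i = .wavy j

/-- The vertices are in the same component of the graph of solid lines; on the boundary the solid
lines identify the points of such a component. -/
def Conn (R : Graph n) : Fin n → Fin n → Prop := EqvGen (Step R)

/-- The vertices are in the same component of the whole graph. -/
def Joined (R : Graph n) : Fin n → Fin n → Prop := EqvGen (Link R)

theorem Conn.refl (R : Graph n) (i : Fin n) : Conn R i i := EqvGen.refl i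
theorem Conn.symm {R : Graph n} {i j : Fin n} (h : Conn R i j) : Conn R j i :=
  EqvGen.symm _ _ h
theorem Conn.trans {R : Graph n} {i j k : Fin n} (h : Conn R i j) (h' : Conn R j k) :
    Conn R i k := EqvGen.trans _ _ _ h h'
theorem Conn.of_solid {R : Graph n} {i j : Fin n} (h : R i = .solid j) : Conn R i j :=
  EqvGen.rel _ _ h
theorem Joined.refl (R : Graph n) (i : Fin n) : Joined R i i := EqvGen.refl i
theorem Joined.symm {R : Graph n} {i j : Fin n} (h : Joined R i j) : Joined R j i :=
  EqvGen.symm _ _ h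
theorem Joined.trans {R : Graph n} {i j k : Fin n} (h : Joined R i j)
    (h' : Joined R j k) : Joined R i k := EqvGen.trans _ _ _ h h'
theorem Joined.of_link {R : Graph n} {i j : Fin n} (h : Link R i j) : Joined R i j :=
  EqvGen.rel _ _ h
theorem Conn.joined {R : Graph n} {i j : Fin n} (h : Conn R i j) : Joined R i j :=
  EqvGen.mono (fun _ _ h => Or.inl h) _ _ h

open Classical in
/-- The sum of a function over the block of a vertex. -/
def blockSum {A : Type} [AddCommMonoid A] (E : Fin n → Fin n → Prop) (f : Fin n → A)
    (i : Fin n) : A := ∑ k with E k i, f k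

theorem blockSum_add {A : Type} [AddCommMonoid A] (E : Fin n → Fin n → Prop) (f g : Fin n → A)
    (i : Fin n) : blockSum E (fun k => f k + g k) i = blockSum E f i + blockSum E g i := by
  simp [blockSum, sum_add_distrib]

theorem blockSum_congr_right {A : Type} [AddCommMonoid A] {E : Fin n → Fin n → Prop}
    (f : Fin n → A) {i j : Fin n} (h : ∀ k, E k i ↔ E k j) : blockSum E f i = blockSum E f j := by
  classical
  simp only [blockSum]
  exact sum_congr (by ext k; simp [h k]) fun _ _ => rfl

theorem blockSum_conn_congr {A : Type} [AddCommMonoid A] {R : Graph n}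
    (f : Fin n → A) {i j : Fin n} (h : Conn R i j) :
    blockSum (Conn R) f i = blockSum (Conn R) f j :=
  blockSum_congr_right f fun _ => ⟨fun h' => h'.trans h, fun h' => h'.trans h.symm⟩

theorem blockSum_joined_congr {A : Type} [AddCommMonoid A] {R : Graph n}
    (f : Fin n → A) {i j : Fin n} (h : Joined R i j) :
    blockSum (Joined R) f i = blockSum (Joined R) f j :=
  blockSum_congr_right f fun _ => ⟨fun h' => h'.trans h, fun h' => h'.trans h.symm⟩

open Classical in
theorem blockSum_push {A : Type} [AddCommMonoid A] (E : Fin n' → Fin n' → Prop) (c : Fin n → Fin n')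
    (f : Fin n → A) (i : Fin n') : blockSum E (push c f) i = ∑ k with E (c k) i, f k := by
  simp only [blockSum, push]
  rw [← sum_fiberwise_of_maps_to (s := univ.filter fun k => E (c k) i)
    (t := univ.filter fun k => E k i) (g := c) (by simp)]
  refine sum_congr rfl fun b hb => ?_
  refine sum_congr ?_ fun _ _ => rfl
  ext a
  simp only [mem_filter, mem_univ, true_and] at hb ⊢
  constructor
  · rintro rfl; exact ⟨hb, rfl⟩
  · exact fun h => h.2

theorem push_push {α β γ A : Type} [Fintype α] [Fintype β] [AddCommMonoid A] (c : α → β)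
    (d : β → γ) (f : α → A) : push d (push c f) = push (d ∘ c) f := by
  classical
  funext b
  simp only [push]
  rw [← sum_fiberwise_of_maps_to (s := univ.filter fun k => (d ∘ c) k = b)
    (t := univ.filter fun k => d k = b) (g := c) (by simp)]
  refine sum_congr rfl fun x hx => ?_
  refine sum_congr ?_ fun _ _ => rfl
  ext a
  simp only [mem_filter, mem_univ, true_and, comp] at hx ⊢
  constructor
  · rintro rfl; exact ⟨hx, rfl⟩
  · exact fun h => h.2

theorem push_id {α A : Type} [Fintype α] [AddCommMonoid A] (f : α → A) :
    push (id : α → α) f = f := by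
  classical
  funext b
  simp [push, sum_filter]

theorem push_of_injective {α β A : Type} [Fintype α] [AddCommMonoid A] {c : α → β}
    (hc : Injective c) (f : α → A) (a : α) : push c f (c a) = f a := by
  classical
  simp only [push]
  rw [sum_eq_single a]
  · intro b hb hba
    exact absurd (hc (mem_filter.1 hb).2) hba
  · simp

theorem push_eq_zero {α β A : Type} [Fintype α] [AddCommMonoid A] {c : α → β}
    (f : α → A) {b : β} (h : ∀ a, c a ≠ b) : push c f b = 0 := by
  classical
  simp only [push]
  refine sum_eq_zero fun a ha => absurd (mem_filter.1 ha).2 (h a)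

/-- The two points `z k`, `z' k` of each vertex. -/
abbrev Pts (n : ℕ) : Type := Fin n ⊕ Fin n

theorem push_elim_inl {A : Type} [AddCommMonoid A] (c d : Fin n → Fin n') (f : Pts n → A)
    (i : Fin n') : push (Sum.map c d) f (.inl i) = push c (fun k => f (.inl k)) i := by
  classical
  simp only [push, sum_filter, Fintype.sum_sum_type]
  simp only [Sum.map_inl, Sum.map_inr, Sum.inl.injEq, reduceCtorEq, if_false,
    sum_const_zero, add_zero]
  refine sum_congr rfl fun x _ => ?_
  split_ifs <;> rfl

theorem push_elim_inr {A : Type} [AddCommMonoid A] (c d : Fin n → Fin n') (f : Pts n → A)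
    (i : Fin n') : push (Sum.map c d) f (.inr i) = push d (fun k => f (.inr k)) i := by
  classical
  simp only [push, sum_filter, Fintype.sum_sum_type]
  simp only [Sum.map_inl, Sum.map_inr, Sum.inr.injEq, reduceCtorEq, if_false,
    sum_const_zero, zero_add]
  refine sum_congr rfl fun x _ => ?_
  split_ifs <;> rfl

/-- The momentum of the exponentials and of the test character at a vertex. -/
def total (m : Fin n → ℤ) (L : Pts n → ℤ) (k : Fin n) : ℤ := m k + L (.inl k) + L (.inr k)

open Classical in
/-- Momentum conservation in every component of the graph, times a product of local weights: the
weight of a vertex depends on the momentum flowing through its solid component and on the momentum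
at its second point. -/
def Gfun (R : Graph n) (m : Fin n → ℤ) (g : Fin n → ℤ → ℤ → ℂ) (L : Pts n → ℤ) : ℂ :=
  if ∀ i, blockSum (Joined R) (total m L) i = 0 then
    ∏ i, g i (blockSum (Conn R) (total m L) i) (L (.inr i)) else 0

/-- A representative of the solid component of a vertex. -/
def rep (R : Graph n) (k : Fin n) : Fin n :=
  Quotient.out (s := EqvGen.setoid (Step R)) (Quotient.mk _ k)

theorem conn_rep (R : Graph n) (k : Fin n) : Conn R (rep R k) k :=
  Quotient.exact (s := EqvGen.setoid (Step R))
    (Quotient.out_eq (s := EqvGen.setoid (Step R)) (Quotient.mk _ k))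

theorem rep_eq_of_conn {R : Graph n} {i j : Fin n} (h : Conn R i j) : rep R i = rep R j := by
  unfold rep
  rw [Quotient.sound (s := EqvGen.setoid (Step R)) (a := i) (b := j) h]

theorem push_rep_congr {A : Type} [AddCommMonoid A] (R : Graph n) {f f' : Fin n → A}
    (h : ∀ i, blockSum (Conn R) f i = blockSum (Conn R) f' i) :
    push (rep R) f = push (rep R) f' := by
  classical
  funext b
  by_cases hb : ∃ k, rep R k = b
  · obtain ⟨k, rfl⟩ := hb
    have key : ∀ f : Fin n → A, push (rep R) f (rep R k) = blockSum (Conn R) f k := by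
      intro f
      simp only [push, blockSum]
      refine sum_congr ?_ fun _ _ => rfl
      ext a
      simp only [mem_filter, mem_univ, true_and]
      exact ⟨fun h => (conn_rep R a).symm.trans (h ▸ conn_rep R k), rep_eq_of_conn⟩
    rw [key, key, h]
  · push Not at hb
    rw [push_eq_zero _ hb, push_eq_zero _ hb]

theorem blockSum_push_rep {A : Type} [AddCommMonoid A] (R : Graph n)
    {E : Fin n → Fin n → Prop} (hE : ∀ k i, E (rep R k) i ↔ E k i) (f : Fin n → A) (i : Fin n) :
    blockSum E (push (rep R) f) i = blockSum E f i := by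
  classical
  rw [blockSum_push]
  simp only [blockSum, hE]

theorem conn_rep_iff (R : Graph n) (k i : Fin n) : Conn R (rep R k) i ↔ Conn R k i :=
  ⟨fun h => (conn_rep R k).symm.trans h, fun h => (conn_rep R k).trans h⟩

theorem joined_rep_iff (R : Graph n) (k i : Fin n) : Joined R (rep R k) i ↔ Joined R k i :=
  ⟨fun h => (conn_rep R k).symm.joined.trans h, fun h => (conn_rep R k).joined.trans h⟩

theorem blockSum_joined_of_conn {A : Type} [AddCommMonoid A] (R : Graph n)
    {f f' : Fin n → A} (h : ∀ i, blockSum (Conn R) f i = blockSum (Conn R) f' i) (i : Fin n) :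
    blockSum (Joined R) f i = blockSum (Joined R) f' i := by
  rw [← blockSum_push_rep R (joined_rep_iff R) f, push_rep_congr R h,
    blockSum_push_rep R (joined_rep_iff R)]

theorem Gfun_push (c : Fin n → Fin n') (R : Graph n) (R' : Graph n')
    (m : Fin n → ℤ) (m' : Fin n' → ℤ) (g : Fin n → ℤ → ℤ → ℂ) (g' : Fin n' → ℤ → ℤ → ℂ)
    (hC : ∀ i j, Conn R i j ↔ Conn R' (c i) (c j))
    (hJ : ∀ i j, Joined R i j ↔ Joined R' (c i) (c j))
    (hm : ∀ i, blockSum (Conn R') (push c m) i = blockSum (Conn R') m' i) (L : Pts n → ℤ)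
    (hg : ∀ P : Fin n' → ℤ, ∏ i, g i (P (c i)) (L (.inr i)) =
        ∏ i, g' i (P i) (push c (fun k => L (.inr k)) i)) :
    Gfun R m g L = Gfun R' m' g' (push (Sum.map (rep R' ∘ c) c) L) := by
  classical
  set K := push (Sum.map (rep R' ∘ c) c) L with hK
  have e : ∀ E : Fin n' → Fin n' → Prop, (∀ k i, E (rep R' k) i ↔ E k i) →
      (∀ i, blockSum E (push c m) i = blockSum E m' i) → ∀ i,
      blockSum E (total m' K) i = ∑ k with E (c k) i, total m L k := by
    intro E hE hm i
    have h1 : total m' K = fun k => m' k + push (rep R') (push c fun k => L (.inl k)) k +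
        push c (fun k => L (.inr k)) k := by
      funext k
      simp only [total, hK, push_elim_inl, push_elim_inr, push_push]
    rw [h1, blockSum_add, blockSum_add, ← hm, blockSum_push_rep R' hE, ← blockSum_add,
      ← blockSum_add]
    have h2 : (fun k => push c m k + push c (fun k => L (.inl k)) k +
        push c (fun k => L (.inr k)) k) = push c (total m L) := by
      funext k
      simp only [push, total, sum_add_distrib]
    rw [h2, blockSum_push]
  have eC : ∀ i, blockSum (Conn R') (total m' K) (c i) = blockSum (Conn R) (total m L) i := by
    intro i
    rw [e _ (conn_rep_iff R') hm]
    simp only [blockSum, ← hC]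
  have eJ' := e _ (joined_rep_iff R') (blockSum_joined_of_conn R' hm)
  have eJ : ∀ i, blockSum (Joined R') (total m' K) (c i) = blockSum (Joined R) (total m L) i := by
    intro i
    rw [eJ']
    simp only [blockSum, ← hJ]
  have hiff : (∀ i, blockSum (Joined R) (total m L) i = 0) ↔
      ∀ i, blockSum (Joined R') (total m' K) i = 0 := by
    constructor
    · intro h i
      by_cases hi : ∃ k, Joined R' (c k) i
      · obtain ⟨k, hk⟩ := hi
        rw [← blockSum_joined_congr _ hk, eJ, h]
      · push Not at hi
        rw [eJ', sum_eq_zero]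
        intro k hk
        exact absurd (mem_filter.1 hk).2 (hi k)
    · intro h i
      rw [← eJ, h]
  simp only [Gfun]
  refine if_congr hiff ?_ rfl
  have := hg (fun i => blockSum (Conn R') (total m' K) i)
  simp only [eC] at this
  rw [this]
  refine prod_congr rfl fun i _ => ?_
  rw [hK, push_elim_inr]

/-- The value of the functional on a graph depends only on the components of the graph, on the total
mode and the total charge of each solid component, and on the local weights. -/
theorem Lam_Gfun_congr (ξ : ℕ → ℝ) (c : Fin n → Fin n') (R : Graph n)
    (R' : Graph n') (m : Fin n → ℤ) (m' : Fin n' → ℤ) (Q : Pts n → ℤ) (Q' : Pts n' → ℤ)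
    (g : Fin n → ℤ → ℤ → ℂ) (g' : Fin n' → ℤ → ℤ → ℂ) (hC : ∀ i j, Conn R i j ↔ Conn R' (c i) (c j))
    (hJ : ∀ i j, Joined R i j ↔ Joined R' (c i) (c j))
    (hm : ∀ i, blockSum (Conn R') (push c m) i = blockSum (Conn R') m' i)
    (hQ : ∀ i, blockSum (Conn R') (push c fun k => Q (.inl k)) i =
      blockSum (Conn R') (fun k => Q' (.inl k)) i)
    (hQr : ∀ i, push c (fun k => Q (.inr k)) i = Q' (.inr i))
    (hg : ∀ (P : Fin n' → ℤ) (l : Fin n → ℤ), (∀ i, Q (.inr i) = 0 → l i = 0) →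
      ∏ i, g i (P (c i)) (l i) = ∏ i, g' i (P i) (push c l i)) :
    Lam ξ (fun _ => 1) Q (Gfun R m g) = Lam ξ (fun _ => 1) Q' (Gfun R' m' g') := by
  have h1 : push (Sum.map (rep R' ∘ c) c) Q = push (Sum.map (rep R' ∘ id) id) Q' := by
    funext x
    rcases x with i | i
    · rw [push_elim_inl, push_elim_inl, ← push_push, comp_id, push_rep_congr R' hQ]
    · rw [push_elim_inr, push_elim_inr, push_id, hQr]
  have h2 : Lam ξ (fun _ => 1) Q (Gfun R m g) =
      Lam ξ ((fun _ => 1) ∘ (Sum.map (rep R' ∘ c) c)) Q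
        (fun L => Gfun R' m' g' (push (Sum.map (rep R' ∘ c) c) L)) :=
    Lam_congr ξ _ Q fun L hL => Gfun_push c R R' m m' g g' hC hJ hm L fun P =>
      hg P (fun k => L (.inr k)) fun i hi => hL _ hi
  have h3 : Lam ξ (fun _ => 1) Q' (Gfun R' m' g') =
      Lam ξ ((fun _ => 1) ∘ (Sum.map (rep R' ∘ id) id)) Q'
        (fun L => Gfun R' m' g' (push (Sum.map (rep R' ∘ id) id) L)) :=
    Lam_congr ξ _ Q' fun L _ => Gfun_push id R' R' m' m' g' g' (fun _ _ => Iff.rfl)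
      (fun _ _ => Iff.rfl) (fun i => by rw [push_id]) L fun P => by rw [push_id]; rfl
  rw [h2, h3, Lam_push, Lam_push, h1]

/-! ### Boundary values of graphs -/

/-- The data of the vertices that enter the boundary value of a graph: the exponents of the factors
`α`, the vertices `J³`, the modes, and the order of the operators. Keeping these independent of each
other allows vertices to be fused, moved and removed. -/
structure Frame (n : ℕ) where
  /-- the exponent of the factor `α` -/
  q : Fin n → ℤ
  /-- the vertices that carry the current `J³` -/
  th : Fin n → Prop
  /-- the modes -/
  m : Fin n → ℤ
  /-- the order of the operators from left to right -/
  lt : Fin n → Fin n → Prop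

/-- A terminal vertex `-2κ α⁻ ∂ᵤ α⁺` without incoming lines. -/
def Free (X : Frame n) (R : Graph n) (k : Fin n) : Prop :=
  X.th k ∧ R k = .diff ∧ ∀ i, R i ≠ .solid k

/-- The graphs that contribute on the boundary. A vertex `-2κ α⁻ ∂ᵤ α⁺` has at most one incoming
line: two of them give the factor `(δ(z', w) - δ(z, w)) (δ(z', w') - δ(z, w'))`, whose derivative
vanishes at `z' = z`. -/
structure Valid (X : Frame n) (R : Graph n) : Prop where
  solid_ne : ∀ i j, R i = .solid j → i ≠ j
  solid_th : ∀ i j, R i = .solid j → X.th j → R j = .diff ∧ ∀ i', R i' = .solid j → i' = i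
  dotted : ∀ i j, R i = .dotted j → i ≠ j ∧ R j = .dotted i
  wavy : ∀ i j, R i = .wavy j → i ≠ j ∧ R j = .wavy i
  kept : ∀ i j, R i = .dotted j →
    blockSum (Conn R) X.q i = 0 ∨ blockSum (Conn R) X.q j = 0

open Classical in
/-- The charge factor of a solid line; the line into a vertex `J³` gives the derivative of a delta
function, hence the mode of that vertex. -/
def lineW (X : Frame n) (R : Graph n) (i : Fin n) : ℂ :=
  match R i with
  | .solid j => (if X.lt i j then -1 else 1) * (if X.th j then -I * X.m j else X.q j)
  | _ => 1

open Classical in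
/-- The factors `μₖ` of the loops. -/
def loopPart (μ : ℕ → ℝ) (R : Graph n) : ℂ :=
  ∏ S ∈ (univ.image (loopOf R)).erase ∅, (μ S.card : ℂ)

/-- Half of the factor `ξ_{|P|}⁻¹` of a dotted line through which the momentum `P` flows. -/
def dottedEnd (ξ : ℕ → ℝ) (P : ℤ) : ℝ := if P = 0 then 0 else (√(ξ P.natAbs))⁻¹

/-- Half of the factor `2κP`, `P > 0`, of a wavy line through which the momentum `P` flows to the
right. Distributing this factor over the two ends of the line is what makes the weight `wgt`
sufficient for convergence. -/
def wavyEnd (κ : ℝ) (P : ℤ) : ℝ := √(2 * κ * max (P : ℝ) 0)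

open Classical in
/-- The local weights of a graph on the boundary. -/
def gW (ξ : ℕ → ℝ) (κ : ℝ) (X : Frame n) (R : Graph n) (i : Fin n) (P l : ℤ) : ℂ :=
  match R i with
  | .dotted _ => dottedEnd ξ P
  | .wavy j => wavyEnd κ (if X.lt i j then -P else P)
  | .diff => if Free X R i then I * l else 1
  | _ => 1

open Classical in
/-- The charges of the factors `α`. -/
def chg (X : Frame n) (R : Graph n) : Pts n → ℤ :=
  Sum.elim (fun k => if Free X R k then -1 else X.q k) (fun k => if Free X R k then 1 else 0)

/-- The correlator of the factors `α`, paired with the dotted and wavy lines and the modes. -/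
def gam (ξ : ℕ → ℝ) (κ : ℝ) (X : Frame n) (R : Graph n) : ℂ :=
  Lam ξ (fun _ => 1) (chg X R) (Gfun R X.m (gW ξ κ X R))

open Classical in
/-- The boundary value of a graph, without the coefficients of the currents. -/
def graphW (ξ : ℕ → ℝ) (κ : ℝ) (μ : ℕ → ℝ) (X : Frame n) (R : Graph n) : ℂ :=
  if Valid X R then (∏ i, lineW X R i) * loopPart μ R * gam ξ κ X R else 0

/-! ### Transport of graphs along injections -/

/-- Relabelling of the targets of the lines. -/
def mapRole (e : Fin n → Fin n') : Role n → Role n'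
  | .solid j => .solid (e j)
  | .dotted j => .dotted (e j)
  | .wavy j => .wavy (e j)
  | .diff => .diff
  | .zeroMode => .zeroMode

theorem eqvGen_of_image {α β : Type} {e : α → β} (he : Injective e) {r : α → α → Prop}
    {r' : β → β → Prop} (h : ∀ x y, r' x y → ∃ i j, x = e i ∧ y = e j ∧ r i j) {x y : β}
    (hxy : EqvGen r' x y) : x = y ∨ ∃ i j, x = e i ∧ y = e j ∧ EqvGen r i j := by
  induction hxy with
  | rel x y hxy =>
    obtain ⟨i, j, hi, hj, hij⟩ := h x y hxy
    exact Or.inr ⟨i, j, hi, hj, .rel _ _ hij⟩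
  | refl x => exact Or.inl rfl
  | symm x y _ ih =>
    rcases ih with rfl | ⟨i, j, hi, hj, hij⟩
    · exact Or.inl rfl
    · exact Or.inr ⟨j, i, hj, hi, .symm _ _ hij⟩
  | trans x y z _ _ ih1 ih2 =>
    rcases ih1 with rfl | ⟨i, j, hi, hj, hij⟩
    · exact ih2
    · rcases ih2 with rfl | ⟨i', j', hi', hj', hij'⟩
      · exact Or.inr ⟨i, j, hi, hj, hij⟩
      · obtain rfl := he (hj.symm.trans hi')
        exact Or.inr ⟨i, j', hi, hj', .trans _ _ _ hij hij'⟩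

theorem eqvGen_map_iff {α β : Type} {e : α → β} (he : Injective e) {r : α → α → Prop}
    {r' : β → β → Prop} (h : ∀ x y, r' x y → ∃ i j, x = e i ∧ y = e j ∧ r i j)
    (h' : ∀ i j, r i j → r' (e i) (e j)) (i j : α) : EqvGen r i j ↔ EqvGen r' (e i) (e j) := by
  constructor
  · intro hij
    induction hij with
    | rel _ _ hxy => exact .rel _ _ (h' _ _ hxy)
    | refl x => exact .refl _
    | symm _ _ _ ih => exact .symm _ _ ih
    | trans _ _ _ _ _ ih1 ih2 => exact .trans _ _ _ ih1 ih2
  · intro hij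
    rcases eqvGen_of_image he h hij with heq | ⟨a, b, ha, hb, hab⟩
    · rw [he heq]; exact .refl _
    · rwa [he ha, he hb]

theorem transGen_map_iff {α β : Type} {e : α → β} (he : Injective e) {r : α → α → Prop}
    {r' : β → β → Prop} (h : ∀ x y, r' x y → ∃ i j, x = e i ∧ y = e j ∧ r i j)
    (h' : ∀ i j, r i j → r' (e i) (e j)) {x y : β} :
    TransGen r' x y ↔ ∃ i j, x = e i ∧ y = e j ∧ TransGen r i j := by
  constructor
  · intro hxy
    induction hxy with
    | single hxy =>
      obtain ⟨i, j, hi, hj, hij⟩ := h _ _ hxy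
      exact ⟨i, j, hi, hj, .single hij⟩
    | tail _ hyz ih =>
      obtain ⟨i, j, hi, hj, hij⟩ := ih
      obtain ⟨a, b, ha, hb, hab⟩ := h _ _ hyz
      obtain rfl := he (hj.symm.trans ha)
      exact ⟨i, b, hi, hb, hij.tail hab⟩
  · rintro ⟨i, j, rfl, rfl, hij⟩
    induction hij with
    | single hxy => exact .single (h' _ _ hxy)
    | tail _ hyz ih => exact ih.tail (h' _ _ hyz)

/-- The graph `R'` arises from `R` by relabelling the vertices along `e` and adding isolated trivial
vertices. -/
structure Embeds (e : Fin n → Fin n') (X : Frame n) (X' : Frame n') (R : Graph n) (R' : Graph n') :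
    Prop where
  inj : Injective e
  q : ∀ i, X'.q (e i) = X.q i
  th : ∀ i, X'.th (e i) ↔ X.th i
  m : ∀ i, X'.m (e i) = X.m i
  lt : ∀ i j, X'.lt (e i) (e j) ↔ X.lt i j
  role : ∀ i, R' (e i) = mapRole e (R i)
  off : ∀ x, (∀ i, e i ≠ x) → X'.q x = 0 ∧ ¬ X'.th x ∧ X'.m x = 0 ∧ R' x = .zeroMode

namespace Embeds

variable {e : Fin n → Fin n'} {X : Frame n} {X' : Frame n'} {R : Graph n} {R' : Graph n'}

theorem solid (h : Embeds e X X' R R') :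
    (∀ x y, R' x = .solid y → ∃ i j, x = e i ∧ y = e j ∧ R i = .solid j) ∧
      ∀ i j, R i = .solid j → R' (e i) = .solid (e j) := by
  have h1 := h.role
  have h2 := h.off
  refine ⟨fun x y hx => ?_, by grind [mapRole]⟩
  obtain ⟨i, rfl⟩ : ∃ i, e i = x := by grind
  cases hi : R i <;> grind [mapRole]

theorem dotted (h : Embeds e X X' R R') :
    (∀ x y, R' x = .dotted y → ∃ i j, x = e i ∧ y = e j ∧ R i = .dotted j) ∧
      ∀ i j, R i = .dotted j → R' (e i) = .dotted (e j) := by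
  have h1 := h.role
  have h2 := h.off
  refine ⟨fun x y hx => ?_, by grind [mapRole]⟩
  obtain ⟨i, rfl⟩ : ∃ i, e i = x := by grind
  cases hi : R i <;> grind [mapRole]

theorem wavy (h : Embeds e X X' R R') :
    (∀ x y, R' x = .wavy y → ∃ i j, x = e i ∧ y = e j ∧ R i = .wavy j) ∧
      ∀ i j, R i = .wavy j → R' (e i) = .wavy (e j) := by
  have h1 := h.role
  have h2 := h.off
  refine ⟨fun x y hx => ?_, by grind [mapRole]⟩
  obtain ⟨i, rfl⟩ : ∃ i, e i = x := by grind
  cases hi : R i <;> grind [mapRole]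

theorem diff (h : Embeds e X X' R R') (i : Fin n) : R' (e i) = .diff ↔ R i = .diff := by
  rw [h.role]; cases R i <;> simp [mapRole]

theorem conn (h : Embeds e X X' R R') (i j : Fin n) : Conn R i j ↔ Conn R' (e i) (e j) :=
  eqvGen_map_iff h.inj h.solid.1 h.solid.2 i j

theorem joined (h : Embeds e X X' R R') (i j : Fin n) : Joined R i j ↔ Joined R' (e i) (e j) := by
  have h1 := h.solid
  have h2 := h.dotted
  have h3 := h.wavy
  refine eqvGen_map_iff h.inj (fun x y h => ?_) (fun i j h => ?_) i j <;> grind [Link]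

theorem push_eq (h : Embeds e X X' R R') {f : Fin n → ℤ} {f' : Fin n' → ℤ}
    (h1 : ∀ i, f' (e i) = f i) (h2 : ∀ x, (∀ i, e i ≠ x) → f' x = 0) : push e f = f' := by
  funext x
  by_cases hx : ∃ i, e i = x
  · obtain ⟨i, rfl⟩ := hx
    rw [push_of_injective h.inj, h1]
  · push Not at hx
    rw [push_eq_zero _ hx, h2 x hx]

theorem free (h : Embeds e X X' R R') (i : Fin n) : Free X' R' (e i) ↔ Free X R i := by
  have h1 := h.solid
  have h2 := h.th
  have h3 := h.diff
  have hinj : ∀ a b, e a = e b → a = b := fun _ _ h' => h.inj h'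
  grind [Free]

theorem valid (h : Embeds e X X' R R') : Valid X R ↔ Valid X' R' := by
  classical
  have hqs : ∀ i, blockSum (Conn R') X'.q (e i) = blockSum (Conn R) X.q i := by
    intro i
    rw [← h.push_eq h.q fun x hx => (h.off x hx).1, blockSum_push]
    simp only [blockSum, ← h.conn]
  have hinj : ∀ a b, e a = e b → a = b := fun _ _ h' => h.inj h'
  have h1 := h.solid
  have h2 := h.dotted
  have h3 := h.wavy
  have h4 := h.diff
  have h5 := h.th
  constructor <;> rintro ⟨a, b, c, d, f⟩ <;> constructor <;> grind

theorem lines (h : Embeds e X X' R R') : ∏ i, lineW X R i = ∏ x, lineW X' R' x := by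
  classical
  refine Fintype.prod_of_injective e h.inj _ _ ?_ ?_
  · intro x hx
    simp [lineW, (h.off x fun i hi => hx ⟨i, hi⟩).2.2.2]
  · intro i
    unfold lineW
    rw [h.role]
    cases R i <;> simp [mapRole, h.lt, h.th, h.m, h.q]

theorem loops (h : Embeds e X X' R R') (μ : ℕ → ℝ) : loopPart μ R = loopPart μ R' := by
  classical
  have he := h.inj
  have htr : ∀ {x y}, TransGen (Step R') x y ↔ ∃ i j, x = e i ∧ y = e j ∧ TransGen (Step R) i j :=
    transGen_map_iff he h.solid.1 h.solid.2
  have h1 : ∀ i, loopOf R' (e i) = (loopOf R i).image e := by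
    intro i
    ext y
    simp only [loopOf, mem_filter, mem_univ, true_and, mem_image, htr]
    constructor
    · rintro ⟨⟨a, b, ha, rfl, hab⟩, ⟨b', a', hb', ha', hba⟩⟩
      rw [← he ha] at hab
      rw [← he ha', ← he hb'] at hba
      exact ⟨b, ⟨hab, hba⟩, rfl⟩
    · rintro ⟨b, ⟨h1, h2⟩, rfl⟩
      exact ⟨⟨i, b, rfl, rfl, h1⟩, ⟨b, i, rfl, rfl, h2⟩⟩
  have h2 : ∀ x, (∀ i, e i ≠ x) → loopOf R' x = ∅ := by
    intro x hx
    ext y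
    simp only [loopOf, mem_filter, mem_univ, true_and, htr, notMem_empty,
      iff_false]
    rintro ⟨⟨a, _, ha, _⟩, _⟩
    exact hx a ha.symm
  have h3 : (univ.image (loopOf R')).erase ∅ =
      ((univ.image (loopOf R)).erase ∅).image (image e) := by
    ext S
    simp only [mem_erase, mem_image, mem_univ, true_and]
    constructor
    · rintro ⟨hS, x, rfl⟩
      by_cases hx : ∃ i, e i = x
      · obtain ⟨i, rfl⟩ := hx
        rw [h1] at hS ⊢
        exact ⟨loopOf R i, ⟨fun h => hS (by rw [h]; simp), i, rfl⟩, rfl⟩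
      · push Not at hx
        exact absurd (h2 x hx) hS
    · rintro ⟨T, ⟨hT, i, rfl⟩, rfl⟩
      exact ⟨fun h => hT (image_eq_empty.1 h), e i, h1 i⟩
  unfold loopPart
  rw [h3, prod_image (fun S _ T _ h => image_injective he h)]
  refine prod_congr rfl fun S _ => ?_
  rw [card_image_of_injective _ he]

theorem Lam_eq (h : Embeds e X X' R R') (ξ : ℕ → ℝ) {g : Fin n → ℤ → ℤ → ℂ}
    {g' : Fin n' → ℤ → ℤ → ℂ} (hg : ∀ i P l, g' (e i) P l = g i P l)
    (hoff : ∀ x, (∀ i, e i ≠ x) → ∀ P l, g' x P l = 1) :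
    Lam ξ (fun _ => 1) (chg X R) (Gfun R X.m g) =
      Lam ξ (fun _ => 1) (chg X' R') (Gfun R' X'.m g') := by
  classical
  have hf : ∀ x, (∀ i, e i ≠ x) → ¬ Free X' R' x := fun x hx hf => (h.off x hx).2.1 hf.1
  refine Lam_Gfun_congr ξ e R R' X.m X'.m _ _ _ _ h.conn h.joined ?_ ?_ ?_ ?_
  · intro i
    rw [h.push_eq h.m fun x hx => (h.off x hx).2.2.1]
  · intro i
    congr 1
    refine h.push_eq (fun i => ?_) fun x hx => ?_
    · simp [chg, h.free, h.q]
    · simp [chg, hf x hx, (h.off x hx).1]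
  · intro i
    refine congrFun (h.push_eq (f' := fun i => chg X' R' (.inr i)) (fun i => ?_) fun x hx => ?_) i
    · simp [chg, h.free]
    · simp [chg, hf x hx]
  · intro P l _
    refine Fintype.prod_of_injective e h.inj _ _ (fun x hx => hoff x (fun i hi => hx ⟨i, hi⟩) _ _)
      fun i => ?_
    rw [push_of_injective h.inj, hg]

theorem gW_eq (h : Embeds e X X' R R') (ξ : ℕ → ℝ) (κ : ℝ) (i : Fin n) (P l : ℤ) :
    gW ξ κ X' R' (e i) P l = gW ξ κ X R i P l := by
  classical
  unfold gW
  rw [h.role]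
  cases R i <;> simp [mapRole, h.lt, h.free]

theorem gW_off (h : Embeds e X X' R R') (ξ : ℕ → ℝ) (κ : ℝ) {x : Fin n'} (hx : ∀ i, e i ≠ x)
    (P l : ℤ) : gW ξ κ X' R' x P l = 1 := by
  simp [gW, (h.off x hx).2.2.2]

/-- A graph whose vertices outside the image of `e` are isolated and trivial has the value of its
restriction. -/
theorem graphW_eq (h : Embeds e X X' R R') (ξ : ℕ → ℝ) (κ : ℝ) (μ : ℕ → ℝ) :
    graphW ξ κ μ X R = graphW ξ κ μ X' R' := by
  classical
  unfold graphW gam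
  rw [h.lines, h.loops, h.Lam_eq ξ (h.gW_eq ξ κ) fun x hx => h.gW_off ξ κ hx]
  exact if_congr h.valid rfl rfl

end Embeds

variable (ξ : ℕ → ℝ) (κ p : ℝ) (μ : ℕ → ℝ) {R R' : Graph n} {X X' : Frame n}
  {k k' : Fin n} {lt : Fin n → Fin n → Prop}

/-! ### Components and loops -/

theorem eqvGen_iff {α : Type} {r : α → α → Prop} {P : α → Prop} (h : ∀ x y, r x y → (P x ↔ P y))
    {x y : α} (hxy : EqvGen r x y) : P x ↔ P y := by
  induction hxy with
  | rel x y hs => exact h x y hs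
  | refl x => exact Iff.rfl
  | symm x y _ ih => exact ih.symm
  | trans x y z _ _ h1 h2 => exact h1.trans h2

theorem conn_iff_reach {k : Fin n} (hk : ∀ j, R k ≠ .solid j) (i : Fin n) :
    Conn R i k ↔ ReflTransGen (Step R) i k := by
  constructor
  · intro h
    refine (eqvGen_iff (P := fun x => ReflTransGen (Step R) x k) (fun x y hs => ?_) h).2 .refl
    refine ⟨fun hx => ?_, fun hy => .head hs hy⟩
    rcases ReflTransGen.cases_head hx with rfl | ⟨z, hz, hzk⟩ <;> grind [Step]
  · intro h
    induction h using ReflTransGen.head_induction_on with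
    | refl => exact Conn.refl _ _
    | head h _ ih => exact (Conn.of_solid h).trans ih

theorem conn_roots_eq {i k : Fin n} (hi : ∀ j, R i ≠ .solid j)
    (hk : ∀ j, R k ≠ .solid j) (h : Conn R i k) : i = k := by
  rcases ReflTransGen.cases_head ((conn_iff_reach hk i).1 h) with rfl | ⟨z, hz, _⟩
  · rfl
  · exact absurd hz (hi z)

/-- A dotted or wavy line joins exactly the solid components of its two ends. -/
theorem joined_pair_iff
    (hd : ∀ i j, R i = .dotted j → R j = .dotted i) (hw : ∀ i j, R i = .wavy j → R j = .wavy i)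
    (h : (R k = .dotted k' ∧ R k' = .dotted k) ∨ (R k = .wavy k' ∧ R k' = .wavy k)) (i : Fin n) :
    Joined R i k ↔ Conn R i k ∨ Conn R i k' := by
  have hk : ∀ j, R k ≠ .solid j := by rcases h with h | h <;> simp [h.1]
  have hk' : ∀ j, R k' ≠ .solid j := by rcases h with h | h <;> simp [h.2]
  have h1 : ∀ z, (∀ j, R z ≠ .solid j) → (Conn R z k ↔ z = k) := fun z hz =>
    ⟨fun h => conn_roots_eq hz hk h, fun h => h ▸ .refl _ _⟩
  have h2 : ∀ z, (∀ j, R z ≠ .solid j) → (Conn R z k' ↔ z = k') := fun z hz =>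
    ⟨fun h => conn_roots_eq hz hk' h, fun h => h ▸ .refl _ _⟩
  constructor
  · intro hik
    refine (eqvGen_iff (P := fun x => Conn R x k ∨ Conn R x k') (fun x y hxy => ?_) hik).2
      (.inl (.refl _ _))
    rcases hxy with hxy | hxy | hxy
    · have hc := Conn.of_solid hxy
      exact or_congr ⟨fun h => hc.symm.trans h, fun h => hc.trans h⟩
        ⟨fun h => hc.symm.trans h, fun h => hc.trans h⟩
    all_goals grind
  · rintro (h1 | h1)
    · exact h1.joined
    · exact h1.joined.trans (Joined.of_link (by grind [Link]))

theorem blockSum_joined_pair {A : Type} [AddCommMonoid A]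
    (hd : ∀ i j, R i = .dotted j → R j = .dotted i) (hw : ∀ i j, R i = .wavy j → R j = .wavy i)
    (h : (R k = .dotted k' ∧ R k' = .dotted k) ∨ (R k = .wavy k' ∧ R k' = .wavy k))
    (hne : k ≠ k') (f : Fin n → A) :
    blockSum (Joined R) f k = blockSum (Conn R) f k + blockSum (Conn R) f k' := by
  classical
  have hk : ∀ j, R k ≠ .solid j := by rcases h with h | h <;> simp [h.1]
  have hk' : ∀ j, R k' ≠ .solid j := by rcases h with h | h <;> simp [h.2]
  simp only [blockSum, joined_pair_iff hd hw h]
  rw [filter_or, sum_union]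
  rw [disjoint_left]
  intro x hx hx'
  simp only [mem_filter, mem_univ, true_and] at hx hx'
  exact hne (conn_roots_eq hk hk' (hx.symm.trans hx'))

theorem reach_loop {i y : Fin n} (hi : TransGen (Step R) i i)
    (hy : ReflTransGen (Step R) i y) : ReflTransGen (Step R) y i := by
  induction hy with
  | refl => exact .refl
  | tail _ hyz ih =>
    obtain ⟨z, hz, hzi⟩ := TransGen.head'_iff.1 hi
    rcases ReflTransGen.cases_head ih with rfl | ⟨z, hz, hzi⟩ <;> grind [Step]

theorem transGen_loop_mono (h : ∀ x, TransGen (Step R) x x → ∀ y, R x = .solid y → R' x = .solid y)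
    {i y : Fin n} (hi : TransGen (Step R) i i) (hy : TransGen (Step R) i y) :
    TransGen (Step R') i y := by
  have honloop : ∀ x, ReflTransGen (Step R) i x → TransGen (Step R) x x := by
    intro x hx
    have h2 := reach_loop hi hx
    rcases reflTransGen_iff_eq_or_transGen.1 hx with rfl | h3
    · exact hi
    · exact h3.trans_right h2
  induction hy with
  | single hxy => exact .single (h _ hi _ hxy)
  | tail hxy hyz ih => exact ih.tail (h _ (honloop _ hxy.to_reflTransGen) _ hyz)

/-- The loops do not change if only vertices off the loops are modified. -/
theorem loopOf_congr (h : ∀ x, TransGen (Step R) x x → ∀ y, R x = .solid y → R' x = .solid y)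
    (h' : ∀ x, TransGen (Step R') x x → ∀ y, R' x = .solid y → R x = .solid y) :
    loopOf R = loopOf R' := by
  have key : ∀ {R R' : Graph n},
      (∀ x, TransGen (Step R) x x → ∀ y, R x = .solid y → R' x = .solid y) → ∀ {i k},
      TransGen (Step R) i k ∧ TransGen (Step R) k i → TransGen (Step R') i k ∧ TransGen (Step R') k i :=
    fun h _ _ ⟨h1, h2⟩ =>
      ⟨transGen_loop_mono h (h1.trans h2) h1, transGen_loop_mono h (h2.trans h1) h2⟩
  funext i
  ext k
  simp only [loopOf, mem_filter, mem_univ, true_and]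
  exact ⟨key h, key h'⟩

theorem not_loop_of_no_in {k : Fin n} (h : ∀ i, R i ≠ .solid k) : ¬ TransGen (Step R) k k := by
  intro hk
  obtain ⟨z, _, hz⟩ := TransGen.tail'_iff.1 hk
  exact h z hz

theorem not_loop_of_root {k : Fin n} (h : ∀ j, R k ≠ .solid j) : ¬ TransGen (Step R) k k := by
  intro hk
  obtain ⟨z, hz, _⟩ := TransGen.head'_iff.1 hk
  exact h z hz

theorem not_loop_of_step_root {a k : Fin n} (ha : R a = .solid k)
    (h : ∀ j, R k ≠ .solid j) : ¬ TransGen (Step R) a a := by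
  intro hk
  obtain ⟨z, hz, hza⟩ := TransGen.head'_iff.1 hk
  rcases ReflTransGen.cases_head hza with rfl | ⟨w, hw, _⟩ <;> grind [Step]

/-! ### Changes of a graph that respect the components -/

theorem gam_congr_of_blocks
    (hC : ∀ i j, Conn R i j ↔ Conn R' i j) (hJ : ∀ i j, Joined R i j ↔ Joined R' i j)
    (hm : ∀ i, blockSum (Conn R') X.m i = blockSum (Conn R') X'.m i)
    (hq : ∀ i, blockSum (Conn R') (fun k => chg X R (.inl k)) i =
      blockSum (Conn R') (fun k => chg X' R' (.inl k)) i)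
    (hF : ∀ i, Free X R i ↔ Free X' R' i)
    (hg : ∀ i P l, gW ξ κ X R i P l = gW ξ κ X' R' i P l) :
    gam ξ κ X R = gam ξ κ X' R' := by
  classical
  unfold gam
  refine Lam_Gfun_congr ξ id R R' X.m X'.m _ _ _ _ hC hJ ?_ ?_ ?_ ?_
  · intro i; rw [push_id, hm]
  · intro i; rw [push_id, hq]
  · intro i; rw [push_id]; simp only [chg, Sum.elim_inr]; split_ifs <;> simp_all
  · intro P l _
    rw [push_id]
    exact prod_congr rfl fun i _ => hg _ _ _

/-- Exchanging the order of two operators changes the sign of the solid lines between them. -/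
theorem graphW_swap_order (hkk : k ≠ k') (hq : X'.q = X.q) (hth : X'.th = X.th) (hm : X'.m = X.m)
    (hlt : ∀ i j, (i = k ∧ j = k') ∨ (i = k' ∧ j = k) ∨ (X'.lt i j ↔ X.lt i j))
    (h1 : X.lt k k' ↔ ¬ X'.lt k k') (h2 : X.lt k' k ↔ ¬ X'.lt k' k)
    (R : Graph n) (hR : R k ≠ .wavy k') :
    graphW ξ κ μ X' R = (if R k = .solid k' then -1 else 1) * (if R k' = .solid k then -1 else 1) *
      graphW ξ κ μ X R := by
  classical
  have hV : Valid X' R ↔ Valid X R := by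
    constructor <;> rintro ⟨a, b, c, d, e⟩ <;> constructor <;> grind
  by_cases hv : Valid X R
  swap
  · simp [graphW, hv, hV]
  have hR' : R k' ≠ .wavy k := fun h => hR (hv.wavy _ _ h).2
  have hfree : ∀ i, Free X' R i ↔ Free X R i := by intro i; simp [Free, hth]
  have hgam : gam ξ κ X' R = gam ξ κ X R := by
    refine gam_congr_of_blocks ξ κ (fun _ _ => Iff.rfl) (fun _ _ => Iff.rfl) (by simp [hm]) ?_ hfree ?_
    · intro i; congr 1; funext j; simp [chg, hfree, hq]
    · intro i P l
      unfold gW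
      cases hRi : R i with
      | wavy j => rcases hlt i j with ⟨rfl, rfl⟩ | ⟨rfl, rfl⟩ | h <;> simp_all
      | diff => simp [hfree]
      | _ => rfl
  have hline : ∏ i, lineW X' R i = (if R k = .solid k' then -1 else 1) *
      (if R k' = .solid k then -1 else 1) * ∏ i, lineW X R i := by
    have hpt : ∀ i, lineW X' R i = (if i = k then (if R k = .solid k' then -1 else 1) else 1) *
        (if i = k' then (if R k' = .solid k then -1 else 1) else 1) * lineW X R i := by
      intro i
      unfold lineW
      cases hRi : R i with
      | solid j =>
        simp only [hth, hm, hq]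
        rcases hlt i j with ⟨rfl, rfl⟩ | ⟨rfl, rfl⟩ | h
        · simp only [hRi, hkk, if_true, if_false]
          split_ifs <;> first | (exfalso; tauto) | ring
        · simp only [hRi, hkk.symm, if_true, if_false]
          split_ifs <;> first | (exfalso; tauto) | ring
        · have e1 : ¬ (i = k ∧ j = k') := by rintro ⟨rfl, rfl⟩; tauto
          have e2 : ¬ (i = k' ∧ j = k) := by rintro ⟨rfl, rfl⟩; tauto
          rw [h]; grind
      | _ => grind
    simp only [hpt, prod_mul_distrib]
    congr 2 <;> simp
  simp only [graphW, hV, hv, if_true, hline, hgam]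
  ring

/-! ### Contraction of a solid line -/

theorem eqvGen_contract {α : Type} {c : α → α} {r r0 : α → α → Prop}
    (h1 : ∀ i j, r i j → EqvGen r0 (c i) (c j))
    (h2 : ∀ i j, r0 i j → EqvGen r i j) (h3 : ∀ i, EqvGen r i (c i)) (i j : α) :
    EqvGen r i j ↔ EqvGen r0 (c i) (c j) := by
  have key : ∀ {r r' : α → α → Prop} {c : α → α}, (∀ i j, r i j → EqvGen r' (c i) (c j)) →
      ∀ {x y}, EqvGen r x y → EqvGen r' (c x) (c y) := by
    intro r r' c h x y h'
    induction h' with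
    | rel _ _ h' => exact h _ _ h'
    | refl x => exact .refl _
    | symm _ _ _ ih => exact .symm _ _ ih
    | trans _ _ _ _ _ ih1 ih2 => exact .trans _ _ _ ih1 ih2
  exact ⟨key h1, fun h => .trans _ _ _ (h3 i)
    (.trans _ _ _ (key (c := id) h2 h) (.symm _ _ (h3 j)))⟩

/-- The map that moves the vertex `k` to `k'`. -/
def moveTo {α : Type} [DecidableEq α] (k k' : α) : α → α := fun i => if i = k then k' else i

theorem moveTo_of_ne {α : Type} [DecidableEq α] {k k' i : α} (h : i ≠ k) : moveTo k k' i = i := by simp [moveTo, h]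

theorem push_moveTo {α A : Type} [Fintype α] [DecidableEq α] [AddCommMonoid A] {k k' : α}
    (hkk : k ≠ k') {f f' : α → A}
    (h : ∀ i, i ≠ k → i ≠ k' → f' i = f i) (hk : f' k = 0) (hk' : f' k' = f k + f k') :
    push (moveTo k k') f = f' := by
  classical
  funext i
  simp only [push, sum_filter]
  simp only [moveTo]
  by_cases hik : i = k
  · rw [hik, hk]
    exact sum_eq_zero fun a _ => if_neg (by grind)
  · by_cases hik' : i = k'
    · rw [hik', hk', sum_eq_add k k' hkk] <;> simp <;> grind
    · rw [h i hik hik', sum_eq_single i] <;> simp <;> grind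

/-- The hypotheses under which the solid line between `k` and `k'` can be contracted: `X'`, `R0`
are obtained from `X`, `R` by fusing the vertex `k` into `k'`. -/
structure Contracts (X X' : Frame n) (R R0 : Graph n) (k k' : Fin n) : Prop where
  ne : k ≠ k'
  lt : X'.lt = X.lt
  q : ∀ i, i ≠ k → i ≠ k' → X'.q i = X.q i
  th : ∀ i, i ≠ k → i ≠ k' → (X'.th i ↔ X.th i)
  m : ∀ i, i ≠ k → i ≠ k' → X'.m i = X.m i
  qk : X'.q k = 0
  mode_k : X'.m k = 0
  thk : ¬ X'.th k
  qk' : X'.q k' = X.q k + X.q k'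
  mode_k' : X'.m k' = X.m k + X.m k'
  role : ∀ i, i ≠ k → i ≠ k' → R0 i = R i
  rolek : R0 k = .zeroMode
  into : ∀ i, i ≠ k' → R i ≠ .solid k
  line : (R k = .solid k' ∧ R k' ≠ .solid k ∧ R0 k' = R k') ∨
    (R k' = .solid k ∧ R k = .diff ∧ R0 k' = .diff)
  free : ¬ Free X R k ∧ ¬ Free X R k' ∧ ¬ Free X' R0 k'

namespace Contracts

variable {X X' : Frame n} {R R0 : Graph n} {k k' : Fin n}

theorem conn_iff (h : Contracts X X' R R0 k k') (i j : Fin n) :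
    Conn R i j ↔ Conn R0 (moveTo k k' i) (moveTo k k' j) := by
  have hkk : EqvGen (Step R) k k' := by
    rcases h.line with ⟨h1, _⟩ | ⟨h1, _⟩
    · exact Conn.of_solid h1
    · exact (Conn.of_solid h1).symm
  have h1 := fun i => EqvGen.refl (r := Step R) i
  have h2 := fun i => EqvGen.refl (r := Step R0) i
  have h3 := h.line
  have h4 := h.role
  have h5 := h.rolek
  have h6 := h.into
  have h7 := h.ne
  refine eqvGen_contract (fun i j hij => ?_) (fun i j hij => .rel _ _ ?_) (fun i => ?_) i j
  · have h8 : R0 i = .solid j → EqvGen (Step R0) i j := fun h => .rel _ _ h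
    grind [moveTo, Step]
  · grind [Step]
  · grind [moveTo]

theorem joined_iff (h : Contracts X X' R R0 k k')
    (hd : ∀ i, R i ≠ .dotted k ∧ R i ≠ .wavy k) (i j : Fin n) :
    Joined R i j ↔ Joined R0 (moveTo k k' i) (moveTo k k' j) := by
  have hkk : EqvGen (Link R) k k' := by
    rcases h.line with ⟨h1, _⟩ | ⟨h1, _⟩
    · exact (Conn.of_solid h1).joined
    · exact (Conn.of_solid h1).symm.joined
  have h1 := fun i => EqvGen.refl (r := Link R) i
  have h3 := h.line
  have h4 := h.role
  have h5 := h.rolek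
  have h6 := h.into
  refine eqvGen_contract (fun i j hij => ?_) (fun i j hij => .rel _ _ ?_) (fun i => ?_) i j
  · by_cases hs : R i = .solid j
    · exact Conn.joined ((h.conn_iff i j).1 (Conn.of_solid hs))
    have h8 : Link R0 i j → EqvGen (Link R0) i j := fun h => .rel _ _ h
    grind [moveTo, Link]
  · grind [Link]
  · grind [moveTo]

theorem free_iff (h : Contracts X X' R R0 k k') {i : Fin n} (hik : i ≠ k) :
    Free X' R0 i ↔ Free X R i := by
  by_cases hik' : i = k'
  · subst hik'
    exact ⟨fun h' => absurd h' h.free.2.2, fun h' => absurd h' h.free.2.1⟩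
  have h1 := h.th i hik hik'
  have h3 := h.line
  have h4 := h.role
  have h5 := h.rolek
  simp only [Free, h1, h4 i hik hik']
  grind

theorem not_free_k (h : Contracts X X' R R0 k k') : ¬ Free X' R0 k := fun h' => h.thk h'.1

theorem gam_eq (h : Contracts X X' R R0 k k') (hd : ∀ i, R i ≠ .dotted k ∧ R i ≠ .wavy k)
    (ξ : ℕ → ℝ) (κ : ℝ) : gam ξ κ X R = gam ξ κ X' R0 := by
  classical
  unfold gam
  refine Lam_Gfun_congr ξ (moveTo k k') R R0 X.m X'.m _ _ _ _ h.conn_iff (h.joined_iff hd) ?_ ?_ ?_ ?_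
  · intro i
    rw [push_moveTo h.ne h.m h.mode_k h.mode_k']
  · intro i
    congr 1
    refine push_moveTo h.ne ?_ ?_ ?_
    · intro j hj hj'
      simp [chg, h.free_iff hj, h.q j hj hj']
    · simp [chg, h.not_free_k, h.qk]
    · simp [chg, h.free.1, h.free.2.1, h.free.2.2, h.qk']
  · intro i
    refine congrFun (push_moveTo (f' := fun i => chg X' R0 (.inr i)) h.ne ?_ ?_ ?_) i
    · intro j hj hj'
      simp [chg, h.free_iff hj]
    · simp [chg, h.not_free_k]
    · simp [chg, h.free.1, h.free.2.1, h.free.2.2]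
  · intro P l hl
    refine prod_congr rfl fun i _ => ?_
    have hpl : push (moveTo k k') l = fun i => if i = k then 0 else if i = k' then l k + l k' else l i := by
      refine push_moveTo h.ne ?_ ?_ ?_
      · intro i hi hi'; simp [hi, hi']
      · simp
      · simp [h.ne.symm]
    rcases eq_or_ne i k with rfl | hik
    · have e1 : gW ξ κ X' R0 i (P i) (push (moveTo i k') l i) = 1 := by simp [gW, h.rolek]
      rw [e1]
      have hf := h.free.1
      unfold gW
      rcases h.line with ⟨h1, _⟩ | ⟨_, h1, _⟩ <;> simp [h1, hf]
    rw [moveTo_of_ne hik, hpl]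
    simp only [hik, if_false]
    have hrole : R0 i = R i ∨ (i = k' ∧ R i = .solid k ∧ R0 i = .diff) := by
      grind [h.line, h.role i hik]
    have h1 := h.free_iff hik
    have h2 := h.free
    unfold gW
    rcases hrole with hr | ⟨rfl, hr, hr0⟩
    · rw [hr, h.lt]
      cases hRi : R i with
      | diff => grind
      | _ => rfl
    · simp [hr, hr0, h2.2.2]

theorem kept_sum (h : Contracts X X' R R0 k k') (i : Fin n) :
    blockSum (Conn R) X.q i = blockSum (Conn R0) X'.q (moveTo k k' i) := by
  rw [← push_moveTo h.ne h.q h.qk h.qk', blockSum_push]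
  simp only [blockSum]
  refine sum_congr ?_ fun _ _ => rfl
  ext a
  simp [h.conn_iff a i]

theorem loop_eq (h : Contracts X X' R R0 k k') (μ : ℕ → ℝ) : loopPart μ R = loopPart μ R0 := by
  have h1 := h.line
  have h2 := h.role
  have h3 := h.rolek
  have h4 : ¬ TransGen (Step R) k k := by
    rcases h1 with ⟨_, h1, _⟩ | ⟨_, h1, _⟩
    · exact not_loop_of_no_in (by grind [h.into])
    · exact not_loop_of_root (by simp [h1])
  have h5 : R k' = .solid k → R k = .diff → ¬ TransGen (Step R) k' k' := fun h1 h2 =>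
    not_loop_of_step_root h1 (by simp [h2])
  have : loopOf R = loopOf R0 := loopOf_congr (by grind) (by grind)
  rw [loopPart, this, loopPart]

end Contracts

/-- A leaf can be removed without changing the validity of the graph. -/
theorem Contracts.valid_iff {X X' : Frame n} {R R0 : Graph n}
    {k k' : Fin n} (h : Contracts X X' R R0 k k') (hk : R k = .solid k')
    (hin : ∀ i, R i ≠ .solid k) (hR0 : R0 = update R k .zeroMode) (hth : ¬ X.th k')
    (hX'k' : X'.th k' → ∀ i, i ≠ k → R i = .solid k' →
      R k' = .diff ∧ ∀ i', i' ≠ k → R i' = .solid k' → i' = i) :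
    Valid X R ↔ Valid X' R0 := by
  have hR0' : ∀ i, i ≠ k → R0 i = R i := fun i hi => by rw [hR0, update_of_ne hi]
  have h1 := h.rolek
  have h2 := h.th
  have h3 := h.ne
  have h4 : ∀ i, i ≠ k → blockSum (Conn R) X.q i = blockSum (Conn R0) X'.q i := fun i hi => by
    rw [h.kept_sum, moveTo_of_ne hi]
  constructor <;> rintro ⟨a, b, c, d, e⟩ <;> constructor <;> grind

theorem Contracts.graphW_leaf_of_lines {X X' : Frame n} {R R0 : Graph n}
    {k k' : Fin n} (h : Contracts X X' R R0 k k') (ξ : ℕ → ℝ) (κ : ℝ) (μ : ℕ → ℝ)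
    (hk : R k = .solid k')
    (hin : ∀ i, R i ≠ .solid k) (hR0 : R0 = update R k .zeroMode) (hth : ¬ X.th k')
    (hX'k' : X'.th k' → ∀ i, i ≠ k → R i = .solid k' →
      R k' = .diff ∧ ∀ i', i' ≠ k → R i' = .solid k' → i' = i) {c c' : ℂ}
    (hline : c * ∏ i, lineW X R i = c' * ∏ i, lineW X' R0 i) :
    c * graphW ξ κ μ X R = c' * graphW ξ κ μ X' R0 := by
  have hV := h.valid_iff hk hin hR0 hth hX'k'
  by_cases hv : Valid X R
  swap
  · have hv' : ¬ Valid X' R0 := fun h' => hv (hV.2 h')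
    simp [graphW, hv, hv']
  have hd : ∀ i, R i ≠ .dotted k ∧ R i ≠ .wavy k := by grind [hv.dotted, hv.wavy]
  have hv' := hV.1 hv
  simp only [graphW, hv, hv', if_true, h.gam_eq hd, h.loop_eq μ]
  linear_combination loopPart μ R0 * gam ξ κ X' R0 * hline

open Classical in
theorem Contracts.lines_leaf {X X' : Frame n} {R R0 : Graph n}
    {k k' : Fin n} (h : Contracts X X' R R0 k k') (hk : R k = .solid k')
    (hin : ∀ i, R i ≠ .solid k) (hR0 : R0 = update R k .zeroMode) (hth : ¬ X.th k')
    (hin' : (X.q k = 0 ∧ ¬ X'.th k') ∨ (∀ i, R i = .solid k' → i = k)) :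
    ∏ i, lineW X R i = (if X.lt k k' then -1 else 1) * X.q k' * ∏ i, lineW X' R0 i := by
  have hR0' : ∀ i, i ≠ k → R0 i = R i := fun i hi => by rw [hR0, update_of_ne hi]
  rw [← mul_prod_erase univ _ (mem_univ k),
    ← mul_prod_erase univ (lineW X' R0) (mem_univ k)]
  have e1 : lineW X R k = (if X.lt k k' then -1 else 1) * X.q k' := by simp [lineW, hk, hth]
  have e2 : lineW X' R0 k = 1 := by simp [lineW, h.rolek]
  rw [e1, e2, one_mul]
  congr 1
  refine prod_congr rfl fun i hi => ?_
  have hik := ne_of_mem_erase hi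
  unfold lineW
  rw [hR0' i hik]
  cases hRi : R i with
  | solid j =>
    have hjk : j ≠ k := by rintro rfl; exact hin i hRi
    simp only [h.lt]
    rcases eq_or_ne j k' with rfl | hjk'
    · rcases hin' with ⟨h1, h2⟩ | h1
      · simp [hth, h2, h.qk', h1]
      · exact absurd (h1 i hRi) hik
    · simp [h.th j hjk hjk', h.q j hjk hjk', h.m j hjk hjk']
  | _ => rfl

open Classical in
/-- A leaf `k` of the graph is absorbed by the vertex `k'` to which its solid line leads. -/
theorem graphW_leaf {X X' : Frame n} {R R0 : Graph n}
    {k k' : Fin n} (h : Contracts X X' R R0 k k') (hk : R k = .solid k')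
    (hin : ∀ i, R i ≠ .solid k) (hR0 : R0 = update R k .zeroMode) (hth : ¬ X.th k')
    (hin' : (X.q k = 0 ∧ ¬ X'.th k') ∨ ((∀ i, R i = .solid k' → i = k) ∧ (X'.th k' → R k' ≠ .diff))) :
    graphW ξ κ μ X R = (if X.lt k k' then -1 else 1) * X.q k' * graphW ξ κ μ X' R0 := by
  rw [← one_mul (graphW ξ κ μ X R)]
  refine h.graphW_leaf_of_lines ξ κ μ hk hin hR0 hth ?_ ?_
  · intro ht i hi hik
    rcases hin' with h1 | h1
    · exact absurd ht h1.2
    · exact absurd (h1.1 i hik) hi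
  · rw [one_mul, h.lines_leaf hk hin hR0 hth (hin'.imp_right fun h' => h'.1)]

open Classical in
/-- A terminal vertex `J³` with a single incoming line, from `k'`, is absorbed by `k'`, which becomes
terminal. -/
theorem graphW_root {X X' : Frame n} {R R0 : Graph n}
    {k k' : Fin n} (h : Contracts X X' R R0 k k') (hk' : R k' = .solid k) (hk : R k = .diff)
    (hR0k' : R0 k' = .diff) (hthk : X.th k) (hthk' : ¬ X.th k') (hthk'' : ¬ X'.th k')
    (hq : X.q k = 0) : graphW ξ κ μ X R = (if X.lt k' k then -1 else 1) * (-I * X.m k) *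
      graphW ξ κ μ X' R0 := by
  have hR0' := h.role
  have hV : Valid X R ↔ Valid X' R0 := by
    have h1 := h.rolek
    have h2 := h.th
    have h3 := h.ne
    have h5 := h.into
    have h4 : ∀ i, i ≠ k → blockSum (Conn R) X.q i = blockSum (Conn R0) X'.q i := fun i hi => by
      rw [h.kept_sum, moveTo_of_ne hi]
    constructor <;> rintro ⟨a, b, c, d, e⟩ <;> constructor <;> grind
  by_cases hv : Valid X R
  swap
  · have hv' : ¬ Valid X' R0 := fun h' => hv (hV.2 h')
    simp [graphW, hv, hv']
  have hd : ∀ i, R i ≠ .dotted k ∧ R i ≠ .wavy k := by grind [hv.dotted, hv.wavy]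
  have hline : ∏ i, lineW X R i = (if X.lt k' k then -1 else 1) * (-I * X.m k) *
      ∏ i, lineW X' R0 i := by
    rw [← mul_prod_erase univ _ (mem_univ k'),
      ← mul_prod_erase univ (lineW X' R0) (mem_univ k')]
    have e1 : lineW X R k' = (if X.lt k' k then -1 else 1) * (-I * X.m k) := by
      simp [lineW, hk', hthk]
    have e2 : lineW X' R0 k' = 1 := by simp [lineW, hR0k']
    rw [e1, e2, one_mul]
    congr 1
    refine prod_congr rfl fun i hi => ?_
    have hik' := ne_of_mem_erase hi
    unfold lineW
    rcases eq_or_ne i k with rfl | hik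
    · simp [hk, h.rolek]
    rw [hR0' i hik hik']
    cases hRi : R i with
    | solid j =>
      have hjk : j ≠ k := by rintro rfl; exact h.into i hik' hRi
      simp only [h.lt]
      rcases eq_or_ne j k' with rfl | hjk'
      · simp [hthk', hthk'', h.qk', hq]
      · simp [h.th j hjk hjk', h.q j hjk hjk', h.m j hjk hjk']
    | _ => rfl
  have hv' := hV.1 hv
  simp only [graphW, hv, hv', if_true, hline, h.gam_eq hd, h.loop_eq μ]
  ring

/-! ### Summability on the boundary -/

theorem sqrt_abs_sum_le {ι : Type} (A : Finset ι) (c : ℤ) (L : ι → ℤ) :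
    √(1 + |((c + ∑ a ∈ A, L a : ℤ) : ℝ)|) ≤
      √(1 + |(c : ℝ)|) * ∏ a ∈ A, √(1 + |(L a : ℝ)|) := by
  classical
  induction A using Finset.induction_on with
  | empty => simp
  | insert a s ha ih =>
    rw [sum_insert ha, prod_insert ha]
    have h1 := sqrt_one_add_abs_add_le (L a : ℝ) ((c + ∑ a ∈ s, L a : ℤ) : ℝ)
    have e : ((c + (L a + ∑ x ∈ s, L x) : ℤ) : ℝ) = (L a : ℝ) + ((c + ∑ a ∈ s, L a : ℤ) : ℝ) := by
      push_cast; ring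
    rw [e]
    refine h1.trans ((mul_le_mul_of_nonneg_left ih (Real.sqrt_nonneg _)).trans (le_of_eq ?_))
    ring

/-- Square roots of the momenta that flow into disjoint sets of points are bounded by the weight. -/
theorem prod_sqrt_le_wgt {ι σ : Type} [Fintype ι] [Fintype σ] (A : σ → Finset ι)
    (hA : Pairwise fun s s' => Disjoint (A s) (A s')) (c : σ → ℤ) (L : ι → ℤ) :
    ∏ s, √(1 + |((c s + ∑ a ∈ A s, L a : ℤ) : ℝ)|) ≤ (∏ s, √(1 + |(c s : ℝ)|)) * wgt L := by
  classical
  calc ∏ s, √(1 + |((c s + ∑ a ∈ A s, L a : ℤ) : ℝ)|)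
      ≤ ∏ s, (√(1 + |(c s : ℝ)|) * ∏ a ∈ A s, √(1 + |(L a : ℝ)|)) :=
        prod_le_prod (fun _ _ => Real.sqrt_nonneg _) fun s _ => sqrt_abs_sum_le _ _ _
    _ = (∏ s, √(1 + |(c s : ℝ)|)) * ∏ a ∈ univ.biUnion A, √(1 + |(L a : ℝ)|) := by
        rw [prod_mul_distrib, prod_biUnion]
        exact fun s _ s' _ h => hA h
    _ ≤ (∏ s, √(1 + |(c s : ℝ)|)) * wgt L := by
        refine mul_le_mul_of_nonneg_left ?_ (prod_nonneg fun _ _ => Real.sqrt_nonneg _)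
        unfold wgt
        rw [← prod_mul_prod_compl (univ.biUnion A)]
        refine le_mul_of_one_le_right (prod_nonneg fun _ _ => Real.sqrt_nonneg _) ?_
        calc (1 : ℝ) = ∏ _a ∈ (univ.biUnion A)ᶜ, (1 : ℝ) := by simp
          _ ≤ _ := prod_le_prod (fun _ _ => zero_le_one) fun a _ => one_le_sqrt_one_add_abs _

open Classical in
/-- The growth that is allowed for the local weight of a vertex. -/
def growth (X : Frame n) (R : Graph n) (i : Fin n) (P l : ℤ) : ℝ :=
  match R i with
  | .wavy _ => √(1 + |(P : ℝ)|)
  | .diff => if Free X R i then 1 + |(l : ℝ)| else 1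
  | _ => 1

/-- The local weights grow at most like `growth` if momentum is conserved. -/
def Tame (X : Frame n) (R : Graph n) (g : Fin n → ℤ → ℤ → ℂ) : Prop :=
  ∃ C : ℝ, 0 ≤ C ∧ ∀ P l : Fin n → ℤ, (∀ i j, R i = .wavy j → P i + P j = 0) →
    (∀ i j, R i = .dotted j →
      P i = blockSum (Conn R) X.m i ∨ P i = -blockSum (Conn R) X.m j) →
    ‖∏ i, g i (P i) (l i)‖ ≤ C * ∏ i, growth X R i (P i) (l i)

open Classical in
/-- The points of the solid component of a vertex. -/
def blockPts (R : Graph n) (i : Fin n) : Finset (Pts n) :=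
  univ.filter fun a => Conn R (Sum.elim id id a) i

theorem mem_blockPts {i : Fin n} {a : Pts n} :
    a ∈ blockPts R i ↔ Conn R (Sum.elim id id a) i := by simp [blockPts]

theorem blockSum_total (R : Graph n) (m : Fin n → ℤ) (L : Pts n → ℤ) (i : Fin n) :
    blockSum (Conn R) (total m L) i = blockSum (Conn R) m i + ∑ a ∈ blockPts R i, L a := by
  classical
  simp only [blockSum, total, blockPts, sum_filter, Fintype.sum_sum_type, Sum.elim_inl,
    Sum.elim_inr, id]
  rw [← sum_add_distrib, ← sum_add_distrib]
  refine sum_congr rfl fun k _ => ?_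
  by_cases hk : Conn R k i <;> simp [hk, add_assoc]

theorem Free.conn_eq {i k : Fin n} (h : Free X R k) (hc : Conn R i k) : i = k := by
  have h1 := (conn_iff_reach (by simp [h.2.1]) i).1 hc
  rcases ReflTransGen.cases_tail h1 with h2 | ⟨z, _, hz⟩
  · exact h2.symm
  · exact absurd hz (h.2.2 z)

theorem Free.joined_eq (hv : Valid X R) {i k : Fin n}
    (h : Free X R k) (hc : Joined R i k) : i = k := by
  have key : ∀ x y, Joined R x y → (x = k ↔ y = k) := by
    intro x y hxy
    induction hxy with
    | rel x y hs =>
      have a1 : x ≠ k := by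
        rintro rfl
        rcases hs with hs | hs | hs <;> rw [h.2.1] at hs <;> cases hs
      have a2 : y ≠ k := by
        rintro rfl
        rcases hs with hs | hs | hs
        · exact h.2.2 x hs
        · have := (hv.dotted x y hs).2; rw [h.2.1] at this; cases this
        · have := (hv.wavy x y hs).2; rw [h.2.1] at this; cases this
      simp [a1, a2]
    | refl x => rfl
    | symm _ _ _ ih => exact ih.symm
    | trans _ _ _ _ _ ih1 ih2 => exact ih1.trans ih2
  exact (key i k hc).2 rfl

theorem Free.blockSum_joined {A : Type} [AddCommMonoid A]
    (hv : Valid X R) {k : Fin n} (h : Free X R k) (f : Fin n → A) :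
    blockSum (Joined R) f k = f k := by
  classical
  rw [blockSum, sum_eq_single k]
  · intro b hb hbk
    exact absurd (h.joined_eq hv (mem_filter.1 hb).2) hbk
  · intro hk
    refine absurd ?_ hk
    simpa using Joined.refl R k

/-- The modes `L` are supported on the points that carry a charge; if the charges of the neutral
sides of the dotted lines have been cancelled, the summand of `Lam` is bounded by the weight. -/
theorem norm_Gfun_le (hv : Valid X R) {g : Fin n → ℤ → ℤ → ℂ} (hg : Tame X R g) :
    ∃ C : ℝ, ∀ Q : Pts n → ℤ,
      (∀ i j, R i = .dotted j → blockSum (Conn R) X.q i = 0 → ∀ k, Conn R k i → Q (.inl k) = 0) →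
      (∀ k, ¬ Free X R k → Q (.inr k) = 0) →
      ∀ L : Pts n → ℤ, (∀ a, Q a = 0 → L a = 0) → ‖Gfun R X.m g L‖ ≤ C * wgt L := by
  classical
  obtain ⟨C, hC, hb⟩ := hg
  let isW : Fin n → Prop := fun i => ∃ j, R i = .wavy j
  let A : Fin n ⊕ Fin n → Finset (Pts n) := Sum.elim
    (fun i => if isW i then blockPts R i else if Free X R i then {.inl i} else ∅)
    (fun i => if Free X R i then {.inr i} else ∅)
  let c : Fin n ⊕ Fin n → ℤ := Sum.elim
    (fun i => if isW i then blockSum (Conn R) X.m i else if Free X R i then X.m i else 0)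
    (fun _ => 0)
  have hWF : ∀ i, isW i → ¬ Free X R i := by
    rintro i ⟨j, hj⟩ hf
    rw [hf.2.1] at hj; cases hj
  have hroot : ∀ i, isW i → ∀ j, R i ≠ .solid j := by
    rintro i ⟨j, hj⟩; simp [hj]
  have hA : Pairwise fun s s' => Disjoint (A s) (A s') := by
    have key : ∀ s s' a, a ∈ A s → a ∈ A s' → s = s' := by
      have h1 : ∀ i a, a ∈ A (.inl i) →
          (isW i ∧ Conn R (Sum.elim id id a) i) ∨ (Free X R i ∧ a = .inl i) := by
        intro i a ha
        simp only [A, Sum.elim_inl] at ha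
        split_ifs at ha with h1 h2
        · exact Or.inl ⟨h1, mem_blockPts.1 ha⟩
        · exact Or.inr ⟨h2, mem_singleton.1 ha⟩
        · simp at ha
      have h2 : ∀ i a, a ∈ A (.inr i) → Free X R i ∧ a = .inr i := by
        intro i a ha
        simp only [A, Sum.elim_inr] at ha
        split_ifs at ha with h1
        · exact ⟨h1, mem_singleton.1 ha⟩
        · simp at ha
      have h3 : ∀ i k, isW i → Free X R k → Conn R k i → False := by
        intro i k hi hk hc
        have := hk.conn_eq hc.symm
        subst this
        exact hWF _ hi hk
      rintro (i | i) (k | k) a ha ha'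
      · rcases h1 i a ha with ⟨hi, hai⟩ | ⟨hi, rfl⟩ <;> rcases h1 k _ ha' with ⟨hk, hak⟩ | ⟨hk, hak⟩
        · rw [conn_roots_eq (hroot i hi) (hroot k hk) (hai.symm.trans hak)]
        · subst hak; exact absurd hai (h3 i k hi hk)
        · exact absurd hak (h3 k i hk hi)
        · rw [hak]
      · obtain ⟨hk, rfl⟩ := h2 k a ha'
        rcases h1 i _ ha with ⟨hi, hai⟩ | ⟨hi, hai⟩
        · exact absurd hai (h3 i k hi hk)
        · cases hai
      · obtain ⟨hk, rfl⟩ := h2 i a ha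
        rcases h1 k _ ha' with ⟨hi, hai⟩ | ⟨hi, hai⟩
        · exact absurd hai (h3 k i hi hk)
        · cases hai
      · obtain ⟨hi, rfl⟩ := h2 i a ha
        obtain ⟨hk, hak⟩ := h2 k _ ha'
        injection hak with hak
        rw [hak]
    intro s s' hss
    rw [disjoint_left]
    exact fun a ha ha' => hss (key s s' a ha ha')
  refine ⟨C * ∏ s, √(1 + |(c s : ℝ)|), fun Q hQ hQr L hL => ?_⟩
  have hnn : 0 ≤ C * (∏ s, √(1 + |(c s : ℝ)|)) * wgt L :=
    mul_nonneg (mul_nonneg hC (prod_nonneg fun _ _ => Real.sqrt_nonneg _))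
      (zero_le_one.trans (one_le_wgt _))
  unfold Gfun
  split_ifs with hcon
  swap
  · simpa using hnn
  have hpair : ∀ i j, (R i = .dotted j ∨ R i = .wavy j) →
      blockSum (Conn R) (total X.m L) i + blockSum (Conn R) (total X.m L) j = 0 := by
    intro i j hij
    rw [← hcon i]
    refine (blockSum_joined_pair (fun i j h => (hv.dotted i j h).2)
      (fun i j h => (hv.wavy i j h).2) ?_ ?_ _).symm
    · rcases hij with h | h
      · exact Or.inl ⟨h, (hv.dotted _ _ h).2⟩
      · exact Or.inr ⟨h, (hv.wavy _ _ h).2⟩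
    · rcases hij with h | h
      · exact (hv.dotted _ _ h).1
      · exact (hv.wavy _ _ h).1
  have hneut : ∀ i j, R i = .dotted j → blockSum (Conn R) X.q i = 0 →
      blockSum (Conn R) (total X.m L) i = blockSum (Conn R) X.m i := by
    intro i j hij h0
    rw [blockSum_total, sum_eq_zero, add_zero]
    rintro (k | k) hk
    · exact hL _ (hQ i j hij h0 k (mem_blockPts.1 hk))
    · refine hL _ (hQr k fun hf => ?_)
      have hki : i = k := hf.conn_eq (mem_blockPts.1 hk).symm
      subst hki
      rw [hf.2.1] at hij; cases hij
  refine (hb _ _ (fun i j hij => hpair i j (Or.inr hij)) ?_).trans ?_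
  · intro i j hij
    rcases hv.kept i j hij with h0 | h0
    · exact Or.inl (hneut i j hij h0)
    · have h1 := hneut j i (hv.dotted i j hij).2 h0
      have h2 := hpair i j (Or.inl hij)
      right; omega
  rw [mul_assoc]
  refine mul_le_mul_of_nonneg_left ?_ hC
  refine le_trans (le_of_eq ?_) (prod_sqrt_le_wgt A hA c L)
  rw [Fintype.prod_sum_type, ← prod_mul_distrib]
  refine prod_congr rfl fun i _ => ?_
  by_cases hW : isW i
  · have hf := hWF i hW
    obtain ⟨j, hj⟩ := hW
    have hW : isW i := ⟨j, hj⟩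
    simp [growth, hj, A, c, hW, hf, blockSum_total]
  by_cases hf : Free X R i
  · have h0 := hcon i
    rw [hf.blockSum_joined hv] at h0
    have h1 : (X.m i + L (.inl i) : ℤ) = -L (.inr i) := by unfold total at h0; omega
    simp only [growth, hf.2.1, hf, if_true, A, c, hW, if_false, Sum.elim_inl, Sum.elim_inr,
      sum_singleton, h1, zero_add]
    push_cast
    rw [abs_neg, Real.mul_self_sqrt (by positivity)]
  · have e : growth X R i (blockSum (Conn R) (total X.m L) i) (L (.inr i)) = 1 := by
      unfold growth
      cases hRi : R i with
      | wavy j => exact absurd ⟨j, hRi⟩ hW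
      | diff => simp [hf]
      | _ => rfl
    rw [e]
    simp [A, c, hW, hf]

theorem Gfun_push_rep (R : Graph n) (m : Fin n → ℤ) (g : Fin n → ℤ → ℤ → ℂ)
    (L : Pts n → ℤ) : Gfun R m g L = Gfun R m g (push (Sum.map (rep R ∘ id) id) L) := by
  refine Gfun_push id R R m m g g (fun _ _ => Iff.rfl) (fun _ _ => Iff.rfl) (fun i => by rw [push_id])
    L fun P => ?_
  simp [push_id]

theorem chg_blockSum (X : Frame n) (R : Graph n) {i : Fin n} (hi : ∀ k, Free X R k → ¬ Conn R k i) :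
    blockSum (Conn R) (fun k => chg X R (.inl k)) i = blockSum (Conn R) X.q i := by
  classical
  refine sum_congr rfl fun k hk => ?_
  have : ¬ Free X R k := fun hf => hi k hf (mem_filter.1 hk).2
  simp [chg, this]

theorem push_rep_eq (R : Graph n) {A : Type} [AddCommMonoid A] (f : Fin n → A) (b : Fin n) :
    push (rep R) f b = 0 ∨ ∃ k, rep R k = b ∧ push (rep R) f b = blockSum (Conn R) f k := by
  classical
  by_cases hb : ∃ k, rep R k = b
  · obtain ⟨k, rfl⟩ := hb
    refine Or.inr ⟨k, rfl, ?_⟩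
    simp only [push, blockSum]
    refine sum_congr ?_ fun _ _ => rfl
    ext a
    simp only [mem_filter, mem_univ, true_and]
    constructor
    · intro h
      exact (conn_rep R a).symm.trans (h ▸ conn_rep R k)
    · exact rep_eq_of_conn
  · push Not at hb
    exact Or.inl (push_eq_zero _ hb)

theorem summable_Gfun {ξ : ℕ → ℝ} (hξ : PosWeights ξ) (hsum : Decay ξ)
    (hv : Valid X R) {g : Fin n → ℤ → ℤ → ℂ} (hg : Tame X R g) :
    Summable (lamTerm ξ (fun _ => 1) (chg X R) (Gfun R X.m g)) := by
  obtain ⟨C, hC⟩ := norm_Gfun_le hv hg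
  have h1 : ∀ t, lamTerm ξ (fun _ => 1) (chg X R) (Gfun R X.m g) t =
      lamTerm ξ (fun _ => 1) (push (Sum.map (rep R ∘ id) id) (chg X R)) (Gfun R X.m g) t := by
    intro t
    rw [← lamTerm_push]
    exact lamTerm_congr _ _ _ (fun L _ => Gfun_push_rep _ _ _ _) t
  rw [funext h1]
  have h2 := hC (push (Sum.map (rep R ∘ id) id) (chg X R)) ?_ ?_
  · exact summable_lamTerm hξ hsum (fun _ => ⟨zero_le_one, le_rfl⟩) h2
  · intro i j hij h0 k hk
    rw [push_elim_inl]
    rcases push_rep_eq R (fun k => chg X R (.inl k)) k with h | ⟨b, hb, h⟩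
    · exact h
    · have hbk : Conn R b k := (conn_rep R b).symm.trans (hb ▸ Conn.refl R _)
      rw [comp_id, h, blockSum_conn_congr _ (hbk.trans hk), chg_blockSum, h0]
      intro k' hf hk'
      have := hf.conn_eq hk'.symm
      subst this
      rw [hf.2.1] at hij; cases hij
  · intro k hk
    rw [push_elim_inr, push_id]
    simp [chg, hk]

theorem norm_dottedEnd (P : ℤ) : ‖((dottedEnd ξ P : ℝ) : ℂ)‖ = dottedEnd ξ P := by
  rw [norm_real, Real.norm_of_nonneg]
  unfold dottedEnd
  split_ifs
  · exact le_rfl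
  · exact inv_nonneg.2 (Real.sqrt_nonneg _)

theorem wavyEnd_le {κ : ℝ} (P : ℤ) : wavyEnd κ P ≤ √(2 * |κ|) * √(1 + |(P : ℝ)|) := by
  unfold wavyEnd
  rw [← Real.sqrt_mul (by positivity)]
  refine Real.sqrt_le_sqrt ?_
  have h1 : max (P : ℝ) 0 ≤ 1 + |(P : ℝ)| := by
    refine max_le ?_ (by positivity)
    have := le_abs_self (P : ℝ); linarith
  have h0 : 0 ≤ max (P : ℝ) 0 := le_max_right _ _
  refine mul_le_mul ?_ h1 h0 (by positivity)
  have := le_abs_self κ; linarith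

open Classical in
/-- A bound for the local weights `gW`. -/
def gBound (X : Frame n) (R : Graph n) (i : Fin n) : ℝ :=
  match R i with
  | .dotted j => dottedEnd ξ (blockSum (Conn R) X.m i) + dottedEnd ξ (-blockSum (Conn R) X.m j)
  | .wavy _ => √(2 * |κ|)
  | _ => 1

theorem dottedEnd_nonneg (P : ℤ) : 0 ≤ dottedEnd ξ P := by
  rw [← norm_dottedEnd]; exact norm_nonneg _

theorem gBound_nonneg (X : Frame n) (R : Graph n) (i : Fin n) : 0 ≤ gBound ξ κ X R i := by
  unfold gBound
  cases R i with
  | dotted j => exact add_nonneg (dottedEnd_nonneg _ _) (dottedEnd_nonneg _ _)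
  | wavy j => exact Real.sqrt_nonneg _
  | _ => exact zero_le_one

theorem norm_gW_le (X : Frame n) (R : Graph n) (i : Fin n) (P l : ℤ) (hP : ∀ j, R i = .dotted j →
      P = blockSum (Conn R) X.m i ∨ P = -blockSum (Conn R) X.m j) :
    ‖gW ξ κ X R i P l‖ ≤ gBound ξ κ X R i * growth X R i P l := by
  unfold gW gBound growth
  cases hRi : R i with
  | dotted j =>
    simp only [norm_dottedEnd, mul_one]
    rcases hP j hRi with h | h <;> rw [h]
    · exact le_add_of_nonneg_right (dottedEnd_nonneg _ _)
    · exact le_add_of_nonneg_left (dottedEnd_nonneg _ _)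
  | wavy j =>
    simp only [norm_real]
    rw [Real.norm_of_nonneg (show 0 ≤ wavyEnd κ _ from Real.sqrt_nonneg _)]
    refine (wavyEnd_le _).trans (le_of_eq ?_)
    split_ifs <;> simp
  | diff =>
    simp only
    split_ifs
    · rw [norm_mul, norm_I, norm_intCast]
      have := abs_nonneg (l : ℝ); linarith
    · simp
  | solid j => simp
  | zeroMode => simp

theorem tame_gW (X : Frame n) (R : Graph n) : Tame X R (gW ξ κ X R) := by
  refine ⟨∏ i, gBound ξ κ X R i, prod_nonneg fun _ _ => gBound_nonneg _ _ _ _ _, ?_⟩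
  intro P l _ hd
  rw [norm_prod, ← prod_mul_distrib]
  exact prod_le_prod (fun _ _ => norm_nonneg _) fun i _ =>
    norm_gW_le ξ κ X R i _ _ fun j hj => hd i j hj

open Classical in
/-- The local weights of a graph, with the weight `P` of the momentum at the vertex `k` in place of
the weights of the wavy line from `k` to `k'`. -/
def gP (X : Frame n) (R : Graph n) (k k' : Fin n) (h : ℤ → ℂ) (i : Fin n) (P l : ℤ) : ℂ :=
  if i = k then h P else if i = k' then 1 else gW ξ κ X R i P l

theorem tame_gP (X : Frame n) (R : Graph n)
    (hkk : k ≠ k') (hk : R k = .wavy k') (hk' : R k' = .wavy k) (h : ℤ → ℂ)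
    (hh : ∃ C, ∀ P, ‖h P‖ ≤ C * (1 + |(P : ℝ)|)) :
    Tame X R (gP ξ κ X R k k' h) := by
  classical
  obtain ⟨C, hC⟩ := hh
  have hC0 : 0 ≤ C := by
    have := (norm_nonneg _).trans (hC 0)
    simpa using this
  refine ⟨C * ∏ i ∈ (univ.erase k).erase k', gBound ξ κ X R i,
    mul_nonneg hC0 (prod_nonneg fun _ _ => gBound_nonneg _ _ _ _ _), ?_⟩
  intro P l hw hd
  have hk'' : k' ∈ univ.erase k := mem_erase.2 ⟨hkk.symm, mem_univ _⟩
  rw [← mul_prod_erase univ _ (mem_univ k), ← mul_prod_erase _ _ hk'',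
    ← mul_prod_erase univ (fun i => growth X R i _ _) (mem_univ k),
    ← mul_prod_erase _ (fun i => growth X R i _ _) hk'']
  have e1 : gP ξ κ X R k k' h k (P k) (l k) = h (P k) := by simp [gP]
  have e2 : gP ξ κ X R k k' h k' (P k') (l k') = 1 := by simp [gP, hkk.symm]
  have e3 : growth X R k (P k) (l k) * growth X R k' (P k') (l k') = 1 + |(P k : ℝ)| := by
    have : P k' = -P k := by have := hw k k' hk; omega
    simp only [growth, hk, hk', this]
    push_cast
    rw [abs_neg, Real.mul_self_sqrt (by positivity)]
  rw [e1, e2, one_mul, norm_mul, norm_prod]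
  calc ‖h (P k)‖ * ∏ i ∈ (univ.erase k).erase k', ‖gP ξ κ X R k k' h i (P i) (l i)‖
      ≤ (C * (1 + |(P k : ℝ)|)) * ∏ i ∈ (univ.erase k).erase k',
          (gBound ξ κ X R i * growth X R i (P i) (l i)) := by
        refine mul_le_mul (hC _) ?_ (prod_nonneg fun _ _ => norm_nonneg _)
          (mul_nonneg hC0 (by positivity))
        refine prod_le_prod (fun _ _ => norm_nonneg _) fun i hi => ?_
        have h1 : i ≠ k' := ne_of_mem_erase hi
        have h2 : i ≠ k := ne_of_mem_erase (mem_of_mem_erase hi)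
        simp only [gP, h1, h2, if_false]
        exact norm_gW_le ξ κ X R i _ _ fun j hj => hd i j hj
    _ = _ := by
        rw [prod_mul_distrib, ← e3]
        ring

/-! ### Boundary correlators as sums over graphs -/

open Classical in
/-- The coefficient of the chosen term at a vertex on the boundary. The unit operator is `none`. The
derivative in `± κ ∂ᵤ α^±` acts on everything that is attached to the vertex, hence multiplies by
minus the mode. -/
def coefB (κ p : ℝ) (c : Option Current) (m : ℤ) (r : Role n) : ℂ :=
  match c with
  | none => if r = .zeroMode then 1 else 0
  | some c => coef κ p c r * (if r = .diff ∧ c ≠ three then -I * m else 1)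

/-- The frame of a sequence of currents, where `none` stands for the unit operator. -/
def frame (φ : Fin n → Option Current) (m : Fin n → ℤ) (lt : Fin n → Fin n → Prop) : Frame n :=
  ⟨fun k => (φ k).elim 0 sgn, fun k => φ k = some three, m, lt⟩

/-- The product of the coefficients of the currents. -/
def coefProd (κ p : ℝ) (φ : Fin n → Option Current) (m : Fin n → ℤ) (R : Graph n) : ℂ :=
  ∏ i, coefB κ p (φ i) (m i) (R i)

/-- The boundary correlator of the modes `m` of the currents `φ`, in the order `lt`. -/
def corr (ξ : ℕ → ℝ) (κ p : ℝ) (μ : ℕ → ℝ) (φ : Fin n → Option Current) (m : Fin n → ℤ)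
    (lt : Fin n → Fin n → Prop) : ℂ :=
  ∑ R : Graph n, coefProd κ p φ m R * graphW ξ κ μ (frame φ m lt) R

theorem graphW_eq_zero {ξ : ℕ → ℝ} {κ : ℝ} {μ : ℕ → ℝ}
    {i j : Fin n} (h : R i = .solid j) (hth : ¬ X.th j) (hq : X.q j = 0) :
    graphW ξ κ μ X R = 0 := by
  classical
  have : ∏ i, lineW X R i = 0 :=
    prod_eq_zero (mem_univ i) (by simp [lineW, h, hth, hq])
  simp [graphW, this]

theorem graphW_of_not_valid {ξ : ℕ → ℝ} {κ : ℝ} {μ : ℕ → ℝ}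
    (h : ¬ Valid X R) : graphW ξ κ μ X R = 0 := by simp [graphW, h]

theorem mapRole_injective {e : Fin n → Fin n'} (he : Injective e) : Injective (mapRole e) := by
  intro r r' h
  cases r <;> cases r' <;> simp [mapRole] at h ⊢ <;> exact he h

theorem coefB_mapRole (κ p : ℝ) (e : Fin n → Fin n') (c : Option Current) (m : ℤ) (r : Role n) :
    coefB κ p c m (mapRole e r) = coefB κ p c m r := by
  rcases c with _ | c
  · cases r <;> simp [coefB, mapRole]
  · cases c <;> cases r <;> simp [coefB, mapRole, coef]

/-- Units may be inserted and the vertices relabelled. -/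
theorem corr_embed (ξ : ℕ → ℝ) (κ p : ℝ) (μ : ℕ → ℝ) {e : Fin n → Fin n'}
    (he : Injective e) {φ : Fin n → Option Current} {φ' : Fin n' → Option Current}
    {m : Fin n → ℤ} {m' : Fin n' → ℤ} {lt : Fin n → Fin n → Prop} {lt' : Fin n' → Fin n' → Prop}
    (hφ : ∀ i, φ' (e i) = φ i) (hm : ∀ i, m' (e i) = m i) (hlt : ∀ i j, lt' (e i) (e j) ↔ lt i j)
    (hoff : ∀ x, (∀ i, e i ≠ x) → φ' x = none ∧ m' x = 0) :
    corr ξ κ p μ φ m lt = corr ξ κ p μ φ' m' lt' := by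
  classical
  unfold corr
  refine Fintype.sum_of_injective
    (fun R : Graph n => extend e (fun i => mapRole e (R i)) fun _ => .zeroMode)
    ?_ _ _ ?_ ?_
  · intro R R' h
    funext i
    have := congrFun h (e i)
    simp only [he.extend_apply] at this
    exact mapRole_injective he this
  · intro R' hR'
    by_cases hz : ∀ x, (∀ i, e i ≠ x) → R' x = .zeroMode
    swap
    · push Not at hz
      obtain ⟨x, hx, hx'⟩ := hz
      have : coefProd κ p φ' m' R' = 0 :=
        prod_eq_zero (mem_univ x) (by simp [coefB, (hoff x hx).1, hx'])
      rw [this, zero_mul]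
    obtain ⟨i, hi⟩ : ∃ i, ∀ r, R' (e i) ≠ mapRole e r := by
      by_contra hc
      push Not at hc
      choose R hR using hc
      refine hR' ⟨R, ?_⟩
      funext x
      by_cases hx : ∃ i, e i = x
      · obtain ⟨i, rfl⟩ := hx
        simp only [he.extend_apply, hR]
      · simp only [extend_apply' _ _ _ hx]
        push Not at hx
        exact (hz x hx).symm
    have hout : ∀ x, (R' (e i) = .solid x ∨ R' (e i) = .dotted x ∨ R' (e i) = .wavy x) →
        ∀ j, e j ≠ x := by
      rintro x hx j rfl
      rcases hx with hx | hx | hx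
      exacts [hi (.solid j) hx, hi (.dotted j) hx, hi (.wavy j) hx]
    cases hr : R' (e i) with
    | diff => exact absurd hr (hi .diff)
    | zeroMode => exact absurd hr (hi .zeroMode)
    | solid x =>
      have hx := (hoff x (hout x (.inl hr))).1
      rw [graphW_eq_zero hr (by simp [frame, hx]) (by simp [frame, hx]), mul_zero]
    | _ x =>
      rw [graphW_of_not_valid, mul_zero]
      intro hv
      grind [hv.dotted (e i) x, hv.wavy (e i) x]
  · intro R
    congr 1
    · unfold coefProd
      refine Fintype.prod_of_injective e he _ _ ?_ ?_
      · intro x hx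
        have hx' : ∀ i, e i ≠ x := fun i hi => hx ⟨i, hi⟩
        rw [extend_apply' _ _ _ (fun ⟨i, hi⟩ => hx' i hi), (hoff x hx').1]
        simp [coefB]
      · intro i
        rw [he.extend_apply, coefB_mapRole, hφ, hm]
    · refine Embeds.graphW_eq ⟨he, ?_, ?_, ?_, hlt, ?_, ?_⟩ ξ κ μ
      · intro i; simp [frame, hφ]
      · intro i; simp [frame, hφ]
      · intro i; simp [frame, hm]
      · intro i; rw [he.extend_apply]
      · intro x hx; simp [frame, hoff x hx, extend_apply' _ _ _ (fun ⟨i, hi⟩ => hx i hi)]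

/-- `k'` is the right neighbour of `k` in the order `lt`. -/
structure Adj (lt : Fin n → Fin n → Prop) (k k' : Fin n) : Prop where
  ne : k ≠ k'
  lt_pair : lt k k'
  not_lt : ¬ lt k' k
  irrefl : ¬ lt k k
  irrefl' : ¬ lt k' k'
  left : ∀ a, a ≠ k → a ≠ k' → (lt a k ↔ lt a k')
  right : ∀ a, a ≠ k → a ≠ k' → (lt k a ↔ lt k' a)

/-- The order in which `k` and `k'` are exchanged. -/
def swapLt (lt : Fin n → Fin n → Prop) (k k' : Fin n) (i j : Fin n) : Prop :=
  lt (Equiv.swap k k' i) (Equiv.swap k k' j)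

namespace Adj

variable {lt : Fin n → Fin n → Prop} {k k' : Fin n}

theorem swapLt_left (h : Adj lt k k') : ¬ swapLt lt k k' k k' := by
  simp [swapLt, h.not_lt]

theorem swapLt_right (h : Adj lt k k') : swapLt lt k k' k' k := by
  simp [swapLt, h.lt_pair]

theorem swapLt_iff (h : Adj lt k k') (i j : Fin n) :
    (i = k ∧ j = k') ∨ (i = k' ∧ j = k) ∨ (swapLt lt k k' i j ↔ lt i j) := by
  have := h.left
  have := h.right
  have := h.irrefl
  have := h.irrefl'
  grind [swapLt]

end Adj

section Exchange

variable (ξ : ℕ → ℝ) (κ p : ℝ) (μ : ℕ → ℝ) (lt : Fin n → Fin n → Prop) (k k' : Fin n)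
  (φ : Fin n → Option Current) (m : Fin n → ℤ)

open Classical in
/-- The graphs with a solid line from `k` to `k'`, but not from `k'` to `k`. -/
def rightPart : ℂ := ∑ R : Graph n, if R k = .solid k' ∧ R k' ≠ .solid k then
  coefProd κ p φ m R * graphW ξ κ μ (frame φ m lt) R else 0

open Classical in
/-- The graphs with a solid line from `k'` to `k`, but not from `k` to `k'`. -/
def leftPart : ℂ := ∑ R : Graph n, if R k' = .solid k ∧ R k ≠ .solid k' then
  coefProd κ p φ m R * graphW ξ κ μ (frame φ m lt) R else 0

open Classical in
/-- The difference made by the order of `k` and `k'` in a graph in which a wavy line joins them: the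
Lam-functional with the weight `h` of the momentum `P` that leaves `k`. -/
def graphP (X : Frame n) (R : Graph n) (h : ℤ → ℂ) : ℂ :=
  if Valid X R then (∏ i, lineW X R i) * loopPart μ R *
    Lam ξ (fun _ => 1) (chg X R) (Gfun R X.m (gP ξ κ X R k k' h)) else 0

open Classical in
/-- The graphs with a wavy line between `k` and `k'`, with the weight `h` of its momentum. -/
def wavyPart (h : ℤ → ℂ) : ℂ := ∑ R : Graph n, if R k = .wavy k' then
  coefProd κ p φ m R * graphP ξ κ μ k k' (frame φ m lt) R h else 0

end Exchange

theorem wavyEnd_mul_self {κ : ℝ} (hκ : 0 < κ) (P : ℤ) :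
    wavyEnd κ P * wavyEnd κ P = 2 * κ * max (P : ℝ) 0 := by
  unfold wavyEnd
  exact Real.mul_self_sqrt (mul_nonneg (by positivity) (le_max_right _ _))

theorem Lam_sub (ξ : ℕ → ℝ) {ι : Type} [Fintype ι] (ρ : ι → ℝ) (q : ι → ℤ) (F F' : (ι → ℤ) → ℂ)
    (h : Summable (lamTerm ξ ρ q F)) (h' : Summable (lamTerm ξ ρ q F')) :
    Lam ξ ρ q F - Lam ξ ρ q F' = Lam ξ ρ q (fun L => F L - F' L) := by
  have h2 : Summable (lamTerm ξ ρ q fun L => -1 * F' L) := by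
    have : lamTerm ξ ρ q (fun L => -1 * F' L) = fun t => -1 * lamTerm ξ ρ q F' t :=
      funext fun t => lamTerm_smul ξ ρ q (-1) F' t
    rw [this]; exact h'.mul_left _
  have := Lam_add ξ ρ q F (fun L => -1 * F' L) h h2
  rw [Lam_smul] at this
  simp only [sub_eq_add_neg, neg_one_mul] at this ⊢
  exact this.symm

theorem graphW_wavy_swap {ξ : ℕ → ℝ} (hξ : PosWeights ξ)
    (hsum : Decay ξ) {κ : ℝ} (hκ : 0 < κ) (μ : ℕ → ℝ)
    {lt : Fin n → Fin n → Prop} {k k' : Fin n} (hadj : Adj lt k k') (φ : Fin n → Option Current)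
    (m : Fin n → ℤ) (R : Graph n) (hk : R k = .wavy k') :
    graphW ξ κ μ (frame φ m lt) R - graphW ξ κ μ (frame φ m (swapLt lt k k')) R =
      graphP ξ κ μ k k' (frame φ m lt) R (fun P => -2 * κ * P) := by
  classical
  set X := frame φ m lt with hX
  set X' := frame φ m (swapLt lt k k') with hX'
  have hV : Valid X' R ↔ Valid X R := by
    constructor <;> rintro ⟨a, b, c, d, e⟩ <;> exact ⟨a, b, c, d, e⟩
  by_cases hv : Valid X R
  swap
  · have hv' : ¬ Valid X' R := fun h => hv (hV.1 h)
    simp [graphW, graphP, hv, hv']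
  have hv' := hV.2 hv
  have hk' : R k' = .wavy k := (hv.wavy _ _ hk).2
  have hlt := hadj.swapLt_iff
  have hline : ∀ i, lineW X' R i = lineW X R i := by
    intro i
    unfold lineW
    cases hRi : R i with
    | solid j =>
      have : X'.lt i j ↔ X.lt i j := by
        rcases hlt i j with ⟨rfl, _⟩ | ⟨rfl, _⟩ | h <;> simp_all [frame]
      simp only [this]; rfl
    | _ => rfl
  have hchg : chg X' R = chg X R := rfl
  simp only [graphW, graphP, hv, hv', if_true, hline, gam, hchg]
  rw [← mul_sub]
  congr 1
  have hs1 := summable_Gfun hξ hsum hv (tame_gW ξ κ X R)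
  have hs2 := summable_Gfun hξ hsum hv' (tame_gW ξ κ X' R)
  rw [hchg] at hs2
  rw [Lam_sub ξ _ _ _ _ hs1 hs2]
  congr 1
  funext L
  unfold Gfun
  have hmm : X'.m = X.m := rfl
  rw [hmm]
  split_ifs with hcon
  swap
  · simp
  have hpair : blockSum (Conn R) (total X.m L) k' = -blockSum (Conn R) (total X.m L) k := by
    have := blockSum_joined_pair (fun i j h => (hv.dotted i j h).2)
      (fun i j h => (hv.wavy i j h).2) (Or.inr ⟨hk, hk'⟩) hadj.ne (total X.m L)
    rw [hcon k] at this
    omega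
  have hk'' : k' ∈ univ.erase k := mem_erase.2 ⟨hadj.ne.symm, mem_univ _⟩
  have split : ∀ f : Fin n → ℂ, ∏ i, f i = f k * (f k' * ∏ i ∈ (univ.erase k).erase k', f i) := by
    intro f
    rw [← mul_prod_erase univ f (mem_univ k), ← mul_prod_erase _ f hk'']
  rw [split, split, split]
  set P := blockSum (Conn R) (total X.m L) k with hP
  have hrest : ∀ g : Fin n → ℤ → ℤ → ℂ, (∀ i, i ≠ k → i ≠ k' → ∀ a b, g i a b = gW ξ κ X R i a b) →
      ∏ i ∈ (univ.erase k).erase k', g i (blockSum (Conn R) (total X.m L) i) (L (.inr i)) =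
      ∏ i ∈ (univ.erase k).erase k',
        gW ξ κ X R i (blockSum (Conn R) (total X.m L) i) (L (.inr i)) := by
    intro g hg
    refine prod_congr rfl fun i hi => hg i ?_ ?_ _ _
    · exact ne_of_mem_erase (mem_of_mem_erase hi)
    · exact ne_of_mem_erase hi
  rw [hrest (gW ξ κ X' R) ?_, hrest (gP ξ κ X R k k' _) ?_]
  · have a1 : X.lt k k' := hadj.lt_pair
    have a2 : ¬ X.lt k' k := hadj.not_lt
    have a3 : ¬ X'.lt k k' := hadj.swapLt_left
    have a4 : X'.lt k' k := hadj.swapLt_right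
    have e1 : gW ξ κ X R k P (L (.inr k)) * gW ξ κ X R k' (-P) (L (.inr k')) =
        ((2 * κ * max (-P : ℝ) 0 : ℝ) : ℂ) := by
      have := wavyEnd_mul_self hκ (-P)
      simp only [gW, hk, hk', a1, a2, if_true, if_false]
      rw [← ofReal_mul, this]; push_cast; rfl
    have e2 : gW ξ κ X' R k P (L (.inr k)) * gW ξ κ X' R k' (-P) (L (.inr k')) =
        ((2 * κ * max (P : ℝ) 0 : ℝ) : ℂ) := by
      have := wavyEnd_mul_self hκ P
      simp only [gW, hk, hk', a3, a4, if_true, if_false, neg_neg]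
      rw [← ofReal_mul, this]
    rw [← mul_assoc, ← mul_assoc, hpair, e1, e2]
    have e3 : max (-P : ℝ) 0 - max (P : ℝ) 0 = -P := by grind
    have e4 : ((2 * κ * max (-P : ℝ) 0 : ℝ) : ℂ) - ((2 * κ * max (P : ℝ) 0 : ℝ) : ℂ) =
        -2 * κ * P := by
      rw [← ofReal_sub, ← mul_sub, e3]; push_cast; ring
    rw [← sub_mul, e4]
    simp [gP, hadj.ne.symm]
  · intro i h1 h2 a b; simp [gP, h1, h2]
  · intro i h1 h2 a b
    unfold gW
    cases hRi : R i with
    | wavy j =>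
      simp only
      have h3 : X'.lt i j ↔ X.lt i j := by rcases hlt i j with ⟨h, _⟩ | ⟨h, _⟩ | h <;> tauto
      simp only [h3]
    | diff => rfl
    | _ => rfl

/-- The commutator of two neighbouring operators. -/
theorem corr_sub_swap {ξ : ℕ → ℝ} (hξ : PosWeights ξ)
    (hsum : Decay ξ) {κ : ℝ} (hκ : 0 < κ) (p : ℝ) (μ : ℕ → ℝ)
    {lt : Fin n → Fin n → Prop} {k k' : Fin n} (hadj : Adj lt k k') (φ : Fin n → Option Current)
    (m : Fin n → ℤ) :
    corr ξ κ p μ φ m lt - corr ξ κ p μ (φ ∘ Equiv.swap k k') (m ∘ Equiv.swap k k') lt =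
      2 * (rightPart ξ κ p μ lt k k' φ m + leftPart ξ κ p μ lt k k' φ m) +
        wavyPart ξ κ p μ lt k k' φ m (fun P => -2 * κ * P) := by
  classical
  have h0 : corr ξ κ p μ (φ ∘ Equiv.swap k k') (m ∘ Equiv.swap k k') lt =
      corr ξ κ p μ φ m (swapLt lt k k') := by
    refine corr_embed ξ κ p μ (e := Equiv.swap k k') (Equiv.injective _) ?_ ?_ ?_ ?_
    · intro i; rfl
    · intro i; rfl
    · intro i j; simp [swapLt]
    · intro x hx; exact absurd (Equiv.swap_apply_self _ _ x) (hx _)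
  rw [h0]
  unfold corr rightPart leftPart wavyPart
  rw [← sum_sub_distrib, ← sum_add_distrib, mul_sum, ← sum_add_distrib]
  refine sum_congr rfl fun R _ => ?_
  by_cases hw : R k = .wavy k'
  · have h1 := graphW_wavy_swap hξ hsum hκ μ hadj φ m R hw
    rw [← mul_sub, h1]
    by_cases h3 : R k' = .solid k
    · have : ¬ Valid (frame φ m lt) R := fun hv => by grind [hv.wavy k k']
      simp [graphP, graphW, this]
    · simp [hw, h3]
  · have h1 := graphW_swap_order ξ κ μ (X := frame φ m lt) (X' := frame φ m (swapLt lt k k'))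
      hadj.ne rfl rfl rfl hadj.swapLt_iff
      ⟨fun _ => hadj.swapLt_left, fun _ => hadj.lt_pair⟩
      ⟨fun h => absurd h hadj.not_lt, fun h => absurd hadj.swapLt_right h⟩ R hw
    rw [h1]
    by_cases h2 : R k = .solid k' <;> by_cases h3 : R k' = .solid k <;> simp [h2, h3, hw]
    all_goals ring

/-! ### The commutators with `J³` -/

theorem sum_role_eq (k : Fin n) (r r0 : Role n) (f : (Graph n) → ℂ) :
    ∑ R : Graph n, (if R k = r then f R else 0) =
      ∑ R : Graph n, if R k = r0 then f (update R k r) else 0 := by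
  rw [← sum_filter, ← sum_filter]
  refine sum_nbij' (fun R => update R k r0) (fun R => update R k r) (by simp) (by simp) ?_ ?_ ?_ <;>
    · intro R hR
      have h := (mem_filter.1 hR).2
      simp [← h]

theorem sum_split {A : Type} [AddCommMonoid A] (h : k ≠ k') (f : Fin n → A) :
    ∑ i, f i = f k + (f k' + ∑ i ∈ (univ.erase k).erase k', f i) := by
  rw [← add_sum_erase univ f (mem_univ k), ← add_sum_erase (univ.erase k) f (a := k') (by simp [h.symm])]

theorem prod_split (h : k ≠ k') (f : Fin n → ℂ) :
    ∏ i, f i = f k * (f k' * ∏ i ∈ (univ.erase k).erase k', f i) := by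
  rw [← mul_prod_erase univ f (mem_univ k), ← mul_prod_erase (univ.erase k) f (a := k') (by simp [h.symm])]

theorem mem_erase_erase {k k' i : Fin n} (h : i ∈ (univ.erase k).erase k') : i ≠ k ∧ i ≠ k' := by
  simp_all

/-- The coefficients at the vertices other than `k` and `k'`. -/
def coefRest (φ : Fin n → Option Current) (m : Fin n → ℤ) (k k' : Fin n) (R : Graph n) : ℂ :=
  ∏ i ∈ (univ.erase k).erase k', coefB κ p (φ i) (m i) (R i)

theorem coefProd_split (φ : Fin n → Option Current) (m : Fin n → ℤ) (h : k ≠ k') (R : Graph n) :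
    coefProd κ p φ m R = coefB κ p (φ k) (m k) (R k) * (coefB κ p (φ k') (m k') (R k') *
      coefRest κ p φ m k k' R) := prod_split h _

theorem coefRest_congr {φ φ' : Fin n → Option Current} {m m' : Fin n → ℤ}
    (h : ∀ i, i ≠ k → i ≠ k' → φ i = φ' i ∧ m i = m' i ∧ R i = R' i) :
    coefRest κ p φ m k k' R = coefRest κ p φ' m' k k' R' := by
  refine prod_congr rfl fun i hi => ?_
  obtain ⟨h1, h2, h3⟩ := h i (mem_erase_erase hi).1 (mem_erase_erase hi).2
  rw [h1, h2, h3]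

theorem sgn_mul_self {c : Current} (hc : c ≠ three) : (c.sgn : ℂ) * c.sgn = 1 := by
  cases c <;> simp [sgn] at hc ⊢

theorem coefB_diff {c : Current} (hc : c ≠ three) (m : ℤ) :
    coefB κ p (some c) m (.diff : Role n) = c.sgn * κ * (-I * m) := by
  cases c <;> simp [coefB, coef] at hc ⊢

theorem coefB_eq_of_ne_diff (c : Option Current) (m m' : ℤ) {r : Role n}
    (hr : r ≠ .diff) : coefB κ p c m r = coefB κ p c m' r := by
  rcases c with _ | c <;> simp [coefB, hr]

theorem coefB_solid {c : Current} (hc : c ≠ three) (m : ℤ) (j : Fin n) :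
    coefB κ p (some c) m (.solid j) = I / 2 := by
  cases c <;> simp [coefB, coef] at hc ⊢

/-- `[J³ₘ, J^±ₙ] = ∓ 2i J^±ₘ₊ₙ`: the line from `J³` to `J^±` is contracted; the part of the
commutator due to the derivative at `J^±` cancels against the lines from `J^±` to `J³`. -/
theorem corr_three_swap {ξ : ℕ → ℝ} (hξ : PosWeights ξ)
    (hsum : Decay ξ) {κ : ℝ} (hκ : 0 < κ) (p : ℝ) (μ : ℕ → ℝ) (hadj : Adj lt k k') (φ : Fin n → Option Current)
    (m : Fin n → ℤ) {c : Current} (hc : c ≠ three) (hk : φ k = some three) (hk' : φ k' = some c) :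
    corr ξ κ p μ φ m lt - corr ξ κ p μ (φ ∘ Equiv.swap k k') (m ∘ Equiv.swap k k') lt =
      -2 * I * c.sgn * corr ξ κ p μ (update φ k none)
        (update (update m k 0) k' (m k + m k')) lt := by
  classical
  rw [corr_sub_swap hξ hsum hκ p μ hadj φ m]
  set φt := update φ k none with hφt
  set mt := update (update m k 0) k' (m k + m k') with hmt
  set X := frame φ m lt with hX
  set X' := frame φt mt lt with hX'
  have hne := hadj.ne
  have hthk : X.th k := hk
  have hthk' : ¬ X.th k' := by simp [hX, frame, hk', hc]
  have hXk : X.q k = 0 := by simp [hX, frame, hk, sgn]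
  have hXk' : X.q k' = c.sgn := by simp [hX, frame, hk']
  have hq0 : X'.q k = 0 := by simp [hX', frame, hφt]
  have hth0 : ¬ X'.th k := by simp [hX', frame, hφt]
  have hth0' : ¬ X'.th k' := by simp [hX', frame, hφt, hne.symm, hk', hc]
  have hw : wavyPart ξ κ p μ lt k k' φ m (fun P => -2 * κ * P) = 0 := by
    unfold wavyPart
    refine sum_eq_zero fun R _ => ?_
    split_ifs with h
    · rw [coefProd_split κ p φ m hne, hk, h]
      simp [coefB, coef]
    · rfl
  have contr : ∀ R R0 : Graph n, (∀ i, i ≠ k → i ≠ k' → R0 i = R i) → R0 k = .zeroMode →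
      (∀ i, i ≠ k' → R i ≠ .solid k) → ((R k = .solid k' ∧ R k' ≠ .solid k ∧ R0 k' = R k') ∨
        (R k' = .solid k ∧ R k = .diff ∧ R0 k' = .diff)) → Contracts X X' R R0 k k' := by
    intro R R0 h1 h2 h3 h4
    have e1 : X'.m k = 0 := by simp [hX', frame, hmt, hne]
    have e2 : X'.m k' = X.m k + X.m k' := by simp [hX', hX, frame, hmt]
    have e3 : X'.q k' = X.q k' := by simp [hX', hX, frame, hφt, hne.symm]
    constructor <;> first | assumption | rfl | (intros; simp [hX, hX', frame, hφt, hmt, *]; done) |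
      grind [Free]
  have hin0 : ∀ R0 : Graph n, (∃ i, R0 i = .solid k) → graphW ξ κ μ X' R0 = 0 :=
    fun R0 ⟨i, hi⟩ => graphW_eq_zero hi hth0 hq0
  have hA : rightPart ξ κ p μ lt k k' φ m = ∑ R0 : Graph n, if R0 k = .zeroMode then
      (-I * c.sgn) * (coefB κ p (some c) (m k') (R0 k') * coefRest κ p φ m k k' R0) *
        graphW ξ κ μ X' R0 else 0 := by
    unfold rightPart
    simp only [ite_and]
    rw [sum_role_eq k (.solid k') .zeroMode]
    refine sum_congr rfl fun R0 _ => ?_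
    split_ifs with h0 hs hs
    · set R := update R0 k (.solid k') with hR
      have hRk : R k = .solid k' := by simp [hR]
      have hRi : ∀ i, i ≠ k → R i = R0 i := fun i hi => by simp [hR, hi]
      by_cases hin : ∃ i, R0 i = .solid k
      · rw [hin0 _ hin, graphW_of_not_valid (X := X) fun hv => by
          obtain ⟨i, hi⟩ := hin
          grind [hv.solid_th i k]]
        simp
      · push Not at hin
        have hinR : ∀ i, R i ≠ .solid k := by grind
        have hC := contr R R0 (fun i hi _ => (hRi i hi).symm) h0 (fun i _ => hinR i)
          (Or.inl ⟨hRk, hinR k', (hRi k' hne.symm).symm⟩)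
        have := graphW_leaf ξ κ μ hC hRk hinR (by
          rw [hR, update_idem, ← h0, update_eq_self]) hthk' (Or.inl ⟨hXk, hth0'⟩)
        rw [this, coefProd_split κ p φ m hne, hk, hk', hRk, hRi k' hne.symm, hXk',
          if_pos (show X.lt k k' from hadj.lt_pair),
          coefRest_congr κ p (φ' := φ) (m' := m) (R' := R0) fun i hi _ => ⟨rfl, rfl, hRi i hi⟩]
        have e0 : coefB κ p (some three) (m k) (.solid k' : Role n) = I := by
          simp [coefB, coef]
        rw [e0]
        ring
    · rw [update_of_ne hne.symm] at hs
      push Not at hs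
      rw [hin0 _ ⟨k', hs⟩, mul_zero]
    · rfl
  have hB : leftPart ξ κ p μ lt k k' φ m = ∑ R0 : Graph n,
      if R0 k = .zeroMode then if R0 k' = .diff then
      -(κ * m k) * coefRest κ p φ m k k' R0 * graphW ξ κ μ X' R0 else 0 else 0 := by
    have e1 : leftPart ξ κ p μ lt k k' φ m = ∑ R : Graph n, if R k = .diff then
        if R k' = .solid k then coefProd κ p φ m R * graphW ξ κ μ X R else 0 else 0 := by
      unfold leftPart
      refine sum_congr rfl fun R _ => ?_
      by_cases h1 : R k' = .solid k <;> by_cases h2 : R k = .diff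
      · simp [h1, h2, hX]
      · rw [graphW_of_not_valid (X := X) fun hv => h2 (hv.solid_th _ _ h1 hthk).1]
        simp
      all_goals simp [h1]
    rw [e1, sum_role_eq k .diff .zeroMode]
    have e2 : ∀ R : Graph n, (if R k = .zeroMode then
        if update R k .diff k' = .solid k then
          coefProd κ p φ m (update R k .diff) *
            graphW ξ κ μ X (update R k .diff) else 0 else 0) =
        if R k' = .solid k then if R k = .zeroMode then
          coefProd κ p φ m (update R k .diff) *
            graphW ξ κ μ X (update R k .diff) else 0 else 0 := by
      intro R
      rw [update_of_ne hne.symm]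
      by_cases h1 : R k' = .solid k <;> by_cases h2 : R k = .zeroMode <;> simp [h1, h2]
    rw [sum_congr rfl fun R _ => e2 R, sum_role_eq k' (.solid k) .diff]
    refine sum_congr rfl fun R0 _ => ?_
    rw [update_of_ne hne]
    by_cases h0 : R0 k = .zeroMode <;> by_cases h1 : R0 k' = .diff
    rotate_left
    iterate 3 simp [h0, h1]
    simp only [h0, h1, if_true]
    set R := update (update R0 k' (.solid k)) k .diff with hR
    have hRk : R k = .diff := by simp [hR]
    have hRk' : R k' = .solid k := by simp [hR, hne.symm]
    have hRi : ∀ i, i ≠ k → i ≠ k' → R i = R0 i := fun i hi hi' => by simp [hR, hi, hi']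
    by_cases hin : ∃ i, R0 i = .solid k
    · rw [hin0 _ hin, graphW_of_not_valid (X := X) fun hv => by
        grind [hv.solid_th k' k hRk' hthk]]
      simp
    · push Not at hin
      have hC := contr R R0 (fun i hi hi' => (hRi i hi hi').symm) h0 (by grind)
        (Or.inr ⟨hRk', hRk, h1⟩)
      have := graphW_root ξ κ μ hC hRk' hRk h1 hthk hthk' hth0' hXk
      rw [this, coefProd_split κ p φ m hne, hk, hk', hRk, hRk', coefB_solid κ p hc,
        if_neg (show ¬ X.lt k' k from hadj.not_lt),
        coefRest_congr κ p (φ' := φ) (m' := m) (R' := R0) fun i hi hi' => ⟨rfl, rfl, hRi i hi hi'⟩]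
      have e3 : X.m k = m k := rfl
      simp only [coefB, coef, e3]
      simp
      ring_nf
      simp [I_sq]
  rw [hw, hA, hB, add_zero, ← sum_add_distrib, mul_sum, corr, mul_sum]
  refine sum_congr rfl fun R0 _ => ?_
  rw [coefProd_split κ p φt mt hne, coefRest_congr κ p (φ := φt) (m := mt) (φ' := φ) (m' := m) (R' := R0)
    fun i hi hi' => ⟨by simp [hφt, hi], by simp [hmt, hi, hi'], rfl⟩]
  have e4 : φt k = none := by simp [hφt]
  have e5 : φt k' = some c := by simp [hφt, hne.symm, hk']
  have e6 : mt k' = m k + m k' := by simp [hmt]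
  rw [e4, e5, e6]
  by_cases h0 : R0 k = .zeroMode
  swap
  · simp [h0, coefB]
  by_cases h1 : R0 k' = .diff
  · simp only [h0, h1, if_true, coefB_diff κ p hc]
    have := sgn_mul_self hc
    simp only [coefB, if_true, one_mul]
    push_cast
    linear_combination (-2 * κ * I ^ 2 * (m k : ℂ)) *
      coefRest κ p φ m k k' R0 * graphW ξ κ μ X' R0 * this - 2 * κ * m k *
      coefRest κ p φ m k k' R0 * graphW ξ κ μ X' R0 * I_sq
  · simp only [h0, h1, if_true, if_false, coefB_eq_of_ne_diff κ p (some c) (m k') (m k + m k') h1]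
    simp only [coefB, if_true, one_mul]
    ring

/-- The graph with relabelled vertices. -/
def relabel (σ : Equiv.Perm (Fin n)) (R : Graph n) : Graph n :=
  fun i => mapRole σ (R (σ.symm i))

theorem relabel_apply (σ : Equiv.Perm (Fin n)) (R : Graph n) (i : Fin n) :
    relabel σ R (σ i) = mapRole σ (R i) := by simp [relabel]

theorem embeds_relabel {σ : Equiv.Perm (Fin n)} (hq : ∀ i, X'.q (σ i) = X.q i)
    (hth : ∀ i, X'.th (σ i) ↔ X.th i) (hm : ∀ i, X'.m (σ i) = X.m i)
    (hlt : ∀ i j, X'.lt (σ i) (σ j) ↔ X.lt i j) (R : Graph n) : Embeds σ X X' R (relabel σ R) :=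
  ⟨σ.injective, hq, hth, hm, hlt, relabel_apply σ R,
    fun x hx => absurd (σ.apply_symm_apply x) (hx _)⟩

theorem relabel_swap_involutive (k k' : Fin n) : Involutive (relabel (Equiv.swap k k')) := by
  intro R
  funext i
  simp only [relabel, Equiv.symm_swap, Equiv.swap_apply_self]
  cases R i <;> simp [mapRole]

theorem relabel_swap_iff (R : Graph n) :
    (relabel (Equiv.swap k k') R k = .solid k' ↔ R k' = .solid k) ∧
    (relabel (Equiv.swap k k') R k' = .solid k ↔ R k = .solid k') ∧
    (relabel (Equiv.swap k k') R k = .wavy k' ↔ R k' = .wavy k) ∧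
    (relabel (Equiv.swap k k') R k' = .wavy k ↔ R k = .wavy k') := by
  simp only [relabel, Equiv.symm_swap, Equiv.swap_apply_left, Equiv.swap_apply_right]
  refine ⟨?_, ?_, ?_, ?_⟩ <;> [cases R k'; cases R k; cases R k'; cases R k] <;>
    simp [mapRole, Equiv.swap_apply_eq_iff]

/-- `2 (rightPart + leftPart)` of a pair of currents in terms of the exchanged pair. -/
theorem leftPart_eq_neg_rightPart (hadj : Adj lt k k') (φ : Fin n → Option Current)
    (m : Fin n → ℤ) : leftPart ξ κ p μ lt k k' φ m =
      -rightPart ξ κ p μ lt k k' (φ ∘ Equiv.swap k k') (m ∘ Equiv.swap k k') := by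
  classical
  unfold leftPart rightPart
  rw [← sum_neg_distrib]
  set σ := Equiv.swap k k' with hσ
  have hσσ : ∀ i, σ (σ i) = i := Equiv.swap_apply_self k k'
  refine Fintype.sum_equiv (relabel_swap_involutive k k').toPerm _ _ fun R => ?_
  obtain ⟨t1, t2, -⟩ := relabel_swap_iff (k := k) (k' := k') R
  simp only [ne_eq, Involutive.coe_toPerm, t1, t2]
  split_ifs with h
  swap
  · simp
  have h1 := graphW_swap_order ξ κ μ (X := frame φ m lt) (X' := frame φ m (swapLt lt k k'))
    hadj.ne rfl rfl rfl hadj.swapLt_iff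
    ⟨fun _ => hadj.swapLt_left, fun _ => hadj.lt_pair⟩
    ⟨fun h => absurd h hadj.not_lt, fun h => absurd hadj.swapLt_right h⟩ R
  have h3 := (embeds_relabel (σ := σ) (X := frame φ m (swapLt lt k k'))
    (X' := frame (φ ∘ σ) (m ∘ σ) lt) (by simp [frame, hσσ]) (by simp [frame, hσσ])
    (by simp [frame, hσσ]) (fun i j => Iff.rfl) R).graphW_eq ξ κ μ
  rw [← h3]
  by_cases hw : R k = .wavy k'
  · have h2 : ∀ lt', graphW ξ κ μ (frame φ m lt') R = 0 :=
      fun lt' => graphW_of_not_valid fun hv => by grind [hv.wavy k k']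
    rw [h2, h2]; simp
  · rw [h1 hw, if_neg h.2, if_pos h.1]
    have h4 : coefProd κ p (φ ∘ σ) (m ∘ σ) (relabel σ R) = coefProd κ p φ m R := by
      unfold coefProd
      refine Fintype.prod_equiv σ _ _ fun i => ?_
      simp [relabel, hσ, coefB_mapRole]
    rw [h4]; ring

/-! ### Moving a line between two neighbouring vertices -/

theorem eqvGen_congr {α : Type} {r r' : α → α → Prop}
    (h1 : ∀ i j, r i j → EqvGen r' i j) (h2 : ∀ i j, r' i j → EqvGen r i j)
    (i j : α) : EqvGen r i j ↔ EqvGen r' i j :=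
  eqvGen_contract (c := id) h1 h2 (fun _ => .refl _) i j

theorem reach_congr {R R' : Graph n} {i : Fin n}
    (h : ∀ x, R x ≠ R' x → ¬ ReflTransGen (Step R) x i ∧
      ¬ ReflTransGen (Step R') x i) (j : Fin n) :
    ReflTransGen (Step R) j i ↔ ReflTransGen (Step R') j i := by
  have key : ∀ {R R' : Graph n}, (∀ x, R x ≠ R' x → ¬ ReflTransGen (Step R) x i) →
      ReflTransGen (Step R) j i → ReflTransGen (Step R') j i := by
    intro R R' h hj
    induction hj using ReflTransGen.head_induction_on with
    | refl => exact .refl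
    | head hxy hy ih =>
      exact .head (show R' _ = _ from
        (by_contra fun hc => h _ (Ne.symm hc) (.head hxy hy) : R' _ = R _).trans hxy) ih
  exact ⟨key fun x hx => (h x hx).1, key fun x hx => (h x hx.symm).2⟩

theorem reach_update {R R' : Graph n} {a x : Fin n} (h : ∀ i, i ≠ a → R' i = R i)
    (hx : ReflTransGen (Step R) x a) : ReflTransGen (Step R') x a := by
  induction hx using ReflTransGen.head_induction_on with
  | refl => exact .refl
  | head hxy hy ih =>
    rename_i x y
    rcases eq_or_ne x a with rfl | hxa
    · exact .refl
    · exact ReflTransGen.head (show R' x = _ from (h x hxa).trans hxy) ih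

theorem reach_step {R : Graph n} {x y z : Fin n} (h : R x = .solid y)
    (hx : ReflTransGen (Step R) x z) (hne : x ≠ z) : ReflTransGen (Step R) y z := by
  rcases ReflTransGen.cases_head hx with h1 | ⟨w, hw, hwz⟩ <;> grind [Step]

theorem transGen_self_iff {R : Graph n} {x y : Fin n} (h : R x = .solid y) :
    TransGen (Step R) x x ↔ ReflTransGen (Step R) y x := by
  rw [TransGen.head'_iff]
  simp [Step, h]

/-- Move the end of the line that leaves `a` from `k` to `k'` or back. -/
def flip (k k' a : Fin n) (R : Graph n) : Graph n :=
  update R a (mapRole (Equiv.swap k k') (R a))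

theorem flip_of_ne {k k' a i : Fin n} (R : Graph n) (h : i ≠ a) : flip k k' a R i = R i := by
  simp [flip, h]

theorem flip_left {k k' a : Fin n} {R : Graph n} (h : R a = .solid k) :
    flip k k' a R a = .solid k' := by simp [flip, h, mapRole]

theorem flip_right {k k' a : Fin n} {R : Graph n} (h : R a = .solid k') :
    flip k k' a R a = .solid k := by simp [flip, h, mapRole]

theorem flip_flip (k k' a : Fin n) (R : Graph n) : flip k k' a (flip k k' a R) = R := by
  have hmm : ∀ r : Role n, mapRole (Equiv.swap k k') (mapRole (Equiv.swap k k') r) = r := by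
    intro r; cases r <;> simp [mapRole]
  simp [flip, hmm]

theorem flip_ne {k k' a : Fin n} {R : Graph n} (hkk : k ≠ k')
    (h : R a = .solid k ∨ R a = .solid k') : flip k k' a R ≠ R := fun hc => by
  have := congrFun hc a
  grind [flip_left, flip_right]

open Classical in
/-- The vertices, not on a loop, from which a line leads to `k` or `k'`. -/
def flippable (k k' : Fin n) (R : Graph n) : Finset (Fin n) :=
  univ.filter fun a => a ≠ k ∧ a ≠ k' ∧ (R a = .solid k ∨ R a = .solid k') ∧
    ¬ TransGen (Step R) a a

theorem mem_flippable {k k' a : Fin n} {R : Graph n} : a ∈ flippable k k' R ↔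
    a ≠ k ∧ a ≠ k' ∧ (R a = .solid k ∨ R a = .solid k') ∧ ¬ TransGen (Step R) a a := by
  simp [flippable]

open Classical in
/-- An element of a nonempty finite set. -/
def pick [Inhabited (Fin n)] (D : Finset (Fin n)) : Fin n :=
  if h : D.Nonempty then h.choose else default

theorem pick_mem [Inhabited (Fin n)] {D : Finset (Fin n)} (h : D.Nonempty) : pick D ∈ D := by
  simp only [pick, h, dif_pos]
  exact h.choose_spec

/-- Contributions that change sign under the motion of lines cancel. -/
theorem sum_eq_zero_of_flip (k k' : Fin n) (hkk : k ≠ k') (S : Finset (Graph n))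
    (f : (Graph n) → ℂ) (hS : ∀ R ∈ S, (flippable k k' R).Nonempty)
    (h : ∀ R ∈ S, ∀ a ∈ flippable k k' R, flip k k' a R ∈ S ∧
      flippable k k' (flip k k' a R) = flippable k k' R ∧ f (flip k k' a R) = -f R) :
    ∑ R ∈ S, f R = 0 := by
  have : Inhabited (Fin n) := ⟨k⟩
  refine sum_involution (fun R _ => flip k k' (pick (flippable k k' R)) R) ?_ ?_ ?_ ?_
  · intro R hR
    rw [(h R hR _ (pick_mem (hS R hR))).2.2, add_neg_cancel]
  · intro R hR _
    exact flip_ne hkk (mem_flippable.1 (pick_mem (hS R hR))).2.2.1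
  · intro R hR
    exact (h R hR _ (pick_mem (hS R hR))).1
  · intro R hR
    rw [(h R hR _ (pick_mem (hS R hR))).2.1, flip_flip]

section SolidPair

variable {k k' a : Fin n} {R : Graph n}

theorem flip_transGen_left (hk : R k = .solid k') (hak : a ≠ k)
    (ha : R a = .solid k) : TransGen (Step R) a a ↔
      TransGen (Step (flip k k' a R)) a a := by
  rw [transGen_self_iff ha, transGen_self_iff (flip_left ha)]
  have hk2 : flip k k' a R k = .solid k' := by rw [flip_of_ne _ hak.symm, hk]
  constructor
  · intro h
    exact reach_step hk2 (reach_update (fun i hi => flip_of_ne _ hi) h) hak.symm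
  · intro h
    exact ReflTransGen.head hk (reach_update (fun i hi => (flip_of_ne _ hi).symm) h)

theorem flip_transGen (hk : R k = .solid k') (hak : a ≠ k)
    (ha : R a = .solid k ∨ R a = .solid k') : TransGen (Step (flip k k' a R)) a a ↔
      TransGen (Step R) a a := by
  rcases ha with ha | ha
  · exact (flip_transGen_left hk hak ha).symm
  · have := flip_transGen_left (R := flip k k' a R) (by rw [flip_of_ne _ hak.symm, hk]) hak
      (flip_right ha)
    rwa [flip_flip] at this

theorem flip_loopOf (hk : R k = .solid k') (hak : a ≠ k)
    (ha : R a = .solid k ∨ R a = .solid k') (hl : ¬ TransGen (Step R) a a) :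
    loopOf (flip k k' a R) = loopOf R := by
  have := flip_transGen hk hak ha
  exact loopOf_congr (by grind [flip_of_ne]) (by grind [flip_of_ne])

theorem transGen_self_iff_loopOf {x : Fin n} : TransGen (Step R) x x ↔ x ∈ loopOf R x := by
  simp [loopOf]

theorem flippable_flip_of_loopOf (hl : loopOf (flip k k' a R) = loopOf R)
    (ha : R a = .solid k ∨ R a = .solid k') :
    flippable k k' (flip k k' a R) = flippable k k' R := by
  ext b
  simp only [mem_flippable, transGen_self_iff_loopOf, hl]
  grind [flip_left, flip_right, flip_of_ne]

theorem flip_conn (hk : R k = .solid k') (hak : a ≠ k)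
    (ha : R a = .solid k ∨ R a = .solid k') : Conn (flip k k' a R) = Conn R := by
  have key : ∀ {R : Graph n}, R k = .solid k' → (R a = .solid k ∨ R a = .solid k') → ∀ i j,
      R i = .solid j → Conn (flip k k' a R) i j := by
    intro R hk ha i j hij
    have h1 : Conn (flip k k' a R) k k' := .of_solid ((flip_of_ne _ hak.symm).trans hk)
    have h2 := h1.symm
    by_cases hia : i = a
    · subst hia
      rcases ha with ha | ha
      · have h3 := (Conn.of_solid (flip_left (k' := k') ha)).trans h2
        grind
      · have h3 := (Conn.of_solid (flip_right (k := k) ha)).trans h1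
        grind
    · exact .of_solid ((flip_of_ne _ hia).trans hij)
  funext i j
  refine propext (eqvGen_congr (fun i j hij => ?_) (key hk ha) i j)
  have := key (R := flip k k' a R) (by rw [flip_of_ne _ hak.symm, hk])
    (by rcases ha with ha | ha <;> simp [flip_left, flip_right, ha]) i j hij
  rwa [flip_flip] at this

/-- The relation `Joined` only depends on `Conn` and on the dotted and wavy lines. -/
theorem joined_congr_of_conn {R R' : Graph n} (hC : Conn R = Conn R')
    (hd : ∀ i j, R i = .dotted j ↔ R' i = .dotted j) (hw : ∀ i j, R i = .wavy j ↔ R' i = .wavy j) :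
    Joined R = Joined R' := by
  have key : ∀ {R R' : Graph n}, Conn R = Conn R' → (∀ i j, R i = .dotted j ↔ R' i = .dotted j) →
      (∀ i j, R i = .wavy j ↔ R' i = .wavy j) → ∀ i j, Link R i j → Joined R' i j := by
    rintro R R' hC hd hw i j (h | h | h)
    · exact (hC ▸ Conn.of_solid h : Conn R' i j).joined
    · exact Joined.of_link (Or.inr (Or.inl ((hd i j).1 h)))
    · exact Joined.of_link (Or.inr (Or.inr ((hw i j).1 h)))
  funext i j
  exact propext (eqvGen_congr (key hC hd hw)
    (key hC.symm (fun i j => (hd i j).symm) fun i j => (hw i j).symm) i j)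

theorem flip_eq_solid (ha : R a = .solid k ∨ R a = .solid k') {r : Role n}
    (hr : ∀ j, r ≠ .solid j) (i : Fin n) : flip k k' a R i = r ↔ R i = r := by
  grind [flip_left, flip_right, flip_of_ne]

theorem flip_into (ha : R a = .solid k ∨ R a = .solid k') {i j : Fin n} (hj : j ≠ k) (hj' : j ≠ k') :
    flip k k' a R i = .solid j ↔ R i = .solid j := by
  grind [flip_left, flip_right, flip_of_ne]

theorem flip_free (hth : ¬ X.th k) (hth' : ¬ X.th k')
    (ha : R a = .solid k ∨ R a = .solid k') (i : Fin n) :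
    Free X (flip k k' a R) i ↔ Free X R i := by
  have h1 := flip_eq_solid ha (r := .diff) (by simp) i
  have h2 : i ≠ k → i ≠ k' → ∀ j, _ := fun hj hj' j => flip_into (i := j) ha hj hj'
  grind [Free]

theorem flip_valid_iff (hth : ¬ X.th k) (hth' : ¬ X.th k') (hak : a ≠ k)
    (hak' : a ≠ k') (ha : R a = .solid k ∨ R a = .solid k') (hkept : ∀ i j, R i = .dotted j →
      blockSum (Conn (flip k k' a R)) X.q i = blockSum (Conn R) X.q i)
    (hkept' : ∀ i j, R i = .dotted j → R j = .dotted i →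
      blockSum (Conn (flip k k' a R)) X.q j = blockSum (Conn R) X.q j) :
    Valid X (flip k k' a R) ↔ Valid X R := by
  have hd : ∀ i j, flip k k' a R i = .dotted j ↔ R i = .dotted j := fun i j =>
    flip_eq_solid ha (by simp) i
  have hw : ∀ i j, flip k k' a R i = .wavy j ↔ R i = .wavy j := fun i j =>
    flip_eq_solid ha (by simp) i
  have hdf : ∀ i, flip k k' a R i = .diff ↔ R i = .diff := fun i => flip_eq_solid ha (by simp) i
  have hsl : ∀ i j, X.th j → (flip k k' a R i = .solid j ↔ R i = .solid j) := fun i j ht =>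
    flip_into ha (by rintro rfl; exact hth ht) (by rintro rfl; exact hth' ht)
  constructor <;> rintro ⟨h1, h2, h3, h4, h5⟩ <;> constructor <;>
    grind [flip_left, flip_right, flip_of_ne]

theorem flip_lines (hth : ¬ X.th k) (hth' : ¬ X.th k') (hq : X.q k' = -X.q k)
    (hlt : X.lt a k ↔ X.lt a k') (ha : R a = .solid k ∨ R a = .solid k') :
    ∏ i, lineW X (flip k k' a R) i = -∏ i, lineW X R i := by
  classical
  rw [← mul_prod_erase univ _ (mem_univ a),
    ← mul_prod_erase univ (lineW X R) (mem_univ a), ← neg_mul]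
  congr 1
  · rcases ha with ha | ha
    · simp [lineW, flip_left ha, ha, hth, hth', hq, hlt]
    · simp [lineW, flip_right ha, ha, hth, hth', hq, hlt]
  · refine prod_congr rfl fun i hi => ?_
    simp only [lineW, flip_of_ne _ (ne_of_mem_erase hi)]

theorem gW_congr {R R' : Graph n} {i : Fin n} {P P' l : ℤ} (hlt : X'.lt = X.lt)
    (hr : R' i = R i ∨ ((∃ j, R i = .solid j) ∧ ∃ j, R' i = .solid j))
    (hP : (∀ j, R i ≠ .solid j) → R i ≠ .diff → P' = P) (hF : Free X' R' i ↔ Free X R i) :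
    gW ξ κ X' R' i P' l = gW ξ κ X R i P l := by
  rcases hr with hr | ⟨⟨j, hj⟩, j', hj'⟩
  · unfold gW
    rw [hr]
    cases hRi : R i with
    | solid j => rfl
    | diff => by_cases h : Free X R i <;> simp [h, hF]
    | zeroMode => rfl
    | dotted j => rw [hP (by simp [hRi]) (by simp [hRi])]
    | wavy j => rw [hP (by simp [hRi]) (by simp [hRi]), hlt]
  · simp [gW, hj, hj']

open Classical in
/-- The boundary value of a graph with the additional weight `h` of the modes of the factors `α`. -/
def graphH (X : Frame n) (R : Graph n) (h : (Pts n → ℤ) → ℂ) : ℂ :=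
  if Valid X R then (∏ i, lineW X R i) * loopPart μ R *
    Lam ξ (fun _ => 1) (chg X R) (fun L => h L * Gfun R X.m (gW ξ κ X R) L) else 0

theorem graphH_one (X : Frame n) (R : Graph n) :
    graphH ξ κ μ X R (fun _ => 1) = graphW ξ κ μ X R := by
  simp only [graphH, graphW, gam, one_mul]

theorem flip_chg (hth : ¬ X.th k) (hth' : ¬ X.th k')
    (ha : R a = .solid k ∨ R a = .solid k') : chg X (flip k k' a R) = chg X R := by
  have hF := flip_free hth hth' ha
  funext x
  rcases x with i | i <;> by_cases h : Free X R i <;> simp [chg, h, hF]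

theorem flip_Gfun (hk : R k = .solid k') (hak : a ≠ k)
    (ha : R a = .solid k ∨ R a = .solid k') (hth : ¬ X.th k) (hth' : ¬ X.th k') :
    Gfun (flip k k' a R) X.m (gW ξ κ X (flip k k' a R)) = Gfun R X.m (gW ξ κ X R) := by
  have hC := flip_conn hk hak ha
  have hJ := joined_congr_of_conn hC (fun i j => flip_eq_solid ha (by simp) i)
    (fun i j => flip_eq_solid ha (by simp) i)
  funext L
  simp only [Gfun, hC, hJ]
  congr 1
  exact prod_congr rfl fun i _ => gW_congr ξ κ rfl (by grind [flip_left, flip_right, flip_of_ne])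
    (fun _ _ => rfl) (flip_free hth hth' ha i)

/-- With opposite charges at `k` and `k'`, moving a line from `k` to `k'` changes the sign. -/
theorem graphH_flip (hk : R k = .solid k') (hak : a ≠ k) (hak' : a ≠ k')
    (ha : R a = .solid k ∨ R a = .solid k') (hl : ¬ TransGen (Step R) a a)
    (hth : ¬ X.th k) (hth' : ¬ X.th k') (hq : X.q k' = -X.q k) (hlt : X.lt a k ↔ X.lt a k')
    (h : (Pts n → ℤ) → ℂ) : graphH ξ κ μ X (flip k k' a R) h = -graphH ξ κ μ X R h := by
  have hB : ∀ i, blockSum (Conn (flip k k' a R)) X.q i = blockSum (Conn R) X.q i := by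
    rw [flip_conn hk hak ha]; exact fun _ => rfl
  have hV := flip_valid_iff (X := X) hth hth' hak hak' ha (fun i j _ => hB i) (fun i j _ _ => hB j)
  by_cases hv : Valid X R
  · simp only [graphH, hv, hV.2 hv, if_true, flip_chg hth hth' ha, flip_Gfun ξ κ hk hak ha hth hth',
      flip_lines hth hth' hq hlt ha, loopPart, flip_loopOf hk hak ha hl]
    ring
  · have hv' : ¬ Valid X (flip k k' a R) := fun h => hv (hV.1 h)
    simp [graphH, hv, hv']

theorem graphW_flip (hk : R k = .solid k') (hak : a ≠ k) (hak' : a ≠ k')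
    (ha : R a = .solid k ∨ R a = .solid k') (hl : ¬ TransGen (Step R) a a)
    (hth : ¬ X.th k) (hth' : ¬ X.th k') (hq : X.q k' = -X.q k) (hlt : X.lt a k ↔ X.lt a k') :
    graphW ξ κ μ X (flip k k' a R) = -graphW ξ κ μ X R := by
  rw [← graphH_one, ← graphH_one, graphH_flip ξ κ μ hk hak hak' ha hl hth hth' hq hlt]

end SolidPair

/-! ### The commutators of equal currents -/

theorem blockSum_exchange {A : Type} [AddCommMonoid A] {E : Fin n → Fin n → Prop} {k k' : Fin n}
    (hkk : k ≠ k') (hE : ∀ i, E k i ↔ E k' i) {f f' : Fin n → A}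
    (h : ∀ i, i ≠ k → i ≠ k' → f i = f' i) (hs : f k + f k' = f' k + f' k') (i : Fin n) :
    blockSum E f i = blockSum E f' i := by
  classical
  have key : ∀ g : Fin n → A, blockSum E g i = (if E k i then g k + g k' else 0) +
      ∑ j ∈ (univ.erase k).erase k', if E j i then g j else 0 := by
    intro g
    have e : blockSum E g i = ∑ j, if E j i then g j else 0 := by
      simp only [blockSum, sum_filter]
    rw [e, sum_split hkk, ← add_assoc, ← hE i]
    by_cases h : E k i <;> simp [h]
  rw [key, key, hs]
  congr 1
  refine sum_congr rfl fun j hj => ?_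
  rw [h j (mem_erase_erase hj).1 (mem_erase_erase hj).2]

/-- Charges and modes may be distributed arbitrarily over two vertices joined by a solid line. -/
theorem graphW_exchange {X X' : Frame n} {R : Graph n}
    {k k' : Fin n} (hkk : k ≠ k') (hk : R k = .solid k') (hlt : X'.lt = X.lt)
    (hth : ∀ i, X'.th i ↔ X.th i) (ht : ¬ X.th k) (ht' : ¬ X.th k')
    (hq : ∀ i, i ≠ k → i ≠ k' → X.q i = X'.q i) (hqs : X.q k + X.q k' = X'.q k + X'.q k')
    (hm : ∀ i, i ≠ k → i ≠ k' → X.m i = X'.m i) (hms : X.m k + X.m k' = X'.m k + X'.m k')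
    (hline : ∏ i, lineW X R i = ∏ i, lineW X' R i) : graphW ξ κ μ X R = graphW ξ κ μ X' R := by
  classical
  have hE : ∀ i, Conn R k i ↔ Conn R k' i := fun i =>
    ⟨fun h => (Conn.of_solid hk).symm.trans h, fun h => (Conn.of_solid hk).trans h⟩
  have hF : ∀ i, Free X R i ↔ Free X' R i := fun i => by simp only [Free, hth]
  have hQ := blockSum_exchange hkk hE hq hqs
  have hV : Valid X R ↔ Valid X' R := by
    constructor <;> rintro ⟨a, b, c, d, e⟩ <;> constructor <;> grind
  have hg : gam ξ κ X R = gam ξ κ X' R :=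
    gam_congr_of_blocks ξ κ (fun _ _ => Iff.rfl) (fun _ _ => Iff.rfl)
      (blockSum_exchange hkk hE hm hms) (blockSum_exchange hkk hE
        (fun i h1 h2 => by have := hF i; have := hq i h1 h2; simp only [chg, Sum.elim_inl]; grind)
        (by have := hF k; have := hF k'; simp only [chg, Sum.elim_inl]; grind [Free])) hF
      fun i P l => gW_congr ξ κ hlt.symm (Or.inl rfl) (fun _ _ => rfl) (hF i)
  simp only [graphW, hline, hg, hV]

theorem sum_role_eq_pair {k k' : Fin n} (hkk : k ≠ k') (r r' : Role n) (f : (Graph n) → ℂ) :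
    ∑ R : Graph n, (if R k = r ∧ R k' = r' then f R else 0) =
      ∑ R : Graph n, if R k = .zeroMode ∧ R k' = .zeroMode then
        f (update (update R k' r') k r) else 0 := by
  simp only [ite_and]
  rw [sum_role_eq k r .zeroMode]
  have e : ∀ R : Graph n, (if R k = .zeroMode then
      if update R k r k' = r' then f (update R k r) else 0 else 0) =
      if R k' = r' then if R k = .zeroMode then f (update R k r) else 0 else 0 := by
    intro R
    rw [update_of_ne hkk.symm]
    by_cases h1 : R k = .zeroMode <;> by_cases h2 : R k' = r' <;> simp [h1, h2]
  rw [sum_congr rfl fun R _ => e R, sum_role_eq k' r' .zeroMode]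
  refine sum_congr rfl fun R _ => ?_
  rw [update_of_ne hkk]
  by_cases h1 : R k = .zeroMode <;> by_cases h2 : R k' = .zeroMode <;> simp [h1, h2]

/-- A wavy line between two vertices which are not `J³`, and the graph in which it is replaced by a
solid line to a terminal vertex. -/
structure WavyPair (X : Frame n) (R RA : Graph n) (k k' : Fin n) : Prop where
  ne : k ≠ k'
  th : ¬ X.th k
  th' : ¬ X.th k'
  wavy : R k = .wavy k'
  wavy' : R k' = .wavy k
  solid : RA k = .solid k'
  diff : RA k' = .diff
  role : ∀ i, i ≠ k → i ≠ k' → RA i = R i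

namespace WavyPair

variable {X : Frame n} {R RA : Graph n} {k k' : Fin n}

theorem joined_iff (h : WavyPair X R RA k k') (i j : Fin n) : Joined R i j ↔ Joined RA i j := by
  have h1 : EqvGen (Link RA) k k' := (Conn.of_solid h.solid).joined
  have h2 : EqvGen (Link R) k k' := Joined.of_link (Or.inr (Or.inr h.wavy))
  have h3 := h1.symm
  have ⟨_, _, _, _, _, _, _, h8⟩ := h
  refine eqvGen_congr ?_ ?_ i j <;> intro i j hij <;> by_cases hik : i = k <;>
    by_cases hik' : i = k' <;> first | (apply Joined.of_link; grind [Link]) | grind [Link]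

theorem conn_iff (h : WavyPair X R RA k k') {i : Fin n} (hi : ∀ j, R i ≠ .solid j) (hik : i ≠ k)
    (hik' : i ≠ k') (j : Fin n) : Conn R j i ↔ Conn RA j i := by
  have hi' : ∀ j, RA i ≠ .solid j := by rw [h.role i hik hik']; exact hi
  rw [conn_iff_reach hi, conn_iff_reach hi']
  have hroot : ∀ {R' : Graph n} {x}, (∀ j, R' x ≠ .solid j) → x ≠ i →
      ¬ ReflTransGen (Step R') x i := by
    intro R' x hx hxi hr
    rcases ReflTransGen.cases_head hr with h1 | ⟨w, hw, _⟩
    · exact hxi h1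
    · exact hx w hw
  have h1 := hroot (R' := R) (by simp [h.wavy]) hik.symm
  have h2 := hroot (R' := R) (by simp [h.wavy']) hik'.symm
  have h3 := hroot (R' := RA) (by simp [h.diff]) hik'.symm
  have h4 : ¬ ReflTransGen (Step RA) k i := fun hr => h3 (reach_step h.solid hr hik.symm)
  have h5 := h.role
  exact reach_congr (fun x hx => by
    by_cases x = k <;> by_cases x = k' <;> simp_all) j

theorem blockSum_eq (h : WavyPair X R RA k k') {A : Type} [AddCommMonoid A] (f : Fin n → A)
    {i : Fin n} (hi : ∀ j, R i ≠ .solid j) (hik : i ≠ k) (hik' : i ≠ k') :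
    blockSum (Conn R) f i = blockSum (Conn RA) f i := by
  classical
  simp only [blockSum]
  refine sum_congr ?_ fun _ _ => rfl
  ext a
  simp only [mem_filter, mem_univ, true_and]
  exact h.conn_iff hi hik hik' a

theorem into (h : WavyPair X R RA k k') {i j : Fin n} (hj : X.th j) :
    RA i = .solid j ↔ R i = .solid j := by
  have ⟨_, _, _, _, _, _, _, _⟩ := h
  grind

theorem free_iff (h : WavyPair X R RA k k') (i : Fin n) : Free X RA i ↔ Free X R i := by
  have h1 := fun j => h.into (i := j) (j := i)
  have ⟨_, _, _, _, _, _, _, _⟩ := h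
  grind [Free]

theorem chg_eq (h : WavyPair X R RA k k') : chg X RA = chg X R := by
  unfold chg
  congr 1 <;> funext i <;> by_cases hf : Free X R i <;> simp [hf, h.free_iff]

theorem valid_iff (h : WavyPair X R RA k k') : Valid X R ↔ Valid X RA := by
  have hB : ∀ i j, R i = .dotted j → i ≠ k → i ≠ k' →
      blockSum (Conn R) X.q i = blockSum (Conn RA) X.q i :=
    fun i j hij => h.blockSum_eq _ (by simp [hij])
  have ht : ∀ j, X.th j → ∀ i, RA i = .solid j ↔ R i = .solid j := fun j hj i => h.into hj
  have ⟨h1, h2, h3, h4, h5, h6, h7, h8⟩ := h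
  constructor <;> rintro ⟨a, b, c, d, e⟩ <;> constructor <;> grind

theorem Gfun_eq (h : WavyPair X R RA k k') (ξ : ℕ → ℝ) (κ : ℝ) (f : ℤ → ℂ) (L : Pts n → ℤ) :
    Gfun R X.m (gP ξ κ X R k k' f) L =
      f (blockSum (Conn R) (total X.m L) k) * Gfun RA X.m (gW ξ κ X RA) L := by
  classical
  have hJ : ∀ i, blockSum (Joined R) (total X.m L) i = blockSum (Joined RA) (total X.m L) i := by
    have : Joined R = Joined RA := by funext i j; exact propext (h.joined_iff i j)
    rw [this]; exact fun _ => rfl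
  unfold Gfun
  simp only [hJ]
  split_ifs with hcon
  swap
  · simp
  rw [prod_split h.ne, prod_split h.ne]
  have h1 : ¬ Free X RA k' := fun hf => h.th' hf.1
  have e1 : gW ξ κ X RA k (blockSum (Conn RA) (total X.m L) k) (L (.inr k)) = 1 := by
    simp [gW, h.solid]
  have e2 : gW ξ κ X RA k' (blockSum (Conn RA) (total X.m L) k') (L (.inr k')) = 1 := by
    simp [gW, h.diff, h1]
  rw [e1, e2, one_mul, one_mul]
  simp only [gP, if_true, h.ne.symm, if_false, one_mul]
  congr 1
  refine prod_congr rfl fun i hi => ?_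
  obtain ⟨hik, hik'⟩ := mem_erase_erase hi
  simp only [hik, hik', if_false]
  exact (gW_congr ξ κ rfl (Or.inl (h.role i hik hik'))
    (fun hs _ => (h.blockSum_eq _ hs hik hik').symm) (h.free_iff i)).symm

theorem lines_eq (h : WavyPair X R RA k k') (hlt : X.lt k k') :
    ∏ i, lineW X RA i = -X.q k' * ∏ i, lineW X R i := by
  classical
  rw [prod_split h.ne, prod_split h.ne]
  have e1 : lineW X RA k = -X.q k' := by simp [lineW, h.solid, h.th', hlt]
  have e2 : lineW X RA k' = 1 := by simp [lineW, h.diff]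
  have e3 : lineW X R k = 1 := by simp [lineW, h.wavy]
  have e4 : lineW X R k' = 1 := by simp [lineW, h.wavy']
  rw [e1, e2, e3, e4, one_mul, one_mul, one_mul]
  congr 1
  refine prod_congr rfl fun i hi => ?_
  obtain ⟨hik, hik'⟩ := mem_erase_erase hi
  simp only [lineW, h.role i hik hik']

theorem loopOf_eq (h : WavyPair X R RA k k') : loopOf RA = loopOf R := by
  have h1 : ∀ (R : Graph n) x, (∀ j, R x ≠ .solid j) → ¬ TransGen (Step R) x x := fun R x =>
    not_loop_of_root
  have h2 : ¬ TransGen (Step RA) k k := not_loop_of_step_root h.solid (by simp [h.diff])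
  have ⟨_, _, _, _, _, _, _, _⟩ := h
  exact loopOf_congr (by grind) (by grind)

theorem graphW_eq (h : WavyPair X R RA k k') (ξ : ℕ → ℝ) (κ : ℝ) (μ : ℕ → ℝ) (hlt : X.lt k k') :
    graphW ξ κ μ X RA = -X.q k' * graphP ξ κ μ k k' X R (fun _ => 1) := by
  by_cases hv : Valid X R
  · have hv' := h.valid_iff.1 hv
    simp only [graphW, graphP, hv, hv', if_true, h.lines_eq hlt, loopPart, h.loopOf_eq, gam,
      h.chg_eq]
    have : Gfun R X.m (gP ξ κ X R k k' fun _ => 1) = Gfun RA X.m (gW ξ κ X RA) := by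
      funext L; rw [h.Gfun_eq, one_mul]
    rw [this]; ring
  · have hv' : ¬ Valid X RA := fun h' => hv (h.valid_iff.2 h')
    simp [graphW, graphP, hv, hv']

end WavyPair

theorem graphP_eq_zero {ξ : ℕ → ℝ} {κ : ℝ} {μ : ℕ → ℝ} {X : Frame n} {R : Graph n}
    {k k' : Fin n} (hk : R k = .wavy k') (hk' : R k' ≠ .wavy k) (f : ℤ → ℂ) :
    graphP ξ κ μ k k' X R f = 0 := by
  have : ¬ Valid X R := fun hv => hk' (hv.wavy _ _ hk).2
  simp [graphP, this]

theorem Embeds.graphP_eq {e : Fin n → Fin n'} {X' : Frame n'}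
    {R' : Graph n'} (h : Embeds e X X' R R') (ξ : ℕ → ℝ) (κ : ℝ) (μ : ℕ → ℝ) (k k' : Fin n)
    (f : ℤ → ℂ) : graphP ξ κ μ k k' X R f = graphP ξ κ μ (e k) (e k') X' R' f := by
  classical
  unfold graphP
  rw [h.lines, h.loops, h.Lam_eq ξ (g' := gP ξ κ X' R' (e k) (e k') f) (fun i P l => ?_)
    fun x hx P l => ?_]
  · exact if_congr h.valid rfl rfl
  · simp [gP, h.inj.eq_iff, h.gW_eq]
  · simp [gP, (hx k).symm, (hx k').symm, h.gW_off ξ κ hx]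

/-- Exchanging the vertices `k`, `k'` at the ends of a wavy line reverses the sign of its momentum,
up to the difference of the two modes. -/
theorem graphP_swap {ξ : ℕ → ℝ} (hξ : PosWeights ξ)
    (hsum : Decay ξ) (κ : ℝ) (μ : ℕ → ℝ) (hadj : Adj lt k k') {φ : Fin n → Option Current}
    (hφ : φ ∘ Equiv.swap k k' = φ) (hth : φ k ≠ some three) (hth' : φ k' ≠ some three)
    (m : Fin n → ℤ) (hk : R k = .wavy k') (hk' : R k' = .wavy k) :
    graphP ξ κ μ k k' (frame φ m lt) R (fun P => P) =
      -graphP ξ κ μ k k' (frame φ m lt) (relabel (Equiv.swap k k') R) (fun P => P) -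
      (m k' - m k : ℤ) *
        graphP ξ κ μ k k' (frame φ m lt) (relabel (Equiv.swap k k') R) (fun _ => 1) := by
  classical
  set σ := Equiv.swap k k' with hσ
  set X := frame φ m lt with hX
  set X1 := frame φ (m ∘ σ) (swapLt lt k k') with hX1
  have hne := hadj.ne
  have hσk : σ k = k' := Equiv.swap_apply_left _ _
  have hσk' : σ k' = k := Equiv.swap_apply_right _ _
  have hφ' : ∀ i, φ (σ i) = φ i := fun i => congrFun hφ i
  have h1 := (embeds_relabel (σ := σ) (X := X) (X' := X1) (fun i => by simp [hX, hX1, frame, hφ'])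
    (fun i => by simp [hX, hX1, frame, hφ']) (fun i => by simp [hX, hX1, frame, hσ])
    (fun i j => by simp [hX, hX1, frame, hσ, swapLt]) R).graphP_eq ξ κ μ k k' (fun P => P)
  rw [h1, hσk, hσk']
  set R1 := relabel σ R with hR1
  obtain ⟨-, -, r1, r2⟩ := relabel_swap_iff (k := k) (k' := k') R
  have hR1k : R1 k = .wavy k' := r1.2 hk'
  have hR1k' : R1 k' = .wavy k := r2.2 hk
  set RA := update (update R1 k' .diff) k (.solid k') with hRA
  have hW : WavyPair X R1 RA k k' := by
    constructor <;> first | assumption | grind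
  have hV : Valid X1 R1 ↔ Valid X R1 := by
    constructor <;> rintro ⟨a, b, c, d, e⟩ <;> exact ⟨a, b, c, d, e⟩
  by_cases hv : Valid X R1
  swap
  · have hv1 : ¬ Valid X1 R1 := fun h => hv (hV.1 h)
    simp [graphP, hv, hv1]
  have hltoff : ∀ i j, i ≠ k → i ≠ k' → (X1.lt i j ↔ X.lt i j) := by
    intro i j hi hi'
    exact (by simpa [hi, hi'] using hadj.swapLt_iff i j : swapLt lt k k' i j ↔ lt i j)
  have hline : ∏ i, lineW X1 R1 i = ∏ i, lineW X R1 i := by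
    refine prod_congr rfl fun i _ => ?_
    unfold lineW
    cases hRi : R1 i with
    | solid j =>
      have hik : i ≠ k := by rintro rfl; rw [hR1k] at hRi; cases hRi
      have hik' : i ≠ k' := by rintro rfl; rw [hR1k'] at hRi; cases hRi
      have e1 : X1.q j = X.q j := rfl
      have e2 : X1.th j ↔ X.th j := Iff.rfl
      have e3 := hltoff i j hik hik'
      by_cases ht : X.th j
      · have hjk : j ≠ k := by rintro rfl; exact hth ht
        have hjk' : j ≠ k' := by rintro rfl; exact hth' ht
        have e4 : X1.m j = X.m j := by
          simp [hX, hX1, frame, hσ, Equiv.swap_apply_of_ne_of_ne hjk hjk']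
        by_cases h : X.lt i j <;> simp [e2, e3, e4, ht, h]
      · by_cases h : X.lt i j <;> simp [e1, e2, e3, ht, h]
    | _ => rfl
  have hJk : Joined R1 k k' := Joined.of_link (Or.inr (Or.inr hR1k))
  have hmoff : ∀ i, i ≠ k → i ≠ k' → ∀ L : Pts n → ℤ, total X1.m L i = total X.m L i := by
    intro i hi hi' L
    simp [total, hX, hX1, frame, hσ, Equiv.swap_apply_of_ne_of_ne hi hi']
  have hmk : X1.m k = X.m k' := by simp [hX, hX1, frame, hσ]
  have hmk' : X1.m k' = X.m k := by simp [hX, hX1, frame, hσ]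
  have hchg : chg X1 R1 = chg X R1 := rfl
  have hG : ∀ L, Gfun R1 X1.m (gP ξ κ X1 R1 k' k fun P => P) L =
      -1 * Gfun R1 X.m (gP ξ κ X R1 k k' fun P => P) L +
        -((m k' - m k : ℤ) : ℂ) * Gfun R1 X.m (gP ξ κ X R1 k k' fun _ => 1) L := by
    intro L
    have hcon : ∀ i, blockSum (Joined R1) (total X1.m L) i = blockSum (Joined R1) (total X.m L) i := by
      refine blockSum_exchange hne (fun i => ⟨fun h => hJk.symm.trans h, fun h => hJk.trans h⟩)
        (fun i h1 h2 => hmoff i h1 h2 L) ?_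
      simp only [total, hmk, hmk']; ring
    have hG0 : Gfun R1 X1.m (gP ξ κ X1 R1 k' k fun P => P) L =
        ((blockSum (Conn R1) (total X1.m L) k' : ℤ) : ℂ) *
          Gfun R1 X.m (gP ξ κ X R1 k k' fun _ => 1) L := by
      unfold Gfun
      simp only [hcon]
      split_ifs
      swap
      · simp
      rw [prod_split hne, prod_split hne]
      simp only [gP, hne, hne.symm, if_true, if_false, one_mul]
      congr 1
      refine prod_congr rfl fun i hi => ?_
      obtain ⟨hik, hik'⟩ := mem_erase_erase hi
      simp only [hik, hik', if_false]
      have hP : (∀ j, R1 i ≠ .solid j) →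
          blockSum (Conn R1) (total X1.m L) i = blockSum (Conn R1) (total X.m L) i := by
        intro hr
        simp only [blockSum]
        refine sum_congr rfl fun j hj => hmoff j ?_ ?_ L
        · rintro rfl
          exact hik (conn_roots_eq (by simp [hR1k]) hr (mem_filter.1 hj).2).symm
        · rintro rfl
          exact hik' (conn_roots_eq (by simp [hR1k']) hr (mem_filter.1 hj).2).symm
      unfold gW
      cases hRi : R1 i with
      | wavy j =>
        rw [hP (by simp [hRi])]
        by_cases h : X.lt i j <;> simp [hltoff i j hik hik', h]
      | dotted j => rw [hP (by simp [hRi])]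
      | _ => rfl
    rw [hG0]
    have e0 : ∀ f : ℤ → ℂ, Gfun R1 X.m (gP ξ κ X R1 k k' f) L =
      f (blockSum (Conn R1) (total X.m L) k) * Gfun RA X.m (gW ξ κ X RA) L :=
        fun f => hW.Gfun_eq ξ κ f L
    rw [e0 (fun P => P), e0 (fun _ => 1)]
    by_cases hc : ∀ i, blockSum (Joined R1) (total X.m L) i = 0
    swap
    · have : Gfun RA X.m (gW ξ κ X RA) L = 0 := by
        unfold Gfun
        rw [if_neg]
        have : Joined R1 = Joined RA := by funext i j; exact propext (hW.joined_iff i j)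
        rwa [← this]
      rw [this]; simp
    have e1 : blockSum (Conn R1) (total X1.m L) k' = -blockSum (Conn R1) (total X1.m L) k := by
      have := blockSum_joined_pair (fun i j h => (hv.dotted i j h).2)
        (fun i j h => (hv.wavy i j h).2) (Or.inr ⟨hR1k, hR1k'⟩) hne (total X1.m L)
      rw [hcon k, hc k] at this
      omega
    have e2 : blockSum (Conn R1) (total X1.m L) k =
        blockSum (Conn R1) (total X.m L) k + (m k' - m k) := by
      have hkk : ¬ Conn R1 k' k := fun h =>
        hne (conn_roots_eq (by simp [hR1k']) (by simp [hR1k]) h).symm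
      have key : ∀ g : Fin n → ℤ, blockSum (Conn R1) g k = g k +
          ∑ j ∈ (univ.erase k).erase k', if Conn R1 j k then g j else 0 := by
        intro g
        have e : blockSum (Conn R1) g k = ∑ j, if Conn R1 j k then g j else 0 := by
          simp only [blockSum, sum_filter]
        rw [e, sum_split hne, if_pos (Conn.refl R1 k), if_neg hkk, zero_add]
      rw [key, key]
      have : ∀ j ∈ (univ.erase k).erase k', (if Conn R1 j k then total X1.m L j else 0) =
          if Conn R1 j k then total X.m L j else 0 := fun j hj => by
        rw [hmoff j (mem_erase_erase hj).1 (mem_erase_erase hj).2]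
      rw [sum_congr rfl this]
      have e3 : X.m k' = m k' := rfl
      have e4 : X.m k = m k := rfl
      simp only [total, hmk, e3, e4]; ring
    rw [e1, e2]
    push_cast; ring
  have hv1 := hV.2 hv
  have s1 := summable_Gfun hξ hsum hv (tame_gP ξ κ X R1 hne hR1k hR1k' (fun P => (P : ℂ))
    ⟨1, fun P => by rw [norm_intCast]; linarith⟩)
  have s2 := summable_Gfun hξ hsum hv (tame_gP ξ κ X R1 hne hR1k hR1k' (fun _ => (1 : ℂ))
    ⟨1, fun P => by rw [norm_one, one_mul]; have := abs_nonneg (P : ℝ); linarith⟩)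
  have s3 : ∀ (z : ℂ) {F}, Summable (lamTerm ξ (fun _ => 1) (chg X R1) F) →
      Summable (lamTerm ξ (fun _ => 1) (chg X R1) fun L => z * F L) := by
    intro z F hF
    have : lamTerm ξ (fun _ => 1) (chg X R1) (fun L => z * F L) =
      fun t => z * lamTerm ξ (fun _ => 1) (chg X R1) F t := funext fun t => lamTerm_smul _ _ _ _ _ _
    rw [this]; exact hF.mul_left z
  simp only [graphP, hv, hv1, if_true, hline, hchg]
  rw [funext hG, Lam_add _ _ _ _ _ (s3 _ s1) (s3 _ s2), Lam_smul, Lam_smul]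
  ring

theorem coefB_wavy {c : Current} (hc : c ≠ three) (m : ℤ) (j : Fin n) :
    coefB κ p (some c) m (.wavy j) = c.sgn := by
  cases c <;> simp [coefB, coef, sgn] at hc ⊢

theorem graphP_smul (k k' : Fin n) (X : Frame n) (R : Graph n) (z : ℂ) (f : ℤ → ℂ) :
    graphP ξ κ μ k k' X R (fun P => z * f P) = z * graphP ξ κ μ k k' X R f := by
  classical
  unfold graphP
  have : Gfun R X.m (gP ξ κ X R k k' fun P => z * f P) =
      fun L => z * Gfun R X.m (gP ξ κ X R k k' f) L := by
    funext L
    unfold Gfun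
    split_ifs
    · rw [← mul_prod_erase univ _ (mem_univ k),
        ← mul_prod_erase univ (fun i => gP ξ κ X R k k' f i _ _) (mem_univ k)]
      simp only [gP, if_true, mul_assoc]
      congr 2
      refine prod_congr rfl fun i hi => ?_
      simp [ne_of_mem_erase hi]
    · simp
  split_ifs
  · rw [this, Lam_smul]; ring
  · simp

/-- `[J^±ₘ, J^±ₙ] = 0`. -/
theorem corr_swap_same {ξ : ℕ → ℝ} (hξ : PosWeights ξ)
    (hsum : Decay ξ) {κ : ℝ} (hκ : 0 < κ) (p : ℝ) (μ : ℕ → ℝ) (hadj : Adj lt k k') (φ : Fin n → Option Current)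
    (m : Fin n → ℤ) {c : Current} (hc : c ≠ three) (hk : φ k = some c) (hk' : φ k' = some c) :
    corr ξ κ p μ φ m lt =
      corr ξ κ p μ (φ ∘ Equiv.swap k k') (m ∘ Equiv.swap k k') lt := by
  classical
  rw [← sub_eq_zero, corr_sub_swap hξ hsum hκ p μ hadj φ m, leftPart_eq_neg_rightPart ξ κ p μ hadj]
  set σ := Equiv.swap k k' with hσ
  have hne := hadj.ne
  have hσk : σ k = k' := Equiv.swap_apply_left _ _
  have hσk' : σ k' = k := Equiv.swap_apply_right _ _
  have hoff : ∀ i, i ≠ k → i ≠ k' → σ i = i := fun i h1 h2 => Equiv.swap_apply_of_ne_of_ne h1 h2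
  have hφ : φ ∘ σ = φ := by
    funext i
    rcases eq_or_ne i k with rfl | h1
    · simp [hσk, hk, hk']
    rcases eq_or_ne i k' with rfl | h2
    · simp [hσk', hk, hk']
    · simp [hoff i h1 h2]
  rw [hφ]
  set X := frame φ m lt with hX
  have hth : ¬ X.th k := by simp [hX, frame, hk, hc]
  have hth' : ¬ X.th k' := by simp [hX, frame, hk', hc]
  have hq : X.q k' = c.sgn := by simp [hX, frame, hk']
  set ε : ℂ := (c.sgn : ℂ) with hε
  have hεε : ε * ε = 1 := sgn_mul_self hc
  set d : ℂ := ((m k' - m k : ℤ) : ℂ) with hd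
  -- the lines from `k` to `k'`
  have hA : 2 * (rightPart ξ κ p μ lt k k' φ m - rightPart ξ κ p μ lt k k' φ (m ∘ σ)) =
      ∑ R : Graph n, if R k = .solid k' ∧ R k' = .diff then
        ε * κ * d * (coefRest κ p φ m k k' R * graphW ξ κ μ X R) else 0 := by
    unfold rightPart
    rw [← sum_sub_distrib, mul_sum]
    refine sum_congr rfl fun R _ => ?_
    by_cases h1 : R k = .solid k'
    swap
    · simp [h1]
    by_cases h2 : R k' = .solid k
    · simp [h1, h2]
    have e1 : graphW ξ κ μ (frame φ (m ∘ σ) lt) R = graphW ξ κ μ X R := by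
      refine (graphW_exchange (X := X) (X' := frame φ (m ∘ σ) lt) ξ κ μ hne h1 rfl (fun _ => Iff.rfl) hth hth' (fun _ _ _ => rfl) rfl
        ?_ ?_ ?_).symm
      · intro i hi hi'; simp [hX, frame, hoff i hi hi']
      · simp [hX, frame, hσk, hσk', add_comm]
      · refine prod_congr rfl fun i _ => ?_
        unfold lineW
        cases hRi : R i with
        | solid j =>
          by_cases ht : X.th j
          · have hjk : j ≠ k := by rintro rfl; exact hth ht
            have hjk' : j ≠ k' := by rintro rfl; exact hth' ht
            have e : (frame φ (m ∘ σ) lt).m j = X.m j := by simp [hX, frame, hoff j hjk hjk']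
            have e' : (frame φ (m ∘ σ) lt).th j ↔ X.th j := Iff.rfl
            simp only [e, e', ht, if_true]; rfl
          · have e' : (frame φ (m ∘ σ) lt).th j ↔ X.th j := Iff.rfl
            simp only [e', ht, if_false]; rfl
        | _ => rfl
    rw [e1, coefProd_split κ p φ m hne, coefProd_split κ p φ (m ∘ σ) hne,
      coefRest_congr κ p (φ := φ) (m := m ∘ σ) (φ' := φ) (m' := m) (R' := R)
        fun i hi hi' => ⟨rfl, by simp [hoff i hi hi'], rfl⟩, hk, hk', h1, coefB_solid κ p hc,
      coefB_solid κ p hc]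
    by_cases h3 : R k' = .diff
    · rw [h3, coefB_diff κ p hc, coefB_diff κ p hc]
      simp only [comp, hσk', hd]
      simp
      linear_combination (-ε * κ * ((m k' : ℂ) - m k) * coefRest κ p φ m k k' R *
        graphW ξ κ μ X R) * I_sq
    · rw [coefB_eq_of_ne_diff κ p (some c) ((m ∘ σ) k') (m k') h3]
      simp [h2, h3, ← hX]
  -- the wavy line between `k` and `k'`
  let S : ℂ := ∑ R : Graph n, if R k = .wavy k' ∧ R k' = .wavy k then
    coefRest κ p φ m k k' R * graphP ξ κ μ k k' X R (fun _ => 1) else 0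
  have hV : wavyPart ξ κ p μ lt k k' φ m (fun P => -2 * κ * P) = κ * d * S := by
    let T : ℂ := ∑ R : Graph n, if R k = .wavy k' ∧ R k' = .wavy k then
      coefRest κ p φ m k k' R * graphP ξ κ μ k k' X R (fun P => (P : ℂ)) else 0
    have e1 : wavyPart ξ κ p μ lt k k' φ m (fun P => -2 * κ * P) = -2 * κ * T := by
      unfold wavyPart
      rw [mul_sum]
      refine sum_congr rfl fun R _ => ?_
      by_cases h1 : R k = .wavy k'
      swap
      · simp [h1]
      by_cases h2 : R k' = .wavy k
      swap
      · simp [h1, h2, graphP_eq_zero h1 h2]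
      simp only [h1, h2, and_self, if_true]
      rw [graphP_smul, coefProd_split κ p φ m hne, hk, hk', h1, h2, coefB_wavy κ p hc,
        coefB_wavy κ p hc]
      linear_combination (-2 * κ * coefRest κ p φ m k k' R *
        graphP ξ κ μ k k' X R (fun P => (P : ℂ))) * hεε
    have hT : T = -T - d * S := by
      have hrest : ∀ R : Graph n,
          coefRest κ p φ m k k' (relabel σ R) = coefRest κ p φ m k k' R := by
        intro R
        refine prod_congr rfl fun i hi => ?_
        obtain ⟨hi, hi'⟩ := mem_erase_erase hi
        have h0 : σ.symm = σ := Equiv.symm_swap _ _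
        rw [relabel, h0, hoff i hi hi', coefB_mapRole]
      have e2 : T = ∑ R : Graph n, if R k = .wavy k' ∧ R k' = .wavy k then
          coefRest κ p φ m k k' R * (-graphP ξ κ μ k k' X (relabel σ R) (fun P => (P : ℂ)) -
            d * graphP ξ κ μ k k' X (relabel σ R) (fun _ => 1)) else 0 := by
        refine sum_congr rfl fun R _ => ?_
        by_cases h : R k = .wavy k' ∧ R k' = .wavy k
        · rw [if_pos h, if_pos h, graphP_swap hξ hsum κ μ hadj hφ hth hth' m h.1 h.2]
        · rw [if_neg h, if_neg h]
      have e3 : -T - d * S = ∑ R : Graph n, if R k = .wavy k' ∧ R k' = .wavy k then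
          coefRest κ p φ m k k' R * (-graphP ξ κ μ k k' X R (fun P => (P : ℂ)) -
            d * graphP ξ κ μ k k' X R (fun _ => 1)) else 0 := by
        simp only [T, S]
        rw [← sum_neg_distrib, mul_sum, ← sum_sub_distrib]
        refine sum_congr rfl fun R _ => ?_
        split_ifs
        · ring
        · simp
      refine e2.trans (Eq.trans ?_ e3.symm)
      refine Fintype.sum_equiv (relabel_swap_involutive k k').toPerm _ _ fun R => ?_
      obtain ⟨-, -, r1, r2⟩ := relabel_swap_iff (k := k) (k' := k') R
      simp only [Involutive.coe_toPerm, r1, r2]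
      simp only [← hσ, hrest, and_comm]
    rw [e1]
    linear_combination (-κ : ℂ) * hT
  rw [← sub_eq_add_neg, hA, hV]
  simp only [S]
  rw [sum_role_eq_pair hne (.solid k') .diff fun R => ε * κ * d *
      (coefRest κ p φ m k k' R * graphW ξ κ μ X R),
    sum_role_eq_pair hne (.wavy k') (.wavy k) fun R => coefRest κ p φ m k k' R *
      graphP ξ κ μ k k' X R (fun _ => 1), mul_sum, ← sum_add_distrib]
  refine sum_eq_zero fun R _ => ?_
  split_ifs
  swap
  · simp
  set RV := update (update R k' (.wavy k)) k (.wavy k') with hRV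
  set RA := update (update R k' .diff) k (.solid k') with hRA
  have hW : WavyPair X RV RA k k' := by
    constructor <;> grind
  rw [hW.graphW_eq ξ κ μ hadj.lt_pair, hq,
    coefRest_congr κ p (φ := φ) (m := m) (φ' := φ) (m' := m) (R := RA) (R' := RV)
      fun i hi hi' => ⟨rfl, rfl, hW.role i hi hi'⟩]
  linear_combination (-κ * d * coefRest κ p φ m k k' RV *
    graphP ξ κ μ k k' X RV (fun _ => 1)) * hεε

/-! ### The commutator of `J⁺` and `J⁻`: lines between the two vertices -/

/-- On loops, a vertex is determined by its successor. -/
theorem loop_step_injective {x y z : Fin n}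
    (hx : TransGen (Step R) x x) (hy : TransGen (Step R) y y)
    (hxz : R x = .solid z) (hyz : R y = .solid z) : x = y := by
  let f : Fin n → Fin n := fun i => match R i with
    | .solid j => j
    | _ => i
  have hf : ∀ i j, R i = .solid j → f i = j := fun i j h => by simp only [f, h]
  have hit : ∀ {a b : Fin n}, TransGen (Step R) a b → ∃ l, 0 < l ∧ f^[l] a = b := by
    intro a b hab
    induction hab with
    | single h => exact ⟨1, one_pos, hf _ _ h⟩
    | tail _ h ih =>
      obtain ⟨l, hl, hl'⟩ := ih
      exact ⟨l + 1, l.succ_pos, by rw [iterate_succ_apply', hl', hf _ _ h]⟩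
  refine (bijOn_periodicPts f).injOn (hit hx) (hit hy) ?_
  rw [hf _ _ hxz, hf _ _ hyz]

/-- No line but the one from `k` leads to `k` or `k'`. -/
def NoIncoming (k k' : Fin n) (R : Graph n) : Prop :=
  ∀ a, a ≠ k → R a ≠ .solid k ∧ R a ≠ .solid k'

theorem coefB_of_solid (κ p : ℝ) (c : Option Current) (m m' : ℤ) (j j' : Fin n) :
    coefB κ p c m (.solid j) = coefB κ p c m' (.solid j') := by
  rcases c with _ | c
  · simp [coefB]
  · cases c <;> simp [coefB, coef]

theorem flip_is_solid {k k' a : Fin n}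
    (ha : R a = .solid k ∨ R a = .solid k') : ∃ j, flip k k' a R a = .solid j := by
  rcases ha with ha | ha
  · exact ⟨_, flip_left ha⟩
  · exact ⟨_, flip_right ha⟩

theorem coefB_flip (κ p : ℝ) (φ : Fin n → Option Current) (m : Fin n → ℤ) {k k' a : Fin n} (ha : R a = .solid k ∨ R a = .solid k') (i : Fin n) :
    coefB κ p (φ i) (m i) (flip k k' a R i) = coefB κ p (φ i) (m i) (R i) := by
  rcases eq_or_ne i a with rfl | hia
  · obtain ⟨j, hj⟩ := flip_is_solid ha
    rw [hj]
    rcases ha with ha | ha <;> rw [ha] <;> exact coefB_of_solid ..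
  · rw [flip_of_ne _ hia]

section Pair

variable {ξ : ℕ → ℝ} {κ p : ℝ} {μ : ℕ → ℝ} {lt : Fin n → Fin n → Prop} {k k' : Fin n}
  {φ : Fin n → Option Current} {c c' : Current}

/-- The lines into two vertices of opposite charge, joined by a solid line, cancel unless they belong
to a loop. -/
theorem rightPart_eq_unflippable (ξ : ℕ → ℝ) (κ p : ℝ) (μ : ℕ → ℝ) (hadj : Adj lt k k')
    (hc : c ≠ three) (hc' : c' ≠ three) (hk : φ k = some c) (hk' : φ k' = some c')
    (hs : c'.sgn = -c.sgn) (m : Fin n → ℤ) : rightPart ξ κ p μ lt k k' φ m = ∑ R : Graph n,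
      if R k = .solid k' ∧ R k' ≠ .solid k ∧ flippable k k' R = ∅ then
        coefProd κ p φ m R * graphW ξ κ μ (frame φ m lt) R else 0 := by
  classical
  have hne := hadj.ne
  have hz : ∑ R ∈ univ.filter (fun R : Graph n => R k = .solid k' ∧
      R k' ≠ .solid k ∧ (flippable k k' R).Nonempty),
      coefProd κ p φ m R * graphW ξ κ μ (frame φ m lt) R = 0 := by
    refine sum_eq_zero_of_flip k k' hne _ _ (fun R hR => (mem_filter.1 hR).2.2.2) ?_
    intro R hR a ha
    obtain ⟨h1, h2, h3⟩ := (mem_filter.1 hR).2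
    obtain ⟨hak, hak', has, hl⟩ := mem_flippable.1 ha
    have hfl := flippable_flip_of_loopOf (flip_loopOf h1 hak has hl) has
    refine ⟨?_, hfl, ?_⟩
    · simp only [mem_filter, mem_univ, true_and]
      rw [flip_of_ne _ hak.symm, flip_of_ne _ hak'.symm, hfl]
      exact ⟨h1, h2, h3⟩
    · rw [graphW_flip ξ κ μ h1 hak hak' has hl (by simp [frame, hk, hc])
        (by simp [frame, hk', hc']) (by simp [frame, hk, hk', hs]) (hadj.left a hak hak')]
      have : coefProd κ p φ m (flip k k' a R) = coefProd κ p φ m R :=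
        prod_congr rfl fun i _ => coefB_flip κ p φ m has i
      rw [this]; ring
  unfold rightPart
  rw [sum_filter] at hz
  rw [← sub_eq_zero, ← sum_sub_distrib]
  refine Eq.trans (sum_congr rfl fun R _ => ?_) hz
  by_cases h1 : R k = .solid k' <;> by_cases h2 : R k' = .solid k <;>
    rcases (flippable k k' R).eq_empty_or_nonempty with h3 | h3
  all_goals first | (simp [h1, h2, h3]; done) | simp [h1, h2, h3, h3.ne_empty]

/-- Two vertices of opposite charge on a common loop can be exchanged. -/
theorem graphW_exchange_loop (ξ : ℕ → ℝ) (κ : ℝ) (μ : ℕ → ℝ) (hadj : Adj lt k k')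
    (hc : c ≠ three) (hc' : c' ≠ three) (hk : φ k = some c) (hk' : φ k' = some c')
    (hs : c'.sgn = -c.sgn) (m : Fin n → ℤ) (hR : R k = .solid k')
    (hR' : R k' ≠ .solid k) (hD : flippable k k' R = ∅) (hin : ¬ NoIncoming k k' R) :
    graphW ξ κ μ (frame φ m lt) R =
        graphW ξ κ μ (frame (φ ∘ Equiv.swap k k') (m ∘ Equiv.swap k k') lt) R ∧
      (graphW ξ κ μ (frame φ m lt) R = 0 ∨ ∃ j, R k' = .solid j) := by
  classical
  set σ := Equiv.swap k k' with hσ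
  have hne := hadj.ne
  have hσk : σ k = k' := Equiv.swap_apply_left _ _
  have hσk' : σ k' = k := Equiv.swap_apply_right _ _
  have hoff : ∀ i, i ≠ k → i ≠ k' → σ i = i := fun i h1 h2 => Equiv.swap_apply_of_ne_of_ne h1 h2
  set X := frame φ m lt with hX
  set X' := frame (φ ∘ σ) (m ∘ σ) lt with hX'
  by_cases hk'k' : R k' = .solid k'
  · rw [graphW_of_not_valid fun hv : Valid X R => hv.solid_ne _ _ hk'k' rfl,
      graphW_of_not_valid fun hv : Valid X' R => hv.solid_ne _ _ hk'k' rfl]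
    exact ⟨rfl, Or.inl rfl⟩
  have hloop : ∀ a, a ≠ k → (R a = .solid k ∨ R a = .solid k') →
      a ≠ k' ∧ TransGen (Step R) a a := by
    intro a hak ha
    have hak' : a ≠ k' := by grind
    exact ⟨hak', by_contra fun hl => by simpa [hD] using mem_flippable.2 ⟨hak, hak', ha, hl⟩⟩
  have hreach : ∀ a, a ≠ k → (R a = .solid k ∨ R a = .solid k') →
      TransGen (Step R) a k' := by
    rintro a _ (ha | ha)
    · exact (TransGen.single (show Step R a k from ha)).tail hR
    · exact .single ha
  have hkl : ∀ a, a ≠ k → R a = .solid k → TransGen (Step R) k k := fun a hak ha => by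
    have h1 := (hloop a hak (.inl ha)).2
    obtain h2 := reach_loop h1 (hreach a hak (.inl ha)).to_reflTransGen
    exact TransGen.head' hR (h2.trans (.single ha))
  have huniq : ∀ a b, a ≠ k → b ≠ k → (R a = .solid k ∨ R a = .solid k') →
      (R b = .solid k ∨ R b = .solid k') → a = b := by
    intro a b ha hb hak hbk
    rcases hak with h1 | h1 <;> rcases hbk with h2 | h2
    · exact loop_step_injective (hloop a ha (.inl h1)).2 (hloop b hb (.inl h2)).2 h1 h2
    · exact absurd (loop_step_injective (hloop b hb (.inr h2)).2 (hkl a ha h1) h2 hR) hb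
    · exact absurd (loop_step_injective (hloop a ha (.inr h1)).2 (hkl b hb h2) h1 hR) ha
    · exact loop_step_injective (hloop a ha (.inr h1)).2 (hloop b hb (.inr h2)).2 h1 h2
  obtain ⟨a, hak, ha⟩ : ∃ a, a ≠ k ∧ (R a = .solid k ∨ R a = .solid k') := by grind [NoIncoming]
  have hak' := (hloop a hak ha).1
  refine ⟨graphW_exchange (X := X) (X' := X') ξ κ μ hne hR rfl ?_ ?_ ?_ ?_ ?_ ?_ ?_ ?_, Or.inr ?_⟩
  · intro i
    rcases eq_or_ne i k with rfl | h1
    · simp [hX, hX', frame, hσk, hk, hk', hc, hc']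
    rcases eq_or_ne i k' with rfl | h2
    · simp [hX, hX', frame, hσk', hk, hk', hc, hc']
    · simp [hX, hX', frame, hoff i h1 h2]
  · simp [hX, frame, hk, hc]
  · simp [hX, frame, hk', hc']
  · intro i h1 h2; simp [hX, hX', frame, hoff i h1 h2]
  · simp [hX, hX', frame, hσk, hσk', add_comm]
  · intro i h1 h2; simp [hX, hX', frame, hoff i h1 h2]
  · simp [hX, hX', frame, hσk, hσk', add_comm]
  · rw [prod_split hak.symm, prod_split hak.symm (lineW X' R)]
    have e : ∀ i ∈ (univ.erase k).erase a, lineW X R i = lineW X' R i := by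
      intro i hi
      obtain ⟨h1, h2⟩ := mem_erase_erase hi
      unfold lineW
      cases hRi : R i with
      | solid j =>
        have hjk : j ≠ k := by rintro rfl; exact h2 (huniq i a h1 hak (.inl hRi) ha)
        have hjk' : j ≠ k' := by rintro rfl; exact h2 (huniq i a h1 hak (.inr hRi) ha)
        simp only [hX, hX', frame, comp, hoff j hjk hjk']
      | _ => rfl
    rw [prod_congr rfl e, ← mul_assoc, ← mul_assoc]
    congr 1
    have hth : ¬ X.th k := by simp [hX, frame, hk, hc]
    have hth' : ¬ X.th k' := by simp [hX, frame, hk', hc']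
    have hσth : ¬ X'.th k := by simp [hX', frame, hσk, hk', hc']
    have hσth' : ¬ X'.th k' := by simp [hX', frame, hσk', hk, hc]
    have hq : X.q k = c.sgn := by simp [hX, frame, hk]
    have hq' : X.q k' = -c.sgn := by simp [hX, frame, hk', hs]
    have hσq : X'.q k = -c.sgn := by simp [hX', frame, hσk, hk', hs]
    have hσq' : X'.q k' = c.sgn := by simp [hX', frame, hσk', hk]
    have hlt : X'.lt = X.lt := rfl
    rcases ha with ha | ha
    · simp only [lineW, hR, ha, hth, hth', hσth, hσth', if_false, hq, hq', hσq, hσq', hlt]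
      push_cast; ring
    · simp only [lineW, hR, ha, hth', hσth', if_false, hq', hσq', hlt]
      push_cast; ring
  · have h2 := reach_loop (hloop a hak ha).2 (hreach a hak ha).to_reflTransGen
    rcases h2.cases_head with h | ⟨j, hj, _⟩
    · exact absurd h.symm hak'
    · exact ⟨j, hj⟩

/-- The vertex `k` is removed, and `k'` takes over its mode and charge. -/
theorem contracts_frame {φ' : Fin n → Option Current} {m m' : Fin n → ℤ}
    (hne : k ≠ k') (hφ : ∀ i, i ≠ k → i ≠ k' → φ' i = φ i)
    (hm : ∀ i, i ≠ k → i ≠ k' → m' i = m i) (hk : φ' k = none) (hmk : m' k = 0)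
    (hmk' : m' k' = m k + m k') (hq : (φ' k').elim 0 sgn = (φ k).elim 0 sgn + (φ k').elim 0 sgn)
    (ht : φ k ≠ some three) (ht' : φ k' ≠ some three) (hs : R k = .solid k')
    (hs' : R k' ≠ .solid k) (hin : ∀ i, R i ≠ .solid k)
    (hf : φ' k' = some three → R k' = .diff → ∃ i, i ≠ k ∧ R i = .solid k') :
    Contracts (frame φ m lt) (frame φ' m' lt) R (update R k .zeroMode) k k' := by
  refine ⟨hne, rfl, ?_, ?_, hm, ?_, hmk, ?_, hq, hmk', ?_, ?_, fun i _ => hin i, ?_, ?_, ?_, ?_⟩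
  · intro i h1 h2; simp [frame, hφ i h1 h2]
  · intro i h1 h2; simp [frame, hφ i h1 h2]
  · simp [frame, hk]
  · simp [frame, hk]
  · intro i h1 _; rw [update_of_ne h1]
  · simp
  · exact Or.inl ⟨hs, hs', by rw [update_of_ne hne.symm]⟩
  · exact fun h => ht h.1
  · exact fun h => ht' h.1
  · rintro ⟨h1, h2, h3⟩
    rw [update_of_ne hne.symm] at h2
    obtain ⟨i, hi, hi'⟩ := hf h1 h2
    exact h3 i (by rw [update_of_ne hi, hi'])

end Pair

/-- The currents after `k` has been removed and `k'` replaced. -/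
def fuseC (k k' : Fin n) (c : Option Current) (φ : Fin n → Option Current) :
    Fin n → Option Current :=
  update (update φ k none) k' c

/-- The modes after `k` has been merged with `k'`. -/
def fuseM (k k' : Fin n) (m : Fin n → ℤ) : Fin n → ℤ :=
  update (update m k 0) k' (m k + m k')

section Pair

variable {ξ : ℕ → ℝ} {κ p : ℝ} {μ : ℕ → ℝ} {lt : Fin n → Fin n → Prop} {k k' : Fin n}
  {φ : Fin n → Option Current}

theorem fuseC_left (hne : k ≠ k') (c : Option Current) : fuseC k k' c φ k = none := by
  simp [fuseC, hne]

theorem fuseC_right (c : Option Current) : fuseC k k' c φ k' = c := by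
  simp [fuseC]

theorem fuseC_of_ne {i : Fin n} (h : i ≠ k) (h' : i ≠ k') (c : Option Current) :
    fuseC k k' c φ i = φ i := by simp [fuseC, h, h']

theorem fuseM_left (hne : k ≠ k') (m : Fin n → ℤ) : fuseM k k' m k = 0 := by
  simp [fuseM, hne]

theorem fuseM_right (m : Fin n → ℤ) : fuseM k k' m k' = m k + m k' := by
  simp [fuseM]

theorem fuseM_of_ne {i : Fin n} (h : i ≠ k) (h' : i ≠ k') (m : Fin n → ℤ) :
    fuseM k k' m i = m i := by simp [fuseM, h, h']

/-- Vertices of charges `±1`, of which the left one is a leaf joined to the right one, are merged. -/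
theorem contracts_fuse {m : Fin n → ℤ} (hne : k ≠ k') {c c' : Current}
    (hc : c ≠ three) (hc' : c' ≠ three) (hk : φ k = some c) (hk' : φ k' = some c')
    (hs : c'.sgn = -c.sgn) {c0 : Option Current} (hc0 : c0.elim 0 sgn = 0)
    (hR : R k = .solid k') (hin : NoIncoming k k' R) (hf : c0 = some three → R k' ≠ .diff) :
    Contracts (frame φ m lt) (frame (fuseC k k' c0 φ) (fuseM k k' m) lt) R
      (update R k .zeroMode) k k' := by
  refine contracts_frame hne (fun i h h' => fuseC_of_ne h h' _) (fun i h h' => fuseM_of_ne h h' _)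
    (fuseC_left hne _) (fuseM_left hne _) (fuseM_right _) ?_ ?_ ?_ hR ?_ ?_ ?_
  · rw [fuseC_right, hc0, hk, hk']; simp [hs]
  · simp [hk, hc]
  · simp [hk', hc']
  · exact (hin k' hne.symm).1
  · grind [NoIncoming]
  · intro h1 h2
    rw [fuseC_right] at h1
    exact absurd h2 (hf h1)

/-- The value of a graph in which the leaf `k` is joined to `k'`, and no other lines end at them. -/
theorem graphW_fuse (ξ : ℕ → ℝ) (κ : ℝ) (μ : ℕ → ℝ) (m : Fin n → ℤ) (hne : k ≠ k') {c c' : Current}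
    (hc : c ≠ three) (hc' : c' ≠ three) (hk : φ k = some c) (hk' : φ k' = some c')
    (hs : c'.sgn = -c.sgn) {c0 : Option Current} (hc0 : c0.elim 0 sgn = 0)
    (hR : R k = .solid k') (hin : NoIncoming k k' R)
    (hf : c0 = some three → R k' ≠ .diff) (hlt : lt k k') : graphW ξ κ μ (frame φ m lt) R = c.sgn *
      graphW ξ κ μ (frame (fuseC k k' c0 φ) (fuseM k k' m) lt) (update R k .zeroMode) := by
  have h := contracts_fuse (lt := lt) (m := m) hne hc hc' hk hk' hs hc0 hR hin hf
  rw [graphW_leaf ξ κ μ h hR ?_ rfl (by simp [frame, hk', hc']) (Or.inr ⟨?_, ?_⟩)]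
  · simp [frame, hlt, hk', hs]
  · grind [NoIncoming]
  · grind [NoIncoming]
  · intro h
    simp only [frame, fuseC_right] at h
    exact hf h

/-- Lines into the merged vertex. -/
theorem graphW_three_eq_zero (ξ : ℕ → ℝ) (κ : ℝ) (μ : ℕ → ℝ) (m : Fin n → ℤ) (hne : k ≠ k') (hin : ¬ NoIncoming k k' R) (hR : R k' ≠ .diff) :
    graphW ξ κ μ (frame (fuseC k k' (some three) φ) (fuseM k k' m) lt) R = 0 := by
  simp only [NoIncoming, not_forall] at hin
  obtain ⟨a, _, ha⟩ := hin
  by_cases h1 : R a = .solid k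
  · exact graphW_eq_zero h1 (by simp [frame, fuseC_left hne]) (by simp [frame, fuseC_left hne])
  · have h2 : R a = .solid k' := by
      by_contra h2; exact ha ⟨h1, h2⟩
    exact graphW_of_not_valid fun hv => hR (hv.solid_th a k' h2 (by simp [frame, fuseC_right])).1

open Classical in
/-- The part of the commutator of `J⁺` and `J⁻` due to the lines between them. -/
theorem rightPart_sub (ξ : ℕ → ℝ) (κ p : ℝ) (μ : ℕ → ℝ) (hadj : Adj lt k k')
    (hk : φ k = some plus) (hk' : φ k' = some minus) (m : Fin n → ℤ) :
    2 * (rightPart ξ κ p μ lt k k' φ m -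
        rightPart ξ κ p μ lt k k' (φ ∘ Equiv.swap k k') (m ∘ Equiv.swap k k')) =
      ∑ R : Graph n, if R k = .zeroMode then if R k' = .diff then
        if NoIncoming k k' R then κ * (m k - m k' : ℤ) * (coefRest κ p φ m k k' R *
          graphW ξ κ μ (frame (fuseC k k' none φ) (fuseM k k' m) lt) R) else 0
        else I * (coefB κ p (some three) 0 (R k') * coefRest κ p φ m k k' R *
          graphW ξ κ μ (frame (fuseC k k' (some three) φ) (fuseM k k' m) lt) R) else 0 := by
  set σ := Equiv.swap k k' with hσ
  have hne := hadj.ne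
  have hσk : σ k = k' := Equiv.swap_apply_left _ _
  have hσk' : σ k' = k := Equiv.swap_apply_right _ _
  have hoff : ∀ i, i ≠ k → i ≠ k' → σ i = i := fun i h1 h2 => Equiv.swap_apply_of_ne_of_ne h1 h2
  have hp : plus ≠ three := by simp
  have hm : minus ≠ three := by simp
  have hkσ : (φ ∘ σ) k = some minus := by simp [hσk, hk']
  have hkσ' : (φ ∘ σ) k' = some plus := by simp [hσk', hk]
  have hfuse : ∀ c0, fuseC k k' c0 (φ ∘ σ) = fuseC k k' c0 φ := by
    intro c0; funext i
    simp only [fuseC, update_apply, comp]; grind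
  have hfuse' : fuseM k k' (m ∘ σ) = fuseM k k' m := by
    funext i
    simp only [fuseM, update_apply, comp]; grind
  rw [rightPart_eq_unflippable ξ κ p μ hadj hp hm hk hk' (by simp [sgn]) m,
    rightPart_eq_unflippable ξ κ p μ hadj hm hp hkσ hkσ' (by simp [sgn]) (m ∘ σ),
    ← sum_sub_distrib, mul_sum]
  simp only [ite_and]
  have e0 : ∀ R : Graph n, 2 * ((if R k = .solid k' then if R k' ≠ .solid k then
      if flippable k k' R = ∅ then coefProd κ p φ m R * graphW ξ κ μ (frame φ m lt) R else 0
      else 0 else 0) - (if R k = .solid k' then if R k' ≠ .solid k then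
      if flippable k k' R = ∅ then coefProd κ p (φ ∘ σ) (m ∘ σ) R *
        graphW ξ κ μ (frame (φ ∘ σ) (m ∘ σ) lt) R else 0 else 0 else 0)) =
      if R k = .solid k' then if R k' ≠ .solid k then if flippable k k' R = ∅ then
        2 * (coefProd κ p φ m R * graphW ξ κ μ (frame φ m lt) R - coefProd κ p (φ ∘ σ) (m ∘ σ) R *
        graphW ξ κ μ (frame (φ ∘ σ) (m ∘ σ) lt) R) else 0 else 0 else 0 := by
    intro R; split_ifs <;> simp
  rw [sum_congr rfl fun R _ => e0 R, sum_role_eq k (.solid k') .zeroMode]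
  refine sum_congr rfl fun R0 _ => ?_
  by_cases h0 : R0 k = .zeroMode
  swap
  · simp [h0]
  simp only [h0, if_true]
  set R := update R0 k (.solid k') with hR
  have hRk : R k = .solid k' := by simp [hR]
  have hRi : ∀ i, i ≠ k → R i = R0 i := fun i h => by simp [hR, h]
  have hR0 : update R k .zeroMode = R0 := by
    rw [hR, update_idem, ← h0, update_eq_self]
  have hN : NoIncoming k k' R ↔ NoIncoming k k' R0 := by grind [NoIncoming]
  have hrest : coefRest κ p φ m k k' R = coefRest κ p φ m k k' R0 :=
    coefRest_congr κ p fun i h _ => ⟨rfl, rfl, hRi i h⟩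
  have hrestσ : coefRest κ p (φ ∘ σ) (m ∘ σ) k k' R = coefRest κ p φ m k k' R0 :=
    coefRest_congr κ p fun i h h' => ⟨by simp [hoff i h h'], by simp [hoff i h h'], hRi i h⟩
  have hcoef : coefProd κ p φ m R = I / 2 *
      (coefB κ p (some minus) (m k') (R0 k') * coefRest κ p φ m k k' R0) := by
    rw [coefProd_split κ p φ m hne, hk, hk', hRk, coefB_solid κ p hp, hrest, hRi k' hne.symm]
  have hcoefσ : coefProd κ p (φ ∘ σ) (m ∘ σ) R = I / 2 *
      (coefB κ p (some plus) (m k) (R0 k') * coefRest κ p φ m k k' R0) := by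
    rw [coefProd_split κ p (φ ∘ σ) (m ∘ σ) hne, hkσ, hkσ', hRk, coefB_solid κ p hm, hrestσ,
      hRi k' hne.symm]
    simp [hσk']
  by_cases hin : NoIncoming k k' R0
  · have hinR := hN.2 hin
    have h1 : R k' ≠ .solid k := (hinR k' hne.symm).1
    have h2 : flippable k k' R = ∅ := by
      rw [eq_empty_iff_forall_notMem]
      grind [mem_flippable, NoIncoming]
    simp only [h1, h2, ne_eq, not_false_eq_true, if_true, hin, hcoef, hcoefσ]
    by_cases hd : R0 k' = .diff
    · rw [graphW_fuse (c0 := none) ξ κ μ m hne hp hm hk hk' (by simp [sgn]) rfl hRk hinR (by simp)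
          hadj.lt_pair,
        graphW_fuse (c0 := none) ξ κ μ (m ∘ σ) hne hm hp hkσ hkσ' (by simp [sgn]) rfl hRk hinR
          (by simp) hadj.lt_pair, hfuse, hfuse', hR0, hd, coefB_diff κ p hp, coefB_diff κ p hm]
      simp only [if_true, sgn]
      push_cast
      linear_combination (κ * (m k' - m k) * coefRest κ p φ m k k' R0 *
        graphW ξ κ μ (frame (fuseC k k' none φ) (fuseM k k' m) lt) R0) * I_sq
    · have hd' : R k' ≠ .diff := by rw [hRi k' hne.symm]; exact hd
      simp only [hd, if_false]
      by_cases hl : (∃ j, R0 k' = .solid j) ∨ ∃ j, R0 k' = .dotted j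
      · rw [graphW_fuse (c0 := some three) ξ κ μ m hne hp hm hk hk' (by simp [sgn])
            (by simp [sgn]) hRk hinR (fun _ => hd') hadj.lt_pair,
          graphW_fuse (c0 := some three) ξ κ μ (m ∘ σ) hne hm hp hkσ hkσ' (by simp [sgn])
            (by simp [sgn]) hRk hinR (fun _ => hd') hadj.lt_pair, hfuse, hfuse', hR0]
        rcases hl with ⟨j, hj⟩ | ⟨j, hj⟩ <;> rw [hj] <;> simp [coefB, coef, sgn] <;> ring
      · rw [graphW_fuse (c0 := none) ξ κ μ m hne hp hm hk hk' (by simp [sgn]) rfl hRk hinR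
            (by simp) hadj.lt_pair,
          graphW_fuse (c0 := none) ξ κ μ (m ∘ σ) hne hm hp hkσ hkσ' (by simp [sgn]) rfl hRk hinR
            (by simp) hadj.lt_pair, hfuse, hfuse', hR0]
        cases hr : R0 k' with
        | solid j => exact absurd (Or.inl ⟨j, hr⟩) hl
        | dotted j => exact absurd (Or.inr ⟨j, hr⟩) hl
        | diff => exact absurd hr hd
        | wavy j => simp [coefB, coef, sgn]
        | zeroMode => simp [coefB, coef, sgn]
  · have hinR : ¬ NoIncoming k k' R := fun h => hin (hN.1 h)
    have e1 : (if R0 k' = .diff then if NoIncoming k k' R0 then κ * (m k - m k' : ℤ) *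
          (coefRest κ p φ m k k' R0 *
          graphW ξ κ μ (frame (fuseC k k' none φ) (fuseM k k' m) lt) R0) else 0
        else I * (coefB κ p (some three) 0 (R0 k') * coefRest κ p φ m k k' R0 *
          graphW ξ κ μ (frame (fuseC k k' (some three) φ) (fuseM k k' m) lt) R0)) = 0 := by
      by_cases hd : R0 k' = .diff
      · simp [hd, hin]
      · simp [hd, graphW_three_eq_zero ξ κ μ m hne hin hd]
    rw [e1]
    split_ifs with h1 h2
    · obtain ⟨h3, h4⟩ := graphW_exchange_loop ξ κ μ hadj hp hm hk hk' (by simp [sgn]) m hRk h1 h2 hinR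
      rw [← h3, hcoef, hcoefσ]
      rcases h4 with h4 | ⟨j, hj⟩
      · rw [h4]; ring
      · rw [← hRi k' hne.symm, hj, coefB_solid κ p hp, coefB_solid κ p hm]; ring
    · rfl
    · rfl

end Pair

/-! ### The commutator of `J⁺` and `J⁻`: wavy lines -/

/-- With opposite charges at two connected vertices, only the sum of their modes matters, and it
vanishes. -/
theorem Lam_Gfun_fuse {R : Graph n} {k k' : Fin n} (hne : k ≠ k')
    (hR : Conn R k k') {Q : Pts n → ℤ} (hQ : Q (.inl k) + Q (.inl k') = 0) (m : Fin n → ℤ)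
    (g : Fin n → ℤ → ℤ → ℂ) (z : ℂ) :
    Lam ξ (fun _ => 1) Q (fun L => (z + (L (.inl k) + L (.inl k') : ℤ)) * Gfun R m g L) =
      z * Lam ξ (fun _ => 1) Q (Gfun R m g) := by
  set c : Pts n → Pts n := moveTo (.inl k) (.inl k') with hc
  have hne' : (Sum.inl k : Pts n) ≠ .inl k' := by simpa using hne
  let f : (Pts n → ℤ) → Pts n → ℤ := fun L =>
    update (update L (.inl k') (L (.inl k) + L (.inl k'))) (.inl k) 0
  have hpush : ∀ L, push c L = f L := by
    intro L
    refine push_moveTo hne' ?_ ?_ ?_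
    · intro i h h'; simp [f, h, h']
    · simp [f]
    · simp [f, hne.symm]
  have hG : ∀ L, Gfun R m g (push c L) = Gfun R m g L := by
    intro L
    have hx : ∀ E : Fin n → Fin n → Prop, (∀ i, E k i ↔ E k' i) →
        ∀ i, blockSum E (total m (push c L)) i = blockSum E (total m L) i := by
      intro E hE i
      refine blockSum_exchange hne hE ?_ ?_ i
      · intro i h h'; simp [total, hpush, f, h, h']
      · simp only [total, hpush, f]; simp [hne.symm]; ring
    have h1 := hx (Conn R) fun i => ⟨fun h => hR.symm.trans h, fun h => hR.trans h⟩
    have h2 := hx (Joined R) fun i => ⟨fun h => hR.joined.symm.trans h, fun h => hR.joined.trans h⟩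
    have h3 : ∀ i, push c L (.inr i) = L (.inr i) := by intro i; simp [hpush, f]
    simp only [Gfun, h1, h2, h3]
  have h1 : ∀ F : (Pts n → ℤ) → ℂ, Lam ξ (fun _ => 1) Q (fun L => F (push c L)) =
      Lam ξ (fun _ => 1) (push c Q) F := fun F => Lam_push ξ c (fun _ => 1) Q F
  have h2 : (fun L : Pts n → ℤ => (z + (L (.inl k) + L (.inl k') : ℤ)) * Gfun R m g L) =
      fun L => (fun K : Pts n → ℤ => (z + (K (.inl k') : ℤ)) * Gfun R m g K) (push c L) := by
    funext L
    simp only [hG]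
    rw [hpush]
    simp [f, hne.symm]
  have h3 : Gfun R m g = fun L => Gfun R m g (push c L) := funext fun L => (hG L).symm
  rw [h2, h1 fun K => (z + (K (.inl k') : ℤ)) * Gfun R m g K, h3, h1, ← Lam_smul]
  refine Lam_congr ξ _ _ fun L hL => ?_
  have : L (.inl k') = 0 := hL _ (by rw [hpush]; simp [f, hne.symm, hQ])
  simp only [this, hG, Int.cast_zero, add_zero]

theorem blockSum_push_eq_zero_iff {R : Graph n} {R' : Graph n'} {c : Fin n → Fin n'}
    (hJ : ∀ i j, Joined R i j ↔ Joined R' (c i) (c j)) (f : Fin n → ℤ) :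
    (∀ i, blockSum (Joined R') (push c f) i = 0) ↔ ∀ i, blockSum (Joined R) f i = 0 := by
  classical
  have e : ∀ i, blockSum (Joined R') (push c f) (c i) = blockSum (Joined R) f i := by
    intro i
    rw [blockSum_push]
    simp only [blockSum, ← hJ]
  constructor
  · intro h i; rw [← e, h]
  · intro h i
    by_cases hi : ∃ x, Joined R' (c x) i
    · obtain ⟨x, hx⟩ := hi
      rw [← blockSum_joined_congr _ hx, e, h]
    · push Not at hi
      rw [blockSum_push]
      exact sum_eq_zero fun x hx => absurd (mem_filter.1 hx).2 (hi x)

section Pair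

variable {k k' a : Fin n} {R RA : Graph n}

open Classical in
theorem blockSum_flip_left (hk : ∀ j, R k ≠ .solid j) (hk' : ∀ j, R k' ≠ .solid j) (hne : k ≠ k')
    (hak : a ≠ k) (hak' : a ≠ k') (ha : R a = .solid k) (f : Fin n → ℤ) :
    blockSum (Conn R) f k = blockSum (Conn (flip k k' a R)) f k +
      ∑ x with ReflTransGen (Step R) x a, f x := by
  set R' := flip k k' a R with hR'
  have hroot : ∀ j, R' k ≠ .solid j := by rw [hR', flip_of_ne _ hak.symm]; exact hk
  have hroot' : ∀ j, R' k' ≠ .solid j := by rw [hR', flip_of_ne _ hak'.symm]; exact hk'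
  have ha' : R' a = .solid k' := flip_left ha
  have hiff : ∀ x, Conn R x k ↔ Conn R' x k ∨ ReflTransGen (Step R) x a := by
    intro x
    rw [conn_iff_reach hk, conn_iff_reach hroot]
    constructor
    · intro h
      induction h using ReflTransGen.head_induction_on with
      | refl => exact Or.inl .refl
      | head hxy hyk ih =>
        rename_i x y
        rcases eq_or_ne x a with rfl | hxa
        · exact Or.inr .refl
        · refine ih.imp (.head (?_ : R' x = .solid y)) (.head hxy)
          rwa [hR', flip_of_ne _ hxa]
    · rintro (h | h)
      · induction h using ReflTransGen.head_induction_on with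
        | refl => exact .refl
        | head hxy hyk ih =>
          rename_i x y
          rcases eq_or_ne x a with rfl | hxa
          · exact .single ha
          · exact .head (by rwa [Step, ← flip_of_ne (k := k) (k' := k') R hxa]) ih
      · exact h.tail ha
  have hdis : ∀ x, Conn R' x k → ¬ ReflTransGen (Step R) x a := by
    intro x h1 h2
    have h3 := (reach_update (R' := R') (fun i hi => flip_of_ne _ hi) h2).tail
      (show Step R' a k' from ha')
    exact hne (conn_roots_eq hroot hroot' (h1.symm.trans ((conn_iff_reach hroot' x).2 h3)))
  simp only [blockSum, hiff, filter_or]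
  rw [sum_union]
  exact disjoint_filter.2 fun x _ h1 => hdis x h1

/-- Moving the line from `a` changes the momentum at `k` by that of the tree with root `a`. -/
theorem blockSum_flip (hk : ∀ j, R k ≠ .solid j) (hk' : ∀ j, R k' ≠ .solid j) (hne : k ≠ k')
    (hak : a ≠ k) (hak' : a ≠ k') (ha : R a = .solid k ∨ R a = .solid k') (f : Fin n → ℤ) :
    blockSum (Conn (flip k k' a R)) f k = blockSum (Conn R) f k +
      (if R a = .solid k then -1 else 1) *
        blockSum (fun x y => ReflTransGen (Step R) x y) f a := by
  classical
  rcases ha with ha | ha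
  · rw [blockSum_flip_left hk hk' hne hak hak' ha f, if_pos ha]
    simp [blockSum]
  · have h1 := blockSum_flip_left (R := flip k k' a R) (by rwa [flip_of_ne _ hak.symm])
      (by rwa [flip_of_ne _ hak'.symm]) hne hak hak' (flip_right ha) f
    rw [flip_flip] at h1
    have h2 : R a ≠ .solid k := by rw [ha]; intro h; injection h with h; exact hne h.symm
    have h3 : ∀ x, ReflTransGen (Step (flip k k' a R)) x a ↔
        ReflTransGen (Step R) x a := fun x =>
      ⟨reach_update fun i hi => (flip_of_ne _ hi).symm, reach_update fun i hi => flip_of_ne _ hi⟩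
    rw [h1, if_neg h2, one_mul]
    simp only [h3]
    simp [blockSum]

namespace WavyPair

variable {X : Frame n}

theorem root (h : WavyPair X R RA k k') (j : Fin n) : R k ≠ .solid j := by simp [h.wavy]

theorem root' (h : WavyPair X R RA k k') (j : Fin n) : R k' ≠ .solid j := by simp [h.wavy']

theorem flip (h : WavyPair X R RA k k') (hak : a ≠ k) (hak' : a ≠ k') :
    WavyPair X (flip k k' a R) (flip k k' a RA) k k' := by
  have ⟨_, _, _, _, _, _, _, _⟩ := h
  have h9 : AffineSl2.flip k k' a RA a = AffineSl2.flip k k' a R a := by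
    simp [AffineSl2.flip, h.role a hak hak']
  constructor <;> grind [flip_of_ne]

theorem not_loop (h : WavyPair X R RA k k') (ha : R a = .solid k ∨ R a = .solid k') :
    ¬ TransGen (Step RA) a a := by
  rw [transGen_self_iff_loopOf, h.loopOf_eq, ← transGen_self_iff_loopOf]
  rcases ha with ha | ha
  · exact not_loop_of_step_root ha h.root
  · exact not_loop_of_step_root ha h.root'

theorem graphP_eq (h : WavyPair X R RA k k') (ξ : ℕ → ℝ) (κ : ℝ) (μ : ℕ → ℝ) (hlt : X.lt k k')
    (hq : X.q k' = -1) (f : ℤ → ℂ) : graphP ξ κ μ k k' X R f =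
      graphH ξ κ μ X RA fun L => f (blockSum (Conn R) (total X.m L) k) := by
  have h1 : loopPart μ RA = loopPart μ R := by rw [loopPart, loopPart, h.loopOf_eq]
  have h2 : Gfun R X.m (gP ξ κ X R k k' f) = fun L =>
      f (blockSum (Conn R) (total X.m L) k) * Gfun RA X.m (gW ξ κ X RA) L :=
    funext fun L => h.Gfun_eq ξ κ f L
  by_cases hv : Valid X R
  · simp only [graphP, graphH, hv, h.valid_iff.1 hv, if_true, h1, h2, h.chg_eq, h.lines_eq hlt, hq]
    simp
  · have hv' : ¬ Valid X RA := fun h' => hv (h.valid_iff.2 h')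
    simp [graphP, graphH, hv, hv']

theorem summable (h : WavyPair X R RA k k') {ξ : ℕ → ℝ} (hξ : PosWeights ξ)
    (hsum : Decay ξ) (κ : ℝ) (hv : Valid X RA) :
    Summable (lamTerm ξ (fun _ => 1) (chg X RA) fun L =>
      ((blockSum (Conn R) (total X.m L) k : ℤ) : ℂ) * Gfun RA X.m (gW ξ κ X RA) L) := by
  have h1 := summable_Gfun hξ hsum (h.valid_iff.2 hv)
    (tame_gP ξ κ X R h.ne h.wavy h.wavy' (fun P => (P : ℂ))
      ⟨1, fun P => by rw [norm_intCast]; linarith⟩)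
  rw [h.chg_eq]
  exact h1.congr fun t => by rw [funext fun L => h.Gfun_eq ξ κ (fun P => (P : ℂ)) L]

end WavyPair

/-- The contributions of a wavy line and two lines into its ends cancel when these are moved. -/
theorem graphP_flip_flip {ξ : ℕ → ℝ} (hξ : PosWeights ξ)
    (hsum : Decay ξ) (κ : ℝ) (μ : ℕ → ℝ) {X : Frame n} {b : Fin n}
    (h : WavyPair X R RA k k') (hq : X.q k = 1) (hq' : X.q k' = -1) (hlt : X.lt k k')
    (hleft : ∀ a, a ≠ k → a ≠ k' → (X.lt a k ↔ X.lt a k'))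
    (hak : a ≠ k) (hak' : a ≠ k') (ha : R a = .solid k ∨ R a = .solid k')
    (hbk : b ≠ k) (hbk' : b ≠ k') (hb : R b = .solid k ∨ R b = .solid k') (hab : a ≠ b) :
    graphP ξ κ μ k k' X R (fun P => P) + graphP ξ κ μ k k' X (flip k k' a R) (fun P => P) +
      graphP ξ κ μ k k' X (flip k k' b R) (fun P => P) +
      graphP ξ κ μ k k' X (flip k k' a (flip k k' b R)) (fun P => P) = 0 := by
  have hqq : X.q k' = -X.q k := by rw [hq, hq']
  have hA : ∀ {a : Fin n}, a ≠ k → a ≠ k' → RA a = R a := fun h1 h2 => h.role _ h1 h2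
  have ha' : RA a = .solid k ∨ RA a = .solid k' := by rwa [hA hak hak']
  have hb' : RA b = .solid k ∨ RA b = .solid k' := by rwa [hA hbk hbk']
  have hRb : flip k k' b R a = R a := flip_of_ne _ hab
  have hRb' : flip k k' b RA a = RA a := flip_of_ne _ hab
  have h_a := h.flip hak hak'
  have h_b := h.flip hbk hbk'
  have h_ab := h_b.flip hak hak'
  have fa : ∀ w, graphH ξ κ μ X (flip k k' a RA) w = -graphH ξ κ μ X RA w :=
    graphH_flip ξ κ μ h.solid hak hak' ha' (h.not_loop ha) h.th h.th' hqq (hleft a hak hak')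
  have fb : ∀ w, graphH ξ κ μ X (flip k k' b RA) w = -graphH ξ κ μ X RA w :=
    graphH_flip ξ κ μ h.solid hbk hbk' hb' (h.not_loop hb) h.th h.th' hqq (hleft b hbk hbk')
  have fab : ∀ w, graphH ξ κ μ X (flip k k' a (flip k k' b RA)) w = graphH ξ κ μ X RA w := by
    intro w
    rw [graphH_flip ξ κ μ h_b.solid hak hak' (by rwa [hRb']) (h_b.not_loop (by rwa [hRb]))
      h.th h.th' hqq (hleft a hak hak'), fb, neg_neg]
  rw [h.graphP_eq ξ κ μ hlt hq', h_a.graphP_eq ξ κ μ hlt hq', h_b.graphP_eq ξ κ μ hlt hq',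
    h_ab.graphP_eq ξ κ μ hlt hq', fa, fb, fab]
  by_cases hv : Valid X RA
  swap
  · simp [graphH, hv]
  have hBC : ∀ {R : Graph n} {a : Fin n}, R k = .solid k' → a ≠ k →
      (R a = .solid k ∨ R a = .solid k') → Conn (flip k k' a R) = Conn R :=
    fun hk hak ha => flip_conn hk hak ha
  have va : Valid X (flip k k' a RA) :=
    (flip_valid_iff h.th h.th' hak hak' ha' (fun i j _ => by rw [hBC h.solid hak ha'])
      (fun i j _ _ => by rw [hBC h.solid hak ha'])).2 hv
  have vb : Valid X (flip k k' b RA) :=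
    (flip_valid_iff h.th h.th' hbk hbk' hb' (fun i j _ => by rw [hBC h.solid hbk hb'])
      (fun i j _ _ => by rw [hBC h.solid hbk hb'])).2 hv
  have hab' : flip k k' b RA a = .solid k ∨ flip k k' b RA a = .solid k' := by rwa [hRb']
  have vab : Valid X (flip k k' a (flip k k' b RA)) :=
    (flip_valid_iff h.th h.th' hak hak' hab' (fun i j _ => by rw [hBC h_b.solid hak hab'])
      (fun i j _ _ => by rw [hBC h_b.solid hak hab'])).2 vb
  have s0 := h.summable hξ hsum κ hv
  have sa := h_a.summable hξ hsum κ va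
  have sb := h_b.summable hξ hsum κ vb
  have sab := h_ab.summable hξ hsum κ vab
  rw [flip_chg h.th h.th' ha', flip_Gfun ξ κ h.solid hak ha' h.th h.th'] at sa
  rw [flip_chg h.th h.th' hb', flip_Gfun ξ κ h.solid hbk hb' h.th h.th'] at sb
  rw [flip_chg h.th h.th' hab', flip_Gfun ξ κ h_b.solid hak hab' h.th h.th',
    flip_chg h.th h.th' hb', flip_Gfun ξ κ h.solid hbk hb' h.th h.th'] at sab
  have key : ∀ f : Fin n → ℤ, blockSum (Conn R) f k +
      blockSum (Conn (flip k k' a (flip k k' b R))) f k =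
      blockSum (Conn (flip k k' a R)) f k + blockSum (Conn (flip k k' b R)) f k := by
    intro f
    rw [blockSum_flip (R := flip k k' b R) h_b.root h_b.root' h.ne hak hak' (by rwa [hRb]),
      blockSum_flip h.root h.root' h.ne hak hak' ha, hRb]
    have : ∀ x, ReflTransGen (Step (flip k k' b R)) x a ↔
        ReflTransGen (Step R) x a := by
      intro x
      refine (reach_congr (fun y hy => ?_) x).symm
      have hyb : y = b := by grind [flip_of_ne]
      rw [hyb]
      have hno : ∀ R : Graph n, (∀ j, R k ≠ .solid j) → (∀ j, R k' ≠ .solid j) →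
          (R b = .solid k ∨ R b = .solid k') → ¬ ReflTransGen (Step R) b a := by
        intro R hk hk' hb hba
        rcases hb with hb | hb <;>
          rcases (reach_step hb hba hab.symm).cases_head with e | ⟨j, hj, _⟩ <;> grind [Step]
      exact ⟨hno R h.root h.root' hb,
        hno _ h_b.root h_b.root' (hb.elim (fun h => .inr (flip_left h)) fun h => .inl (flip_right h))⟩
    have e : blockSum (fun x y => ReflTransGen (Step (flip k k' b R)) x y) f a =
        blockSum (fun x y => ReflTransGen (Step R) x y) f a := by
      unfold blockSum
      congr 1
      ext x
      simp [this x]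
    rw [e]; ring
  simp only [graphH, hv, if_true]
  have e := Lam_add ξ _ _ _ _ s0 sab
  have e' := Lam_add ξ _ _ _ _ sa sb
  have e2 : (fun L => ((blockSum (Conn R) (total X.m L) k : ℤ) : ℂ) * Gfun RA X.m (gW ξ κ X RA) L +
      ((blockSum (Conn (flip k k' a (flip k k' b R))) (total X.m L) k : ℤ) : ℂ) *
        Gfun RA X.m (gW ξ κ X RA) L) =
      fun L => ((blockSum (Conn (flip k k' a R)) (total X.m L) k : ℤ) : ℂ) *
        Gfun RA X.m (gW ξ κ X RA) L +
      ((blockSum (Conn (flip k k' b R)) (total X.m L) k : ℤ) : ℂ) *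
        Gfun RA X.m (gW ξ κ X RA) L := by
    funext L
    have := congrArg (fun z : ℤ => (z : ℂ)) (key (total X.m L))
    push_cast at this
    linear_combination Gfun RA X.m (gW ξ κ X RA) L * this
  rw [e2, e'] at e
  linear_combination (-(∏ i, lineW X RA i) * loopPart μ RA) * e

end Pair

theorem Lam_eq_zero {ι : Type} [Fintype ι] (ρ : ι → ℝ) (q : ι → ℤ)
    {F : (ι → ℤ) → ℂ} (h : ∀ L, (∀ a, q a = 0 → L a = 0) → F L = 0) : Lam ξ ρ q F = 0 := by
  have h1 : Lam ξ ρ q F = Lam ξ ρ q fun L => 0 * F L :=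
    Lam_congr ξ ρ q fun L hL => by rw [h L hL, zero_mul]
  rw [h1, Lam_smul, zero_mul]

theorem blockSum_conn_isolated {R : Graph n} {k : Fin n} (f : Fin n → ℤ)
    (h1 : ∀ j, R k ≠ .solid j) (h2 : ∀ x, R x ≠ .solid k) : blockSum (Conn R) f k = f k := by
  unfold blockSum
  rw [sum_filter]
  refine (sum_eq_single k ?_ (by simp)).trans (if_pos (Conn.refl R k))
  intro x _ hx
  refine if_neg fun h' => ?_
  rcases ((conn_iff_reach h1 x).1 h').cases_tail with e | ⟨y, _, hy⟩
  · exact hx e.symm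
  · exact h2 y hy

/-- A vertex without lines and charge has mode zero. -/
theorem graphW_isolated_eq_zero
    {R : Graph n} {k : Fin n} (hth : ¬ X.th k) (hq : X.q k = 0) (hk : R k = .zeroMode)
    (hin : ∀ i, R i ≠ .solid k) (hm : X.m k ≠ 0) : graphW ξ κ μ X R = 0 := by
  classical
  by_cases hv : Valid X R
  swap
  · exact graphW_of_not_valid hv
  have hl : ∀ x y, Link R x y → x ≠ k ∧ y ≠ k := by
    have ⟨_, _, h1, h2, _⟩ := hv
    grind [Link]
  have hJ : ∀ x y, Joined R x y → (x = k ↔ y = k) := by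
    intro x y h
    induction h with
    | rel x y h => simp [hl _ _ h]
    | refl x => exact Iff.rfl
    | symm x y _ ih => exact ih.symm
    | trans x y z _ _ ih1 ih2 => exact ih1.trans ih2
  have hg : gam ξ κ X R = 0 := by
    refine Lam_eq_zero ξ _ _ fun L hL => ?_
    unfold Gfun
    rw [if_neg]
    intro h
    have h1 := h k
    have h2 : blockSum (Joined R) (total X.m L) k = total X.m L k := by
      unfold blockSum
      rw [sum_filter]
      refine (sum_eq_single k ?_ (by simp)).trans (if_pos (Joined.refl R k))
      intro x _ hx
      exact if_neg fun h' => hx ((hJ x k h').2 rfl)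
    have hF : ¬ Free X R k := fun h => hth h.1
    rw [h2, total, hL (.inl k) (by simp [chg, hF, hq]), hL (.inr k) (by simp [chg, hF])] at h1
    exact hm (by omega)
  simp [graphW, hg]

/-- At a vertex without charge, terminal and empty vertices have the same value. -/
theorem graphW_update_diff {R R' : Graph n} {k : Fin n} (hth : ¬ X.th k) (hk : R k = .zeroMode)
    (hk' : R' k = .diff) (h : ∀ i, i ≠ k → R' i = R i) : graphW ξ κ μ X R' = graphW ξ κ μ X R := by
  classical
  have hs : ∀ r : Role n, r ≠ .zeroMode → r ≠ .diff → ∀ i, R' i = r ↔ R i = r := by grind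
  have hsol := fun i j => hs (.solid j) (by simp) (by simp) i
  have hdot := fun i j => hs (.dotted j) (by simp) (by simp) i
  have hwav := fun i j => hs (.wavy j) (by simp) (by simp) i
  have hS : Step R' = Step R := by funext i j; exact propext (hsol i j)
  have hC : Conn R' = Conn R := by simp only [Conn, hS]
  have hJ : Joined R' = Joined R := by
    have : Link R' = Link R := by
      funext i j; simp only [Link, hsol, hdot, hwav]
    simp only [Joined, this]
  have hF : ∀ i, Free X R' i ↔ Free X R i := by grind [Free]
  have hV : Valid X R' ↔ Valid X R := by
    have hB : ∀ i, blockSum (Conn R') X.q i = blockSum (Conn R) X.q i := fun i => by rw [hC]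
    constructor <;> rintro ⟨a, b, c, d, e⟩ <;> constructor <;> grind
  have hg : gam ξ κ X R' = gam ξ κ X R := by
    refine gam_congr_of_blocks ξ κ (fun i j => by rw [hC]) (fun i j => by rw [hJ]) (fun _ => rfl)
      (fun i => ?_) hF ?_
    · refine congrFun (congrArg _ ?_) i
      funext i; by_cases h : Free X R i <;> simp [chg, h, hF]
    · intro i P l
      rcases eq_or_ne i k with rfl | hi
      · have : ¬ Free X R' i := fun h => hth h.1
        simp [gW, hk, hk', this]
      · exact gW_congr ξ κ rfl (Or.inl (h i hi)) (fun _ _ => rfl) (hF i)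
  have hline : ∏ i, lineW X R' i = ∏ i, lineW X R i := by
    refine prod_congr rfl fun i _ => ?_
    rcases eq_or_ne i k with rfl | hi
    · simp [lineW, hk, hk']
    · simp [lineW, h i hi]
  have hloop : loopPart μ R' = loopPart μ R := by
    have : loopOf R' = loopOf R := by funext i; simp only [loopOf, hS]
    rw [loopPart, loopPart, this]
  by_cases hv : Valid X R
  · simp only [graphW, hv, hV.2 hv, if_true, hg, hline, hloop]
  · have hv' : ¬ Valid X R' := fun h => hv (hV.1 h)
    simp [graphW, hv, hv']

section Pair

variable {lt : Fin n → Fin n → Prop} {k k' : Fin n} {φ : Fin n → Option Current} {m : Fin n → ℤ}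
  {R RA : Graph n}

/-- A wavy line with one line into its ends: the sum over the two ends. -/
theorem graphP_single {ξ : ℕ → ℝ} (hξ : PosWeights ξ)
    (hsum : Decay ξ) (κ : ℝ) (μ : ℕ → ℝ) (hadj : Adj lt k k')
    (hk : φ k = some plus) (hk' : φ k' = some minus) (h : WavyPair (frame φ m lt) R RA k k')
    {a : Fin n} (hak : a ≠ k) (hak' : a ≠ k') (ha : R a = .solid k')
    (hu : ∀ x, R x = .solid k ∨ R x = .solid k' → x = a) :
    graphP ξ κ μ k k' (frame φ m lt) R (fun P => P) +
        graphP ξ κ μ k k' (frame φ m lt) (flip k k' a R) (fun P => P) =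
      -I * graphW ξ κ μ (frame (fuseC k k' (some three) φ) (fuseM k k' m) lt)
        (update RA k .zeroMode) := by
  classical
  set X := frame φ m lt with hX
  set X3 := frame (fuseC k k' (some three) φ) (fuseM k k' m) lt with hX3
  have hne := h.ne
  have hq : X.q k = 1 := by simp [hX, frame, hk, sgn]
  have hq' : X.q k' = -1 := by simp [hX, frame, hk', sgn]
  have hRAa : RA a = .solid k' := (h.role a hak hak').trans ha
  have ⟨_, _, _, _, _, hs, hd, hr⟩ := h
  have hnk : ∀ x, R x ≠ .solid k := by grind
  have hnkA : ∀ x, RA x ≠ .solid k := by grind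
  have huA : ∀ x, x ≠ k → RA x = .solid k' → x = a := by grind
  have hC : Contracts X X3 RA (update RA k .zeroMode) k k' := by
    refine contracts_frame hne (fun i h h' => fuseC_of_ne h h' _) (fun i h h' => fuseM_of_ne h h' _)
      (fuseC_left hne _) (fuseM_left hne _) (fuseM_right _) ?_ ?_ ?_ h.solid ?_ hnkA ?_
    · rw [fuseC_right, hk, hk']; simp [sgn]
    · simp [hk]
    · simp [hk']
    · rw [h.diff]; simp
    · exact fun _ _ => ⟨a, hak, hRAa⟩
  have hW : I * (m k + m k' : ℤ) * graphW ξ κ μ X RA =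
      1 * graphW ξ κ μ X3 (update RA k .zeroMode) := by
    refine hC.graphW_leaf_of_lines ξ κ μ h.solid hnkA rfl h.th' ?_ ?_
    · intro _ i hi hi'
      exact ⟨h.diff, fun i' h1 h2 => (huA i' h1 h2).trans (huA i hi hi').symm⟩
    · rw [prod_split hak.symm, prod_split hak.symm (lineW X3 _)]
      have e : ∀ i ∈ (univ.erase k).erase a, lineW X RA i =
          lineW X3 (update RA k .zeroMode) i := by
        intro i hi
        obtain ⟨h1, h2⟩ := mem_erase_erase hi
        unfold lineW
        rw [update_of_ne h1]
        cases hRi : RA i with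
        | solid j =>
          have hjk : j ≠ k := by rintro rfl; exact hnkA i hRi
          have hjk' : j ≠ k' := by rintro rfl; exact h2 (huA i h1 hRi)
          have e1 : X3.q j = X.q j := by simp [hX, hX3, frame, fuseC_of_ne hjk hjk']
          have e2 : X3.th j ↔ X.th j := by simp [hX, hX3, frame, fuseC_of_ne hjk hjk']
          have e3 : X3.m j = X.m j := by simp [hX, hX3, frame, fuseM_of_ne hjk hjk']
          by_cases ht : X.th j <;> simp [e1, e2, e3, ht] <;> rfl
        | _ => rfl
      rw [prod_congr rfl e]
      have e1 : lineW X RA k = 1 := by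
        simp [lineW, h.solid, h.th', hq', show X.lt k k' from hadj.lt_pair]
      have e2 : lineW X RA a = (if lt a k' then -1 else 1) * (-1) := by
        simp [lineW, hRAa, h.th', hq', show X.lt = lt from rfl]
      have e3 : lineW X3 (update RA k .zeroMode) k = 1 := by simp [lineW]
      have e4 : lineW X3 (update RA k .zeroMode) a =
          (if lt a k' then -1 else 1) * (-I * (m k + m k' : ℤ)) := by
        have h1 : X3.th k' := by simp [hX3, frame, fuseC_right]
        have h2 : X3.m k' = m k + m k' := fuseM_right m
        simp only [lineW, update_of_ne hak, hRAa, h1, if_true, h2]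
        rfl
      rw [e1, e2, e3, e4]; ring
  have hfl := h.flip hak hak'
  rw [h.graphP_eq ξ κ μ hadj.lt_pair hq', hfl.graphP_eq ξ κ μ hadj.lt_pair hq',
    graphH_flip ξ κ μ h.solid hak hak' (Or.inr hRAa) (h.not_loop (Or.inr ha)) h.th h.th'
      (by rw [hq, hq']) (hadj.left a hak hak')]
  by_cases hv : Valid X RA
  swap
  · rw [graphW_of_not_valid hv, mul_zero, one_mul] at hW
    rw [← hW]; simp [graphH, hv]
  have hBC : Conn (flip k k' a RA) = Conn RA :=
    flip_conn h.solid hak (Or.inr hRAa)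
  have hv' : Valid X (flip k k' a RA) :=
    (flip_valid_iff h.th h.th' hak hak' (Or.inr hRAa) (fun i j _ => by rw [hBC])
      (fun i j _ _ => by rw [hBC])).2 hv
  have s0 := h.summable hξ hsum κ hv
  have s1 := hfl.summable hξ hsum κ hv'
  rw [flip_chg h.th h.th' (Or.inr hRAa), flip_Gfun ξ κ h.solid hak (Or.inr hRAa) h.th h.th'] at s1
  have hx : Lam ξ (fun _ => 1) (chg X RA) (fun L =>
      ((blockSum (Conn R) (total X.m L) k : ℤ) : ℂ) * Gfun RA X.m (gW ξ κ X RA) L) -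
      Lam ξ (fun _ => 1) (chg X RA) (fun L =>
      ((blockSum (Conn (flip k k' a R)) (total X.m L) k : ℤ) : ℂ) * Gfun RA X.m (gW ξ κ X RA) L) =
      (m k + m k' : ℤ) * Lam ξ (fun _ => 1) (chg X RA) (Gfun RA X.m (gW ξ κ X RA)) := by
    rw [Lam_sub ξ _ _ _ _ s0 s1]
    have hF : ∀ i, ¬ X.th i → ¬ Free X RA i := fun i h h' => h h'.1
    rw [← Lam_Gfun_fuse ξ hne (Conn.of_solid h.solid) (Q := chg X RA)
      (by simp [chg, hF k h.th, hF k' h.th', hq, hq'])]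
    refine Lam_congr ξ _ _ fun L hL => ?_
    by_cases hG : ∀ i, blockSum (Joined RA) (total X.m L) i = 0
    swap
    · simp [Gfun, hG]
    rw [← sub_mul]
    congr 1
    have hJ : Joined (flip k k' a R) = Joined RA := by
      rw [← joined_congr_of_conn hBC (fun i j => flip_eq_solid (Or.inr hRAa) (by simp) i)
        fun i j => flip_eq_solid (Or.inr hRAa) (by simp) i]
      funext i j
      exact propext (hfl.joined_iff i j)
    have hvR := hfl.valid_iff.2 hv'
    have e1 := blockSum_joined_pair (fun i j h => (hvR.dotted i j h).2)
      (fun i j h => (hvR.wavy i j h).2) (Or.inr ⟨hfl.wavy, hfl.wavy'⟩) hne (total X.m L)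
    have e2 : blockSum (Conn (flip k k' a R)) (total X.m L) k' = total X.m L k' := by
      refine blockSum_conn_isolated _ hfl.root' fun x hx => ?_
      grind [flip_right, flip_of_ne]
    rw [hJ, hG k, e2] at e1
    rw [blockSum_conn_isolated _ h.root hnk]
    have l1 : L (.inr k) = 0 := hL _ (by simp [chg, hF k h.th])
    have l2 : L (.inr k') = 0 := hL _ (by simp [chg, hF k' h.th'])
    simp only [total, l1, l2] at e1 ⊢
    have e3 : X.m k = m k := rfl
    have e4 : X.m k' = m k' := rfl
    rw [e3]
    rw [e4] at e1
    have : blockSum (Conn (flip k k' a R)) (total X.m L) k = -(m k' + L (.inl k') + 0) := by omega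
    rw [this]
    push_cast; ring
  have hW' : graphW ξ κ μ X RA = (∏ i, lineW X RA i) * loopPart μ RA *
      Lam ξ (fun _ => 1) (chg X RA) (Gfun RA X.m (gW ξ κ X RA)) := by
    simp [graphW, hv, gam]
  rw [one_mul, hW'] at hW
  rw [← hW]
  simp only [graphH, hv, if_true]
  linear_combination (∏ i, lineW X RA i) * loopPart μ RA * hx +
    ((∏ i, lineW X RA i) * loopPart μ RA * (m k + m k' : ℤ) *
      Lam ξ (fun _ => 1) (chg X RA) (Gfun RA X.m (gW ξ κ X RA))) * I_sq

end Pair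

section Pair

variable {lt : Fin n → Fin n → Prop} {k k' : Fin n} {φ : Fin n → Option Current} {m : Fin n → ℤ}
  {R RA : Graph n}

/-- A wavy line without lines into its ends. Its momentum consists of the mode of the left end and of
the momentum of the factor `α` there; the latter becomes the derivative at a vertex
`-2κ α⁻ ∂ᵤ α⁺`. -/
theorem graphP_isolated {ξ : ℕ → ℝ} (hξ : PosWeights ξ)
    (hsum : Decay ξ) (κ : ℝ) (μ : ℕ → ℝ) (hadj : Adj lt k k')
    (hk : φ k = some plus) (hk' : φ k' = some minus) (h : WavyPair (frame φ m lt) R RA k k')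
    (hin : NoIncoming k k' R) : graphP ξ κ μ k k' (frame φ m lt) R (fun P => P) =
      m k * graphW ξ κ μ (frame (fuseC k k' none φ) (fuseM k k' m) lt)
        (update RA k .zeroMode) -
      I * graphW ξ κ μ (frame (fuseC k k' (some three) φ) (fuseM k k' m) lt)
        (update RA k .zeroMode) := by
  classical
  set X := frame φ m lt with hX
  set X3 := frame (fuseC k k' (some three) φ) (fuseM k k' m) lt with hX3
  set X0 := frame (fuseC k k' none φ) (fuseM k k' m) lt with hX0
  set Rd := update RA k .zeroMode with hRd
  have hne := h.ne
  have hq : X.q k = 1 := by simp [hX, frame, hk, sgn]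
  have hq' : X.q k' = -1 := by simp [hX, frame, hk', sgn]
  have ⟨_, _, _, hw, _, hs, hdf, hr⟩ := h
  have hinA : NoIncoming k k' RA := by grind [NoIncoming]
  have hnk : ∀ x, R x ≠ .solid k := by grind [NoIncoming]
  have hnkA : ∀ x, RA x ≠ .solid k := by grind [NoIncoming]
  have hnd : ∀ x, Rd x ≠ .solid k' := by grind [NoIncoming]
  have hC : Contracts X X0 RA Rd k k' := contracts_fuse hne (by simp) (by simp) hk hk'
    (by simp [sgn]) (c0 := none) rfl h.solid hinA (by simp)
  have hth0 : ¬ X0.th k' := by simp [hX0, frame, fuseC_right]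
  have hth3 : X3.th k' := by simp [hX3, frame, fuseC_right]
  have hd0 : Rd k' = .diff := by rw [hRd, update_of_ne hne.symm, h.diff]
  have hoff : ∀ j, j ≠ k' → (X3.th j ↔ X0.th j) ∧ X3.q j = X0.q j := by
    intro j hj
    rcases eq_or_ne j k with rfl | hjk
    · simp [hX0, hX3, frame, fuseC_left hne]
    · simp [hX0, hX3, frame, fuseC_of_ne hjk hj]
  have hqq : X3.q = X0.q := by
    funext j
    rcases eq_or_ne j k' with rfl | hj
    · simp [hX0, hX3, frame, fuseC_right, sgn]
    · exact (hoff j hj).2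
  have hV : Valid X RA ↔ Valid X0 Rd :=
    hC.valid_iff h.solid hnkA rfl h.th' fun h => absurd h hth0
  have hV3 : Valid X0 Rd ↔ Valid X3 Rd := by
    have ht : ∀ i j, Rd i = .solid j → (X3.th j ↔ X0.th j) := fun i j hij =>
      (hoff j (by rintro rfl; exact hnd i hij)).1
    constructor <;> rintro ⟨a, b, c, d, e⟩ <;> constructor <;> first | assumption | grind
  have hline : ∏ i, lineW X RA i = ∏ i, lineW X3 Rd i := by
    rw [hC.lines_leaf h.solid hnkA rfl h.th' (Or.inr fun i hi => by
      by_contra hik; exact (hinA i hik).2 hi), hq', if_pos (show X.lt k k' from hadj.lt_pair)]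
    have : ∏ i, lineW X0 Rd i = ∏ i, lineW X3 Rd i := by
      refine prod_congr rfl fun i _ => ?_
      unfold lineW
      cases hRi : Rd i with
      | solid j =>
        have hj : j ≠ k' := by rintro rfl; exact hnd i hRi
        have e1 : X3.lt = X0.lt := rfl
        have e2 : X3.m = X0.m := rfl
        simp only [e1, e2, hqq, (hoff j hj).1]
      | _ => rfl
    rw [this]; push_cast; ring
  have hloop : loopPart μ RA = loopPart μ Rd := hC.loop_eq μ
  have hFne : ∀ i, ¬ X.th i → ¬ Free X RA i := fun i h h' => h h'.1
  have hF3 : Free X3 Rd k' := ⟨hth3, hd0, hnd⟩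
  have hF3k : ¬ Free X3 Rd k := fun h' => by
    have := h'.2.1; rw [hRd, update_self] at this; cases this
  have hF : ∀ i, i ≠ k → i ≠ k' → (Free X3 Rd i ↔ Free X RA i) := by
    intro i h1 h2
    rw [← hC.free_iff h1]
    unfold Free
    rw [(hoff i h2).1]
  rw [h.graphP_eq ξ κ μ hadj.lt_pair hq']
  have hW0 := graphW_fuse (c0 := none) ξ κ μ m hne (by simp) (by simp) hk hk' (by simp [sgn]) rfl
    h.solid hinA (by simp) hadj.lt_pair
  rw [← hX, ← hX0, ← hRd] at hW0
  have hW0' : graphW ξ κ μ X0 Rd = graphW ξ κ μ X RA := by rw [hW0]; simp [sgn]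
  rw [hW0']
  by_cases hv : Valid X RA
  swap
  · have hv3 : ¬ Valid X3 Rd := fun h' => hv (hV.2 (hV3.2 h'))
    simp [graphH, graphW, hv, hv3]
  have hv3 := hV3.1 (hV.1 hv)
  set G := Gfun RA X.m (gW ξ κ X RA) with hG
  set K := Lam ξ (fun _ => 1) (chg X RA) fun L => ((L (.inl k) : ℤ) : ℂ) * G L with hK
  have hP : Lam ξ (fun _ => 1) (chg X RA) (fun L =>
      ((blockSum (Conn R) (total X.m L) k : ℤ) : ℂ) * G L) =
      m k * Lam ξ (fun _ => 1) (chg X RA) G + K := by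
    have s0 := h.summable hξ hsum κ hv
    have s1 : Summable (lamTerm ξ (fun _ => 1) (chg X RA) fun L => (m k : ℂ) * G L) := by
      have := (summable_Gfun hξ hsum hv (tame_gW ξ κ X RA)).mul_left (m k : ℂ)
      exact this.congr fun t => (lamTerm_smul _ _ _ _ _ _).symm
    rw [← Lam_smul, ← sub_eq_iff_eq_add', Lam_sub ξ _ _ _ _ s0 s1]
    refine Lam_congr ξ _ _ fun L hL => ?_
    have l1 : L (.inr k) = 0 := hL _ (by simp [chg, hFne k h.th])
    rw [blockSum_conn_isolated _ h.root hnk, total, l1, show X.m k = m k from rfl]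
    push_cast; ring
  have h3 : gam ξ κ X3 Rd = I * K := by
    have hne2 : (Sum.inl k : Pts n) ≠ .inr k' := by simp
    set c : Pts n → Pts n := moveTo (.inl k) (.inr k') with hc
    have hpush : ∀ L : Pts n → ℤ, push c L =
        update (update L (.inr k') (L (.inl k) + L (.inr k'))) (.inl k) 0 := by
      intro L
      refine push_moveTo hne2 ?_ ?_ ?_
      · intro i h h'; simp [h, h']
      · simp
      · simp
    have hchg : push c (chg X RA) = chg X3 Rd := by
      refine push_moveTo hne2 ?_ ?_ ?_
      · rintro (i | i) h1 h2
        · have h1' : i ≠ k := by rintro rfl; exact h1 rfl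
          rcases eq_or_ne i k' with rfl | h3
          · simp [chg, hF3, hFne i h.th', hq']
          · have : X3.q i = X.q i := by simp [hX3, hX, frame, fuseC_of_ne h1' h3]
            by_cases hf : Free X RA i <;> simp [chg, hF i h1' h3, hf, this]
        · have h2' : i ≠ k' := by rintro rfl; exact h2 rfl
          rcases eq_or_ne i k with rfl | h3
          · simp [chg, hF3k, hFne i h.th]
          · by_cases hf : Free X RA i <;> simp [chg, hF i h3 h2', hf]
      · have : X3.q k = 0 := by simp [hX3, frame, fuseC_left hne]
        simp [chg, hF3k, this]
      · simp [chg, hF3, hFne k' h.th', hFne k h.th, hq]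
    have hd : ∀ i, RA i ≠ .dotted k ∧ RA i ≠ .wavy k := by
      have ⟨_, _, h1, h2, _⟩ := hv
      grind
    have hp := Lam_push ξ c (fun _ => 1) (chg X RA) (Gfun Rd X3.m (gW ξ κ X3 Rd))
    rw [hchg] at hp
    rw [gam, ← hp, hK, ← Lam_smul]
    refine Lam_congr ξ _ _ fun L hL => ?_
    have l1 : L (.inr k) = 0 := hL _ (by simp [chg, hFne k h.th])
    have l2 : L (.inr k') = 0 := hL _ (by simp [chg, hFne k' h.th'])
    have htot : total X3.m (push c L) = push (moveTo k k') (total X.m L) := by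
      refine (push_moveTo hne ?_ ?_ ?_).symm
      · intro i h1 h2
        simp [total, hpush, h1, h2, hX3, hX, frame, fuseM_of_ne h1 h2]
      · simp [total, hpush, hX3, frame, fuseM_left hne, l1, hne]
      · simp [total, hpush, hX3, hX, frame, fuseM_right, l1, l2, hne.symm]; ring
    have hJ := blockSum_push_eq_zero_iff (hC.joined_iff hd) (total X.m L)
    rw [hG]
    unfold Gfun
    rw [htot]
    simp only [hJ]
    split_ifs
    swap
    · simp
    rw [prod_split hne, prod_split hne]
    have e1 : ∀ P l, gW ξ κ X3 Rd k P l = 1 := fun P l => by simp [gW, hRd]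
    have e2 : ∀ P l, gW ξ κ X3 Rd k' P l = I * l := fun P l => by simp [gW, hd0, hF3]
    have e3 : ∀ P l, gW ξ κ X RA k P l = 1 := fun P l => by simp [gW, h.solid]
    have e4 : ∀ P l, gW ξ κ X RA k' P l = 1 := fun P l => by
      simp [gW, h.diff, hFne k' h.th']
    have e5 : ∀ i ∈ (univ.erase k).erase k',
        gW ξ κ X3 Rd i (blockSum (Conn Rd) (push (moveTo k k') (total X.m L)) i)
          (push c L (.inr i)) =
        gW ξ κ X RA i (blockSum (Conn RA) (total X.m L) i) (L (.inr i)) := by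
      intro i hi
      obtain ⟨h1, h2⟩ := mem_erase_erase hi
      have e6 : blockSum (Conn Rd) (push (moveTo k k') (total X.m L)) i =
          blockSum (Conn RA) (total X.m L) i := by
        rw [blockSum_push]
        unfold blockSum
        congr 1
        ext x
        have := hC.conn_iff x i
        rw [moveTo_of_ne h1] at this
        simp [this]
      have e7 : push c L (.inr i) = L (.inr i) := by simp [hpush, h2]
      rw [e6, e7]
      exact gW_congr ξ κ rfl (Or.inl (by rw [hRd, update_of_ne h1])) (fun _ _ => rfl)
        (hF i h1 h2)
    rw [prod_congr rfl e5, e1, e2, e3, e4]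
    have e8 : push c L (.inr k') = L (.inl k) := by simp [hpush, l2]
    rw [e8]; ring
  have hWA : graphW ξ κ μ X RA = (∏ i, lineW X RA i) * loopPart μ RA *
      Lam ξ (fun _ => 1) (chg X RA) G := by simp [graphW, hv, gam, hG]
  have hW3 : graphW ξ κ μ X3 Rd = (∏ i, lineW X RA i) * loopPart μ RA * (I * K) := by
    simp only [graphW, hv3, if_true, h3, ← hline, ← hloop]
  rw [hWA, hW3]
  rw [hG] at hP ⊢
  simp only [graphH, hv, if_true]
  rw [hP]
  linear_combination (∏ i, lineW X RA i) * loopPart μ RA * K * I_sq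

end Pair

section Pair

variable {lt : Fin n → Fin n → Prop} {k k' : Fin n} {φ : Fin n → Option Current}

open Classical in
/-- The part of the commutator of `J⁺` and `J⁻` due to the wavy lines between them. -/
theorem wavyPart_eq {ξ : ℕ → ℝ} (hξ : PosWeights ξ)
    (hsum : Decay ξ) (κ p : ℝ) (μ : ℕ → ℝ) (hadj : Adj lt k k')
    (hk : φ k = some plus) (hk' : φ k' = some minus) (m : Fin n → ℤ) :
    wavyPart ξ κ p μ lt k k' φ m (fun P => -2 * κ * P) =
      ∑ R : Graph n, if R k = .zeroMode ∧ R k' = .zeroMode then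
        2 * κ * (coefRest κ p φ m k k' R * ((if NoIncoming k k' R then
          m k * graphW ξ κ μ (frame (fuseC k k' none φ) (fuseM k k' m) lt)
            (update (update R k' .diff) k .zeroMode) else 0) -
          I * graphW ξ κ μ (frame (fuseC k k' (some three) φ) (fuseM k k' m) lt)
            (update (update R k' .diff) k .zeroMode))) else 0 := by
  have hne := hadj.ne
  have : Inhabited (Fin n) := ⟨k⟩
  set X := frame φ m lt with hX
  set X3 := frame (fuseC k k' (some three) φ) (fuseM k k' m) lt with hX3
  set X0 := frame (fuseC k k' none φ) (fuseM k k' m) lt with hX0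
  have hth : ¬ X.th k := by simp [hX, frame, hk]
  have hth' : ¬ X.th k' := by simp [hX, frame, hk']
  have hq : X.q k = 1 := by simp [hX, frame, hk, sgn]
  have hq' : X.q k' = -1 := by simp [hX, frame, hk', sgn]
  let RA : (Graph n) → Graph n := fun R =>
    update (update R k' .diff) k (.solid k')
  let Rd : (Graph n) → Graph n := fun R =>
    update (update R k' .diff) k .zeroMode
  have hRd : ∀ R, update (RA R) k .zeroMode = Rd R := fun R => update_idem ..
  have hRd' : ∀ R x, x ≠ k → x ≠ k' → Rd R x = R x := fun R x h1 h2 => by simp [Rd, h1, h2]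
  let S : Finset (Graph n) :=
    univ.filter fun R => R k = .wavy k' ∧ R k' = .wavy k
  have hS : ∀ {R}, R ∈ S ↔ R k = .wavy k' ∧ R k' = .wavy k := by intro R; simp [S]
  have hWP : ∀ {R}, R ∈ S → WavyPair X R (RA R) k k' := by
    intro R hR
    obtain ⟨h1, h2⟩ := hS.1 hR
    constructor <;> first | assumption | grind
  have hfl : ∀ {R}, R ∈ S → ∀ x, x ∈ flippable k k' R ↔ (R x = .solid k ∨ R x = .solid k') := by
    intro R hR x
    obtain ⟨h1, h2⟩ := hS.1 hR
    rw [mem_flippable]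
    refine ⟨fun h => h.2.2.1, fun h => ⟨by grind, by grind, h, ?_⟩⟩
    exact h.elim (not_loop_of_step_root · (hWP hR).root) (not_loop_of_step_root · (hWP hR).root')
  have hN : ∀ {R}, R ∈ S → (NoIncoming k k' R ↔ flippable k k' R = ∅) := by
    intro R hR
    rw [eq_empty_iff_forall_notMem]
    have h0 := hS.1 hR
    have h1 := hfl hR
    simp only [NoIncoming, h1]
    grind
  have hflip : ∀ {R} {a : Fin n}, R ∈ S → a ∈ flippable k k' R → flip k k' a R ∈ S ∧
      flippable k k' (flip k k' a R) = flippable k k' R ∧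
      coefRest κ p φ m k k' (flip k k' a R) = coefRest κ p φ m k k' R := by
    intro R a hR ha
    obtain ⟨h1, h2, h3, _⟩ := mem_flippable.1 ha
    have hm : flip k k' a R ∈ S := by
      rw [hS, flip_of_ne _ h1.symm, flip_of_ne _ h2.symm]; exact hS.1 hR
    refine ⟨hm, ?_, prod_congr rfl fun i _ => coefB_flip κ p φ m h3 i⟩
    ext x
    rw [hfl hm, hfl hR]
    grind [flip_left, flip_right, flip_of_ne]
  let F : (Graph n) → ℂ := fun R => coefRest κ p φ m k k' R *
    (graphP ξ κ μ k k' X R (fun P => P) + I * graphW ξ κ μ X3 (Rd R))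
  have hX3k : ∀ {R a}, a ∈ flippable k k' R → R a = .solid k → graphW ξ κ μ X3 (Rd R) = 0 := by
    intro R a ha h
    obtain ⟨h1, h2, _⟩ := mem_flippable.1 ha
    exact graphW_eq_zero ((hRd' R a h1 h2).trans h) (by simp [hX3, frame, fuseC_left hne])
      (by simp [hX3, frame, fuseC_left hne])
  have hX3z : ∀ {R a b}, a ∈ flippable k k' R → b ∈ flippable k k' R → a ≠ b →
      graphW ξ κ μ X3 (Rd R) = 0 := by
    intro R a b ha hb hab
    obtain ⟨h1, h2, h3, _⟩ := mem_flippable.1 ha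
    obtain ⟨h4, h5, h6, _⟩ := mem_flippable.1 hb
    rcases h3 with h3 | h3
    · exact hX3k ha h3
    rcases h6 with h6 | h6
    · exact hX3k hb h6
    refine graphW_of_not_valid fun hv => hab ?_
    exact (hv.solid_th b k' ((hRd' R b h4 h5).trans h6) (by simp [hX3, frame, fuseC_right])).2 a
      ((hRd' R a h1 h2).trans h3)
  let S1 : Finset (Graph n) := S.filter fun R => (flippable k k' R).Nonempty
  let A : (Graph n) → Fin n := fun R => pick (flippable k k' R)
  let B : (Graph n) → Fin n := fun R => pick ((flippable k k' R).erase (A R))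
  have hS1 : ∀ {R}, R ∈ S1 → R ∈ S ∧ A R ∈ flippable k k' R := by
    intro R hR
    obtain ⟨h1, h2⟩ := mem_filter.1 hR
    exact ⟨h1, pick_mem h2⟩
  have hflip1 : ∀ {R a}, R ∈ S1 → a ∈ flippable k k' R → flip k k' a R ∈ S1 ∧
      A (flip k k' a R) = A R ∧ B (flip k k' a R) = B R := by
    intro R a hR ha
    obtain ⟨h1, h2, _⟩ := hflip (hS1 hR).1 ha
    refine ⟨mem_filter.2 ⟨h1, ?_⟩, ?_, ?_⟩
    · rw [h2]; exact ⟨a, ha⟩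
    · simp only [A, h2]
    · simp only [B, A, h2]
  -- Each contribution is added to the one with the first line moved; of these sums, those with
  -- further lines cancel in pairs.
  let g : (Graph n) → ℂ := fun R => F R + F (flip k k' (A R) R)
  have hsame : ∑ R ∈ S1, F (flip k k' (A R) R) = ∑ R ∈ S1, F R := by
    refine sum_nbij' (fun R => flip k k' (A R) R) (fun R => flip k k' (A R) R)
      (fun R hR => (hflip1 hR (hS1 hR).2).1) (fun R hR => (hflip1 hR (hS1 hR).2).1) ?_ ?_
      (fun _ _ => rfl)
    · intro R hR; rw [(hflip1 hR (hS1 hR).2).2.1, flip_flip]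
    · intro R hR; rw [(hflip1 hR (hS1 hR).2).2.1, flip_flip]
  have hsingle : ∀ R ∈ S1, g R ≠ 0 → ((flippable k k' R).erase (A R)).Nonempty := by
    intro R hR hg
    by_contra he
    rw [not_nonempty_iff_eq_empty] at he
    apply hg
    obtain ⟨hRS, hA⟩ := hS1 hR
    have hu : ∀ x, R x = .solid k ∨ R x = .solid k' → x = A R := by
      intro x hx
      by_contra hxa
      have := mem_erase.2 ⟨hxa, (hfl hRS x).2 hx⟩
      simp [he] at this
    obtain ⟨h1, h2, h3, _⟩ := mem_flippable.1 hA
    obtain ⟨h4, h5, h6⟩ := hflip hRS hA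
    simp only [g, F, h6]
    rcases h3 with h3 | h3
    · have h7 : (flip k k' (A R) R) (A R) = .solid k' := flip_left h3
      have h8 := graphP_single hξ hsum κ μ hadj hk hk' (hWP h4) h1 h2 h7
        (by grind [flip_of_ne])
      rw [flip_flip, hRd, ← hX, ← hX3] at h8
      rw [hX3k hA h3]
      linear_combination coefRest κ p φ m k k' R * h8
    · have h8 := graphP_single hξ hsum κ μ hadj hk hk' (hWP hRS) h1 h2 h3 hu
      rw [hRd, ← hX, ← hX3] at h8
      rw [hX3k (R := flip k k' (A R) R) (by rwa [h5]) (flip_right h3)]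
      linear_combination coefRest κ p φ m k k' R * h8
  have hcancel : ∑ R ∈ S1, F R = 0 := by
    have h1 : ∑ R ∈ S1, g R = 0 := by
      rw [← sum_filter_of_ne hsingle]
      have hB : ∀ {R}, R ∈ S1.filter (fun R => ((flippable k k' R).erase (A R)).Nonempty) →
          R ∈ S1 ∧ B R ∈ flippable k k' R ∧ B R ≠ A R := by
        intro R hR
        obtain ⟨h1, h2⟩ := mem_filter.1 hR
        have := mem_erase.1 (pick_mem h2)
        exact ⟨h1, this.2, this.1⟩
      refine sum_involution (fun R _ => flip k k' (B R) R) ?_ ?_ ?_ ?_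
      · intro R hR
        obtain ⟨hR1, hb, hba⟩ := hB hR
        obtain ⟨hRS, ha⟩ := hS1 hR1
        obtain ⟨a1, a2, a3, _⟩ := mem_flippable.1 ha
        obtain ⟨b1, b2, b3, _⟩ := mem_flippable.1 hb
        obtain ⟨fa1, fa2, fa3⟩ := hflip hRS ha
        obtain ⟨fb1, fb2, fb3⟩ := hflip hRS hb
        obtain ⟨fab1, fab2, fab3⟩ := hflip fb1 (a := A R) (by rwa [fb2])
        simp only [g, F, (hflip1 hR1 hb).2.1]
        rw [hX3z ha hb hba.symm, hX3z (R := flip k k' (A R) R) (by rwa [fa2]) (by rwa [fa2]) hba,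
          hX3z (R := flip k k' (B R) R) (by rwa [fb2]) (by rwa [fb2]) hba,
          hX3z (R := flip k k' (A R) (flip k k' (B R) R)) (by rwa [fab2, fb2])
            (by rwa [fab2, fb2]) hba, fab3, fb3, fa3]
        have := graphP_flip_flip hξ hsum κ μ (hWP hRS) hq hq' hadj.lt_pair hadj.left a1 a2 a3
          b1 b2 b3 hba.symm
        linear_combination coefRest κ p φ m k k' R * this
      · intro R hR _
        exact flip_ne hne (mem_flippable.1 (hB hR).2.1).2.2.1
      · intro R hR
        obtain ⟨h1, h2, _⟩ := hB hR
        obtain ⟨h4, h5, h6⟩ := hflip1 h1 h2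
        refine mem_filter.2 ⟨h4, ?_⟩
        rw [h5, (hflip (hS1 h1).1 h2).2.1]
        exact (mem_filter.1 hR).2
      · intro R hR
        rw [(hflip1 (hB hR).1 (hB hR).2.1).2.2, flip_flip]
    simp only [g] at h1
    rw [sum_add_distrib, hsame, ← two_mul] at h1
    exact (mul_eq_zero.1 h1).resolve_left two_ne_zero
  have hmain : ∑ R ∈ S, F R = ∑ R ∈ S, coefRest κ p φ m k k' R *
      (if NoIncoming k k' R then m k * graphW ξ κ μ X0 (Rd R) else 0) := by
    rw [← sum_filter_add_sum_filter_not S (fun R => (flippable k k' R).Nonempty)]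
    change ∑ R ∈ S1, F R + _ = _
    rw [hcancel, zero_add, sum_filter]
    refine sum_congr rfl fun R hR => ?_
    by_cases h : (flippable k k' R).Nonempty
    · have : ¬ NoIncoming k k' R := by rw [hN hR]; exact h.ne_empty
      simp [h, this]
    · have hin : NoIncoming k k' R := by
        rw [hN hR]; exact not_nonempty_iff_eq_empty.1 h
      have h8 := graphP_isolated hξ hsum κ μ hadj hk hk' (hWP hR) hin
      rw [hRd, ← hX, ← hX3, ← hX0] at h8
      simp only [h, hin, not_false_eq_true, if_true, F, h8]
      ring
  have e1 : wavyPart ξ κ p μ lt k k' φ m (fun P => -2 * κ * P) = ∑ R ∈ S,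
      2 * κ * (coefRest κ p φ m k k' R * ((if NoIncoming k k' R then
        m k * graphW ξ κ μ X0 (Rd R) else 0) - I * graphW ξ κ μ X3 (Rd R))) := by
    have e2 : wavyPart ξ κ p μ lt k k' φ m (fun P => -2 * κ * P) = ∑ R ∈ S,
        2 * κ * (coefRest κ p φ m k k' R * graphP ξ κ μ k k' X R fun P => P) := by
      rw [sum_filter]
      refine sum_congr rfl fun R _ => ?_
      by_cases h1 : R k = .wavy k'
      swap
      · simp [h1]
      by_cases h2 : R k' = .wavy k
      swap
      · simp [h1, h2, graphP_eq_zero h1 h2]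
      simp only [h1, h2, and_self, if_true]
      rw [graphP_smul, coefProd_split κ p φ m hne, hk, hk', h1, h2, coefB_wavy κ p (by simp),
        coefB_wavy κ p (by simp)]
      simp only [sgn]
      push_cast; ring
    rw [e2]
    simp only [mul_sub, sum_sub_distrib, ← mul_sum]
    rw [← hmain]
    simp only [F, mul_add, sum_add_distrib]
    ring
  rw [e1, sum_filter, sum_role_eq_pair hne (.wavy k') (.wavy k) fun R =>
    2 * κ * (coefRest κ p φ m k k' R * ((if NoIncoming k k' R then
        m k * graphW ξ κ μ X0 (Rd R) else 0) - I * graphW ξ κ μ X3 (Rd R)))]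
  refine sum_congr rfl fun R _ => ?_
  by_cases h : R k = .zeroMode ∧ R k' = .zeroMode
  swap
  · rw [if_neg h, if_neg h]
  rw [if_pos h, if_pos h]
  set R' := update (update R k' (.wavy k)) k (.wavy k') with hR'
  have hR'i : ∀ i, i ≠ k → i ≠ k' → R' i = R i := fun i h1 h2 => by simp [hR', h1, h2]
  have hd : Rd R' = Rd R := by
    funext i
    grind
  have hNN : NoIncoming k k' R' ↔ NoIncoming k k' R := by grind [NoIncoming]
  rw [hd, coefRest_congr κ p (φ := φ) (m := m) (φ' := φ) (m' := m) (R := R') (R' := R)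
    fun i h1 h2 => ⟨rfl, rfl, hR'i i h1 h2⟩]
  simp only [hNN]
  rfl

/-- `[J⁺ₘ, J⁻ₙ] = i J³ₘ₊ₙ + 4κ m δ_{m+n,0}`. -/
theorem corr_plus_minus {ξ : ℕ → ℝ} (hξ : PosWeights ξ)
    (hsum : Decay ξ) {κ : ℝ} (hκ : 0 < κ) (p : ℝ) (μ : ℕ → ℝ)
    (hadj : Adj lt k k') (hk : φ k = some plus) (hk' : φ k' = some minus) (m : Fin n → ℤ) :
    corr ξ κ p μ φ m lt - corr ξ κ p μ (φ ∘ Equiv.swap k k') (m ∘ Equiv.swap k k') lt =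
      I * corr ξ κ p μ (fuseC k k' (some three) φ) (fuseM k k' m) lt +
        central 4 κ (m k) (m k') * corr ξ κ p μ (fuseC k k' none φ) (fuseM k k' m) lt := by
  classical
  have hne := hadj.ne
  rw [corr_sub_swap hξ hsum hκ p μ hadj φ m, leftPart_eq_neg_rightPart ξ κ p μ hadj,
    ← sub_eq_add_neg, rightPart_sub ξ κ p μ hadj hk hk' m, wavyPart_eq hξ hsum κ p μ hadj hk hk' m]
  set X3 := frame (fuseC k k' (some three) φ) (fuseM k k' m) lt with hX3
  set X0 := frame (fuseC k k' none φ) (fuseM k k' m) lt with hX0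
  have hrest : ∀ (c : Option Current) (R : Graph n),
      coefRest κ p (fuseC k k' c φ) (fuseM k k' m) k k' R = coefRest κ p φ m k k' R :=
    fun c R => coefRest_congr κ p fun i h1 h2 => ⟨fuseC_of_ne h1 h2 c, fuseM_of_ne h1 h2 m, rfl⟩
  have h3 : I * corr ξ κ p μ (fuseC k k' (some three) φ) (fuseM k k' m) lt =
      ∑ R : Graph n, if R k = .zeroMode then
        I * (coefB κ p (some three) 0 (R k') * coefRest κ p φ m k k' R *
          graphW ξ κ μ X3 R) else 0 := by
    rw [corr, mul_sum]
    refine sum_congr rfl fun R _ => ?_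
    rw [coefProd_split κ p _ _ hne, hrest, fuseC_left hne, fuseC_right]
    have : coefB κ p (some three) (fuseM k k' m k') (R k') = coefB κ p (some three) 0 (R k') := by
      simp [coefB]
    rw [this]
    by_cases h : R k = .zeroMode
    · simp [h, coefB, hX3]
    · simp [h, coefB]
  have h0 : corr ξ κ p μ (fuseC k k' none φ) (fuseM k k' m) lt =
      ∑ R : Graph n, if R k = .zeroMode ∧ R k' = .zeroMode then
        coefRest κ p φ m k k' R * graphW ξ κ μ X0 R else 0 := by
    rw [corr]
    refine sum_congr rfl fun R _ => ?_
    rw [coefProd_split κ p _ _ hne, hrest, fuseC_left hne, fuseC_right]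
    by_cases h : R k = .zeroMode <;> by_cases h' : R k' = .zeroMode <;> simp [h, h', coefB, hX0]
  rw [h3, h0, ← sub_eq_iff_eq_add', add_comm, add_sub_assoc, ← sum_sub_distrib]
  have e1 : ∀ R : Graph n, ((if R k = .zeroMode then if R k' = .diff then
        if NoIncoming k k' R then κ * (m k - m k' : ℤ) * (coefRest κ p φ m k k' R *
          graphW ξ κ μ X0 R) else 0
        else I * (coefB κ p (some three) 0 (R k') * coefRest κ p φ m k k' R *
          graphW ξ κ μ X3 R) else 0) - (if R k = .zeroMode then
        I * (coefB κ p (some three) 0 (R k') * coefRest κ p φ m k k' R *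
          graphW ξ κ μ X3 R) else 0)) =
      if R k = .zeroMode ∧ R k' = .diff then
        coefRest κ p φ m k k' R * ((if NoIncoming k k' R then κ * (m k - m k' : ℤ) *
          graphW ξ κ μ X0 R else 0) + 2 * κ * I * graphW ξ κ μ X3 R) else 0 := by
    intro R
    by_cases h : R k = .zeroMode <;> by_cases h' : R k' = .diff <;> simp only [h, h', if_true,
      if_false, and_self, and_false, false_and, sub_self]
    have : coefB κ p (some three) 0 (.diff : Role n) = -2 * κ := by simp [coefB, coef]
    rw [this]
    split_ifs <;> ring
  rw [sum_congr rfl fun R _ => e1 R, sum_role_eq_pair hne .zeroMode .diff fun R =>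
    coefRest κ p φ m k k' R * ((if NoIncoming k k' R then κ * (m k - m k' : ℤ) *
          graphW ξ κ μ X0 R else 0) + 2 * κ * I * graphW ξ κ μ X3 R),
    ← sum_add_distrib, mul_sum]
  refine sum_congr rfl fun R _ => ?_
  by_cases h : R k = .zeroMode ∧ R k' = .zeroMode
  swap
  · simp only [if_neg h]; simp
  simp only [if_pos h]
  set Rd := update (update R k' .diff) k .zeroMode with hRd
  have hi : ∀ i, i ≠ k' → Rd i = R i := by grind
  have hth : ¬ X0.th k' := by simp [hX0, frame, fuseC_right]
  have hq : X0.q k' = 0 := by simp [hX0, frame, fuseC_right]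
  have hW : graphW ξ κ μ X0 Rd = graphW ξ κ μ X0 R :=
    graphW_update_diff ξ κ μ hth h.2 (by simp [hRd, hne.symm]) hi
  have hNN : NoIncoming k k' Rd ↔ NoIncoming k k' R := by
    grind [NoIncoming]
  rw [hW, coefRest_congr κ p (φ := φ) (m := m) (φ' := φ) (m' := m) (R := Rd) (R' := R)
    fun i _ h2 => ⟨rfl, rfl, hi i h2⟩]
  simp only [hNN]
  by_cases hin : NoIncoming k k' R
  · simp only [hin, if_true]
    by_cases hc : m k + m k' = 0
    · have : m k' = -m k := by omega
      rw [central, if_pos hc, this]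
      push_cast; ring
    · have hz : graphW ξ κ μ X0 R = 0 := by
        refine graphW_isolated_eq_zero ξ κ μ hth hq h.2 ?_ (by
          rw [hX0]; change fuseM k k' m k' ≠ 0; rwa [fuseM_right])
        intro i
        rcases eq_or_ne i k with rfl | h1
        · simp [h.1]
        · exact (hin i h1).2
      rw [hz]; ring
  · have hz : graphW ξ κ μ X0 R = 0 := by
      simp only [NoIncoming, not_forall] at hin
      obtain ⟨a, ha, hin⟩ := hin
      rcases not_and_or.1 hin with h1 | h1
      · exact graphW_eq_zero (not_not.1 h1) (by simp [hX0, frame, fuseC_left hne])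
          (by simp [hX0, frame, fuseC_left hne])
      · exact graphW_eq_zero (not_not.1 h1) hth hq
    simp only [hin, if_false, hz]; ring

end Pair

/-! ### Boundary correlators of words -/

section Words

variable {ξ : ℕ → ℝ} {κ p : ℝ} {μ : ℕ → ℝ}

/-- The boundary correlator of a product of modes and units. -/
def optCorr (ξ : ℕ → ℝ) (κ p : ℝ) (μ : ℕ → ℝ) (l : List (Option Current × ℤ)) : ℂ :=
  corr ξ κ p μ (fun k : Fin l.length => (l.get k).1) (fun k => (l.get k).2) (· < ·)

/-- The boundary correlator of a product of modes. -/
def boundaryCorr (ξ : ℕ → ℝ) (κ p : ℝ) (μ : ℕ → ℝ) (w : Word) : ℂ :=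
  corr ξ κ p μ (fun k : Fin w.length => some (w.get k).1) (fun k => (w.get k).2) (· < ·)

theorem corr_eq_optCorr (l : List (Option Current × ℤ)) {N : ℕ} (hN : l.length = N)
    (φ : Fin N → Option Current) (m : Fin N → ℤ)
    (h : ∀ (i : ℕ) (h : i < N), φ ⟨i, h⟩ = (l[i]'(hN ▸ h)).1 ∧ m ⟨i, h⟩ = (l[i]'(hN ▸ h)).2) :
    corr ξ κ p μ φ m (· < ·) = optCorr ξ κ p μ l := by
  subst hN
  unfold optCorr
  congr 1
  · funext k; exact (h k k.2).1
  · funext k; exact (h k k.2).2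

/-- The word with its letters regarded as operators other than the unit. -/
def optWord (w : Word) : List (Option Current × ℤ) := w.map fun x => (some x.1, x.2)

theorem optCorr_optWord (w : Word) : optCorr ξ κ p μ (optWord w) = boundaryCorr ξ κ p μ w :=
  (corr_eq_optCorr _ (by simp [optWord]) _ _ (fun i h => by simp [optWord])).symm

theorem optCorr_unit (w w' : List (Option Current × ℤ)) :
    optCorr ξ κ p μ (w ++ (none, 0) :: w') = optCorr ξ κ p μ (w ++ w') := by
  symm
  have hlen : (w ++ (none, 0) :: w').length = (w ++ w').length + 1 := by simp; omega
  let e : Fin (w ++ w').length → Fin (w ++ (none, 0) :: w').length := fun i =>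
    if h : (i : ℕ) < w.length then ⟨i, by have := i.2; omega⟩ else ⟨i + 1, by have := i.2; omega⟩
  have he : ∀ i, (e i : ℕ) = if (i : ℕ) < w.length then (i : ℕ) else i + 1 := by
    intro i; simp only [e]; split_ifs <;> rfl
  have hget : ∀ i, (w ++ (none, 0) :: w').get (e i) = (w ++ w').get i := by
    intro i
    simp only [List.get_eq_getElem, he]
    split_ifs with h
    · rw [List.getElem_append_left h, List.getElem_append_left h]
    · rw [List.getElem_append_right (by omega), List.getElem_append_right (by omega)]
      simp [show (i : ℕ) + 1 - w.length = (i - w.length) + 1 by omega]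
  refine corr_embed ξ κ p μ (e := e) ?_ ?_ ?_ ?_ ?_
  · intro i j hij
    have := congrArg Fin.val hij
    rw [he, he] at this
    ext; split_ifs at this <;> omega
  · intro i; rw [hget]
  · intro i; rw [hget]
  · intro i j
    rw [Fin.lt_def, Fin.lt_def, he, he]
    split_ifs <;> omega
  · intro x hx
    have : (x : ℕ) = w.length := by
      by_contra hne
      rcases lt_or_gt_of_ne hne with h | h
      · refine hx ⟨x, by simp; omega⟩ (Fin.ext ?_)
        rw [he]; simp [h]
      · refine hx ⟨x - 1, by have := x.2; omega⟩ (Fin.ext ?_)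
        rw [he]
        have h' : ¬ (x : ℕ) - 1 < w.length := by omega
        simp only [h', if_false]; omega
    simp [List.get_eq_getElem, this]

/-- Values at two adjacent positions of a word. -/
theorem corr_eq_optCorr_pair (w w' : List (Option Current × ℤ)) (x y x' y' : Option Current × ℤ)
    (k k' : Fin (w ++ x :: y :: w').length) (hk : (k : ℕ) = w.length) (hk' : (k' : ℕ) = w.length + 1)
    (φ : Fin (w ++ x :: y :: w').length → Option Current) (m : Fin (w ++ x :: y :: w').length → ℤ)
    (hx : φ k = x'.1 ∧ m k = x'.2) (hy : φ k' = y'.1 ∧ m k' = y'.2)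
    (h : ∀ i, i ≠ k → i ≠ k' → φ i = ((w ++ x :: y :: w').get i).1 ∧
      m i = ((w ++ x :: y :: w').get i).2) :
    corr ξ κ p μ φ m (· < ·) = optCorr ξ κ p μ (w ++ x' :: y' :: w') := by
  refine corr_eq_optCorr _ (by simp) _ _ fun i hi => ?_
  by_cases h1 : i = w.length
  · subst h1
    have : (⟨w.length, hi⟩ : Fin _) = k := Fin.ext hk.symm
    rw [this]; simpa using hx
  by_cases h2 : i = w.length + 1
  · subst h2
    have : (⟨w.length + 1, hi⟩ : Fin _) = k' := Fin.ext hk'.symm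
    rw [this]; simpa using hy
  have := h ⟨i, hi⟩ (fun hh => h1 (by rw [← hk, ← hh])) (fun hh => h2 (by rw [← hk', ← hh]))
  rw [this.1, this.2]
  have hE : (w ++ x :: y :: w').get ⟨i, hi⟩ = (w ++ x' :: y' :: w')[i]'(by simpa using hi) := by
    simp only [List.get_eq_getElem]
    rcases lt_or_ge i w.length with h3 | h3
    · rw [List.getElem_append_left h3, List.getElem_append_left h3]
    · rw [List.getElem_append_right h3, List.getElem_append_right h3]
      obtain ⟨j, hj⟩ : ∃ j, i - w.length = j + 2 := ⟨i - w.length - 2, by omega⟩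
      simp [hj]
  rw [hE]; exact ⟨rfl, rfl⟩

section Pair

variable (w w' : List (Option Current × ℤ)) (x y : Option Current × ℤ)

/-- The position of the first letter of the distinguished pair. -/
def fstPos : Fin (w ++ x :: y :: w').length := ⟨w.length, by simp⟩

/-- The position of the second letter of the distinguished pair. -/
def sndPos : Fin (w ++ x :: y :: w').length := ⟨w.length + 1, by simp⟩

theorem adj_pos : Adj (· < ·) (fstPos w w' x y) (sndPos w w' x y) := by
  constructor <;> simp [fstPos, sndPos, Fin.lt_def, Fin.ext_iff] <;> intros <;> omega

theorem get_fstPos : (w ++ x :: y :: w').get (fstPos w w' x y) = x := by simp [fstPos]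

theorem get_sndPos : (w ++ x :: y :: w').get (sndPos w w' x y) = y := by simp [sndPos]

theorem corr_comp_swap : corr ξ κ p μ
      ((fun k => ((w ++ x :: y :: w').get k).1) ∘ Equiv.swap (fstPos w w' x y) (sndPos w w' x y))
      ((fun k => ((w ++ x :: y :: w').get k).2) ∘ Equiv.swap (fstPos w w' x y) (sndPos w w' x y))
      (· < ·) = optCorr ξ κ p μ (w ++ y :: x :: w') := by
  refine corr_eq_optCorr_pair w w' x y y x (fstPos w w' x y) (sndPos w w' x y) rfl rfl _ _ ?_ ?_ ?_
  · simp only [comp, Equiv.swap_apply_left, get_sndPos, and_self]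
  · simp only [comp, Equiv.swap_apply_right, get_fstPos, and_self]
  · intro i h1 h2
    simp only [comp, Equiv.swap_apply_of_ne_of_ne h1 h2, and_self]

theorem corr_fuse_pair (c : Option Current) : corr ξ κ p μ
      (fuseC (fstPos w w' x y) (sndPos w w' x y) c fun k => ((w ++ x :: y :: w').get k).1)
      (fuseM (fstPos w w' x y) (sndPos w w' x y) fun k => ((w ++ x :: y :: w').get k).2)
      (· < ·) = optCorr ξ κ p μ (w ++ (c, x.2 + y.2) :: w') := by
  have hne := (adj_pos w w' x y).ne
  rw [← optCorr_unit]
  refine corr_eq_optCorr_pair w w' x y (none, 0) (c, x.2 + y.2) (fstPos w w' x y)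
    (sndPos w w' x y) rfl rfl _ _ ?_ ?_ ?_
  · simp [fuseC, fuseM, hne]
  · have h1 := get_fstPos w w' x y
    have h2 := get_sndPos w w' x y
    simp only [fuseC, fuseM, update_self, h1, h2, and_self]
  · intro i h1 h2
    simp only [fuseC, fuseM, update_of_ne h1, update_of_ne h2, and_self]

end Pair

section Relations

variable (hξ : PosWeights ξ) (hsum : Decay ξ)

theorem boundaryCorr_append_pair (w w' : Word) (x y : Current × ℤ) :
    boundaryCorr ξ κ p μ (w ++ [x, y] ++ w') =
      optCorr ξ κ p μ (optWord w ++ (some x.1, x.2) :: (some y.1, y.2) :: optWord w') := by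
  rw [← optCorr_optWord]; simp [optWord]

theorem boundaryCorr_append_single (w w' : Word) (x : Current × ℤ) :
    boundaryCorr ξ κ p μ (w ++ [x] ++ w') =
      optCorr ξ κ p μ (optWord w ++ (some x.1, x.2) :: optWord w') := by
  rw [← optCorr_optWord]; simp [optWord]

include hξ hsum

theorem boundaryCorr_plus_minus (hκ : 0 < κ) (w w' : Word) (m n : ℤ) :
    boundaryCorr ξ κ p μ (w ++ [(plus, m), (minus, n)] ++ w') -
      boundaryCorr ξ κ p μ (w ++ [(minus, n), (plus, m)] ++ w') =
    I * boundaryCorr ξ κ p μ (w ++ [(three, m + n)] ++ w') +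
      central 4 κ m n * boundaryCorr ξ κ p μ (w ++ w') := by
  simp only [boundaryCorr_append_pair, boundaryCorr_append_single]
  have h := corr_plus_minus hξ hsum hκ p μ
    (adj_pos (optWord w) (optWord w') (some plus, m) (some minus, n))
    (φ := fun k => (List.get _ k).1) (by simp only [get_fstPos]) (by simp only [get_sndPos])
    (fun k => (List.get _ k).2)
  rw [corr_comp_swap, corr_fuse_pair, corr_fuse_pair] at h
  simp only [get_fstPos, get_sndPos] at h
  refine h.trans ?_
  congr 1
  by_cases hz : m + n = 0
  · rw [hz, optCorr_unit, ← optCorr_optWord]; simp [optWord]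
  · simp [central, hz]

theorem boundaryCorr_three_swap (hκ : 0 < κ) (w w' : Word) (m n : ℤ) {c : Current}
    (hc : c ≠ three) : boundaryCorr ξ κ p μ (w ++ [(three, m), (c, n)] ++ w') -
      boundaryCorr ξ κ p μ (w ++ [(c, n), (three, m)] ++ w') =
    -2 * I * c.sgn * boundaryCorr ξ κ p μ (w ++ [(c, m + n)] ++ w') := by
  simp only [boundaryCorr_append_pair, boundaryCorr_append_single]
  have h := corr_three_swap hξ hsum hκ p μ
    (adj_pos (optWord w) (optWord w') (some three, m) (some c, n))
    (fun k => (List.get _ k).1) (fun k => (List.get _ k).2) hc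
    (by simp only [get_fstPos]) (by simp only [get_sndPos])
  rw [corr_comp_swap] at h
  have h2 := corr_fuse_pair (ξ := ξ) (κ := κ) (p := p) (μ := μ) (optWord w) (optWord w')
    (some three, m) (some c, n) (some c)
  rw [← h2]
  refine h.trans ?_
  congr 2
  funext i
  unfold fuseC
  rcases eq_or_ne i (sndPos (optWord w) (optWord w') (some three, m) (some c, n)) with rfl | hi
  · rw [update_self, update_of_ne (adj_pos _ _ _ _).ne.symm]
    simp only [get_sndPos]
  · rw [update_of_ne hi]

theorem boundaryCorr_swap_same (hκ : 0 < κ) (w w' : Word) (m n : ℤ) {c : Current} (hc : c ≠ three) :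
    boundaryCorr ξ κ p μ (w ++ [(c, m), (c, n)] ++ w') =
      boundaryCorr ξ κ p μ (w ++ [(c, n), (c, m)] ++ w') := by
  simp only [boundaryCorr_append_pair]
  have h := corr_swap_same hξ hsum hκ p μ
    (adj_pos (optWord w) (optWord w') (some c, m) (some c, n))
    (fun k => (List.get _ k).1) (fun k => (List.get _ k).2) hc
    (by simp only [get_fstPos]) (by simp only [get_sndPos])
  rw [corr_comp_swap] at h
  exact h

/-- By the Jacobi identity, since `i J³_n = [J⁺_n, J⁻_0]` up to a multiple of the unit. -/
theorem boundaryCorr_three_three (hκ : 0 < κ) (w w' : Word) (m n : ℤ) :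
    boundaryCorr ξ κ p μ (w ++ [(three, m), (three, n)] ++ w') -
      boundaryCorr ξ κ p μ (w ++ [(three, n), (three, m)] ++ w') =
    central (-8) κ m n * boundaryCorr ξ κ p μ (w ++ w') := by
  set C := boundaryCorr ξ κ p μ
  have pm := @boundaryCorr_plus_minus ξ κ p μ hξ hsum hκ
  have tp := fun v v' a b => @boundaryCorr_three_swap ξ κ p μ hξ hsum hκ v v' a b plus (by simp)
  have tm := fun v v' a b => @boundaryCorr_three_swap ξ κ p μ hξ hsum hκ v v' a b minus (by simp)
  have p1 := pm (w ++ [(three, m)]) w' n 0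
  have p2 := pm w ((three, m) :: w') n 0
  have t1 := tp w ((minus, 0) :: w') m n
  have t2 := tm (w ++ [(plus, n)]) w' m 0
  have t3 := tm w ((plus, n) :: w') m 0
  have t4 := tp (w ++ [(minus, 0)]) w' m n
  have q1 := pm w w' (m + n) 0
  have q2 := pm w w' n m
  simp only [List.append_assoc, List.cons_append, List.nil_append, add_zero, sgn, Int.cast_one,
    Int.cast_neg, add_comm n m] at *
  have h0 : ∀ a, central 4 κ a 0 = 0 := by
    intro a; unfold central; split_ifs with h
    · simp [show a = 0 by omega]
    · rfl
  have hc : central (-8) κ m n = 2 * central 4 κ n m := by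
    unfold central
    rw [add_comm n m]
    split_ifs with h
    · rw [show n = -m by omega]; push_cast; ring
    · ring
  rw [h0] at p1 p2 q1
  rw [hc]
  have hI := I_mul_I
  linear_combination -I * (p2 - p1 + t1 + t2 - t3 - t4 + 2 * I * (q2 - q1)) +
    (C (w ++ (three, m) :: (three, n) :: w') - C (w ++ (three, n) :: (three, m) :: w') -
      2 * central 4 κ n m * C (w ++ w')) * hI

theorem boundaryCorr_relations (hκ : 0 < κ) : CorrelatorRelations κ (boundaryCorr ξ κ p μ) where
  plus_minus := boundaryCorr_plus_minus hξ hsum hκ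
  three_three := boundaryCorr_three_three hξ hsum hκ
  three_plus w w' m n := by
    rw [boundaryCorr_three_swap hξ hsum hκ w w' m n (by simp)]; simp [sgn]
  three_minus w w' m n := by
    rw [boundaryCorr_three_swap hξ hsum hκ w w' m n (by simp)]; simp [sgn]
  plus_plus w w' m n := boundaryCorr_swap_same hξ hsum hκ w w' m n (by simp)
  minus_minus w w' m n := boundaryCorr_swap_same hξ hsum hκ w w' m n (by simp)

end Relations

end Words

/-! ### Hermiticity -/

section Hermitian

variable {ξ : ℕ → ℝ} {κ p : ℝ} {μ : ℕ → ℝ}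

/-- The frame with opposite charges, modes and order. -/
def Frame.opp (X : Frame n) : Frame n := ⟨-X.q, X.th, -X.m, fun i j => X.lt j i⟩

theorem conj_graphW (hth : ∀ k, ¬ X.th k)
    (hlt : ∀ i j, i ≠ j → (X.lt i j ↔ ¬ X.lt j i)) (R : Graph n) :
    graphW ξ κ μ X.opp R = conj (graphW ξ κ μ X R) := by
  classical
  have hneg : ∀ (E : Fin n → Fin n → Prop) (f : Fin n → ℤ) i,
      blockSum E (fun k => -f k) i = -blockSum E f i := fun E f i => by simp [blockSum]
  have hq : ∀ i, blockSum (Conn R) X.opp.q i = -blockSum (Conn R) X.q i := fun i => hneg _ X.q i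
  have hV : Valid X.opp R ↔ Valid X R := by
    constructor <;> intro h
    · exact ⟨h.solid_ne, h.solid_th, h.dotted, h.wavy, fun i j hij => by
        simpa [hq] using h.kept i j hij⟩
    · exact ⟨h.solid_ne, h.solid_th, h.dotted, h.wavy, fun i j hij => by
        simpa [hq] using h.kept i j hij⟩
  by_cases hv : Valid X R
  swap
  · rw [graphW_of_not_valid hv, graphW_of_not_valid (hV.not.2 hv), map_zero]
  have hfree : ∀ k, ¬ Free X R k := fun k h => hth k h.1
  have hfree' : ∀ k, ¬ Free X.opp R k := fun k h => hth k h.1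
  have hline : ∀ i, lineW X.opp R i = conj (lineW X R i) := by
    intro i
    cases hr : R i with
    | solid j =>
      have h1 : ¬ X.opp.th j := hth j
      have h2 : X.opp.lt i j ↔ ¬ X.lt i j := hlt j i (hv.solid_ne i j hr).symm
      have h3 : X.opp.q j = -X.q j := rfl
      simp only [lineW, hr, h1, hth j, h2, h3, if_false]
      split_ifs <;> simp_all
    | _ => simp [lineW, hr]
  have hchg : chg X.opp R = -chg X R := by
    funext a
    rcases a with k | k
    · simp only [chg, Sum.elim_inl, hfree k, hfree' k, if_false, Pi.neg_apply]; rfl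
    · simp only [chg, Sum.elim_inr, hfree k, hfree' k, if_false, Pi.neg_apply, neg_zero]
  have htot : ∀ L, total X.opp.m L = fun k => -total X.m (-L) k := by
    intro L; funext k; simp only [total, Frame.opp, Pi.neg_apply]; ring
  have hgW : ∀ i P l l', gW ξ κ X.opp R i (-P) l' = conj (gW ξ κ X R i P l) := by
    intro i P l l'
    cases hr : R i with
    | wavy j =>
      have h2 : X.opp.lt i j ↔ ¬ X.lt i j := hlt j i (hv.wavy i j hr).1.symm
      simp only [gW, hr, h2, conj_ofReal, neg_neg]
      by_cases h : X.lt i j <;> simp [h]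
    | dotted j => simp [gW, hr, dottedEnd]
    | diff => simp [gW, hr, hfree i, hfree' i]
    | _ => simp [gW, hr]
  have hgam : gam ξ κ X.opp R = conj (gam ξ κ X R) := by
    unfold gam
    rw [hchg, Lam_neg_charge, conj_Lam, ← Lam_neg_modes ξ _ _ fun L => conj (Gfun R X.m _ L)]
    congr 1
    funext L
    simp only [Gfun, htot, hneg, neg_eq_zero]
    split_ifs with h
    · rw [map_prod]
      exact prod_congr rfl fun i _ => hgW i _ _ _
    · simp
  have hloop : conj (loopPart μ R) = loopPart μ R := by simp [loopPart]
  simp only [graphW, hv, hV.2 hv, if_true, map_mul, map_prod, hloop, ← hgam, hline]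

theorem conj_coefB (κ p : ℝ) {c : Current} (hc : c ≠ three) (m : ℤ) (r : Role n) :
    conj (coefB κ p (some c) m r) = -coefB κ p (some c.dag) (-m) r := by
  have h2 : conj (2 : ℂ) = 2 := conj_ofNat 2
  cases c
  · cases r <;> simp [coefB, coef, dag, sgn, h2, neg_div]
  · cases r <;> simp [coefB, coef, dag, sgn, h2, neg_div]
  · exact absurd rfl hc

/-- Hermiticity for operators other than `J³`, in any linear order. -/
theorem conj_corr (φ : Fin n → Option Current) (m : Fin n → ℤ) (lt : Fin n → Fin n → Prop)
    (hlt : ∀ i j, i ≠ j → (lt i j ↔ ¬ lt j i)) (hφ : ∀ k, φ k = some plus ∨ φ k = some minus) :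
    (-1) ^ n * corr ξ κ p μ (fun k => (φ k).map dag) (fun k => -m k) (fun i j => lt j i) =
      conj (corr ξ κ p μ φ m lt) := by
  unfold corr
  rw [map_sum, mul_sum]
  refine sum_congr rfl fun R _ => ?_
  have hfr : frame (fun k => (φ k).map dag) (fun k => -m k) (fun i j => lt j i) =
      (frame φ m lt).opp := by
    simp only [frame, Frame.opp, Frame.mk.injEq]
    refine ⟨?_, ?_, rfl, trivial⟩
    · funext k; rcases hφ k with h | h <;> simp [h, dag, sgn]
    · funext k; rcases hφ k with h | h <;> simp [h, dag]
  rw [hfr, conj_graphW (fun k => by rcases hφ k with h | h <;> simp [frame, h]) hlt, map_mul,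
    ← mul_assoc]
  congr 1
  unfold coefProd
  rw [map_prod, show ((-1 : ℂ)) ^ n = ∏ _i : Fin n, (-1 : ℂ) by simp, ← prod_mul_distrib]
  refine prod_congr rfl fun i _ => ?_
  rcases hφ i with h | h <;> simp only [h, Option.map_some]
  · rw [conj_coefB κ p (c := plus) (by simp), neg_one_mul]
  · rw [conj_coefB κ p (c := minus) (by simp), neg_one_mul]

theorem boundaryCorr_hermitian_of_pm (w : Word) (hw : ∀ x ∈ w, x.1 ≠ three) :
    (-1) ^ w.length * boundaryCorr ξ κ p μ (adjWord w) = conj (boundaryCorr ξ κ p μ w) := by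
  have hlen : (adjWord w).length = w.length := by simp [adjWord]
  have key := conj_corr (ξ := ξ) (κ := κ) (p := p) (μ := μ)
    (fun k : Fin w.length => some (w.get k).1) (fun k => (w.get k).2) (· < ·)
    (fun i j h => ⟨fun h' => not_lt.2 h'.le, fun h' => lt_of_le_of_ne (not_lt.1 h') h⟩)
    (fun k => by
      have := hw _ (w.get_mem k)
      rcases h : (w.get k).1 <;> simp_all)
  unfold boundaryCorr
  rw [← key]
  congr 1
  symm
  have hv : ∀ i : Fin w.length, w.length - 1 - (Fin.cast hlen.symm (Fin.rev i) : ℕ) = i := by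
    intro i; simp only [Fin.val_cast, Fin.val_rev]; omega
  refine corr_embed ξ κ p μ (e := fun i => (Fin.cast hlen.symm (Fin.rev i))) ?_ ?_ ?_ ?_ ?_
  · intro i j h; simpa using h
  · intro i
    simp only [List.get_eq_getElem, adjWord, List.getElem_reverse, List.getElem_map]
    have h := hv i
    simp only [List.length_map, Option.map_some]
    congr 4
  · intro i
    simp only [List.get_eq_getElem, adjWord, List.getElem_reverse, List.getElem_map]
    have h := hv i
    simp only [List.length_map]
    congr 3
  · intro i j
    rw [Fin.lt_def, Fin.val_cast, Fin.val_cast, Fin.val_rev, Fin.val_rev, Fin.lt_def]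
    omega
  · intro x hx
    exact absurd (by simp) (hx (Fin.rev (Fin.cast hlen x)))

theorem adjWord_append (w w' : Word) : adjWord (w ++ w') = adjWord w' ++ adjWord w := by
  simp [adjWord]

/-- The modes of `J³` are commutators of those of `J⁺` and `J⁻`, so the general case reduces to
words without `J³`. -/
theorem boundaryCorr_hermitian (hξ : PosWeights ξ) (hsum : Decay ξ) (hκ : 0 < κ) :
    CorrelatorHermitian (boundaryCorr ξ κ p μ) := by
  classical
  have main : ∀ (N : ℕ) (w : Word), (w.filter fun x => decide (x.1 = three)).length = N →
      (-1) ^ w.length * boundaryCorr ξ κ p μ (adjWord w) = conj (boundaryCorr ξ κ p μ w) := by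
    intro N
    induction N with
    | zero =>
      intro w hw
      refine boundaryCorr_hermitian_of_pm w fun x hx h => ?_
      rw [List.length_eq_zero_iff, List.filter_eq_nil_iff] at hw
      exact hw x hx (by simpa using h)
    | succ N ih =>
      intro w hw
      obtain ⟨x, hx⟩ : ∃ x, x ∈ w.filter fun x => decide (x.1 = three) :=
        List.exists_mem_of_length_pos (by omega)
      rw [List.mem_filter, decide_eq_true_iff] at hx
      obtain ⟨hxw, hx3⟩ := hx
      obtain ⟨c, m⟩ := x
      simp only at hx3
      subst hx3
      obtain ⟨v, v', rfl⟩ := List.append_of_mem hxw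
      have h1 := ih (v ++ [(plus, m), (minus, 0)] ++ v') (by
        simp only [List.filter_append, List.length_append, List.filter_cons] at hw ⊢
        simp at hw ⊢; omega)
      have h2 := ih (v ++ [(minus, 0), (plus, m)] ++ v') (by
        simp only [List.filter_append, List.length_append, List.filter_cons] at hw ⊢
        simp at hw ⊢; omega)
      have r1 := boundaryCorr_plus_minus (p := p) (μ := μ) hξ hsum hκ v v' m 0
      have r2 := boundaryCorr_plus_minus (p := p) (μ := μ) hξ hsum hκ (adjWord v') (adjWord v) 0 (-m)
      have c1 : central 4 κ m 0 = 0 := by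
        unfold central; split_ifs with h
        · simp [show m = 0 by omega]
        · rfl
      have c2 : central 4 κ 0 (-m) = 0 := by simp [central]
      simp only [adjWord_append] at h1 h2 ⊢
      rw [c1, add_zero, zero_mul, add_zero] at r1
      rw [c2, zero_add, zero_mul, add_zero] at r2
      have e1 : adjWord v' ++ (adjWord [(plus, m), (minus, 0)] ++ adjWord v) =
          adjWord v' ++ [(plus, 0), (minus, -m)] ++ adjWord v := by simp [adjWord, dag]
      have e2 : adjWord v' ++ (adjWord [(minus, 0), (plus, m)] ++ adjWord v) =
          adjWord v' ++ [(minus, -m), (plus, 0)] ++ adjWord v := by simp [adjWord, dag]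
      have e3 : adjWord ((three, m) :: v') ++ adjWord v =
          adjWord v' ++ [(three, -m)] ++ adjWord v := by simp [adjWord, dag]
      have e4 : v ++ (three, m) :: v' = v ++ [(three, m)] ++ v' := by simp
      rw [e1] at h1
      rw [e2] at h2
      rw [e3, e4]
      simp only [List.length_append, List.length_cons, List.length_nil, zero_add] at h1 h2 ⊢
      have r1' := congrArg conj r1
      simp only [map_sub, map_mul, conj_I, ← h1, ← h2] at r1'
      have hI := I_mul_I
      rw [pow_add, pow_add] at r1' ⊢
      linear_combination I * (r1' - (-1) ^ v.length * (-1) ^ v'.length * r2) -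
        (conj (boundaryCorr ξ κ p μ (v ++ [(three, m)] ++ v')) + (-1) ^ v.length *
          (-1) ^ v'.length * boundaryCorr ξ κ p μ (adjWord v' ++ [(three, -m)] ++ adjWord v)) * hI
  exact fun w => main _ w rfl

end Hermitian

/-! ### The module with a Hermitian form -/

section Module

/-- The free module on words, on which the modes act by prepending a letter. -/
abbrev FreeWords : Type := Word →₀ ℂ

/-- Prepending a letter. -/
def prepend (c : Current) (m : ℤ) : Module.End ℂ FreeWords :=
  Finsupp.lmapDomain ℂ ℂ fun w => (c, m) :: w

@[simp]
theorem prepend_single (c : Current) (m : ℤ) (w : Word) (a : ℂ) :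
    prepend c m (Finsupp.single w a) = Finsupp.single ((c, m) :: w) a := by
  simp [prepend, Finsupp.lmapDomain_apply]

/-- The sesquilinear form on words given by the correlators `C`. -/
def wordForm (C : Word → ℂ) : FreeWords →ₗ⋆[ℂ] FreeWords →ₗ[ℂ] ℂ :=
  Finsupp.lsum ℂ fun v =>
    { toFun := fun a => conj a • Finsupp.linearCombination ℂ fun w =>
        (-1) ^ v.length * C (adjWord v ++ w)
      map_add' := fun a b => by rw [map_add, add_smul]
      map_smul' := fun a b => by rw [smul_eq_mul, map_mul, mul_smul] }

theorem wordForm_single (C : Word → ℂ) (v w : Word) (a b : ℂ) :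
    wordForm C (Finsupp.single v a) (Finsupp.single w b) =
      conj a * (b * ((-1) ^ v.length * C (adjWord v ++ w))) := by
  simp [wordForm]

theorem adjWord_adjWord (w : Word) : adjWord (adjWord w) = w := by
  have h : (fun x : Current × ℤ => (x.1.dag.dag, x.2)) = id := by
    funext x; obtain ⟨c, m⟩ := x; cases c <;> simp [dag]
  simp [adjWord, ← List.map_reverse, comp_def, h]

theorem length_adjWord (w : Word) : (adjWord w).length = w.length := by simp [adjWord]

variable {C : Word → ℂ}

theorem wordForm_hermitian (hC : CorrelatorHermitian C) (x y : FreeWords) :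
    wordForm C y x = conj (wordForm C x y) := by
  induction x using Finsupp.induction_linear with
  | zero => simp
  | add x x' h h' => simp [h, h']
  | single v a =>
    induction y using Finsupp.induction_linear with
    | zero => simp
    | add y y' h h' => simp [h, h']
    | single w b =>
      have h := hC (adjWord v ++ w)
      rw [adjWord_append, adjWord_adjWord, List.length_append, length_adjWord, pow_add] at h
      have h1 : ((-1 : ℂ)) ^ v.length * (-1) ^ v.length = 1 := by rw [← mul_pow]; simp
      simp only [wordForm_single, map_mul, map_pow, map_neg, map_one, conj_conj, ← h]
      linear_combination (-(conj b * a * (-1) ^ w.length * C (adjWord w ++ v))) * h1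

theorem wordForm_prepend (c : Current) (m : ℤ) (x y : FreeWords) :
    wordForm C (prepend c m x) y = -wordForm C x (prepend c.dag (-m) y) := by
  induction x using Finsupp.induction_linear with
  | zero => simp
  | add x x' h h' => simp only [map_add, LinearMap.add_apply, h, h', neg_add]
  | single v a =>
    induction y using Finsupp.induction_linear with
    | zero => simp
    | add y y' h h' => simp only [map_add, h, h', neg_add]
    | single w b =>
      simp only [prepend_single, wordForm_single, List.length_cons, pow_succ]
      have : adjWord ((c, m) :: v) ++ w = adjWord v ++ (c.dag, -m) :: w := by simp [adjWord]
      rw [this]; ring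

/-- The radical of the form. -/
def radical (C : Word → ℂ) : Submodule ℂ FreeWords := LinearMap.ker (wordForm C)

/-- The module defined by the correlators. -/
abbrev QuotWords (C : Word → ℂ) : Type := FreeWords ⧸ radical C

theorem radical_le_comap (c : Current) (m : ℤ) : radical C ≤ (radical C).comap (prepend c m) := by
  intro x hx
  rw [radical, LinearMap.mem_ker] at hx
  rw [Submodule.mem_comap, radical, LinearMap.mem_ker]
  refine LinearMap.ext fun y => ?_
  simp [wordForm_prepend, hx]

/-- The action of the modes. -/
def modeOp (C : Word → ℂ) (c : Current) (m : ℤ) : Module.End ℂ (QuotWords C) :=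
  (radical C).mapQ (radical C) (prepend c m) (radical_le_comap c m)

/-- The class of a word. -/
def wordClass (C : Word → ℂ) (w : Word) : QuotWords C :=
  (radical C).mkQ (Finsupp.single w 1)

theorem modeOp_wordClass (c : Current) (m : ℤ) (w : Word) :
    modeOp C c m (wordClass C w) = wordClass C ((c, m) :: w) := by
  simp [modeOp, wordClass]

theorem wordOp_ext {A B : Module.End ℂ (QuotWords C)}
    (h : ∀ w, A (wordClass C w) = B (wordClass C w)) : A = B := by
  refine Submodule.linearMap_qext _ (Finsupp.lhom_ext' fun w => LinearMap.ext_ring ?_)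
  exact h w

theorem applyWord_modeOp (w v : Word) :
    applyWord (modeOp C) w (wordClass C v) = wordClass C (w ++ v) := by
  induction w with
  | nil => rfl
  | cons x w ih =>
    change modeOp C x.1 x.2 (applyWord (modeOp C) w (wordClass C v)) = _
    rw [ih, modeOp_wordClass]; rfl

theorem span_wordClass : Submodule.span ℂ (Set.range (wordClass C)) = ⊤ := by
  rw [eq_top_iff]
  rintro x -
  obtain ⟨x, rfl⟩ := (radical C).mkQ_surjective x
  induction x using Finsupp.induction_linear with
  | zero => simp
  | add x x' h h' => rw [map_add]; exact Submodule.add_mem _ h h'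
  | single w a =>
    rw [← mul_one a, ← smul_eq_mul, ← Finsupp.smul_single, map_smul]
    exact Submodule.smul_mem _ _ (Submodule.subset_span ⟨w, rfl⟩)

/-- The form on the quotient. -/
def quotForm (hC : CorrelatorHermitian C) : QuotWords C →ₗ⋆[ℂ] QuotWords C →ₗ[ℂ] ℂ :=
  (radical C).liftQ
    { toFun := fun x => (radical C).liftQ (wordForm C x) fun y hy => by
        rw [radical, LinearMap.mem_ker] at hy
        rw [LinearMap.mem_ker, wordForm_hermitian hC, hy]; simp
      map_add' := fun x y => by ext; simp
      map_smul' := fun a x => by ext; simp }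
    fun x hx => by
      rw [radical, LinearMap.mem_ker] at hx
      rw [LinearMap.mem_ker]; ext; simp [hx]

theorem quotForm_mk (hC : CorrelatorHermitian C) (x y : FreeWords) :
    quotForm hC ((radical C).mkQ x) ((radical C).mkQ y) = wordForm C x y := rfl

theorem mkQ_eq_of_form (hC : CorrelatorHermitian C) {x y : FreeWords}
    (h : ∀ v : Word, wordForm C (Finsupp.single v 1) x = wordForm C (Finsupp.single v 1) y) :
    (radical C).mkQ x = (radical C).mkQ y := by
  rw [Submodule.mkQ_apply, Submodule.mkQ_apply, Submodule.Quotient.eq, radical, LinearMap.mem_ker]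
  refine LinearMap.ext fun z => ?_
  rw [wordForm_hermitian hC]
  induction z using Finsupp.induction_linear with
  | zero => simp
  | add z z' h h' => simp only [map_add, LinearMap.add_apply, h, h', LinearMap.zero_apply, add_zero]
  | single w a =>
    rw [← mul_one a, ← smul_eq_mul, ← Finsupp.smul_single, LinearMap.map_smulₛₗ,
      LinearMap.smul_apply, map_sub, h w]
    simp

theorem definesModule {κ : ℝ} (hR : CorrelatorRelations κ C) (hC : CorrelatorHermitian C) :
    DefinesModule κ C := by
  have key : ∀ {x y : FreeWords}, (∀ v : Word, wordForm C (Finsupp.single v 1) x =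
      wordForm C (Finsupp.single v 1) y) → (radical C).mkQ x = (radical C).mkQ y :=
    fun h => mkQ_eq_of_form hC h
  have hw : ∀ w, wordClass C w = (radical C).mkQ (Finsupp.single w 1) := fun _ => rfl
  refine ⟨QuotWords C, inferInstance, inferInstance, modeOp C, wordClass C [], quotForm hC,
    ⟨?_, ?_, ?_, ?_, ?_, ?_⟩, ⟨?_, ?_⟩, ?_, ?_⟩
  · intro m n
    refine wordOp_ext fun w => ?_
    simp only [LinearMap.sub_apply, LinearMap.add_apply, LinearMap.smul_apply, Module.End.mul_apply,
      Module.End.one_apply, modeOp_wordClass]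
    simp only [hw, ← map_sub, ← map_smul, ← map_add]
    refine key fun v => ?_
    simp only [map_sub, map_add, map_smul, wordForm_single, smul_eq_mul]
    have := hR.plus_minus (adjWord v) w m n
    simp only [List.append_assoc, List.cons_append, List.nil_append] at this
    linear_combination conj (1 : ℂ) * (-1) ^ v.length * this
  · intro m n
    refine wordOp_ext fun w => ?_
    simp only [LinearMap.sub_apply, LinearMap.smul_apply, Module.End.mul_apply,
      Module.End.one_apply, modeOp_wordClass]
    simp only [hw, ← map_sub, ← map_smul]
    refine key fun v => ?_
    simp only [map_sub, map_smul, wordForm_single, smul_eq_mul]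
    have := hR.three_three (adjWord v) w m n
    simp only [List.append_assoc, List.cons_append, List.nil_append] at this
    linear_combination conj (1 : ℂ) * (-1) ^ v.length * this
  · intro m n
    refine wordOp_ext fun w => ?_
    simp only [LinearMap.sub_apply, LinearMap.smul_apply, Module.End.mul_apply, modeOp_wordClass]
    simp only [hw, ← map_sub, ← map_smul]
    refine key fun v => ?_
    simp only [map_sub, map_smul, wordForm_single, smul_eq_mul]
    have := hR.three_plus (adjWord v) w m n
    simp only [List.append_assoc, List.cons_append, List.nil_append] at this
    linear_combination conj (1 : ℂ) * (-1) ^ v.length * this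
  · intro m n
    refine wordOp_ext fun w => ?_
    simp only [LinearMap.sub_apply, LinearMap.smul_apply, Module.End.mul_apply, modeOp_wordClass]
    simp only [hw, ← map_sub, ← map_smul]
    refine key fun v => ?_
    simp only [map_sub, map_smul, wordForm_single, smul_eq_mul]
    have := hR.three_minus (adjWord v) w m n
    simp only [List.append_assoc, List.cons_append, List.nil_append] at this
    linear_combination conj (1 : ℂ) * (-1) ^ v.length * this
  · intro m n
    refine wordOp_ext fun w => ?_
    simp only [Module.End.mul_apply, modeOp_wordClass]
    refine key fun v => ?_
    simp only [wordForm_single]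
    have := hR.plus_plus (adjWord v) w m n
    simp only [List.append_assoc, List.cons_append, List.nil_append] at this
    rw [this]
  · intro m n
    refine wordOp_ext fun w => ?_
    simp only [Module.End.mul_apply, modeOp_wordClass]
    refine key fun v => ?_
    simp only [wordForm_single]
    have := hR.minus_minus (adjWord v) w m n
    simp only [List.append_assoc, List.cons_append, List.nil_append] at this
    rw [this]
  · intro x y
    obtain ⟨x, rfl⟩ := (radical C).mkQ_surjective x
    obtain ⟨y, rfl⟩ := (radical C).mkQ_surjective y
    exact wordForm_hermitian hC x y
  · intro c m x y
    obtain ⟨x, rfl⟩ := (radical C).mkQ_surjective x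
    obtain ⟨y, rfl⟩ := (radical C).mkQ_surjective y
    exact wordForm_prepend c m x y
  · simp only [applyWord_modeOp, List.append_nil]
    exact span_wordClass
  · intro w
    rw [applyWord_modeOp, List.append_nil, hw, hw, quotForm_mk, wordForm_single]
    simp [adjWord]

end Module

/-! ### Fourier expansions of the kernels inside the disc -/

section Kernels

theorem summable_geom_int {s : ℝ} (h0 : 0 ≤ s) (h1 : s < 1) (k : ℕ) :
    Summable fun N : ℤ => s ^ N.natAbs * (1 + |(N : ℝ)|) ^ k := by
  have key : Summable fun n : ℕ => s ^ n * (1 + (n : ℝ)) ^ k := by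
    have h := fun j : ℕ => summable_pow_mul_geometric_of_norm_lt_one j
      (show ‖s‖ < 1 by rwa [Real.norm_of_nonneg h0])
    have h2 : Summable fun n : ℕ => ∑ j ∈ range (k + 1),
        (k.choose j : ℝ) * ((n : ℝ) ^ j * s ^ n) :=
      summable_sum fun j _ => (h j).mul_left _
    refine h2.congr fun n => ?_
    rw [add_comm (1 : ℝ), add_pow, mul_sum]
    exact sum_congr rfl fun j _ => by rw [one_pow]; ring
  refine summable_int_of_nat ?_ ?_
  · simpa using key
  · simpa using key

/-- The point with polar coordinates `ρ`, `x`. -/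
def pt (ρ x : ℝ) : ℂ := ρ * exp (I * x)

/-- The character `x ↦ e^{iNx}`. -/
def chr (N : ℤ) (x : ℝ) : ℂ := exp (I * (N * x))

theorem norm_chr (N : ℤ) (x : ℝ) : ‖chr N x‖ = 1 := by
  rw [chr, show I * ((N : ℂ) * x) = ((N * x : ℝ) : ℂ) * I by push_cast; ring,
    norm_exp_ofReal_mul_I]

theorem chr_add (N N' : ℤ) (x : ℝ) : chr (N + N') x = chr N x * chr N' x := by
  rw [chr, chr, chr, ← exp_add]; push_cast; ring_nf

theorem chr_zero (x : ℝ) : chr 0 x = 1 := by simp [chr]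

theorem chr_sub_angle (N : ℤ) (x y : ℝ) : chr N (x - y) = chr N x * chr (-N) y := by
  rw [chr, chr, chr, ← exp_add]; push_cast; ring_nf

theorem chr_sum {α : Type} (s : Finset α) (f : α → ℤ) (x : ℝ) :
    chr (∑ a ∈ s, f a) x = ∏ a ∈ s, chr (f a) x := by
  rw [chr]; simp only [chr]
  rw [← exp_sum]; push_cast; rw [sum_mul, mul_sum]

/-- The terms of the kernels, as functions of the product of the radii and of the angle. -/
def kTerm (s θ : ℝ) (N : ℤ) : ℂ := (s : ℂ) ^ N.natAbs * chr N θ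

theorem conj_chr (N : ℤ) (x : ℝ) : conj (chr N x) = chr (-N) x := by
  rw [chr, chr, ← exp_conj]
  simp

theorem pt_eq (ρ x : ℝ) : pt ρ x = ρ * chr 1 x := by simp [pt, chr]

theorem chr_pow (N : ℤ) (x : ℝ) (n : ℕ) : chr N x ^ n = chr (n * N) x := by
  rw [chr, chr, ← exp_nat_mul]; push_cast; ring_nf

theorem pt_mul_conj_pow (ρ σ x y : ℝ) (n : ℕ) :
    (pt ρ x * conj (pt σ y)) ^ n = kTerm (ρ * σ) (x - y) n := by
  rw [pt_eq, pt_eq, map_mul, conj_chr, conj_ofReal, kTerm, chr_sub_angle]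
  simp only [mul_pow, chr_pow, Int.natAbs_natCast, ofReal_mul, mul_one, mul_neg]
  ring

theorem conj_pt_mul_pow (ρ σ x y : ℝ) (n : ℕ) :
    (conj (pt ρ x) * pt σ y) ^ n = kTerm (ρ * σ) (x - y) (-n) := by
  rw [pt_eq, pt_eq, map_mul, conj_chr, conj_ofReal, kTerm, chr_sub_angle]
  simp only [mul_pow, chr_pow, Int.natAbs_neg, Int.natAbs_natCast, ofReal_mul, mul_one,
    mul_neg, neg_neg]
  ring

theorem norm_kTerm {s : ℝ} (hs : 0 ≤ s) (θ : ℝ) (N : ℤ) : ‖kTerm s θ N‖ = s ^ N.natAbs := by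
  rw [kTerm, norm_mul, norm_chr, norm_pow, norm_real, Real.norm_of_nonneg hs, mul_one]

theorem summable_kTerm {s : ℝ} (h0 : 0 ≤ s) {c : ℤ → ℂ}
    (hc : Summable fun N => ‖c N‖ * s ^ N.natAbs) (θ : ℝ) : Summable fun N => c N * kTerm s θ N :=
  Summable.of_norm <| hc.congr fun N => by rw [norm_mul, norm_kTerm h0]

theorem tsum_int_split {f : ℤ → ℂ} (hf : Summable f) (h0 : f 0 = 0) :
    ∑' N, f N = ∑' n : ℕ, (f ((n + 1 : ℕ) : ℤ) + f (-((n + 1 : ℕ) : ℤ))) := by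
  have h1 : Summable fun n : ℕ => f n := hf.comp_injective Nat.cast_injective
  have h2 : Summable fun n : ℕ => f (-((n : ℤ) + 1)) :=
    hf.comp_injective (i := fun n : ℕ => -((n : ℤ) + 1)) fun a b h => by
      simp only at h; omega
  rw [tsum_of_nat_of_neg_add_one h1 h2, h1.tsum_eq_zero_add]
  have h3 : Summable fun n : ℕ => f ((n + 1 : ℕ) : ℤ) := (summable_nat_add_iff 1).2 h1
  rw [Nat.cast_zero, h0, zero_add, ← h3.tsum_add (by simpa using h2)]
  exact tsum_congr fun n => by push_cast; rfl

variable {ρ σ x y : ℝ}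

theorem deltaKer_eq (h0 : 0 ≤ ρ * σ) (h1 : ρ * σ < 1) :
    deltaKer (pt ρ x) (pt σ y) = ∑' N, kTerm (ρ * σ) (x - y) N := by
  have hf : Summable fun N => kTerm (ρ * σ) (x - y) N := by
    have := summable_kTerm (c := fun _ => 1) h0 (by simpa using summable_geom_int h0 h1 0) (x - y)
    simpa using this
  unfold deltaKer
  simp only [pt_mul_conj_pow, conj_pt_mul_pow]
  rw [tsum_of_nat_of_neg_add_one (hf.comp_injective Nat.cast_injective)
    (hf.comp_injective (i := fun n : ℕ => -((n : ℤ) + 1)) fun a b h => by simp only at h; omega)]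
  congr 1

theorem xiHat_natCast (ξ : ℕ → ℝ) (n : ℕ) : xiHat ξ ((n + 1 : ℕ) : ℤ) = ξ (n + 1) := by
  rw [xiHat, if_neg (by omega)]; rfl

theorem xiHat_neg (ξ : ℕ → ℝ) (j : ℤ) : xiHat ξ (-j) = xiHat ξ j := by simp [xiHat]

theorem covN_eq {ξ : ℕ → ℝ} (h0 : 0 ≤ ρ * σ)
    (hs : Summable fun j : ℤ => ‖(xiHat ξ j : ℂ)‖ * (ρ * σ) ^ j.natAbs) :
    covN ξ (pt ρ x) (pt σ y) = ∑' j : ℤ, xiHat ξ j * kTerm (ρ * σ) (x - y) j := by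
  rw [tsum_int_split (summable_kTerm (c := fun j => (xiHat ξ j : ℂ)) h0 hs _) (by simp [xiHat])]
  unfold covN
  refine tsum_congr fun n => ?_
  rw [pt_mul_conj_pow, conj_pt_mul_pow, xiHat_neg, xiHat_natCast, mul_add]

/-- The Fourier coefficients of a dotted line, up to the powers of the radii. -/
def dotCoef (ξ : ℕ → ℝ) (N : ℤ) : ℝ := if N = 0 then 0 else (ξ N.natAbs)⁻¹

theorem dotD_eq {ξ : ℕ → ℝ} {M : ℕ} : dotD ξ M (pt ρ x) (pt σ y) =
      ∑' N : ℤ, (if M < N.natAbs then 0 else (dotCoef ξ N : ℂ)) * kTerm (ρ * σ) (x - y) N := by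
  rw [tsum_int_split]
  · rw [tsum_eq_sum (s := range M)]
    · unfold dotD
      rw [range_eq_Ico, sum_Ico_add' (fun n : ℕ =>
        (if M < ((n : ℕ) : ℤ).natAbs then 0 else (dotCoef ξ (n : ℕ) : ℂ)) *
          kTerm (ρ * σ) (x - y) (n : ℕ) + (if M < (-((n : ℕ) : ℤ)).natAbs then 0 else
            (dotCoef ξ (-((n : ℕ) : ℤ)) : ℂ)) * kTerm (ρ * σ) (x - y) (-((n : ℕ) : ℤ))) 0 M 1]
      refine sum_congr (by ext; simp [mem_Ico]) fun n hn => ?_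
      rw [mem_Ico] at hn
      have h1 : ¬ M < n := by omega
      have h2 : n ≠ 0 := by omega
      simp only [Int.natAbs_neg, Int.natAbs_natCast, h1, if_false, dotCoef, neg_eq_zero,
        Nat.cast_eq_zero, h2, pt_mul_conj_pow, conj_pt_mul_pow, ofReal_inv]
      ring
    · intro n hn
      have : M < n + 1 := by simpa [Nat.lt_succ_iff] using hn
      simp only [Int.natAbs_neg, Int.natAbs_natCast, this, if_true, zero_mul, add_zero]
  · refine summable_of_hasFiniteSupport ((Icc (-(M : ℤ)) M).finite_toSet.subset fun N hN => ?_)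
    by_contra hc
    refine hN ?_
    have : M < N.natAbs := by
      simp only [coe_Icc, Set.mem_Icc, not_and_or, not_le] at hc; omega
    simp [this]
  · simp [dotCoef]

/-- The Fourier coefficients of a wavy line, up to the powers of the radii. -/
def wavyCoef (N : ℤ) : ℝ := 2 * κ * max (N : ℝ) 0

theorem wavyW_eq {κ : ℝ} (h0 : 0 ≤ ρ * σ) (h1 : ρ * σ < 1) :
    wavyW κ (pt ρ x) (pt σ y) = ∑' N : ℤ, (wavyCoef κ N : ℂ) * kTerm (ρ * σ) (x - y) N := by
  rw [tsum_int_split (summable_kTerm h0 ?_ _) (by simp [wavyCoef])]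
  · unfold wavyW
    refine tsum_congr fun n => ?_
    rw [pt_mul_conj_pow]
    have h2 : max (((n + 1 : ℕ) : ℤ) : ℝ) 0 = n + 1 := by
      push_cast; exact max_eq_left (by positivity)
    have h3 : max ((-((n + 1 : ℕ) : ℤ) : ℤ) : ℝ) 0 = 0 := by
      push_cast; exact max_eq_right (by linarith [(n.cast_nonneg : (0 : ℝ) ≤ n)])
    rw [wavyCoef, wavyCoef, h2, h3]
    push_cast; ring
  · refine Summable.of_nonneg_of_le (fun N => by positivity) (fun N => ?_)
      ((summable_geom_int h0 h1 1).mul_left (2 * |κ|))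
    rw [norm_real, wavyCoef, norm_mul, norm_mul, Real.norm_ofNat, Real.norm_eq_abs,
      Real.norm_of_nonneg (le_max_right _ _), pow_one]
    have : max (N : ℝ) 0 ≤ 1 + |(N : ℝ)| := max_le (by linarith [le_abs_self (N : ℝ)]) (by positivity)
    nlinarith [mul_le_mul_of_nonneg_left this (show 0 ≤ 2 * |κ| * (ρ * σ) ^ N.natAbs by positivity)]

end Kernels

/-! ### The correlator of exponentials inside the disc -/

section Exponentials

variable {ι : Type} [Fintype ι]

/-- The coefficient of a term of the Fourier expansion of the correlator of exponentials. -/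
def expCoef (ξ : ℕ → ℝ) (ρ : ι → ℝ) (q : ι → ℤ) (x : Σ t : Seqs, Fin t.1 → ι × ι) : ℂ :=
  seqW ξ x.1 * ∏ i, pairW ρ q (x.1.2 i) (x.2 i)

/-- A bound for the momenta of a term. -/
def momBound (x : Σ t : Seqs, Fin t.1 → ι × ι) : ℝ := ∏ i, (1 + |(x.1.2 i : ℝ)|)

theorem summable_xiHat_geom {ξ : ℕ → ℝ} (hξ : PosWeights ξ)
    (hsum : Decay ξ) {s : ℝ} (h0 : 0 ≤ s) (h1 : s < 1) (k : ℕ) :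
    Summable fun j : ℤ => xiHat ξ j * (s ^ j.natAbs * (1 + |(j : ℝ)|) ^ k) := by
  set C := ∑' j : ℤ, s ^ j.natAbs * (1 + |(j : ℝ)|) ^ k
  refine Summable.of_nonneg_of_le
    (fun j => mul_nonneg (xiHat_nonneg hξ j) (by positivity)) (fun j => ?_)
    ((summable_xiHat_weight hξ hsum).mul_right C)
  have h2 : s ^ j.natAbs * (1 + |(j : ℝ)|) ^ k ≤ C :=
    (summable_geom_int h0 h1 k).le_tsum j fun _ _ => by positivity
  have h3 : xiHat ξ j ≤ xiHat ξ j * (1 + |(j : ℝ)|) :=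
    le_mul_of_one_le_right (xiHat_nonneg hξ j) (by linarith [abs_nonneg (j : ℝ)])
  exact mul_le_mul h3 h2 (by positivity) ((xiHat_nonneg hξ j).trans h3)

variable {ξ : ℕ → ℝ} (hξ : PosWeights ξ) (hsum : Decay ξ)
  {ρ : ι → ℝ} (h0 : ∀ a, 0 ≤ ρ a) (h1 : ∀ a, ρ a < 1) (q : ι → ℤ)

include hξ hsum h0 h1

theorem summable_pair_geom (k : ℕ) :
    Summable fun j : ℤ => xiHat ξ j * (∑ x, ‖pairW ρ q j x‖) * (1 + |(j : ℝ)|) ^ k := by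
  have : ∀ x : ι × ι, Summable fun j : ℤ =>
      xiHat ξ j * ‖pairW ρ q j x‖ * (1 + |(j : ℝ)|) ^ k := by
    intro x
    have hs1 : ρ x.1 * ρ x.2 < 1 := by nlinarith [h0 x.1, h0 x.2, h1 x.1, h1 x.2]
    have hs0 := mul_nonneg (h0 x.1) (h0 x.2)
    refine ((summable_xiHat_geom hξ hsum hs0 hs1 k).mul_left
      ‖-(1 / 2) * (q x.1 : ℂ) * (q x.2 : ℂ)‖).congr fun j => ?_
    rw [pairW, norm_mul _ (_ ^ j.natAbs), norm_pow, norm_real, Real.norm_of_nonneg hs0]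
    ring
  refine (summable_sum fun x (_ : x ∈ univ) => this x).congr fun j => ?_
  rw [mul_sum, sum_mul]

theorem summable_expCoef (k : ℕ) : Summable fun x => ‖expCoef ξ ρ q x‖ * momBound x ^ k := by
  refine (summable_sigma_of_nonneg fun x => ?_).2 ⟨fun t => Summable.of_finite, ?_⟩
  · exact mul_nonneg (norm_nonneg _) (pow_nonneg (prod_nonneg fun _ _ => by positivity) _)
  set Y : ℤ → ℝ := fun j => xiHat ξ j * (∑ x, ‖pairW ρ q j x‖) * (1 + |(j : ℝ)|) ^ k with hY
  have hY0 : ∀ j, 0 ≤ Y j := fun j =>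
    mul_nonneg (mul_nonneg (xiHat_nonneg hξ j) (sum_nonneg fun _ _ => norm_nonneg _))
      (by positivity)
  have hs := summable_pair_geom hξ hsum h0 h1 q k
  refine (summable_norm_exp_seqs (fun j => (Y j : ℂ)) (hs.congr fun j => by
    rw [norm_real, Real.norm_of_nonneg (hY0 j)])).congr fun t => ?_
  rw [tsum_fintype]
  simp only [expCoef, momBound, seqW, norm_mul, norm_prod, norm_real,
    Real.norm_of_nonneg (hY0 _), ← prod_pow]
  simp only [hY, prod_mul_distrib, prod_univ_sum, Fintype.piFinset_univ,
    Real.norm_of_nonneg (xiHat_nonneg hξ _)]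
  rw [mul_sum, sum_mul, mul_sum]
  exact sum_congr rfl fun _ _ => by ring

theorem expCorr_eq (U : ι → ℝ) : expCorr ξ q (fun a => pt (ρ a) (U a)) =
      if ∑ a, q a = 0 then ∑' x, expCoef ξ ρ q x * ∏ a, chr (mom x.1 x.2 a) (U a) else 0 := by
  unfold expCorr
  split_ifs with hq
  swap
  · rfl
  set y : ℤ → ℂ := fun j => ∑ x : ι × ι,
    xiHat ξ j * (pairW ρ q j x * chr j (U x.1 - U x.2)) with hy
  have hynorm : Summable fun j => ‖y j‖ := by
    refine Summable.of_nonneg_of_le (fun _ => norm_nonneg _) (fun j => ?_)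
      (summable_pair_geom hξ hsum h0 h1 q 0)
    refine (norm_sum_le _ _).trans ?_
    rw [pow_zero, mul_one, mul_sum]
    refine sum_le_sum fun x _ => ?_
    rw [norm_mul, norm_mul, norm_chr, mul_one, norm_real,
      Real.norm_of_nonneg (xiHat_nonneg hξ j)]
  have hexp : -(1 / 2) * ∑ a, ∑ b, (q a : ℂ) * (q b : ℂ) *
      covN ξ (pt (ρ a) (U a)) (pt (ρ b) (U b)) = ∑' j, y j := by
    have hs : ∀ a b, Summable fun j : ℤ => ‖(xiHat ξ j : ℂ)‖ * (ρ a * ρ b) ^ j.natAbs := by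
      intro a b
      refine (summable_xiHat_geom hξ hsum (mul_nonneg (h0 a) (h0 b))
        (by nlinarith [h0 a, h0 b, h1 a, h1 b] : ρ a * ρ b < 1) 0).congr fun j => ?_
      rw [norm_real, Real.norm_of_nonneg (xiHat_nonneg hξ j), pow_zero, mul_one]
    simp only [hy]
    rw [Summable.tsum_finsetSum]
    · rw [Fintype.sum_prod_type, mul_sum]
      refine sum_congr rfl fun a _ => ?_
      rw [mul_sum]
      refine sum_congr rfl fun b _ => ?_
      rw [covN_eq (mul_nonneg (h0 a) (h0 b)) (hs a b), ← mul_assoc, ← tsum_mul_left]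
      refine tsum_congr fun j => ?_
      simp only [pairW, kTerm]; push_cast; ring
    · rintro ⟨a, b⟩ -
      refine (summable_kTerm (mul_nonneg (h0 a) (h0 b)) (hs a b) (U a - U b)).mul_left
        (-(1 / 2) * (q a : ℂ) * (q b : ℂ)) |>.congr fun j => ?_
      simp only [pairW, kTerm]; push_cast; ring
  rw [hexp, ← (hasSum_exp_seqs y hynorm).tsum_eq]
  have hSum : Summable fun x => expCoef ξ ρ q x * ∏ a, chr (mom x.1 x.2 a) (U a) := by
    refine Summable.of_norm ((summable_expCoef hξ hsum h0 h1 q 0).congr fun x => ?_)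
    rw [norm_mul, norm_prod]; simp [norm_chr]
  rw [hSum.tsum_sigma' fun t => Summable.of_finite]
  refine tsum_congr fun t => ?_
  rw [tsum_fintype]
  simp only [hy, prod_univ_sum, Fintype.piFinset_univ, mul_sum]
  refine sum_congr rfl fun p _ => ?_
  have hm : ∏ a, chr (mom t p a) (U a) = ∏ i, chr (t.2 i) (U (p i).1 - U (p i).2) := by
    simp only [mom, chr_sum]
    rw [Finset.prod_comm]
    refine prod_congr rfl fun i _ => ?_
    classical
    have h : ∀ a, chr (t.2 i * ((if (p i).1 = a then 1 else 0) - if (p i).2 = a then 1 else 0)) (U a) =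
        (if (p i).1 = a then chr (t.2 i) (U a) else 1) *
          if (p i).2 = a then chr (-t.2 i) (U a) else 1 := by
      intro a
      split_ifs <;> simp [← chr_add, chr_zero]
    simp only [h, prod_mul_distrib, prod_ite_eq, mem_univ, if_true,
      chr_sub_angle]
  simp only [expCoef, seqW, hm, prod_mul_distrib]
  ring

end Exponentials

/-! ### Derivatives and integrals of the expansions -/

section Characters

theorem continuous_chr (N : ℤ) : Continuous (chr N) := by unfold chr; fun_prop

theorem hasDerivAt_chr (N : ℤ) (x : ℝ) : HasDerivAt (chr N) (I * N * chr N x) x := by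
  have h : HasDerivAt (fun x : ℝ => I * ((N : ℂ) * (x : ℂ))) (I * N) x := by
    simpa using (((hasDerivAt_id x).ofReal_comp).const_mul (N : ℂ)).const_mul I
  exact (h.cexp).congr_deriv (by rw [chr, mul_comm])

variable {Λ : Type} {c : Λ → ℂ} (K : Λ → Fin n → ℤ)

theorem continuous_tsum_chr (hc : Summable fun l => ‖c l‖) :
    Continuous fun u : Fin n → ℝ => ∑' l, c l * ∏ k, chr (K l k) (u k) := by
  refine continuous_tsum (fun l => ?_) hc fun l u => ?_
  · exact continuous_const.mul (continuous_finsetProd _ fun k _ =>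
      (continuous_chr _).comp (continuous_apply k))
  · rw [norm_mul, norm_prod]; simp [norm_chr]

theorem mode_tsum_chr [Countable Λ] (hc : Summable fun l => ‖c l‖) (m : Fin n → ℤ) :
    ((2 * Real.pi : ℝ) : ℂ)⁻¹ ^ n *
      ∫ u in Set.Icc (0 : Fin n → ℝ) (fun _ => 2 * Real.pi),
        (∑' l, c l * ∏ k, chr (K l k) (u k)) * exp (I * ∑ k, (m k : ℂ) * (u k : ℂ)) =
      ∑' l, c l * if ∀ k, K l k + m k = 0 then 1 else 0 := by
  have hexp : ∀ l (u : Fin n → ℝ), (c l * ∏ k, chr (K l k) (u k)) *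
      exp (I * ∑ k, (m k : ℂ) * (u k : ℂ)) =
      c l * exp (I * ∑ k, (((K l + m) k : ℤ) : ℂ) * (u k : ℂ)) := by
    intro l u
    simp only [chr]
    rw [mul_assoc, ← exp_sum, ← exp_add, ← mul_sum, ← mul_add,
      ← sum_add_distrib]
    congr 5
    funext k; simp only [Pi.add_apply]; push_cast; ring
  simp only [← tsum_mul_right, hexp]
  rw [← MeasureTheory.integral_tsum_of_summable_integral_norm]
  · rw [← tsum_mul_left]
    refine tsum_congr fun l => ?_
    rw [MeasureTheory.integral_const_mul, mul_left_comm, integral_torus_character]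
    congr 1
    exact if_congr ⟨fun h k => congrFun h k, fun h => funext h⟩ rfl rfl
  · intro l
    exact (Continuous.continuousOn (by fun_prop)).integrableOn_Icc
  · have : ∀ l (u : Fin n → ℝ),
        ‖c l * exp (I * ∑ k, (((K l + m) k : ℤ) : ℂ) * (u k : ℂ))‖ = ‖c l‖ := by
      intro l u
      rw [norm_mul, show I * ∑ k, (((K l + m) k : ℤ) : ℂ) * (u k : ℂ) =
        ((∑ k, ((K l + m) k : ℝ) * u k : ℝ) : ℂ) * I by push_cast; ring,
        norm_exp_ofReal_mul_I, mul_one]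
    simp only [this, MeasureTheory.integral_const, smul_eq_mul]
    exact hc.mul_left _

end Characters

section Vertices

variable (tgt : Fin n → Option (Fin n)) (β γ : Fin n → ℂ)

/-- The lines that end at `k`. -/
def inc (k : Fin n) : Finset (Fin n) := univ.filter fun i => tgt i = some k

/-- The dependence of a term of the expansion on the second point `x` of the vertex `k`, whose first
point is at the angle `y`, when the momenta `N` flow through the lines. -/
def vtx (k : Fin n) (l : ℤ) (N : Fin n → ℤ) (y x : ℝ) : ℂ :=
  chr l x * ∏ i ∈ inc tgt k, (β i * chr (-N i) y + γ i * chr (-N i) x)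

/-- The derivative of `vtx`. -/
def vtxDeriv (k : Fin n) (l : ℤ) (N : Fin n → ℤ) (y x : ℝ) : ℂ :=
  I * l * chr l x * ∏ i ∈ inc tgt k, (β i * chr (-N i) y + γ i * chr (-N i) x) +
    chr l x * ∑ i ∈ inc tgt k, (∏ j ∈ (inc tgt k).erase i,
      (β j * chr (-N j) y + γ j * chr (-N j) x)) * (γ i * (I * (-N i : ℤ) * chr (-N i) x))

/-- The value of the derivative of `vtx` where the two points coincide, up to a character. -/
def vtxCoef (k : Fin n) (l : ℤ) (N : Fin n → ℤ) : ℂ :=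
  I * l * ∏ i ∈ inc tgt k, (β i + γ i) +
    ∑ i ∈ inc tgt k, (∏ j ∈ (inc tgt k).erase i, (β j + γ j)) * (γ i * (I * (-N i : ℤ)))

theorem hasDerivAt_vtx (k : Fin n) (l : ℤ) (N : Fin n → ℤ) (y x : ℝ) :
    HasDerivAt (vtx tgt β γ k l N y) (vtxDeriv tgt β γ k l N y x) x := by
  have h := (hasDerivAt_chr l x).mul (HasDerivAt.fun_finsetProd (u := inc tgt k)
    (f := fun i x => β i * chr (-N i) y + γ i * chr (-N i) x)
    fun i _ => ((hasDerivAt_chr (-N i) x).const_mul (γ i)).const_add (β i * chr (-N i) y))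
  refine h.congr_deriv ?_
  simp [vtxDeriv]

theorem vtx_self (k : Fin n) (l : ℤ) (N : Fin n → ℤ) (y : ℝ) :
    vtx tgt β γ k l N y y = chr (l - ∑ i ∈ inc tgt k, N i) y * ∏ i ∈ inc tgt k, (β i + γ i) := by
  rw [vtx, sub_eq_add_neg, chr_add, ← sum_neg_distrib, chr_sum]
  simp only [← add_mul, prod_mul_distrib]
  ring

theorem vtxDeriv_self (k : Fin n) (l : ℤ) (N : Fin n → ℤ) (y : ℝ) :
    vtxDeriv tgt β γ k l N y y = chr (l - ∑ i ∈ inc tgt k, N i) y * vtxCoef tgt β γ k l N := by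
  rw [vtxDeriv, vtxCoef, sub_eq_add_neg, chr_add, ← sum_neg_distrib, chr_sum, mul_add,
    mul_sum, mul_sum]
  simp only [← add_mul, prod_mul_distrib]
  congr 1
  · ring
  · refine sum_congr rfl fun i hi => ?_
    rw [← mul_prod_erase _ (fun i => chr (-N i) y) hi]
    ring

theorem one_add_sum_le_prod {α : Type} (s : Finset α) {f : α → ℝ} (hf : ∀ a, 0 ≤ f a) :
    1 + ∑ a ∈ s, f a ≤ ∏ a ∈ s, (1 + f a) := by
  classical
  induction s using Finset.induction_on with
  | empty => simp
  | insert a s ha ih =>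
    rw [sum_insert ha, prod_insert ha]
    have := sum_nonneg fun i (_ : i ∈ s) => hf i
    nlinarith [hf a, mul_le_mul_of_nonneg_left ih (hf a)]

/-- A bound for the coefficients of the lines. -/
def lineBound : ℝ := ∏ i, (1 + (‖β i‖ + ‖γ i‖))

/-- A bound for the momenta of the lines. -/
def flowBound (N : Fin n → ℤ) : ℝ := ∏ i, (1 + |(N i : ℝ)|)

theorem norm_prod_line_le (s : Finset (Fin n)) (N : Fin n → ℤ) (y x : ℝ) :
    ‖∏ i ∈ s, (β i * chr (-N i) y + γ i * chr (-N i) x)‖ ≤ lineBound β γ := by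
  rw [norm_prod]
  refine (prod_le_prod (fun _ _ => norm_nonneg _) fun i _ => ?_).trans
    (prod_le_prod_of_subset_of_one_le (subset_univ s)
      (fun i _ => by positivity) fun i _ _ => by linarith [norm_nonneg (β i), norm_nonneg (γ i)])
  refine (norm_add_le _ _).trans ?_
  rw [norm_mul, norm_mul, norm_chr, norm_chr]; linarith

theorem norm_vtx_le (k : Fin n) (l : ℤ) (N : Fin n → ℤ) (y x : ℝ) :
    ‖vtx tgt β γ k l N y x‖ ≤ lineBound β γ := by
  rw [vtx, norm_mul, norm_chr, one_mul]; exact norm_prod_line_le β γ _ N y x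

theorem norm_vtxDeriv_le (k : Fin n) (l : ℤ) (N : Fin n → ℤ) (y x : ℝ) :
    ‖vtxDeriv tgt β γ k l N y x‖ ≤ lineBound β γ ^ 2 * (|(l : ℝ)| + ∑ i, |(N i : ℝ)|) := by
  have h1 : 1 ≤ lineBound β γ :=
    (by simp : (1 : ℝ) = ∏ _i : Fin n, 1).le.trans (prod_le_prod (fun _ _ => zero_le_one)
      fun i _ => by linarith [norm_nonneg (β i), norm_nonneg (γ i)])
  have hγ : ∀ i, ‖γ i‖ ≤ lineBound β γ := by
    intro i
    refine le_trans ?_ (prod_le_prod_of_subset_of_one_le (subset_univ {i})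
      (fun i _ => by positivity) fun i _ _ => by linarith [norm_nonneg (β i), norm_nonneg (γ i)])
    rw [prod_singleton]; linarith [norm_nonneg (β i), norm_nonneg (γ i)]
  have h2 : lineBound β γ ≤ lineBound β γ ^ 2 := by nlinarith
  rw [vtxDeriv, mul_add]
  refine (norm_add_le _ _).trans (add_le_add ?_ ?_)
  · rw [norm_mul, norm_mul, norm_mul, norm_chr, norm_I, norm_intCast, one_mul,
      mul_one, mul_comm]
    exact mul_le_mul_of_nonneg_right ((norm_prod_line_le β γ _ N y x).trans h2) (abs_nonneg _)
  · rw [norm_mul, norm_chr, one_mul]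
    refine (norm_sum_le _ _).trans ?_
    rw [mul_sum]
    refine (sum_le_sum fun i _ => ?_).trans (sum_le_sum_of_subset_of_nonneg
      (subset_univ _) fun i _ _ => by positivity)
    rw [norm_mul, norm_mul, norm_mul, norm_mul, norm_chr, norm_I, norm_intCast,
      mul_one, one_mul, pow_two, mul_assoc]
    refine mul_le_mul (norm_prod_line_le β γ _ N y x) ?_ (by positivity) (by positivity)
    simpa using mul_le_mul_of_nonneg_right (hγ i) (abs_nonneg (N i : ℝ))

theorem abs_mom_le {ι : Type} [Fintype ι] (x : Σ t : Seqs, Fin t.1 → ι × ι) (a : ι) :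
    1 + |(mom x.1 x.2 a : ℝ)| ≤ momBound x := by
  refine le_trans (add_le_add le_rfl ?_) (one_add_sum_le_prod _ fun i => abs_nonneg _)
  simp only [mom]
  push_cast
  refine (abs_sum_le_sum_abs _ _).trans (sum_le_sum fun i _ => ?_)
  rw [abs_mul]
  refine mul_le_of_le_one_right (abs_nonneg _) ?_
  split_ifs <;> simp

theorem norm_vertex_le (k : Fin n) (X : Σ t : Seqs, Fin t.1 → Pts n × Pts n) (N : Fin n → ℤ)
    (y x : ℝ) : ‖vtx tgt β γ k (mom X.1 X.2 (.inr k)) N y x‖ ≤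
        lineBound β γ ^ 2 * (momBound X * flowBound N) ∧
      ‖vtxDeriv tgt β γ k (mom X.1 X.2 (.inr k)) N y x‖ ≤
        lineBound β γ ^ 2 * (momBound X * flowBound N) := by
  have hfb : 1 + ∑ i, |(N i : ℝ)| ≤ flowBound N := one_add_sum_le_prod _ fun i => abs_nonneg _
  have hs0 : 0 ≤ ∑ i, |(N i : ℝ)| := sum_nonneg fun i _ => abs_nonneg _
  have hB : 1 ≤ lineBound β γ :=
    (by simp : (1 : ℝ) = ∏ _i : Fin n, 1).le.trans (prod_le_prod (fun _ _ => zero_le_one)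
      fun i _ => by linarith [norm_nonneg (β i), norm_nonneg (γ i)])
  have hm := abs_mom_le X (.inr k)
  have hm0 := abs_nonneg (mom X.1 X.2 (.inr k) : ℝ)
  constructor
  · refine (norm_vtx_le tgt β γ k _ _ _ _).trans ?_
    exact (by nlinarith : lineBound β γ ≤ lineBound β γ ^ 2).trans
      (le_mul_of_one_le_right (by positivity) (by nlinarith))
  · refine (norm_vtxDeriv_le tgt β γ k _ _ _ _).trans ?_
    exact mul_le_mul_of_nonneg_left (by nlinarith) (by positivity)

end Vertices

section Expansion

variable {ξ : ℕ → ℝ} (hξ : PosWeights ξ) (hsum : Decay ξ)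
  {r : Fin n → ℝ} (h0 : ∀ k, 0 ≤ r k) (h1 : ∀ k, r k < 1) (Q : Pts n → ℤ)
  {A : Fin n → ℤ → ℂ} (hA : ∀ i, Summable fun N => ‖A i N‖ * (1 + |(N : ℝ)|) ^ n)
  (tgt : Fin n → Option (Fin n)) (β γ : Fin n → ℂ)

/-- The terms of the expansion: a term of the correlator of exponentials, and the momenta of the
lines. -/
abbrev Terms (n : ℕ) : Type := (Σ t : Seqs, Fin t.1 → Pts n × Pts n) × (Fin n → ℤ)

/-- The momentum at the vertex `k`. -/
def flow (N : Fin n → ℤ) (L : Pts n → ℤ) (k : Fin n) : ℤ :=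
  L (.inl k) + L (.inr k) + N k - ∑ i ∈ inc tgt k, N i

/-- The derivatives at the vertices in `s`, and the coefficients of the lines. -/
def vertexProd (s : List (Fin n)) (N : Fin n → ℤ) (L : Pts n → ℤ) : ℂ :=
  ∏ k, if k ∈ s then vtxCoef tgt β γ k (L (.inr k)) N else ∏ i ∈ inc tgt k, (β i + γ i)

include hξ hsum h0 h1 hA

theorem summable_terms :
    Summable fun l : Terms n => ‖expCoef ξ (Sum.elim r r) Q l.1 * ∏ i, A i (l.2 i)‖ *
      ∏ _k : Fin n, (lineBound β γ ^ 2 * (momBound l.1 * flowBound l.2)) := by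
  have hx := summable_expCoef hξ hsum (ρ := Sum.elim r r) (by rintro (k | k) <;> exact h0 k)
    (by rintro (k | k) <;> exact h1 k) Q n
  have hN := (summable_and_hasSum_pi (fun i N => A i N * ((1 + |(N : ℝ)| : ℝ) : ℂ) ^ n) (fun i =>
    (hA i).congr fun N => by
      rw [norm_mul, norm_pow, norm_real, Real.norm_of_nonneg (by positivity)])).1
  refine ((hx.mul_of_nonneg hN (fun x => ?_) fun N => norm_nonneg _).mul_left
    ((lineBound β γ ^ 2) ^ n)).congr fun l => ?_
  · exact mul_nonneg (norm_nonneg _) (pow_nonneg (prod_nonneg fun _ _ => by positivity) _)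
  · simp only [norm_mul, norm_prod, norm_pow, prod_mul_distrib, prod_const,
      card_univ, Fintype.card_fin, flowBound, norm_real, ← prod_pow]
    have : ∀ N : ℤ, ‖1 + |(N : ℝ)|‖ = 1 + |(N : ℝ)| := fun N => Real.norm_of_nonneg (by positivity)
    simp only [this]
    ring

/-- The expansion of the derivatives of the value of a graph. -/
theorem partials_expansion (hQ : ∑ a, Q a = 0) (s : List (Fin n)) (hs : s.Nodup) (u : Fin n → ℝ) :
    partials s (fun u' => (∏ i, ∑' N, A i N * chr N (u i) * (tgt i).elim 1 fun j =>
          β i * chr (-N) (u j) + γ i * chr (-N) (u' j)) *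
        expCorr ξ Q (Sum.elim (pts r u) (pts r u'))) u =
      ∑' l : Terms n, expCoef ξ (Sum.elim r r) Q l.1 * (∏ i, A i (l.2 i)) *
        vertexProd tgt β γ s l.2 (mom l.1.1 l.1.2) *
          ∏ k, chr (flow tgt l.2 (mom l.1.1 l.1.2) k) (u k) := by
  have hSum := summable_terms hξ hsum h0 h1 Q hA β γ
  set c : Terms n → ℂ := fun l => expCoef ξ (Sum.elim r r) Q l.1 * (∏ i, A i (l.2 i)) *
    (∏ i, chr (l.2 i) (u i)) * ∏ k, chr (mom l.1.1 l.1.2 (.inl k)) (u k) with hc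
  set G : Terms n → Fin n → ℝ → ℂ := fun l k x =>
    vtx tgt β γ k (mom l.1.1 l.1.2 (.inr k)) l.2 (u k) x with hG
  have hnc : ∀ l, ‖c l‖ = ‖expCoef ξ (Sum.elim r r) Q l.1 * ∏ i, A i (l.2 i)‖ := by
    intro l; simp [hc, norm_prod, norm_chr]
  have hF : (fun u' => (∏ i, ∑' N, A i N * chr N (u i) * (tgt i).elim 1 fun j =>
          β i * chr (-N) (u j) + γ i * chr (-N) (u' j)) *
        expCorr ξ Q (Sum.elim (pts r u) (pts r u'))) =
      fun u' => ∑' l, c l * ∏ k, G l k (u' k) := by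
    funext u'
    have hp : Sum.elim (pts r u) (pts r u') =
        fun a => pt (Sum.elim r r a) (Sum.elim u u' a) := by
      funext a; rcases a with k | k <;> rfl
    rw [hp, expCorr_eq hξ hsum (by rintro (k | k) <;> exact h0 k)
      (by rintro (k | k) <;> exact h1 k), if_pos hQ]
    set g : Fin n → ℤ → ℂ := fun i N => A i N * chr N (u i) * (tgt i).elim 1 fun j =>
      β i * chr (-N) (u j) + γ i * chr (-N) (u' j) with hg
    have hgs : ∀ i, Summable fun N => ‖g i N‖ := by
      intro i
      refine Summable.of_nonneg_of_le (fun _ => norm_nonneg _) (fun N => ?_)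
        ((hA i).mul_right (1 + (‖β i‖ + ‖γ i‖)))
      simp only [hg]
      rw [norm_mul, norm_mul, norm_chr, mul_one]
      refine mul_le_mul ?_ ?_ (norm_nonneg _) (by positivity)
      · exact le_mul_of_one_le_right (norm_nonneg _)
          (one_le_pow₀ (by linarith [abs_nonneg (N : ℝ)]))
      · rcases tgt i with _ | j
        · simp; positivity
        · refine (norm_add_le _ _).trans ?_
          rw [norm_mul, norm_mul, norm_chr, norm_chr]; linarith
    obtain ⟨hg1, hg2⟩ := summable_and_hasSum_pi g hgs
    have hx : Summable fun x : Σ t : Seqs, Fin t.1 → Pts n × Pts n =>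
        ‖expCoef ξ (Sum.elim r r) Q x * ∏ a, chr (mom x.1 x.2 a) (Sum.elim u u' a)‖ := by
      refine (summable_expCoef hξ hsum (ρ := Sum.elim r r) (by rintro (k | k) <;> exact h0 k)
        (by rintro (k | k) <;> exact h1 k) Q 0).congr fun x => ?_
      rw [norm_mul, norm_prod]; simp [norm_chr]
    rw [← hg2.tsum_eq, mul_comm, tsum_mul_tsum_of_summable_norm hx hg1]
    refine tsum_congr fun l => ?_
    have hT : ∏ i, ((tgt i).elim 1 fun j => β i * chr (-l.2 i) (u j) + γ i * chr (-l.2 i) (u' j)) =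
        ∏ k, ∏ i ∈ inc tgt k, (β i * chr (-l.2 i) (u k) + γ i * chr (-l.2 i) (u' k)) := by
      simp only [inc, prod_filter]
      rw [Finset.prod_comm]
      refine prod_congr rfl fun i _ => ?_
      rcases h : tgt i with _ | j
      · simp
      · simp
    simp only [hc, hG, hg, vtx, prod_mul_distrib, hT, Fintype.prod_sum_type, Sum.elim_inl,
      Sum.elim_inr]
    ring
  rw [hF, partials_tsum c G (fun l k x => vtxDeriv tgt β γ k (mom l.1.1 l.1.2 (.inr k)) l.2 (u k) x)
    (fun l _ => lineBound β γ ^ 2 * (momBound l.1 * flowBound l.2))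
    (fun l k x => hasDerivAt_vtx tgt β γ k _ _ _ _)
    (fun l k x => (norm_vertex_le tgt β γ k l.1 l.2 _ x).1)
    (fun l k x => (norm_vertex_le tgt β γ k l.1 l.2 _ x).2) (hSum.congr fun l => by rw [hnc]) s hs]
  refine tsum_congr fun l => ?_
  have : ∀ k, (if k ∈ s then vtxDeriv tgt β γ k (mom l.1.1 l.1.2 (.inr k)) l.2 (u k) (u k)
      else G l k (u k)) = chr (mom l.1.1 l.1.2 (.inr k) - ∑ i ∈ inc tgt k, l.2 i) (u k) *
        if k ∈ s then vtxCoef tgt β γ k (mom l.1.1 l.1.2 (.inr k)) l.2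
          else ∏ i ∈ inc tgt k, (β i + γ i) := by
    intro k
    split_ifs
    · rw [vtxDeriv_self]
    · rw [← vtx_self]
  simp only [this, prod_mul_distrib, vertexProd, hc, flow]
  simp only [chr_add, prod_mul_distrib, sub_eq_add_neg]
  ring

theorem summable_expansion (s : List (Fin n)) :
    Summable fun l : Terms n => ‖expCoef ξ (Sum.elim r r) Q l.1 * (∏ i, A i (l.2 i)) *
      vertexProd tgt β γ s l.2 (mom l.1.1 l.1.2)‖ := by
  refine Summable.of_nonneg_of_le (fun _ => norm_nonneg _) (fun l => ?_)
    (summable_terms hξ hsum h0 h1 Q hA β γ)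
  rw [norm_mul, vertexProd, norm_prod]
  refine mul_le_mul_of_nonneg_left (prod_le_prod (fun _ _ => norm_nonneg _) fun k _ => ?_)
    (norm_nonneg _)
  have h := norm_vertex_le tgt β γ k l.1 l.2 0 0
  rw [vtx_self, vtxDeriv_self, norm_mul, norm_mul, norm_chr, one_mul, one_mul] at h
  split_ifs
  exacts [h.2, h.1]

end Expansion

/-! ### The forest of momentum carrying lines -/

section Flow

variable {tgt : Fin n → Option (Fin n)}

/-- The relation of a vertex with the end of its outgoing line. -/
def TStep (tgt : Fin n → Option (Fin n)) (i j : Fin n) : Prop := tgt i = some j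

open Classical in
/-- In a forest, momentum conservation at all vertices determines the momenta of the lines. -/
theorem flow_eq_zero_iff (hac : ∀ i, ¬ TransGen (TStep tgt) i i) (S N : Fin n → ℤ) :
    (∀ k, S k + N k - ∑ i ∈ inc tgt k, N i = 0) ↔
      N = fun k => -∑ l with ReflTransGen (TStep tgt) l k, S l := by
  set A : Matrix (Fin n) (Fin n) ℤ :=
    fun k i => (if i = k then 1 else 0) - if tgt i = some k then 1 else 0 with hA
  set B : Matrix (Fin n) (Fin n) ℤ :=
    fun k l => if ReflTransGen (TStep tgt) l k then 1 else 0 with hB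
  have hAN : ∀ N k, (A.mulVec N) k = N k - ∑ i ∈ inc tgt k, N i := by
    intro N k
    simp [Matrix.mulVec, dotProduct, hA, sub_mul, sum_sub_distrib, inc, sum_filter]
  have hBS : ∀ S k, (B.mulVec S) k = ∑ l with ReflTransGen (TStep tgt) l k, S l := by
    intro S k
    simp [Matrix.mulVec, dotProduct, hB, sum_filter]
  have hBA : B * A = 1 := by
    ext k i
    rw [Matrix.mul_apply, Matrix.one_apply]
    simp only [hA, hB, mul_sub, sum_sub_distrib, mul_ite, mul_one, mul_zero,
      sum_ite_eq, mem_univ, if_true]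
    rcases h : tgt i with _ | j
    · have : ReflTransGen (TStep tgt) i k ↔ k = i := by
        constructor
        · intro hik
          rcases ReflTransGen.cases_head hik with rfl | ⟨z, hz, _⟩
          · rfl
          · rw [TStep, h] at hz; cases hz
        · rintro rfl; exact .refl
      simp [this]
    · simp only [Option.some_inj, sum_ite_eq, mem_univ, if_true]
      rcases eq_or_ne k i with rfl | hki
      · have : ¬ ReflTransGen (TStep tgt) j k := fun h' =>
          hac k (TransGen.head' h h')
        simp [this, ReflTransGen.refl]
      · have : ReflTransGen (TStep tgt) i k ↔ ReflTransGen (TStep tgt) j k := by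
          constructor
          · intro hik
            rcases ReflTransGen.cases_head hik with rfl | ⟨z, hz, hzk⟩
            · exact absurd rfl hki
            · rw [TStep, h, Option.some_inj] at hz; rwa [hz]
          · intro hjk; exact ReflTransGen.head h hjk
        simp [this, hki]
  have hAB := mul_eq_one_comm.1 hBA
  constructor
  · intro h
    have h1 : A.mulVec N = -S := by
      funext k; rw [hAN, Pi.neg_apply]; linarith [h k]
    have h2 := congrArg B.mulVec h1
    rw [Matrix.mulVec_mulVec, hBA, Matrix.one_mulVec, Matrix.mulVec_neg] at h2
    rw [h2]; funext k; rw [Pi.neg_apply, hBS]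
  · rintro h k
    have h1 : N = -B.mulVec S := by rw [h]; funext k; rw [Pi.neg_apply, hBS]
    have h2 := hAN N k
    rw [h1, Matrix.mulVec_neg, Matrix.mulVec_mulVec, hAB, Matrix.one_mulVec, ← h1, Pi.neg_apply] at h2
    linarith

theorem exists_root (hac : ∀ i, ¬ TransGen (TStep tgt) i i) (i : Fin n) :
    ∃ k, tgt k = none ∧ ReflTransGen (TStep tgt) i k := by
  let r : Fin n → Fin n → Prop := fun a b => TransGen (TStep tgt) b a
  have : IsTrans (Fin n) r := ⟨fun _ _ _ h h' => h'.trans h⟩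
  have : Std.Irrefl r := ⟨hac⟩
  induction i using (Finite.wellFounded_of_trans_of_irrefl r).induction with
  | _ i ih =>
    rcases h : tgt i with _ | j
    · exact ⟨i, h, .refl⟩
    · obtain ⟨k, hk, hjk⟩ := ih j (.single h)
      exact ⟨k, hk, ReflTransGen.head h hjk⟩

end Flow

section Forest

variable {R : Graph n}

open Classical in
/-- The end of the line leaving a vertex, for the lines that carry a momentum: the solid lines that
do not close a loop, and the dotted and wavy lines at their left ends. -/
def lineTgt (R : Graph n) (i : Fin n) : Option (Fin n) :=
  match R i with
  | .solid j => if Closes R i j then none else some j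
  | .dotted j => if i < j then some j else none
  | .wavy j => if i < j then some j else none
  | _ => none

/-- Dotted and wavy lines are symmetric. -/
structure Paired (R : Graph n) : Prop where
  dotted : ∀ i j, R i = .dotted j → i ≠ j ∧ R j = .dotted i
  wavy : ∀ i j, R i = .wavy j → i ≠ j ∧ R j = .wavy i

theorem lineTgt_eq_some {i j : Fin n} : lineTgt R i = some j ↔
    (R i = .solid j ∧ ¬ Closes R i j) ∨ (R i = .dotted j ∧ i < j) ∨ (R i = .wavy j ∧ i < j) := by
  unfold lineTgt
  cases h : R i with
  | solid x => by_cases hc : Closes R i x <;> simp [hc] <;> rintro rfl <;> exact hc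
  | dotted x => by_cases hc : i < x <;> simp [hc] <;> rintro rfl <;> omega
  | wavy x => by_cases hc : i < x <;> simp [hc] <;> rintro rfl <;> omega
  | _ => simp

theorem TStep.link {i j : Fin n} (h : TStep (lineTgt R) i j) : Link R i j := by
  rcases lineTgt_eq_some.1 h with h | h | h
  exacts [.inl h.1, .inr (.inl h.1), .inr (.inr h.1)]

theorem TStep.solid (hP : Paired R) {i j k : Fin n} (h : TStep (lineTgt R) i j)
    (h' : TStep (lineTgt R) j k) : R i = .solid j ∧ ¬ Closes R i j := by
  rcases lineTgt_eq_some.1 h with h | ⟨h, hij⟩ | ⟨h, hij⟩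
  · exact h
  · have h2 := (hP.dotted i j h).2
    rcases lineTgt_eq_some.1 h' with h3 | ⟨h3, hjk⟩ | h3
    · rw [h2] at h3; cases h3.1
    · rw [h2] at h3; injection h3 with h3; subst h3; exact absurd hij hjk.not_gt
    · rw [h2] at h3; cases h3.1
  · have h2 := (hP.wavy i j h).2
    rcases lineTgt_eq_some.1 h' with h3 | h3 | ⟨h3, hjk⟩
    · rw [h2] at h3; cases h3.1
    · rw [h2] at h3; cases h3.1
    · rw [h2] at h3; injection h3 with h3; subst h3; exact absurd hij hjk.not_gt

theorem tStep_step (hP : Paired R) {i j k : Fin n} (h : TransGen (TStep (lineTgt R)) i j)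
    (h' : TStep (lineTgt R) j k) : TransGen (Step R) i j := by
  induction h generalizing k with
  | single h => exact .single (h.solid hP h').1
  | tail _ h ih => exact (ih h).tail (h.solid hP h').1

theorem step_unique {i j k : Fin n} (h : Step R i j) (h' : Step R i k) : j = k := by
  rw [Step, h] at h'; injection h'

theorem loopOf_eq_of_mem {i k : Fin n} (h : k ∈ loopOf R i) : loopOf R k = loopOf R i := by
  simp only [loopOf, mem_filter, mem_univ, true_and] at h ⊢
  ext x
  simp only [mem_filter, mem_univ, true_and]
  exact ⟨fun hx => ⟨h.1.trans hx.1, hx.2.trans h.2⟩, fun hx => ⟨h.2.trans hx.1, hx.2.trans h.1⟩⟩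

theorem mem_loopOf {i k : Fin n} : k ∈ loopOf R i ↔
    TransGen (Step R) i k ∧ TransGen (Step R) k i := by simp [loopOf]

theorem mem_loopOf_of_reach {i y : Fin n} (hi : TransGen (Step R) i i)
    (hy : ReflTransGen (Step R) i y) : y ∈ loopOf R i :=
  mem_loopOf.2 ⟨hi.trans_left hy, TransGen.trans_right (reach_loop hi hy) hi⟩

theorem lineTgt_acyclic (hP : Paired R) (x : Fin n) : ¬ TransGen (TStep (lineTgt R)) x x := by
  intro hx
  have hsucc : ∀ y, TransGen (TStep (lineTgt R)) y y → ∃ z, R y = .solid z ∧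
      ¬ Closes R y z ∧ TransGen (TStep (lineTgt R)) z z := by
    intro y hy
    obtain ⟨z, hz, hzy⟩ := TransGen.head'_iff.1 hy
    obtain ⟨v, hv⟩ : ∃ v, TStep (lineTgt R) z v := by
      rcases ReflTransGen.cases_head hzy with rfl | ⟨v, hv, _⟩
      exacts [⟨z, hz⟩, ⟨v, hv⟩]
    exact ⟨z, (hz.solid hP hv).1, (hz.solid hP hv).2, TransGen.tail'_iff.2 ⟨y, hzy, hz⟩⟩
  have hself : ∀ y, TransGen (TStep (lineTgt R)) y y → TransGen (Step R) y y := by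
    intro y hy
    obtain ⟨z, hz, _⟩ := TransGen.head'_iff.1 hy
    exact tStep_step hP hy hz
  have hreach : ∀ y, ReflTransGen (Step R) x y →
      TransGen (TStep (lineTgt R)) y y := by
    intro y hy
    induction hy with
    | refl => exact hx
    | tail _ hyz ih =>
      obtain ⟨w, hw, _, hww⟩ := hsucc _ ih
      rwa [← step_unique (show Step R _ w from hw) hyz]
  have hne : (loopOf R x).Nonempty := ⟨x, mem_loopOf.2 ⟨hself x hx, hself x hx⟩⟩
  obtain ⟨j, hj, hmin⟩ : ∃ j ∈ loopOf R x, ∀ k ∈ loopOf R x, j ≤ k :=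
    ⟨_, min'_mem _ hne, fun k hk => min'_le _ k hk⟩
  have hjj := hself j (hreach j (mem_loopOf.1 hj).1.to_reflTransGen)
  obtain ⟨i, hji, hij⟩ := TransGen.tail'_iff.1 hjj
  have hxi : ReflTransGen (Step R) x i := (mem_loopOf.1 hj).1.to_reflTransGen.trans hji
  obtain ⟨z, hz, hzc, _⟩ := hsucc i (hreach i hxi)
  obtain rfl := step_unique (show Step R i z from hz) hij
  exact hzc ⟨mem_loopOf_of_reach hjj hji, by rwa [loopOf_eq_of_mem hj]⟩

/-- The momentum of a dotted or wavy line comes from the solid component of its left end. -/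
theorem tReach_iff_conn (hP : Paired R) {i j : Fin n}
    (hi : (R i = .dotted j ∨ R i = .wavy j) ∧ i < j) (l : Fin n) :
    ReflTransGen (TStep (lineTgt R)) l i ↔ Conn R l i := by
  have hns : ∀ x, R i ≠ .solid x := by rcases hi.1 with h | h <;> simp [h]
  have hT : TStep (lineTgt R) i j := lineTgt_eq_some.2 (by tauto)
  rw [conn_iff_reach hns]
  constructor
  · intro h
    rcases reflTransGen_iff_eq_or_transGen.1 h with rfl | h
    · exact .refl
    · exact (tStep_step hP h hT).to_reflTransGen
  · intro h
    induction h using ReflTransGen.head_induction_on with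
    | refl => exact .refl
    | head hxy hyi ih =>
      rename_i x y
      refine ReflTransGen.head (lineTgt_eq_some.2 (.inl ⟨hxy, fun hc => ?_⟩)) ih
      have hyy : TransGen (Step R) y y :=
        (mem_loopOf.1 hc.1).1.trans (mem_loopOf.1 hc.1).2
      rcases ReflTransGen.cases_head (reach_loop hyy hyi) with rfl | ⟨z, hz, _⟩
      · exact not_loop_of_root hns hyy
      · exact hns z hz

theorem tReach_of_closes (hP : Paired R) {a b : Fin n} (hab : R a = .solid b)
    (hc : Closes R a b) : ReflTransGen (TStep (lineTgt R)) b a := by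
  have hbb : TransGen (Step R) b b := (mem_loopOf.1 hc.1).1.trans (mem_loopOf.1 hc.1).2
  obtain ⟨k, hk, hbk⟩ := exists_root (lineTgt_acyclic hP) b
  have hmem : ∀ y, ReflTransGen (TStep (lineTgt R)) b y →
      ReflTransGen (Step R) b y := by
    intro y hy
    induction hy with
    | refl => exact .refl
    | tail _ hyz ih =>
      refine ih.tail ?_
      obtain ⟨w, hw, _⟩ := TransGen.head'_iff.1 (mem_loopOf.1 (mem_loopOf_of_reach hbb ih)).2
      rcases lineTgt_eq_some.1 hyz with h | h | h
      · exact h.1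
      · rw [Step, h.1] at hw; cases hw
      · rw [Step, h.1] at hw; cases hw
  have hkl := mem_loopOf_of_reach hbb (hmem k hbk)
  obtain ⟨z, hz, hzb⟩ := TransGen.head'_iff.1 (mem_loopOf.1 hkl).2
  have hz' : R k = .solid z := hz
  have hcz : Closes R k z := by
    by_contra h
    rw [lineTgt_eq_some.2 (.inl ⟨hz', h⟩)] at hk; cases hk
  have hzl : z ∈ loopOf R b := mem_loopOf_of_reach hbb ((hmem k hbk).tail hz)
  have hzb : z = b := le_antisymm
    (hcz.2 b (by rw [loopOf_eq_of_mem hzl]; exact mem_loopOf.2 ⟨hbb, hbb⟩)) (hc.2 z hzl)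
  subst hzb
  rw [loop_step_injective ((mem_loopOf.1 hc.1).2.trans (mem_loopOf.1 hc.1).1)
    ((mem_loopOf.1 hkl).2.trans (mem_loopOf.1 hkl).1) hab hz']
  exact hbk

/-- The trees of the forest are the connected components of the graph. -/
theorem tReach_iff_joined (hP : Paired R) {k : Fin n} (hk : lineTgt R k = none) (l : Fin n) :
    ReflTransGen (TStep (lineTgt R)) l k ↔ Joined R l k := by
  have hstep : ∀ {a b}, TStep (lineTgt R) a b → (ReflTransGen (TStep (lineTgt R)) a k ↔
      ReflTransGen (TStep (lineTgt R)) b k) := by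
    intro a b hab
    refine ⟨fun h => ?_, fun h => .head hab h⟩
    rcases ReflTransGen.cases_head h with rfl | ⟨z, hz, hzk⟩
    · rw [TStep, hk] at hab; cases hab
    · rw [TStep, hab, Option.some_inj] at hz; rwa [hz]
  have hreach : ∀ {a b}, ReflTransGen (TStep (lineTgt R)) a b →
      (ReflTransGen (TStep (lineTgt R)) a k ↔
        ReflTransGen (TStep (lineTgt R)) b k) := by
    intro a b hab
    induction hab with
    | refl => exact Iff.rfl
    | tail _ h ih => exact ih.trans (hstep h)
  have hsym : ∀ {a b}, a ≠ b → (R a = .dotted b ∧ R b = .dotted a ∨ R a = .wavy b ∧ R b = .wavy a) →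
      (ReflTransGen (TStep (lineTgt R)) a k ↔
        ReflTransGen (TStep (lineTgt R)) b k) := by
    intro a b hne h
    rcases lt_or_gt_of_ne hne with hlt | hlt
    · exact hstep (lineTgt_eq_some.2 (by tauto))
    · exact (hstep (lineTgt_eq_some.2 (by tauto))).symm
  constructor
  · intro h
    induction h using ReflTransGen.head_induction_on with
    | refl => exact Joined.refl _ _
    | head hxy _ ih => exact (Joined.of_link hxy.link).trans ih
  · intro h
    have key : ∀ {a b}, Joined R a b → (ReflTransGen (TStep (lineTgt R)) a k ↔
        ReflTransGen (TStep (lineTgt R)) b k) := by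
      intro a b hab
      induction hab with
      | refl => exact Iff.rfl
      | symm _ _ _ ih => exact ih.symm
      | trans _ _ _ _ _ ih1 ih2 => exact ih1.trans ih2
      | rel a b hab =>
        rcases hab with h | h | h
        · by_cases hc : Closes R a b
          · exact (hreach (tReach_of_closes hP h hc)).symm
          · exact hstep (lineTgt_eq_some.2 (.inl ⟨h, hc⟩))
        · exact hsym (hP.dotted a b h).1 (.inl ⟨h, (hP.dotted a b h).2⟩)
        · exact hsym (hP.wavy a b h).1 (.inr ⟨h, (hP.wavy a b h).2⟩)
    exact (key h).2 .refl

open Classical in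
/-- The factor `μₖ` of a line that closes a loop. -/
def closeW (R : Graph n) (i : Fin n) : ℂ :=
  match R i with
  | .solid j => if Closes R i j then (μ (loopOf R j).card : ℂ) else 1
  | _ => 1

open Classical in
theorem prod_closeW : ∏ i, closeW μ R i = loopPart μ R := by
  set c : Finset (Fin n) := univ.filter fun i => ∃ j, R i = .solid j ∧ Closes R i j with hc
  have himg : (univ.image (loopOf R)).erase ∅ = c.image (loopOf R) := by
    ext S
    simp only [mem_erase, mem_image, mem_univ, true_and, hc, mem_filter]
    constructor
    · rintro ⟨hS, x, rfl⟩
      have hne : (loopOf R x).Nonempty := nonempty_iff_ne_empty.2 hS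
      have hj := min'_mem _ hne
      set j := (loopOf R x).min' hne
      have hjj := (mem_loopOf.1 hj).2.trans (mem_loopOf.1 hj).1
      obtain ⟨i, hji, hij⟩ := TransGen.tail'_iff.1 hjj
      have hi := mem_loopOf_of_reach hjj hji
      refine ⟨i, ⟨j, hij, hi, fun k hk => ?_⟩, (loopOf_eq_of_mem hi).trans (loopOf_eq_of_mem hj)⟩
      rw [loopOf_eq_of_mem hj] at hk
      exact min'_le _ k hk
    · rintro ⟨i, ⟨j, hij, hcl⟩, rfl⟩
      refine ⟨fun h => ?_, i, rfl⟩
      have := mem_loopOf.2 ⟨(mem_loopOf.1 hcl.1).2.trans (mem_loopOf.1 hcl.1).1,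
        (mem_loopOf.1 hcl.1).2.trans (mem_loopOf.1 hcl.1).1⟩
      rw [h] at this; simp at this
  unfold loopPart
  rw [himg, prod_image]
  · rw [← prod_subset (subset_univ c)]
    · refine prod_congr rfl fun i hi => ?_
      obtain ⟨j, hij, hcl⟩ := (mem_filter.1 hi).2
      simp only [closeW, hij, hcl, if_true, loopOf_eq_of_mem hcl.1]
    · intro i _ hi
      unfold closeW
      cases h : R i with
      | solid j =>
        have : ¬ Closes R i j := fun h' => hi (mem_filter.2 ⟨mem_univ _, j, h, h'⟩)
        simp [this]
      | _ => rfl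
  · intro i hi i' hi' heq
    obtain ⟨j, hij, hcl⟩ := (mem_filter.1 hi).2
    obtain ⟨j', hij', hcl'⟩ := (mem_filter.1 hi').2
    have heq : loopOf R i = loopOf R i' := heq
    rw [loopOf_eq_of_mem hcl.1, loopOf_eq_of_mem hcl'.1] at heq
    have hm : ∀ {i j}, Closes R i j → j ∈ loopOf R j := fun h =>
      mem_loopOf.2 ⟨(mem_loopOf.1 h.1).1.trans (mem_loopOf.1 h.1).2,
        (mem_loopOf.1 h.1).1.trans (mem_loopOf.1 h.1).2⟩
    have : j = j' := le_antisymm (hcl.2 _ (heq ▸ hm hcl')) (hcl'.2 _ (heq ▸ hm hcl))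
    subst this
    exact loop_step_injective ((mem_loopOf.1 hcl.1).2.trans (mem_loopOf.1 hcl.1).1)
      ((mem_loopOf.1 hcl'.1).2.trans (mem_loopOf.1 hcl'.1).1) hij hij'

end Forest

/-! ### The modes of a graph inside the disc -/

section Modes

variable (ξ : ℕ → ℝ) (κ : ℝ) (μ : ℕ → ℝ) (M : ℕ) (r : Fin n → ℝ) (φ : Fin n → Current)
  (m : Fin n → ℤ) (R : Graph n)

/-- The Fourier coefficients of the lines on the boundary. -/
def lineCoef (i : Fin n) (N : ℤ) : ℝ :=
  match lineTgt R i, R i with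
  | none, _ => if N = 0 then 1 else 0
  | some _, .dotted _ => dotCoef ξ N
  | some _, .wavy _ => wavyCoef κ N
  | some _, _ => 1

/-- The factor by which the Fourier coefficients of the lines inside the disc differ from those on
the boundary. -/
def damp (i : Fin n) (N : ℤ) : ℝ :=
  match lineTgt R i, R i with
  | none, _ => 1
  | some j, .dotted _ => if M < N.natAbs then 0 else (r i * r j) ^ N.natAbs
  | some j, _ => (r i * r j) ^ N.natAbs

/-- The charge at the first point of the target of a solid line. -/
def lineB (i : Fin n) : ℂ :=
  match R i with
  | .solid j => baseCharge φ R j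
  | _ => 1

/-- The charge at the second point of the target of a solid line. -/
def lineD (i : Fin n) : ℂ :=
  match R i with
  | .solid j => diffCharge φ R j
  | _ => 0

open Classical in
/-- The constant factors of the lines. -/
def lineS (i : Fin n) : ℂ :=
  match R i with
  | .solid j => (if i < j then -1 else 1) * if Closes R i j then (baseCharge φ R j : ℂ) else 1
  | _ => 1

variable {ξ κ μ M r φ m R}

theorem lineFactor_eq (h0 : ∀ k, 0 ≤ r k) (h1 : ∀ k, r k < 1) (u u' : Fin n → ℝ) (i : Fin n) :
    lineFactor ξ κ μ M φ R (pts r u) (pts r u') i = lineS φ R i * closeW μ R i *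
      ∑' N, ((damp M r R i N * lineCoef ξ κ R i N : ℝ) : ℂ) * chr N (u i) *
        (lineTgt R i).elim 1 fun j =>
          lineB φ R i * chr (-N) (u j) + lineD φ R i * chr (-N) (u' j) := by
  have hr : ∀ a b, 0 ≤ r a * r b ∧ r a * r b < 1 := fun a b =>
    ⟨mul_nonneg (h0 a) (h0 b), by nlinarith [h0 a, h0 b, h1 a, h1 b]⟩
  have hk : ∀ a b x y N, kTerm (r a * r b) (x - y) N =
      (((r a * r b) ^ N.natAbs : ℝ) : ℂ) * chr N x * chr (-N) y := fun a b x y N => by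
    rw [kTerm, chr_sub_angle]; push_cast; ring
  have hpt : ∀ (v : Fin n → ℝ) a, pts r v a = pt (r a) (v a) := fun _ _ => rfl
  have hone : lineTgt R i = none →
      ∑' N, ((damp M r R i N * lineCoef ξ κ R i N : ℝ) : ℂ) * chr N (u i) *
        (lineTgt R i).elim 1 (fun j =>
          lineB φ R i * chr (-N) (u j) + lineD φ R i * chr (-N) (u' j)) = 1 := by
    intro h
    rw [tsum_eq_single 0 fun N hN => by simp [lineCoef, damp, h, hN]]
    simp [lineCoef, damp, h, chr_zero]
  have hks : ∀ a b θ, Summable fun N => kTerm (r a * r b) θ N := fun a b θ => by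
    simpa using summable_kTerm (c := fun _ => 1) (hr a b).1
      (by simpa using summable_geom_int (hr a b).1 (hr a b).2 0) θ
  cases h : R i with
  | diff => rw [hone (by simp [lineTgt, h])]; simp [lineFactor, lineS, closeW, h]
  | zeroMode => rw [hone (by simp [lineTgt, h])]; simp [lineFactor, lineS, closeW, h]
  | solid j =>
    by_cases hc : Closes R i j
    · rw [hone (by simp [lineTgt, h, hc])]
      simp only [lineFactor, lineS, closeW, h, hc, if_true]; ring
    · have ht : lineTgt R i = some j := by simp [lineTgt, h, hc]
      simp only [lineFactor, lineS, closeW, h, hc, if_false, ht, Option.elim_some, damp, lineCoef,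
        lineB, lineD, mul_one, hpt]
      rw [deltaKer_eq (hr i j).1 (hr i j).2, deltaKer_eq (hr i j).1 (hr i j).2, ← tsum_mul_left,
        ← tsum_mul_left, ← ((hks i j _).mul_left _).tsum_add ((hks i j _).mul_left _)]
      congr 1
      refine tsum_congr fun N => ?_
      rw [hk, hk]; ring
  | dotted j =>
    by_cases hc : i < j
    · have ht : lineTgt R i = some j := by simp [lineTgt, h, hc]
      simp only [lineFactor, lineS, closeW, h, hc, if_true, ht, Option.elim_some, damp, lineCoef,
        lineB, lineD, one_mul, hpt, zero_mul, add_zero]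
      rw [dotD_eq]
      refine tsum_congr fun N => ?_
      rw [hk]; split_ifs <;> push_cast <;> ring
    · rw [hone (by simp [lineTgt, h, hc])]; simp [lineFactor, lineS, closeW, h, hc]
  | wavy j =>
    by_cases hc : i < j
    · have ht : lineTgt R i = some j := by simp [lineTgt, h, hc]
      simp only [lineFactor, lineS, closeW, h, hc, if_true, ht, Option.elim_some, damp, lineCoef,
        lineB, lineD, one_mul, hpt, zero_mul, add_zero]
      rw [wavyW_eq (hr i j).1 (hr i j).2]
      refine tsum_congr fun N => ?_
      rw [hk]; push_cast; ring
    · rw [hone (by simp [lineTgt, h, hc])]; simp [lineFactor, lineS, closeW, h, hc]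

theorem summable_line (h0 : ∀ k, 0 ≤ r k) (h1 : ∀ k, r k < 1) (i : Fin n) (k : ℕ) :
    Summable fun N =>
      ‖((damp M r R i N * lineCoef ξ κ R i N : ℝ) : ℂ)‖ * (1 + |(N : ℝ)|) ^ k := by
  have hr : ∀ a b, 0 ≤ r a * r b ∧ r a * r b < 1 := fun a b =>
    ⟨mul_nonneg (h0 a) (h0 b), by nlinarith [h0 a, h0 b, h1 a, h1 b]⟩
  simp only [norm_real]
  rcases ht : lineTgt R i with _ | j
  · refine summable_of_hasFiniteSupport ((Set.finite_singleton (0 : ℤ)).subset fun N hN => ?_)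
    by_contra hc
    exact hN (by simp [damp, lineCoef, ht, show N ≠ 0 from hc])
  · cases h : R i with
    | dotted j' =>
      refine summable_of_hasFiniteSupport
        ((Icc (-(M : ℤ)) M).finite_toSet.subset fun N hN => ?_)
      by_contra hc
      refine hN ?_
      have : M < N.natAbs := by
        simp only [coe_Icc, Set.mem_Icc, not_and_or, not_le] at hc; omega
      simp [damp, ht, h, this]
    | wavy j' =>
      refine Summable.of_nonneg_of_le (fun N => by positivity) (fun N => ?_)
        ((summable_geom_int (hr i j).1 (hr i j).2 (k + 1)).mul_left (2 * |κ|))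
      simp only [damp, lineCoef, ht, h, wavyCoef]
      rw [norm_mul, norm_mul, norm_mul, Real.norm_of_nonneg (pow_nonneg (hr i j).1 _),
        Real.norm_of_nonneg (le_max_right _ _), Real.norm_ofNat, Real.norm_eq_abs]
      have h2 : max (N : ℝ) 0 ≤ 1 + |(N : ℝ)| :=
        max_le (by linarith [le_abs_self (N : ℝ)]) (by positivity)
      have h3 := pow_nonneg (hr i j).1 N.natAbs
      calc _ = (2 * |κ| * (r i * r j) ^ N.natAbs * (1 + |(N : ℝ)|) ^ k) * max (N : ℝ) 0 := by ring
        _ ≤ (2 * |κ| * (r i * r j) ^ N.natAbs * (1 + |(N : ℝ)|) ^ k) * (1 + |(N : ℝ)|) :=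
          mul_le_mul_of_nonneg_left h2 (by positivity)
        _ = _ := by ring
    | _ =>
      refine (summable_geom_int (hr i j).1 (hr i j).2 k).congr fun N => ?_
      simp [damp, lineCoef, ht, h, abs_of_nonneg (h0 _)]

theorem partials_const_mul (s : List (Fin n)) (c : ℂ) (f : (Fin n → ℝ) → ℂ) (v : Fin n → ℝ) :
    partials s (fun v => c * f v) v = c * partials s f v := by
  induction s generalizing v with
  | nil => rfl
  | cons a s ih =>
    change deriv (fun t : ℝ => partials s (fun v => c * f v) (update v a t)) (v a) =
      c * deriv (fun t : ℝ => partials s f (update v a t)) (v a)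
    simp only [ih]
    exact deriv_const_mul_field _

open Classical in
/-- The charges of the factors `α` that do not cancel. -/
def vertexCharge (φ : Fin n → Current) (R : Graph n) : Pts n → ℤ :=
  Sum.elim (fun k => if Cancelled φ R k then 0 else baseCharge φ R k) (diffCharge φ R)

open Classical in
/-- The momenta of the lines, given the momenta of the vertices. -/
def lineMom (R : Graph n) (S : Fin n → ℤ) (k : Fin n) : ℤ :=
  -∑ l with ReflTransGen (TStep (lineTgt R)) l k, S l

/-- The list of the vertices with a derivative. -/
abbrev diffList (R : Graph n) : List (Fin n) :=
  (List.finRange n).filter fun k => R k = .diff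

/-- The lines and derivatives of a graph for given momenta of the correlator of exponentials. -/
def graphTerm (ξ : ℕ → ℝ) (κ : ℝ) (M : ℕ) (r : Fin n → ℝ) (φ : Fin n → Current) (m : Fin n → ℤ)
    (R : Graph n) (L : Pts n → ℤ) : ℂ :=
  (∏ i, ((damp M r R i (lineMom R (total m L) i) * lineCoef ξ κ R i (lineMom R (total m L) i) : ℝ)
    : ℂ)) * vertexProd (lineTgt R) (lineB φ R) (lineD φ R) (diffList R) (lineMom R (total m L)) L

variable (hξ : PosWeights ξ) (hsum : Decay ξ)

theorem amplitude_eq (h0 : ∀ k, 0 ≤ r k) (h1 : ∀ k, r k < 1) (u : Fin n → ℝ) :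
    amplitude ξ κ p μ M φ R r u = (∏ i, coef κ p (φ i) (R i) * (lineS φ R i * closeW μ R i)) *
      partials (diffList R) (fun u' =>
        (∏ i, ∑' N, ((damp M r R i N * lineCoef ξ κ R i N : ℝ) : ℂ) * chr N (u i) *
          (lineTgt R i).elim 1 fun j =>
            lineB φ R i * chr (-N) (u j) + lineD φ R i * chr (-N) (u' j)) *
        expCorr ξ (vertexCharge φ R) (Sum.elim (pts r u) (pts r u'))) u := by
  rw [← partials_const_mul]
  unfold amplitude undiffAmp
  congr 1
  funext u'
  simp only [lineFactor_eq h0 h1, prod_mul_distrib]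
  unfold vertexCharge
  ring

include hξ hsum

/-- The regularized modes of a graph: the integration over the angles leaves one value for the
momenta of the lines. -/
theorem mode_amplitude (hP : Paired R) (p : ℝ) (h0 : ∀ k, 0 ≤ r k) (h1 : ∀ k, r k < 1) :
    Continuous (amplitude ξ κ p μ M φ R r) ∧ ((2 * Real.pi : ℝ) : ℂ)⁻¹ ^ n *
      ∫ u in Set.Icc (0 : Fin n → ℝ) (fun _ => 2 * Real.pi),
        amplitude ξ κ p μ M φ R r u * exp (I * ∑ k, (m k : ℂ) * (u k : ℂ)) =
      (∏ i, coef κ p (φ i) (R i) * (lineS φ R i * closeW μ R i)) *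
        Lam ξ (Sum.elim r r) (vertexCharge φ R) (graphTerm ξ κ M r φ m R) := by
  set K := ∏ i, coef κ p (φ i) (R i) * (lineS φ R i * closeW μ R i)
  by_cases hQ : ∑ a, vertexCharge φ R a = 0
  swap
  · have : amplitude ξ κ p μ M φ R r = fun _ => 0 := by
      funext u
      rw [amplitude_eq p h0 h1]
      simp only [expCorr, hQ, if_false, mul_zero]
      have := partials_const_mul (diffList R) 0 (fun _ => (0 : ℂ)) u
      simp only [mul_zero, zero_mul] at this
      rw [this, mul_zero]
    rw [this]
    exact ⟨continuous_const, by rw [Lam, if_neg hQ]; simp⟩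
  have hA : ∀ i, Summable fun N =>
      ‖((damp M r R i N * lineCoef ξ κ R i N : ℝ) : ℂ)‖ * (1 + |(N : ℝ)|) ^ n :=
    fun i => summable_line h0 h1 i n
  set c : Terms n → ℂ := fun l => expCoef ξ (Sum.elim r r) (vertexCharge φ R) l.1 *
    (∏ i, ((damp M r R i (l.2 i) * lineCoef ξ κ R i (l.2 i) : ℝ) : ℂ)) *
      vertexProd (lineTgt R) (lineB φ R) (lineD φ R) (diffList R) l.2 (mom l.1.1 l.1.2) with hc
  have hcs : Summable fun l => ‖c l‖ :=
    summable_expansion hξ hsum h0 h1 (vertexCharge φ R) hA _ _ _ _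
  set F : Terms n → Fin n → ℤ := fun l => flow (lineTgt R) l.2 (mom l.1.1 l.1.2)
  have hamp : amplitude ξ κ p μ M φ R r = fun u => K * ∑' l, c l * ∏ k, chr (F l k) (u k) := by
    funext u
    rw [amplitude_eq p h0 h1, partials_expansion hξ hsum h0 h1 _ hA _ _ _ hQ _
      ((List.nodup_finRange n).filter _)]
  rw [hamp]
  refine ⟨continuous_const.mul (continuous_tsum_chr F hcs), ?_⟩
  have hpull : ∀ u : Fin n → ℝ, K * (∑' l, c l * ∏ k, chr (F l k) (u k)) *
      exp (I * ∑ k, (m k : ℂ) * (u k : ℂ)) =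
      K * ((∑' l, c l * ∏ k, chr (F l k) (u k)) *
        exp (I * ∑ k, (m k : ℂ) * (u k : ℂ))) := fun u => by ring
  simp only [hpull]
  rw [MeasureTheory.integral_const_mul, mul_left_comm, mode_tsum_chr F hcs]
  congr 1
  have hflow : ∀ l : Terms n, (∀ k, F l k + m k = 0) ↔
      l.2 = lineMom R (total m (mom l.1.1 l.1.2)) := by
    intro l
    have h := flow_eq_zero_iff (lineTgt_acyclic hP) (total m (mom l.1.1 l.1.2)) l.2
    refine Iff.trans (forall_congr' fun k => ?_) h
    simp only [F, flow, total]
    constructor <;> intro h <;> linarith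
  have hcs' : Summable fun l => c l * if ∀ k, F l k + m k = 0 then 1 else 0 := by
    refine Summable.of_norm (Summable.of_nonneg_of_le (fun _ => norm_nonneg _) (fun l => ?_) hcs)
    rw [norm_mul]
    refine mul_le_of_le_one_right (norm_nonneg _) ?_
    split_ifs <;> simp
  have hin : ∀ x, ∑' N, (c (x, N) * if ∀ k, F (x, N) k + m k = 0 then 1 else 0) =
      expCoef ξ (Sum.elim r r) (vertexCharge φ R) x * graphTerm ξ κ M r φ m R (mom x.1 x.2) := by
    intro x
    rw [tsum_eq_single (lineMom R (total m (mom x.1 x.2))) fun N hN => by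
      rw [if_neg fun h => hN ((hflow (x, N)).1 h), mul_zero], if_pos ((hflow _).2 rfl), mul_one]
    simp only [hc, graphTerm]; ring
  have hxs := hcs'.prod
  rw [hcs'.tsum_prod, Lam, if_pos hQ]
  simp only [hin] at hxs ⊢
  rw [hxs.tsum_sigma]
  refine tsum_congr fun t => ?_
  rw [tsum_fintype]
  simp only [expCoef, lamTerm, mul_sum]
  exact sum_congr rfl fun p _ => by ring

end Modes

/-! ### Evaluation of the regularized graphs -/

section Evaluation

variable {ξ : ℕ → ℝ} {κ p : ℝ} {μ : ℕ → ℝ} {M : ℕ} {r : Fin n → ℝ} {φ : Fin n → Current}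
  {m : Fin n → ℤ} {R : Graph n}

/-- The frame of a product of modes in its given order. -/
abbrev wordFrame (φ : Fin n → Current) (m : Fin n → ℤ) : Frame n :=
  frame (fun k => some (φ k)) m (· < ·)

open Classical in
/-- The second point of a vertex is identified with the first one, unless the vertex is free. -/
def mergePts (X : Frame n) (R : Graph n) : Pts n → Pts n :=
  Sum.elim Sum.inl fun k => if Free X R k then .inr k else .inl k

open Classical in
theorem push_mergePts (X : Frame n) (f : Pts n → ℤ) : push (mergePts X R) f = Sum.elim
      (fun k => f (.inl k) + if Free X R k then 0 else f (.inr k))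
      (fun k => if Free X R k then f (.inr k) else 0) := by
  have hl : ∀ k, mergePts X R (.inl k) = .inl k := fun _ => rfl
  have hr : ∀ k, mergePts X R (.inr k) = if Free X R k then .inr k else .inl k := fun _ => rfl
  funext a
  rw [push, sum_filter, Fintype.sum_sum_type]
  simp only [hl, hr]
  rcases a with k | k
  · simp only [Sum.inl.injEq, sum_ite_eq', mem_univ, if_true, Sum.elim_inl]
    congr 1
    rw [sum_eq_single k]
    · by_cases h : Free X R k <;> simp [h]
    · intro b _ hb; by_cases h : Free X R b <;> simp [h, hb]
    · simp
  · simp only [reduceCtorEq, if_false, sum_const_zero, zero_add, Sum.elim_inr]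
    rw [sum_eq_single k]
    · by_cases h : Free X R k <;> simp [h]
    · intro b _ hb; by_cases h : Free X R b <;> simp [h, hb]
    · simp

theorem total_push_mergePts (X : Frame n) (L : Pts n → ℤ) :
    total m (push (mergePts X R) L) = total m L := by
  classical
  funext k
  simp only [total, push_mergePts, Sum.elim_inl, Sum.elim_inr]
  split_ifs <;> ring

theorem IsGraph.paired (h : IsGraph φ R) : Paired R :=
  ⟨fun i j hij => ⟨(h.2.1 i j hij).1.symm, (h.2.1 i j hij).2⟩,
    fun i j hij => ⟨(h.2.2.1 i j hij).1.symm, (h.2.2.1 i j hij).2.1⟩⟩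

/-- The ends of the dotted and wavy lines. -/
def endW (ξ : ℕ → ℝ) (κ : ℝ) (R : Graph n) (i : Fin n) (P : ℤ) : ℝ :=
  match R i with
  | .dotted _ => dottedEnd ξ P
  | .wavy j => wavyEnd κ (if i < j then -P else P)
  | _ => 1

/-- The other end of a dotted or wavy line. -/
def otherEnd (R : Graph n) (i : Fin n) : Fin n :=
  match R i with
  | .dotted j => j
  | .wavy j => j
  | _ => i

theorem otherEnd_involutive (hP : Paired R) : Involutive (otherEnd R) := by
  intro i
  cases h : R i with
  | dotted j => simp [otherEnd, h, (hP.dotted i j h).2]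
  | wavy j => simp [otherEnd, h, (hP.wavy i j h).2]
  | _ => simp [otherEnd, h]

/-- The factor of a dotted or wavy line is distributed over its two ends. -/
theorem prod_lineCoef (hξ : PosWeights ξ) (hκ : 0 < κ) (hP : Paired R) (N P : Fin n → ℤ)
    (h0 : ∀ i, lineTgt R i = none → N i = 0)
    (hN : ∀ i j, (R i = .dotted j ∨ R i = .wavy j) → i < j → N i = -P i ∧ P j = -P i) :
    ∏ i, lineCoef ξ κ R i (N i) = ∏ i, endW ξ κ R i (P i) := by
  set f := otherEnd R with hf
  have hinv := otherEnd_involutive hP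
  have h1 : ∀ i, endW ξ κ R i (P i) = (if i < f i then endW ξ κ R i (P i) else 1) *
      if f i < i then endW ξ κ R i (P i) else 1 := by
    intro i
    rcases lt_trichotomy i (f i) with h | h | h
    · simp [h, h.not_gt]
    · rw [if_neg (by omega), if_neg (by omega), one_mul]
      cases hr : R i with
      | dotted j => exact absurd (by simpa [hf, otherEnd, hr] using h) (hP.dotted i j hr).1
      | wavy j => exact absurd (by simpa [hf, otherEnd, hr] using h) (hP.wavy i j hr).1
      | _ => simp [endW, hr]
    · simp [h, h.not_gt]
  rw [prod_congr rfl fun i _ => h1 i, prod_mul_distrib,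
    ← Equiv.prod_comp (Involutive.toPerm f hinv) fun i => if f i < i then endW ξ κ R i (P i) else 1,
    ← prod_mul_distrib]
  refine prod_congr rfl fun i _ => ?_
  have h2 : Involutive.toPerm f hinv i = f i := rfl
  have h3 : f (f i) = i := hinv i
  rw [h2, h3]
  cases hr : R i with
  | dotted j =>
    have hfi : f i = j := by simp [hf, otherEnd, hr]
    rw [hfi]
    by_cases hij : i < j
    · obtain ⟨h4, h5⟩ := hN i j (.inl hr) hij
      have ht : lineTgt R i = some j := by simp [lineTgt, hr, hij]
      simp only [hij, if_true, endW, hr, (hP.dotted i j hr).2, lineCoef, ht, h4, h5, dotCoef,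
        dottedEnd, neg_eq_zero, Int.natAbs_neg]
      split_ifs with h6
      · simp
      · rw [← mul_inv, Real.mul_self_sqrt (hξ _ (by omega)).le]
    · have ht : lineTgt R i = none := by simp [lineTgt, hr, hij]
      simp [lineCoef, ht, h0 i ht, hij]
  | wavy j =>
    have hfi : f i = j := by simp [hf, otherEnd, hr]
    rw [hfi]
    by_cases hij : i < j
    · obtain ⟨h4, h5⟩ := hN i j (.inr hr) hij
      have ht : lineTgt R i = some j := by simp [lineTgt, hr, hij]
      simp only [hij, if_true, endW, hr, (hP.wavy i j hr).2, lineCoef, ht, h4, h5, wavyCoef,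
        wavyEnd, hij.not_gt, if_false]
      rw [Real.mul_self_sqrt (by positivity)]
    · have ht : lineTgt R i = none := by simp [lineTgt, hr, hij]
      simp [lineCoef, ht, h0 i ht, hij]
  | solid j =>
    have hfi : f i = i := by simp [hf, otherEnd, hr]
    rw [hfi]
    rcases ht : lineTgt R i with _ | j'
    · simp [lineCoef, ht, h0 i ht]
    · simp [lineCoef, ht, hr]
  | _ =>
    have hfi : f i = i := by simp [hf, otherEnd, hr]
    have ht : lineTgt R i = none := by simp [lineTgt, hr]
    rw [hfi]
    simp [lineCoef, ht, h0 i ht]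

open Classical in
/-- The charge or mode factor of the end of a solid line that does not close a loop. -/
def targetW (X : Frame n) (R : Graph n) (i k : Fin n) : ℂ :=
  match R i with
  | .solid _ => if X.th k then -I * X.m k else X.q k
  | _ => 1

theorem not_closes_diff {i k : Fin n} (hk : R k = .diff) : ¬ Closes R i k := by
  intro h
  obtain ⟨z, hz, _⟩ := TransGen.head'_iff.1 (mem_loopOf.1 h.1).1
  rw [Step, hk] at hz; cases hz

theorem baseCharge_of_ne {k : Fin n} (hk : R k ≠ .diff) : baseCharge φ R k = (φ k).sgn := by
  unfold baseCharge; cases hr : R k <;> first | exact absurd hr hk | (cases φ k <;> rfl)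

theorem diffCharge_of_ne {k : Fin n} (hk : R k ≠ .diff) : diffCharge φ R k = 0 := by
  unfold diffCharge; cases hr : R k <;> first | exact absurd hr hk | (cases φ k <;> rfl)

theorem charge_diff {k : Fin n} (hk : R k = .diff) (h3 : φ k ≠ three) :
    baseCharge φ R k = 0 ∧ diffCharge φ R k = (φ k).sgn := by
  unfold baseCharge diffCharge
  rw [hk]; cases h : φ k <;> first | exact absurd h h3 | exact ⟨rfl, rfl⟩

theorem charge_three_diff {k : Fin n} (hk : R k = .diff) (h3 : φ k = three) :
    baseCharge φ R k = -1 ∧ diffCharge φ R k = 1 := by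
  unfold baseCharge diffCharge
  rw [hk, h3]; exact ⟨rfl, rfl⟩

theorem mem_inc {tgt : Fin n → Option (Fin n)} {i k : Fin n} : i ∈ inc tgt k ↔ tgt i = some k := by
  simp [inc]

theorem prod_lineW (hG : IsGraph φ R) (hth : ∀ k, X.th k ↔ φ k = three)
    (hq : ∀ k, X.q k = (φ k).sgn) (hlt : ∀ i j, X.lt i j ↔ i < j) :
    ∏ i, lineW X R i = (∏ i, lineS φ R i) * ∏ k, ∏ i ∈ inc (lineTgt R) k, targetW X R i k := by
  classical
  have h1 : ∏ k, ∏ i ∈ inc (lineTgt R) k, targetW X R i k =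
      ∏ i, (lineTgt R i).elim 1 fun k => targetW X R i k := by
    simp only [inc, prod_filter]
    rw [Finset.prod_comm]
    refine prod_congr rfl fun i _ => ?_
    rcases lineTgt R i with _ | j <;> simp
  rw [h1, ← prod_mul_distrib]
  refine prod_congr rfl fun i _ => ?_
  cases hr : R i with
  | solid j =>
    by_cases hc : Closes R i j
    · have hj : R j ≠ .diff := fun h => not_closes_diff h hc
      have h3 : ¬ X.th j := fun h => hj ((hG.1 i j hr).2 ((hth j).1 h))
      simp [lineW, lineS, lineTgt, hr, hc, h3, hlt, baseCharge_of_ne hj, hq]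
    · simp [lineW, lineS, lineTgt, targetW, hr, hc, hlt]
  | dotted j => by_cases hc : i < j <;> simp [lineW, lineS, lineTgt, targetW, hr, hc]
  | wavy j => by_cases hc : i < j <;> simp [lineW, lineS, lineTgt, targetW, hr, hc]
  | _ => simp [lineW, lineS, lineTgt, hr]

theorem solid_of_inc_diff (hP : Paired R) {i k : Fin n} (hk : R k = .diff)
    (hi : i ∈ inc (lineTgt R) k) : R i = .solid k := by
  rcases lineTgt_eq_some.1 (mem_inc.1 hi) with h | h | h
  · exact h.1
  · have := (hP.dotted i k h.1).2; rw [hk] at this; cases this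
  · have := (hP.wavy i k h.1).2; rw [hk] at this; cases this

theorem inc_of_solid_diff {i k : Fin n} (hk : R k = .diff) (hi : R i = .solid k) :
    i ∈ inc (lineTgt R) k := mem_inc.2 (lineTgt_eq_some.2 (.inl ⟨hi, not_closes_diff hk⟩))

/-- If two lines end at a vertex `-2κ α⁻ ∂ᵤ α⁺`, the derivative vanishes there. -/
theorem vtxCoef_two (hP : Paired R) {k i i' : Fin n} (hk : R k = .diff) (h3 : φ k = three)
    (hi : R i = .solid k) (hi' : R i' = .solid k) (hne : i ≠ i') (l : ℤ) (N : Fin n → ℤ) :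
    vtxCoef (lineTgt R) (lineB φ R) (lineD φ R) k l N = 0 := by
  have h0 : ∀ a ∈ inc (lineTgt R) k, lineB φ R a + lineD φ R a = 0 := by
    intro a ha
    have := solid_of_inc_diff hP hk ha
    simp [lineB, lineD, this, charge_three_diff hk h3]
  have hm := inc_of_solid_diff hk hi
  have hm' := inc_of_solid_diff hk hi'
  unfold vtxCoef
  rw [prod_eq_zero hm (h0 i hm), mul_zero, zero_add]
  refine sum_eq_zero fun a _ => ?_
  obtain ⟨b, hb, hba⟩ : ∃ b ∈ inc (lineTgt R) k, b ≠ a := by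
    by_cases h : i = a
    · exact ⟨i', hm', fun h' => hne (h.trans h'.symm)⟩
    · exact ⟨i, hm, h⟩
  rw [prod_eq_zero (mem_erase.2 ⟨hba, hb⟩) (h0 b hb), zero_mul]

open Classical in
/-- The factor of a vertex with given momenta of its lines. -/
theorem vertex_eq (hG : IsGraph φ R) (hv : Valid (wordFrame φ m) R) {L : Pts n → ℤ}
    (hL : ∀ a, vertexCharge φ R a = 0 → L a = 0) {N : Fin n → ℤ}
    (hN : ∀ k, total m L k + N k - ∑ i ∈ inc (lineTgt R) k, N i = 0)
    (h0 : ∀ i, lineTgt R i = none → N i = 0) (k : Fin n) :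
    (if k ∈ diffList R then vtxCoef (lineTgt R) (lineB φ R) (lineD φ R) k (L (.inr k)) N
      else ∏ i ∈ inc (lineTgt R) k, (lineB φ R i + lineD φ R i)) =
    (∏ i ∈ inc (lineTgt R) k, targetW (wordFrame φ (total m L)) R i k) *
      (if R k = .diff ∧ φ k ≠ three then -I * m k else 1) *
        (if Free (wordFrame φ m) R k then I * L (.inr k) else 1) := by
  have hP := hG.paired
  have hmem : k ∈ diffList R ↔ R k = .diff := by simp [diffList, List.mem_finRange]
  have hth : ∀ m', (wordFrame φ m').th k ↔ φ k = three := fun m' => by simp [frame]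
  have hq : ∀ m', (wordFrame φ m').q k = (φ k).sgn := fun m' => by simp [frame]
  by_cases hk : R k = .diff
  swap
  · have hF : ¬ Free (wordFrame φ m) R k := fun h => hk h.2.1
    simp only [hmem, hk, false_and, if_false, hF, mul_one]
    refine prod_congr rfl fun i hi => ?_
    rcases lineTgt_eq_some.1 (mem_inc.1 hi) with h | h | h
    · have h3 : φ k ≠ three := fun h' => hk ((hG.1 i k h.1).2 h')
      simp [lineB, lineD, targetW, h.1, hth, h3, hq, baseCharge_of_ne hk, diffCharge_of_ne hk]
    · simp [lineB, lineD, targetW, h.1]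
    · simp [lineB, lineD, targetW, h.1]
  have hNk : N k = 0 := h0 k (by simp [lineTgt, hk])
  have hNs := hN k
  rw [hNk, add_zero] at hNs
  have hsol : ∀ i ∈ inc (lineTgt R) k, R i = .solid k := fun i hi => solid_of_inc_diff hP hk hi
  by_cases h3 : φ k = three
  swap
  · have hF : ¬ Free (wordFrame φ m) R k := fun h => h3 ((hth m).1 h.1)
    simp only [hmem, hk, h3, hF, if_true, if_false, mul_one, ne_eq, not_false_eq_true, and_self]
    obtain ⟨hb, hd⟩ := charge_diff hk h3
    have hLk : L (.inl k) = 0 := hL _ (by simp [vertexCharge, hb])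
    have hB : ∀ i ∈ inc (lineTgt R) k, lineB φ R i = 0 := fun i hi => by
      simp [lineB, hsol i hi, hb]
    have hD : ∀ i ∈ inc (lineTgt R) k, lineD φ R i = (φ k).sgn := fun i hi => by
      simp [lineD, hsol i hi, hd]
    have hW : ∏ i ∈ inc (lineTgt R) k, targetW (wordFrame φ (total m L)) R i k =
        ∏ i ∈ inc (lineTgt R) k, (lineB φ R i + lineD φ R i) :=
      prod_congr rfl fun i hi => by
        rw [hB i hi, hD i hi]; simp [targetW, hsol i hi, hth, h3, hq]
    have hS : ∑ i ∈ inc (lineTgt R) k, (N i : ℂ) = m k + L (.inr k) := by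
      simp only [total, hLk] at hNs
      rw [← Int.cast_sum]
      exact_mod_cast (by omega : ∑ i ∈ inc (lineTgt R) k, N i = m k + L (.inr k))
    rw [hW, vtxCoef, sum_congr rfl fun i hi => show _ =
      (∏ i ∈ inc (lineTgt R) k, (lineB φ R i + lineD φ R i)) * (-I * N i) by
        rw [← mul_prod_erase _ (fun i => lineB φ R i + lineD φ R i) hi, hB i hi]
        push_cast; ring, ← mul_sum, ← mul_sum, hS]
    ring
  simp only [hmem, hk, h3, if_true, ne_eq, not_true_eq_false, and_false, if_false, mul_one]
  obtain ⟨hb, hd⟩ := charge_three_diff hk h3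
  by_cases hF : Free (wordFrame φ m) R k
  · have hi : inc (lineTgt R) k = ∅ :=
      eq_empty_of_forall_notMem fun i hi => hF.2.2 i (hsol i hi)
    simp [hF, vtxCoef, hi]
  · obtain ⟨a, ha⟩ : ∃ a, R a = .solid k := by
      by_contra h; push Not at h
      exact hF ⟨(hth m).2 h3, hk, h⟩
    have hi : inc (lineTgt R) k = {a} := by
      ext b
      rw [mem_singleton]
      exact ⟨fun hb => (hv.solid_th a k ha ((hth m).2 h3)).2 b (hsol b hb),
        fun h => h ▸ inc_of_solid_diff hk ha⟩
    rw [hi, sum_singleton] at hNs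
    have hNa : N a = total m L k := by omega
    have hm' : (wordFrame φ (total m L)).m k = total m L k := rfl
    rw [hi, if_neg hF, mul_one, vtxCoef, hi]
    simp only [prod_singleton, sum_singleton, erase_singleton,
      prod_empty, lineB, lineD, ha, hb, hd, targetW, (hth _).2 h3, if_true, hm', hNa]
    push_cast; ring

/-- The momenta of the lines vanish at the roots of the forest if and only if momentum is conserved
in all connected components. -/
theorem lineMom_root_iff (hP : Paired R) (S : Fin n → ℤ) :
    (∀ i, lineTgt R i = none → lineMom R S i = 0) ↔ ∀ i, blockSum (Joined R) S i = 0 := by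
  classical
  have h : ∀ k, lineTgt R k = none → lineMom R S k = -blockSum (Joined R) S k := by
    intro k hk
    simp only [lineMom, blockSum, tReach_iff_joined hP hk]
  constructor
  · intro h0 i
    obtain ⟨k, hk, hik⟩ := exists_root (lineTgt_acyclic hP) i
    have := h0 k hk
    rw [h k hk, neg_eq_zero] at this
    rwa [blockSum_joined_congr S ((tReach_iff_joined hP hk i).1 hik)]
  · intro h0 k hk
    rw [h k hk, h0, neg_zero]

/-- The value of a regularized graph for given momenta of the vertices. -/
theorem graphTerm_eq (hξ : PosWeights ξ) (hκ : 0 < κ) (hG : IsGraph φ R)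
    (hv : Valid (wordFrame φ m) R) {L : Pts n → ℤ} (hL : ∀ a, vertexCharge φ R a = 0 → L a = 0) :
    (∏ i, coef κ p (φ i) (R i) * (lineS φ R i * closeW μ R i)) * graphTerm ξ κ M r φ m R L =
    coefProd κ p (fun k => some (φ k)) m R * (∏ i, lineW (wordFrame φ (total m L)) R i) *
      loopPart μ R * ((∏ i, (damp M r R i (lineMom R (total m L) i) : ℂ)) *
        Gfun R m (gW ξ κ (wordFrame φ m) R) (push (mergePts (wordFrame φ m) R) L)) := by
  classical
  have hP := hG.paired
  set N := lineMom R (total m L) with hNdef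
  simp only [Gfun, total_push_mergePts]
  by_cases h0 : ∀ i, lineTgt R i = none → N i = 0
  swap
  · rw [if_neg fun h => h0 ((lineMom_root_iff hP _).2 h), mul_zero, mul_zero]
    push Not at h0
    obtain ⟨i, hi, hNi⟩ := h0
    have hz : graphTerm ξ κ M r φ m R L = 0 := by
      rw [graphTerm, prod_eq_zero (mem_univ i) (by
        have : lineMom R (total m L) i ≠ 0 := hNi
        simp [lineCoef, hi, this]), zero_mul]
    rw [hz, mul_zero]
  have hJ := (lineMom_root_iff hP _).1 h0
  rw [if_pos hJ]
  have hflow := (flow_eq_zero_iff (lineTgt_acyclic hP) (total m L) N).2 (by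
    rw [hNdef]; funext k; rw [lineMom])
  have hcoef := prod_lineCoef hξ hκ hP N (fun i => blockSum (Conn R) (total m L) i) h0 (by
    intro i j hij hlt
    constructor
    · rw [hNdef, lineMom, blockSum]
      simp only [tReach_iff_conn hP ⟨hij, hlt⟩]
    · have h1 := blockSum_joined_pair (fun i j h => (hP.dotted i j h).2)
        (fun i j h => (hP.wavy i j h).2) (k := i) (k' := j) (by
          rcases hij with h | h
          exacts [.inl ⟨h, (hP.dotted i j h).2⟩, .inr ⟨h, (hP.wavy i j h).2⟩]) hlt.ne (total m L)
      rw [hJ] at h1; linarith)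
  have hgW : ∏ i, gW ξ κ (wordFrame φ m) R i (blockSum (Conn R) (total m L) i)
        (push (mergePts (wordFrame φ m) R) L (.inr i)) =
      (∏ i, (endW ξ κ R i (blockSum (Conn R) (total m L) i) : ℂ)) *
        ∏ i, if Free (wordFrame φ m) R i then I * L (.inr i) else 1 := by
    rw [← prod_mul_distrib]
    refine prod_congr rfl fun i _ => ?_
    rw [push_mergePts]
    have hF : R i ≠ .diff → ¬ Free (wordFrame φ m) R i := fun h h' => h h'.2.1
    cases hr : R i with
    | diff => by_cases h : Free (wordFrame φ m) R i <;> simp [gW, endW, hr, h]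
    | wavy j =>
      rw [if_neg (hF (by simp [hr])), mul_one]
      by_cases h : i < j <;> simp [gW, endW, hr, h, frame]
    | _ => simp [gW, endW, hr, hF]
  rw [graphTerm, vertexProd, prod_congr rfl fun k _ => vertex_eq hG hv hL hflow h0 k, hgW,
    prod_lineW hG (X := wordFrame φ (total m L)) (fun k => by simp [frame]) (fun k => by simp [frame])
      (fun i j => Iff.rfl), ← prod_closeW]
  have hcB : coefProd κ p (fun k => some (φ k)) m R = ∏ i, coef κ p (φ i) (R i) *
      if R i = .diff ∧ φ i ≠ three then -I * m i else 1 :=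
    prod_congr rfl fun i _ => by simp only [coefB]
  have hcoef' := congrArg (fun x : ℝ => (x : ℂ)) hcoef
  simp only [ofReal_prod] at hcoef'
  rw [hcB]
  simp only [ofReal_mul, prod_mul_distrib, ← hNdef, hcoef']
  ring

end Evaluation

/-! ### The boundary limit -/

/-- Dominated convergence for `Lam`. -/
theorem tendsto_Lam {ι A : Type} [Fintype ι] {ξ : ℕ → ℝ} (hξ : PosWeights ξ)
    (hsum : Decay ξ) {l : Filter A} {ρ : A → ι → ℝ} {ρ₀ : ι → ℝ}
    {q : ι → ℤ} {F : A → (ι → ℤ) → ℂ} {F₀ : (ι → ℤ) → ℂ} {C : ℝ}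
    (hρ : ∀ᶠ x in l, ∀ a, 0 ≤ ρ x a ∧ ρ x a ≤ 1)
    (hF : ∀ᶠ x in l, ∀ L, (∀ a, q a = 0 → L a = 0) → ‖F x L‖ ≤ C * wgt L)
    (hρ₀ : ∀ a, Tendsto (fun x => ρ x a) l (𝓝 (ρ₀ a)))
    (hF₀ : ∀ L, Tendsto (fun x => F x L) l (𝓝 (F₀ L))) :
    Tendsto (fun x => Lam ξ (ρ x) q (F x)) l (𝓝 (Lam ξ ρ₀ q F₀)) := by
  unfold Lam
  split_ifs
  swap
  · exact tendsto_const_nhds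
  refine tendsto_tsum_of_dominated_convergence ((summable_lamMaj hξ hsum q).mul_left C) ?_
    (by filter_upwards [hρ, hF] with x h1 h2 t using norm_lamTerm_le hξ h1 h2 t)
  intro t
  refine tendsto_const_nhds.mul (tendsto_finsetSum _ fun P _ => ?_)
  refine (tendsto_finsetProd _ fun i _ => ?_).mul (hF₀ _)
  refine tendsto_const_nhds.mul (Tendsto.pow ?_ _)
  exact (continuous_ofReal.tendsto _).comp ((hρ₀ _).mul (hρ₀ _))

section Limit

variable {ξ : ℕ → ℝ} {κ p : ℝ} {μ : ℕ → ℝ} {φ : Fin n → Current} {m : Fin n → ℤ}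
  {R : Graph n}

theorem mem_side {i k : Fin n} : k ∈ side R i ↔ ReflTransGen (Step R) k i := by
  simp [side]

theorem mem_side_iff_conn {i j k : Fin n} (h : R i = .dotted j) : k ∈ side R i ↔ Conn R k i := by
  rw [mem_side, conn_iff_reach (by simp [h])]

theorem neutral_iff {i j : Fin n} (h : R i = .dotted j) :
    Neutral φ (side R i) ↔ blockSum (Conn R) (wordFrame φ m).q i = 0 := by
  classical
  have : side R i = univ.filter fun k => Conn R k i := by
    ext k; simp [mem_side_iff_conn h]
  rw [Neutral, this]; rfl

theorem Cancelled.not_diff {k : Fin n} (h : Cancelled φ R k) : R k ≠ .diff := by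
  obtain ⟨i, j, hi, hk, _⟩ := h
  intro hd
  rcases ReflTransGen.cases_head (mem_side.1 hk) with h | ⟨z, hz, _⟩
  · rw [← h, hd] at hi; cases hi
  · rw [Step, hd] at hz; cases hz

open Classical in
/-- The charges that do not cancel, with the two points of a vertex identified if it is not free. -/
def mergedCharge (φ : Fin n → Current) (m : Fin n → ℤ) (R : Graph n) : Pts n → ℤ :=
  Sum.elim (fun k => if Cancelled φ R k then 0 else chg (wordFrame φ m) R (.inl k))
    fun k => chg (wordFrame φ m) R (.inr k)

theorem push_vertexCharge :
    push (mergePts (wordFrame φ m) R) (vertexCharge φ R) = mergedCharge φ m R := by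
  classical
  have hth : ∀ k, (wordFrame φ m).th k ↔ φ k = three := fun k => by simp [frame]
  have hq : ∀ k, (wordFrame φ m).q k = (φ k).sgn := fun k => by simp [frame]
  rw [push_mergePts]
  funext a
  rcases a with k | k <;> simp only [mergedCharge, vertexCharge, Sum.elim_inl, Sum.elim_inr, chg]
  · by_cases hd : R k = .diff
    · have hc : ¬ Cancelled φ R k := fun h => h.not_diff hd
      by_cases h3 : φ k = three
      · rw [(charge_three_diff hd h3).1, (charge_three_diff hd h3).2]
        by_cases hF : Free (wordFrame φ m) R k <;> simp [hc, hF, hq, h3, sgn]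
      · have hF : ¬ Free (wordFrame φ m) R k := fun h => h3 ((hth k).1 h.1)
        simp [hc, hF, hq, charge_diff hd h3]
    · have hF : ¬ Free (wordFrame φ m) R k := fun h => hd h.2.1
      simp [hF, hq, baseCharge_of_ne hd, diffCharge_of_ne hd]
  · by_cases hF : Free (wordFrame φ m) R k
    · simp [hF, (charge_three_diff hF.2.1 ((hth k).1 hF.1)).2]
    · simp [hF]

/-- The cancellation of the factors `α` of neutral sides does not change the boundary value, since
the boundary value depends only on the charges of the solid components. -/
theorem Lam_mergedCharge :
    Lam ξ (fun _ => 1) (mergedCharge φ m R) (Gfun R m (gW ξ κ (wordFrame φ m) R)) =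
      gam ξ κ (wordFrame φ m) R := by
  classical
  set G := Gfun R m (gW ξ κ (wordFrame φ m) R) with hG
  have key : ∀ Q, Lam ξ (fun _ => 1) Q G =
      Lam ξ (fun _ => 1) (push (Sum.map (rep R) id) Q) G := fun Q => by
    rw [← Lam_push]
    exact congrArg _ (funext fun L => Gfun_push_rep R m _ L)
  rw [show gam ξ κ (wordFrame φ m) R = Lam ξ (fun _ => 1) (chg (wordFrame φ m) R) G from rfl, key,
    key (chg _ R)]
  congr 1
  funext a
  rcases a with k | k
  swap
  · rw [push_elim_inr, push_elim_inr]; rfl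
  rw [push_elim_inl, push_elim_inl, push_rep_congr R fun i => ?_]
  by_cases h : ∃ k, Conn R k i ∧ Cancelled φ R k
  · obtain ⟨k, hki, i', j, hi', hk, hN⟩ := h
    have hii : Conn R i' i := (((mem_side_iff_conn hi').1 hk).symm).trans hki
    rw [← blockSum_conn_congr _ hii, ← blockSum_conn_congr _ hii, chg_blockSum _ _ fun k hF hc => ?_,
      (neutral_iff hi').1 hN]
    · refine sum_eq_zero fun k hk => ?_
      have hc : Cancelled φ R k :=
        ⟨i', j, hi', (mem_side_iff_conn hi').2 (mem_filter.1 hk).2, hN⟩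
      simp [mergedCharge, hc]
    · have := hF.conn_eq hc.symm
      rw [this, hF.2.1] at hi'; cases hi'
  · refine sum_congr rfl fun k hk => ?_
    have hc : ¬ Cancelled φ R k := fun hc => h ⟨k, (mem_filter.1 hk).2, hc⟩
    simp [mergedCharge, hc]

theorem tendsto_damp (i : Fin n) (N : ℤ) : Tendsto (fun x : ℕ × (Fin n → ℝ) => damp x.1 x.2 R i N)
      (atTop ×ˢ 𝓝[Set.univ.pi fun _ => Set.Ioo (0 : ℝ) 1] 1) (𝓝 1) := by
  set l := (atTop : Filter ℕ) ×ˢ 𝓝[Set.univ.pi fun _ : Fin n => Set.Ioo (0 : ℝ) 1] 1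
  have hr : ∀ k, Tendsto (fun x : ℕ × (Fin n → ℝ) => x.2 k) l (𝓝 1) := fun k =>
    (((continuous_apply k).tendsto (1 : Fin n → ℝ)).mono_left nhdsWithin_le_nhds).comp tendsto_snd
  rcases ht : lineTgt R i with _ | j
  · simp only [damp, ht]; exact tendsto_const_nhds
  have hp : Tendsto (fun x : ℕ × (Fin n → ℝ) => (x.2 i * x.2 j) ^ N.natAbs) l (𝓝 1) := by
    simpa using ((hr i).mul (hr j)).pow N.natAbs
  have hM : ∀ᶠ x : ℕ × (Fin n → ℝ) in l, N.natAbs ≤ x.1 :=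
    tendsto_fst.eventually (eventually_ge_atTop _)
  refine hp.congr' ?_
  filter_upwards [hM] with x hx
  cases hr : R i <;> simp [damp, ht, hr, hx.not_gt]

theorem abs_damp_le {M : ℕ} {r : Fin n → ℝ} (h : ∀ k, 0 ≤ r k ∧ r k ≤ 1) (i : Fin n) (N : ℤ) :
    |damp M r R i N| ≤ 1 := by
  have hp : ∀ j, |(r i * r j) ^ N.natAbs| ≤ 1 := fun j => by
    rw [abs_of_nonneg (pow_nonneg (mul_nonneg (h i).1 (h j).1) _)]
    exact pow_le_one₀ (mul_nonneg (h i).1 (h j).1) (mul_le_one₀ (h i).2 (h j).1 (h j).2)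
  unfold damp
  split
  · simp
  · split_ifs
    · simp
    · exact hp _
  · exact hp _

/-- The mode of a regularized graph in terms of the boundary weights. -/
theorem mode_eq (hξ : PosWeights ξ) (hκ : 0 < κ) (hG : IsGraph φ R)
    (hv : Valid (wordFrame φ m) R) (M : ℕ) (r : Fin n → ℝ) :
    (∏ i, coef κ p (φ i) (R i) * (lineS φ R i * closeW μ R i)) *
        Lam ξ (Sum.elim r r) (vertexCharge φ R) (graphTerm ξ κ M r φ m R) =
      coefProd κ p (fun k => some (φ k)) m R * (∏ i, lineW (wordFrame φ m) R i) * loopPart μ R *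
        Lam ξ (Sum.elim r r) (mergedCharge φ m R) fun L =>
          (∏ i, (damp M r R i (lineMom R (total m L) i) : ℂ)) *
            Gfun R m (gW ξ κ (wordFrame φ m) R) L := by
  classical
  have hρ : (Sum.elim r r : Pts n → ℝ) = Sum.elim r r ∘ mergePts (wordFrame φ m) R := by
    funext a
    rcases a with k | k
    · rfl
    · simp only [comp_apply, mergePts, Sum.elim_inr]; split_ifs <;> rfl
  rw [← Lam_smul, Lam_congr ξ _ _ fun L hL => graphTerm_eq hξ hκ hG hv hL]
  have h := Lam_push ξ (mergePts (wordFrame φ m) R) (Sum.elim r r) (vertexCharge φ R) fun L =>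
    coefProd κ p (fun k => some (φ k)) m R * (∏ i, lineW (wordFrame φ (total m L)) R i) *
      loopPart μ R * ((∏ i, (damp M r R i (lineMom R (total m L) i) : ℂ)) *
        Gfun R m (gW ξ κ (wordFrame φ m) R) L)
  rw [← hρ, push_vertexCharge] at h
  simp only [total_push_mergePts] at h
  rw [h, ← Lam_smul]
  refine Lam_congr ξ _ _ fun L hL => ?_
  have hW : ∀ i, lineW (wordFrame φ (total m L)) R i = lineW (wordFrame φ m) R i := by
    intro i
    cases hr : R i with
    | solid j =>
      by_cases h3 : φ j = three
      · have hF : ¬ Free (wordFrame φ m) R j := fun hF => hF.2.2 i hr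
        have h1 := hL (.inl j) (by
          have hq : (wordFrame φ m).q j = 0 := by simp [frame, h3, sgn]
          simp [mergedCharge, chg, hF, hq])
        have h2 := hL (.inr j) (by simp [mergedCharge, chg, hF])
        simp [lineW, hr, frame, h3, total, h1, h2]
      · simp [lineW, hr, frame, h3]
    | _ => simp [lineW, hr]
  simp only [hW]

/-- Two lines into a vertex `-2κ α⁻ ∂ᵤ α⁺` make the graph vanish. -/
theorem graphTerm_eq_zero (hG : IsGraph φ R) (hK : Kept φ R) (hv : ¬ Valid (wordFrame φ m) R)
    (M : ℕ) (r : Fin n → ℝ) (L : Pts n → ℤ) : graphTerm ξ κ M r φ m R L = 0 := by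
  obtain ⟨k, i, i', h3, hk, hi, hi', hne⟩ : ∃ k i i', φ k = three ∧ R k = .diff ∧
      R i = .solid k ∧ R i' = .solid k ∧ i ≠ i' := by
    by_contra! h
    refine hv ⟨fun i j hij => (hG.1 i j hij).1.symm, fun i j hij h3 => ?_,
      fun i j hij => ⟨(hG.2.1 i j hij).1.symm, (hG.2.1 i j hij).2⟩,
      fun i j hij => ⟨(hG.2.2.1 i j hij).1.symm, (hG.2.2.1 i j hij).2.1⟩, fun i j hij => ?_⟩
    · have h3' : φ j = three := by simpa [frame] using h3
      have hd := (hG.1 i j hij).2 h3'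
      exact ⟨hd, fun i' hi' => h j i' i h3' hd hi' hij⟩
    · rw [← neutral_iff hij, ← neutral_iff (hG.2.1 i j hij).2]
      exact hK i j hij
  have hmem : k ∈ diffList R := by simp [diffList, List.mem_finRange, hk]
  have hz : vertexProd (lineTgt R) (lineB φ R) (lineD φ R) (diffList R) (lineMom R (total m L)) L
      = 0 :=
    prod_eq_zero (mem_univ k)
      (by rw [if_pos hmem, vtxCoef_two hG.paired hk h3 hi hi' hne])
  rw [graphTerm, hz, mul_zero]

/-- The contribution of a graph to the correlators of the modes has a boundary value. -/
theorem tendsto_mode (hξ : PosWeights ξ) (hsum : Decay ξ)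
    (hκ : 0 < κ) (hG : IsGraph φ R) (hK : Kept φ R) : Tendsto (fun x : ℕ × (Fin n → ℝ) =>
      (∏ i, coef κ p (φ i) (R i) * (lineS φ R i * closeW μ R i)) *
        Lam ξ (Sum.elim x.2 x.2) (vertexCharge φ R) (graphTerm ξ κ x.1 x.2 φ m R))
      (atTop ×ˢ 𝓝[Set.univ.pi fun _ => Set.Ioo (0 : ℝ) 1] 1)
      (𝓝 (coefProd κ p (fun k => some (φ k)) m R * graphW ξ κ μ (wordFrame φ m) R)) := by
  classical
  by_cases hv : Valid (wordFrame φ m) R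
  swap
  · have hz : ∀ M r, graphTerm ξ κ M r φ m R = fun _ => 0 := fun M r =>
      funext fun L => graphTerm_eq_zero hG hK hv M r L
    have hL : ∀ r : Fin n → ℝ, Lam ξ (Sum.elim r r) (vertexCharge φ R) (fun _ => 0) = 0 := fun r => by
      simpa using Lam_smul ξ (Sum.elim r r) (vertexCharge φ R) 0 fun _ => 0
    simp only [hz, hL, mul_zero, graphW_of_not_valid hv]
    exact tendsto_const_nhds
  simp only [mode_eq hξ hκ hG hv, graphW, hv, if_true]
  rw [← mul_assoc, ← mul_assoc, ← Lam_mergedCharge]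
  refine tendsto_const_nhds.mul ?_
  obtain ⟨C, hC⟩ := norm_Gfun_le hv (tame_gW ξ κ (wordFrame φ m) R)
  have hC := hC (mergedCharge φ m R)
    (fun i j hij h0 k hk => by
      have : Cancelled φ R k := ⟨i, j, hij, (mem_side_iff_conn hij).2 hk, (neutral_iff hij).2 h0⟩
      simp [mergedCharge, this])
    (fun k hk => by simp [mergedCharge, chg, hk])
  set l := (atTop : Filter ℕ) ×ˢ 𝓝[Set.univ.pi fun _ : Fin n => Set.Ioo (0 : ℝ) 1] 1
  have hr : ∀ k, Tendsto (fun x : ℕ × (Fin n → ℝ) => x.2 k) l (𝓝 1) := fun k =>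
    (((continuous_apply k).tendsto (1 : Fin n → ℝ)).mono_left nhdsWithin_le_nhds).comp tendsto_snd
  have h01 : ∀ᶠ x : ℕ × (Fin n → ℝ) in l, ∀ k, 0 ≤ x.2 k ∧ x.2 k ≤ 1 := by
    filter_upwards [tendsto_snd.eventually eventually_mem_nhdsWithin] with x hx k
    exact ⟨(hx k trivial).1.le, (hx k trivial).2.le⟩
  refine tendsto_Lam hξ hsum (C := C) ?_ ?_ ?_ ?_
  · filter_upwards [h01] with x hx
    rintro (k | k) <;> exact hx k
  · filter_upwards [h01] with x hx L hL
    rw [norm_mul, norm_prod]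
    refine (mul_le_of_le_one_left (norm_nonneg _) (prod_le_one (fun _ _ => norm_nonneg _)
      fun i _ => ?_)).trans (hC L hL)
    rw [norm_real]
    exact abs_damp_le hx i _
  · rintro (k | k) <;> exact hr k
  · intro L
    have h := tendsto_finsetProd (univ : Finset (Fin n)) fun i _ =>
      (continuous_ofReal.tendsto _).comp (tendsto_damp (R := R) i (lineMom R (total m L) i))
    simpa using h.mul_const (Gfun R m (gW ξ κ (wordFrame φ m) R) L)

/-- The graphs that are not admitted do not contribute to the boundary correlators. -/
theorem isGraph_and_kept (hv : Valid (wordFrame φ m) R)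
    (hc : coefProd κ p (fun k => some (φ k)) m R ≠ 0) : IsGraph φ R ∧ Kept φ R := by
  have hc' : ∀ i, coef κ p (φ i) (R i) ≠ 0 := fun i h =>
    hc (prod_eq_zero (mem_univ i) (by simp [coefB, h]))
  refine ⟨⟨fun i j hij => ⟨(hv.solid_ne i j hij).symm, fun h3 =>
      (hv.solid_th i j hij (by simpa [frame] using h3)).1⟩,
    fun i j hij => ⟨(hv.dotted i j hij).1.symm, (hv.dotted i j hij).2⟩,
    fun i j hij => ⟨(hv.wavy i j hij).1.symm, (hv.wavy i j hij).2, fun h3 => hc' i ?_⟩,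
    fun i hi h3 => hc' i ?_⟩, fun i j hij => ?_⟩
  · rw [h3, hij]; rfl
  · rw [h3, hi]; rfl
  · rw [neutral_iff (m := m) hij, neutral_iff (m := m) (hv.dotted i j hij).2]
    exact hv.kept i j hij

end Limit

/-- The renormalized correlators of the modes converge to the boundary correlators. -/
theorem isBoundaryValue {ξ : ℕ → ℝ} {κ : ℝ} (hξ : PosWeights ξ)
    (hsum : Decay ξ) (hκ : 0 < κ) (p : ℝ) (μ : ℕ → ℝ) :
    IsBoundaryValue ξ κ p μ (boundaryCorr ξ κ p μ) := by
  classical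
  intro w
  set φ : Fin w.length → Current := fun k => (w.get k).1 with hφ
  set m : Fin w.length → ℤ := fun k => (w.get k).2 with hm
  have hlim : boundaryCorr ξ κ p μ w =
      ∑ R ∈ univ.filter (fun R : Fin w.length → Role w.length => IsGraph φ R ∧ Kept φ R),
        coefProd κ p (fun k => some (φ k)) m R * graphW ξ κ μ (wordFrame φ m) R := by
    refine (sum_subset (filter_subset _ _) fun R _ hR => ?_).symm
    by_cases hv : Valid (wordFrame φ m) R
    · by_contra h
      exact hR (mem_filter.2 ⟨mem_univ _, isGraph_and_kept hv (left_ne_zero_of_mul h)⟩)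
    · rw [graphW_of_not_valid hv, mul_zero]
  rw [hlim]
  refine (tendsto_finsetSum _ fun R hR => tendsto_mode (p := p) (μ := μ) (m := m) hξ hsum hκ
    (mem_filter.1 hR).2.1 (mem_filter.1 hR).2.2).congr' ?_
  filter_upwards [tendsto_snd.eventually eventually_mem_nhdsWithin] with x hx
  have hmode := fun R (hR : IsGraph φ R) => mode_amplitude (κ := κ) (μ := μ) (M := x.1) (φ := φ)
    (m := m) (r := x.2) hξ hsum hR.paired p (fun k => (hx k trivial).1.le) fun k => (hx k trivial).2
  simp only [renMode, renCorr, sum_mul]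
  rw [MeasureTheory.integral_finsetSum, mul_sum]
  · exact sum_congr rfl fun R hR => ((hmode R (mem_filter.1 hR).2.1).2).symm
  · intro R hR
    have hc := (hmode R (mem_filter.1 hR).2.1).1
    exact (Continuous.continuousOn (by fun_prop)).integrableOn_compact isCompact_Icc

end AffineSl2

end

theorem theorem4p3 (ξ : ℕ → ℝ) (hξ : ∀ n, 1 ≤ n → 0 < ξ n)
    (hsum : Summable fun n : ℕ => (n : ℝ) * ξ n) (κ p : ℝ) (hκ : 0 < κ) (μ : ℕ → ℝ) :
    ∃ C : AffineSl2.Word → ℂ,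
      AffineSl2.IsBoundaryValue ξ κ p μ C ∧
      AffineSl2.CorrelatorRelations κ C ∧
      AffineSl2.CorrelatorHermitian C ∧
      AffineSl2.DefinesModule κ C := by
  exact ⟨AffineSl2.boundaryCorr ξ κ p μ, AffineSl2.isBoundaryValue hξ hsum hκ p μ,
    AffineSl2.boundaryCorr_relations hξ hsum hκ, AffineSl2.boundaryCorr_hermitian hξ hsum hκ,
    AffineSl2.definesModule (AffineSl2.boundaryCorr_relations hξ hsum hκ)
      (AffineSl2.boundaryCorr_hermitian hξ hsum hκ)⟩
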